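/- Let $A,B\in\mathbb R\setminus\{0\}$ and let $m\in\mathbb Z$ be not divisible by $3$. Write $z=p+iq=\sqrt{2I}\,e^{i\theta}$. Consider, for $\varepsilon\neq 0$, a two-degree-of-freedom Hamiltonian system on $\{(s,E,z)\}=(\mathbb R/2\pi\mathbb Z)\times\mathbb R\times\mathbb C$ which near its periodic orbit $\{E=0,\ z=0\}$ is in tripling (order-three resonant) normal form up to arbitrary higher-order terms, $$\mathcal H = E+\omega I+AI^2+BI^{3/2}\cos(3\theta-ms)+R(s,z),\qquad \omega=\tfrac m3+\varepsilon ,$$ where $R$ is any $C^\infty$ function, $2\pi$-periodic in $s$, with $R(s,z)=O(|z|^5)$; the tripling is at $\varepsilon=0$. Let $f$ be the Poincaré map to $\{s=0\}$ in the energy level $\mathcal H=0$. The twist $\tau_0$ of the periodic orbit is the coefficient in the Birkhoff normal form $(J,\theta)\mapsto(J,\theta+2\pi(\omega+\tau_0J))$, to which $f$ is brought, up to terms of order four, by a smooth area- and orientation-preserving change of coordinates fixing the origin. **(1) Codimension-one twistless bifurcation.** For every $\varepsilon\ne0$ and every such $R$, the Poincaré map exists near the origin and has a unique twist, $\tau_0(\varepsilon)=2A-\frac{3B^2}{2\varepsilon}$.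 Hence $\tau_0$ vanishes for exactly one value of the parameter, $\varepsilon_0=\frac{3B^2}{4A}$, and $\tau_0'(\varepsilon_0)\neq0$. Now consider the exact normal form in the rotating frame, $H(I,\varphi)=\varepsilon I+AI^2+BI^{3/2}\cos3\varphi$, with scaled parameter $\tilde\varepsilon=A\varepsilon/B^2$ and scaled energy $\tilde h=A^3h/B^4$ (so $\varepsilon_0$ is $\tilde\varepsilon_0=\frac34$). The action $J$ of an invariant circle around the origin is $(2\pi)^{-1}$ times the area it encloses, its rotation number $\Omega$ is the mean angular velocity $\lim_{t\to\infty}\varphi(t)/t$ of its orbits, and its twist is $d\Omega/dJ$. A circle is twistless if its twist is $0$. **(2) Saddle-center bifurcation of the period-three orbits.** For $0<\tilde\varepsilon<\frac9{32}$ the equilibria of $H$ other than the origin are two triples, each the set of images of one point under rotations by multiples of $2\pi/3$ (period-three orbits in the original frame): one triple consists of saddles, the other of centers. As $\tilde\varepsilon\uparrow\frac9{32}$ the two triples merge, at $\tilde\varepsilon=\frac9{32}$, into one such triple of degenerate equilibria, with $\tilde h=\left(\frac3{16}\right)^3=\frac{27}{4096}$. For $\tilde\varepsilon>\frac9{32}$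 there is no equilibrium other than the origin. **(3) Invariant circles.** For $\tilde\varepsilon>\frac9{32}$ every level set $\{\tilde h=\eta\}$, $\eta>0$, meets each ray from the origin exactly once. It has a well-defined twist, which tends to $\tau_0(\varepsilon)$ as $\eta\to0$. **(4) The twistless curve.** There is a continuous function $\eta_*:\left(\frac9{32},\frac34\right)\to(0,\infty)$ such that for every $\tilde\varepsilon\in\left(\frac9{32},\frac34\right)$ the circle $\{\tilde h=\eta_*(\tilde\varepsilon)\}$ is twistless, with the following properties. * It is created at the origin at $\tilde\varepsilon=\frac34$: $\eta_*(\tilde\varepsilon)\to0$ and its action tends to $0$ as $\tilde\varepsilon\uparrow\frac34$. Moreover there is $\delta>0$ such that, for $|\tilde\varepsilon-\frac34|<\delta$ and $0<\eta<\delta$, the circle $\{\tilde h=\eta\}$ is twistless if and only if $\tilde\varepsilon<\frac34$ and $\eta=\eta_*(\tilde\varepsilon)$. * It then moves away from the origin as the tripling point is approached: on $\left(\frac34-\delta,\frac34\right)$ its action increases strictly as $\tilde\varepsilon$ decreases. * It eventually collides with the saddle-center bifurcation: as $\tilde\varepsilon\downarrow\frac9{32}$, $\eta_*(\tilde\varepsilon)\to\frac{27}{4096}$,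 and the distance of each of the three degenerate equilibria of (2) from the twistless curve tends to $0$. -/

import Mathlib

open Filter Topology Asymptotics MeasureTheory
open scoped ContDiff

noncomputable section

namespace Tripling

/-- The symplectic plane is `ℂ`, with `z = p + i q = √(2I) e^{iφ}`.  Hamilton's equations
`q' = ∂H/∂p`, `p' = -∂H/∂q` (equivalently `φ' = ∂H/∂I`, `I' = -∂H/∂φ`) are the equation
`z' = hamVF H z`. -/
def hamVF (H : ℂ → ℝ) (z : ℂ) : ℂ :=
  -((fderiv ℝ H z Complex.I : ℝ) : ℂ) + ((fderiv ℝ H z 1 : ℝ) : ℂ) * Complex.I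

/-- The coordinate `I = |z|² / 2`. -/
def radialAction (z : ℂ) : ℝ := ‖z‖ ^ 2 / 2

/-- The tripling normal form `H(I, φ) = ε I + A I² + B I^{3/2} cos 3φ` in the frame rotating with
the resonance. -/
def normalForm (ε A B : ℝ) (z : ℂ) : ℝ :=
  ε * radialAction z + A * radialAction z ^ 2
    + B * radialAction z ^ (3 / 2 : ℝ) * Real.cos (3 * Complex.arg z)

/-- The normal form in the original frame,
`ω I + A I² + B I^{3/2} cos (3θ - m s)` with `ω = m/3 + ε`. -/
def resonantForm (m : ℤ) (ε A B : ℝ) (s : ℝ) (z : ℂ) : ℝ :=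
  (m / 3 + ε) * radialAction z + A * radialAction z ^ 2
    + B * radialAction z ^ (3 / 2 : ℝ) * Real.cos (3 * Complex.arg z - m * s)

/-! ### Two degrees of freedom: periodic orbit, Poincaré map, Birkhoff twist -/

/-- Arbitrary terms of order at least five in `(q, p)`, smooth and `2π`-periodic in the angle. -/
structure IsRemainder (R : ℝ → ℂ → ℝ) : Prop where
  smooth : ContDiff ℝ ∞ (fun x : ℝ × ℂ => R x.1 x.2)
  periodic : ∀ s z, R (s + 2 * Real.pi) z = R s z
  order : ∀ s, (fun z => R s z) =O[𝓝 0] fun z => ‖z‖ ^ 5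

/-- The two-degree-of-freedom Hamiltonian in resonant normal form near a periodic orbit.
The phase space has coordinates `(s, E, z)`, where `s` is an angle (modulo `2π`) along the
periodic orbit `{E = 0, z = 0}`, `E` is the momentum conjugate to `s`, and `z = p + i q` is
transverse. -/
def fullHam (m : ℤ) (ε A B : ℝ) (R : ℝ → ℂ → ℝ) (x : ℝ × ℝ × ℂ) : ℝ :=
  x.2.1 + resonantForm m ε A B x.1 x.2.2 + R x.1 x.2.2

/-- `t ↦ (s t, E t, ζ t)` solves Hamilton's equations of `H` on `[0, T]`. -/
def IsOrbit (H : ℝ × ℝ × ℂ → ℝ) (T : ℝ) (s E : ℝ → ℝ) (ζ : ℝ → ℂ) : Prop :=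
  ∀ t ∈ Set.Icc 0 T,
    HasDerivWithinAt s (fderiv ℝ H (s t, E t, ζ t) (0, 1, 0)) (Set.Icc 0 T) t ∧
    HasDerivWithinAt E (-fderiv ℝ H (s t, E t, ζ t) (1, 0, 0)) (Set.Icc 0 T) t ∧
    HasDerivWithinAt ζ (hamVF (fun z => H (s t, E t, z)) (ζ t)) (Set.Icc 0 T) t

/-- `f` is, near the origin, the first return map of the flow of `H` to the section `s = 0`
(modulo `2π`) in the energy level `H = 0` of the periodic orbit `{E = 0, z = 0}`. -/
def IsPoincareMap (H : ℝ × ℝ × ℂ → ℝ) (f : ℂ → ℂ) : Prop :=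
  ∀ᶠ z in 𝓝 (0 : ℂ), ∃ (T : ℝ) (s E : ℝ → ℝ) (ζ : ℝ → ℂ), 0 < T ∧ IsOrbit H T s E ζ ∧
    s 0 = 0 ∧ ζ 0 = z ∧ H (s 0, E 0, ζ 0) = 0 ∧
    (∀ t ∈ Set.Ioo 0 T, s t ∈ Set.Ioo 0 (2 * Real.pi)) ∧ s T = 2 * Real.pi ∧ ζ T = f z

/-- The map `f` with fixed point `0` has rotation number `ν` and twist `τ` at the fixed point:
a smooth area- and orientation-preserving change of coordinates `g` fixing the origin brings it
to the Birkhoff normal form `(J, θ) ↦ (J, θ + 2π (ν + τ J))` up to terms of order four, where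
`J = |g z|² / 2`. -/
def HasBirkhoffTwist (f : ℂ → ℂ) (ν τ : ℝ) : Prop :=
  ∃ g : ℂ → ℂ, ContDiffAt ℝ ∞ g 0 ∧ g 0 = 0 ∧ (∀ᶠ z in 𝓝 (0 : ℂ), (fderiv ℝ g z).det = 1) ∧
    (fun z => g (f z)
      - Complex.exp (((2 * Real.pi * (ν + τ * radialAction (g z)) : ℝ) : ℂ) * Complex.I) * g z)
      =O[𝓝 0] fun z => ‖z‖ ^ 4

/-! ### One degree of freedom: action, rotation number and twist of invariant circles -/

/-- The area between the origin, where `H = 0`, and the level `H = h`, divided by `2π`.  It is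
used when `{H = h}` is a circle around the origin bounding a disc in which the values of `H` lie
between `0` and `h`; then it is the action `(2π)⁻¹ ∮ I dφ` of this circle. -/
def action (H : ℂ → ℝ) (h : ℝ) : ℝ :=
  (volume {z : ℂ | H z ∈ Set.uIcc 0 h}).toReal / (2 * Real.pi)

/-- The orbit of `z₀` under the flow of `H` avoids the origin and turns around it with mean
angular velocity `Ω`.  This is the rotation number (turns per iteration) of the orbit
under the time-`2π` map. -/
def HasRotationNumber (H : ℂ → ℝ) (z₀ : ℂ) (Ω : ℝ) : Prop :=
  ∃ (z : ℝ → ℂ) (φ : ℝ → ℝ), z 0 = z₀ ∧ (∀ t, HasDerivAt z (hamVF H (z t)) t) ∧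
    Continuous φ ∧ (∀ t, z t ≠ 0 ∧ z t = (‖z t‖ : ℂ) * Complex.exp ((φ t : ℂ) * Complex.I)) ∧
    Tendsto (fun t => φ t / t) atTop (𝓝 Ω)

/-- The invariant circle `{H = h}` has twist `τ = dΩ/dJ`: the rotation number on the circles
near it is a function `Ω` of the action `J`, with derivative `τ` at the action of `{H = h}`. -/
def HasTorusTwist (H : ℂ → ℝ) (h τ : ℝ) : Prop :=
  ∃ Ω : ℝ → ℝ,
    (∀ᶠ k in 𝓝 h, ∀ z, H z = k → HasRotationNumber H z (Ω (action H k))) ∧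
    HasDerivAt Ω τ (action H h)

/-- The equilibria of `H` other than the origin. -/
def equilibria (H : ℂ → ℝ) : Set ℂ := {z | z ≠ 0 ∧ hamVF H z = 0}

/-- The images of `z` under rotations by multiples of `2π/3`.  If `z ≠ 0` is an equilibrium of the
normal form in the rotating frame, they are the points of a period-three orbit of the Poincaré map
in the original frame. -/
def tripleOrbit (z : ℂ) : Set ℂ :=
  {w | ∃ k : ℤ, w = Complex.exp (((2 * Real.pi * k / 3 : ℝ) : ℂ) * Complex.I) * z}

/-- Determinant of the linearization of the Hamiltonian vector field (which has trace `0`): an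
equilibrium is a saddle if it is negative, a center (elliptic) if it is positive and degenerate
(parabolic) if it is zero. -/
def linDet (H : ℂ → ℝ) (z : ℂ) : ℝ := (fderiv ℝ (hamVF H) z).det

/-- The normal form as a function of the scaled parameter `e = A ε / B²`. -/
def scaledForm (A B e : ℝ) : ℂ → ℝ := normalForm (B ^ 2 / A * e) A B

/-- The energy `h` as a function of the scaled energy `η = A³ h / B⁴`. -/
def scaledEnergy (A B η : ℝ) : ℝ := B ^ 4 / A ^ 3 * η

end Tripling

end

namespace Tripling

/-! Twist of the periodic orbit. Since `s' = 1`, the Poincaré map is the time-`2π` map of a forced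
planar equation. In the frame rotating with frequency `m/3` this equation is `w' = i(εw + A|w|²w +
3b w̄²) + O(|w|⁴)` with `b = B/(2√2)`. For `ε ≠ 0` the explicit substitution `birkhoffMap` with `c =
b/ε` removes the term `w̄²` and changes the cubic coefficient to `A - 6b²/ε`; since `J = |u|²/2`,
the twist is twice this number, `2A - 3B²/(2ε)` (`IsPoincareMap.birkhoff`). The substitution
preserves area only up to terms of order three in its Jacobian, and a correction of order four makes
it exact (`exists_symplectic_birkhoffMap`). Uniqueness holds for every rotation number, resonant or
not: the first Fourier coefficient, on small circles, of a conjugacy with linear part `ay + bȳ`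
between two normal forms gives `τ₁ = (|a|² + 2|b|²) τ₂`. The factor is at least `1`, and so is the
one for the inverse conjugacy (`exists_twist_eq_mul`).

Invariant circles. The dilation `z = (B/A) y` reduces everything to `A = B = 1`. If `T(η)` is the
period of the level curve of energy `η`, the enclosed area has derivative `T`, so `Ω = 2π/T` and the
twist is `-(2π)² T'/T³`: a twistless circle is a critical point of the period. Factoring the quartic
that gives the intersections with the symmetry axes suggests a parameter `v ∈ [0, 1/4)` with `η =
v(e - v)²/(1 - 4v)`. In terms of it `T = 4 Y^{-1/4} K(X/(2√Y))`, where `X`, `Y` are rational in `e`,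
`v` and `K` is the complete elliptic integral of the first kind (`levPeriod_lvEnergy`).

The twistless curve. `T' = 0` reads `critFun = 0`. At a zero with `v > 0`, Legendre's equation
eliminates `K''` and the vanishing itself eliminates `K`; what remains of the derivative is a
positive multiple of a polynomial of known sign (`period_polynomial_neg`). So `critFun` crosses zero
only upwards, hence at most once. At `v = 0` it has the sign of `4e - 3`, which gives the birth at
`e = 3/4`. For `9/32 < e < 3/4` the period therefore increases up to the critical level and
decreases after it. As `e ↓ 9/32` it blows up at `v = 3/16` and stays bounded at each other fixed
`v`, which drags the maximum to the level of the degenerate equilibria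
(`tendsto_critV_saddleCenter`). The growth of the circle near `e = 3/4` follows from strict
differentiability at `(3/4, 0)`. -/

/-! ### The normal forms as polynomials in `z` and its conjugate. -/

theorem two_mul_sqrt_two_pos : (0 : ℝ) < 2 * √2 := by positivity

theorem norm_sq_eq_normSq (z : ℂ) : ‖z‖ ^ 2 = Complex.normSq z := Complex.sq_norm z

theorem radialAction_rpow (z : ℂ) : radialAction z ^ (3 / 2 : ℝ) = ‖z‖ ^ 3 / (2 * √2) := by
  unfold radialAction
  have h2 : (‖z‖ ^ 2 / 2) = (‖z‖ / √2) ^ 2 := by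
    rw [div_pow, Real.sq_sqrt (by norm_num)]
  rw [h2, ← Real.rpow_natCast, ← Real.rpow_mul (by positivity)]
  have : ((2 : ℕ) : ℝ) * (3 / 2) = ((3 : ℕ) : ℝ) := by norm_num
  rw [this, Real.rpow_natCast, div_pow]
  congr 1
  rw [pow_succ, Real.sq_sqrt (by norm_num)]

/-- By de Moivre the apparently singular term `I^{3/2} cos(3θ - t)` is a constant times the real
part of a cubic polynomial, so the Hamiltonians are smooth at the origin. -/
theorem norm_cube_mul_cos (z : ℂ) (t : ℝ) :
    ‖z‖ ^ 3 * Real.cos (3 * Complex.arg z - t)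
      = (z ^ 3 * Complex.exp (((-t : ℝ) : ℂ) * Complex.I)).re := by
  have h : z ^ 3 * Complex.exp (((-t : ℝ) : ℂ) * Complex.I)
      = ((‖z‖ ^ 3 : ℝ) : ℂ) * Complex.exp (((3 * Complex.arg z - t : ℝ) : ℂ) * Complex.I) := by
    conv_lhs => rw [← Complex.norm_mul_exp_arg_mul_I z]
    rw [mul_pow, ← Complex.exp_nat_mul, mul_assoc, ← Complex.exp_add]
    push_cast
    congr 2
    ring
  rw [h, Complex.re_ofReal_mul, Complex.exp_ofReal_mul_I_re]

theorem resonantForm_eq (m : ℤ) (ε A B s : ℝ) (z : ℂ) :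
    resonantForm m ε A B s z = (m / 3 + ε) * (Complex.normSq z / 2)
      + A * (Complex.normSq z / 2) ^ 2
      + B / (2 * √2) * (z ^ 3 * Complex.exp (((-(m * s) : ℝ) : ℂ) * Complex.I)).re := by
  rw [← norm_cube_mul_cos, resonantForm, radialAction_rpow]
  unfold radialAction
  rw [norm_sq_eq_normSq]
  ring

theorem normalForm_eq (ε A B : ℝ) (z : ℂ) :
    normalForm ε A B z = ε * (Complex.normSq z / 2) + A * (Complex.normSq z / 2) ^ 2
      + B / (2 * √2) * (z ^ 3).re := by
  have h := norm_cube_mul_cos z 0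
  simp only [sub_zero, neg_zero, Complex.ofReal_zero, zero_mul, Complex.exp_zero, mul_one] at h
  rw [← h, normalForm, radialAction_rpow]
  unfold radialAction
  rw [norm_sq_eq_normSq]
  ring

/-- The quartic potential common to both frames. -/
noncomputable def quarticHam (a A b : ℝ) (w : ℂ) (z : ℂ) : ℝ :=
  a * (Complex.normSq z / 2) + A * (Complex.normSq z / 2) ^ 2 + b * (z ^ 3 * w).re

theorem contDiff_normSq : ContDiff ℝ ∞ (fun z : ℂ => Complex.normSq z) := by
  have : (fun z : ℂ => Complex.normSq z) = fun z => Complex.reCLM z * Complex.reCLM z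
      + Complex.imCLM z * Complex.imCLM z := by
    ext z; simp [Complex.normSq_apply]
  rw [this]; fun_prop

theorem hasFDerivAt_normSq (z : ℂ) : HasFDerivAt (fun z : ℂ => Complex.normSq z)
    ((2 * z.re) • Complex.reCLM + (2 * z.im) • Complex.imCLM) z := by
  have h1 := (Complex.reCLM.hasFDerivAt (x := z)).mul (Complex.reCLM.hasFDerivAt (x := z))
  have h2 := (Complex.imCLM.hasFDerivAt (x := z)).mul (Complex.imCLM.hasFDerivAt (x := z))
  refine (h1.add h2).congr_of_eventuallyEq ?_ |>.congr_fderiv ?_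
  · exact Eventually.of_forall fun z => by simp [Complex.normSq_apply]
  · ext
    simp; ring

theorem hasFDerivAt_re_cube (w z : ℂ) : HasFDerivAt (fun z : ℂ => (z ^ 3 * w).re)
    (Complex.reCLM.comp ((ContinuousLinearMap.mul ℝ ℂ) (3 * z ^ 2 * w))) z := by
  have h : HasDerivAt (fun z : ℂ => z ^ 3 * w) (3 * z ^ 2 * w) z := by
    simpa using (hasDerivAt_pow 3 z).mul_const w
  have h2 := h.hasFDerivAt.restrictScalars ℝ
  have h3 := (Complex.reCLM.hasFDerivAt (x := z ^ 3 * w)).comp z h2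
  refine h3.congr_fderiv ?_
  ext
  simp [mul_comm]

theorem hasFDerivAt_quarticHam (a A b : ℝ) (w z : ℂ) : HasFDerivAt (quarticHam a A b w)
    (((a + A * Complex.normSq z) / 2) • ((2 * z.re) • Complex.reCLM + (2 * z.im) • Complex.imCLM)
      + b • Complex.reCLM.comp ((ContinuousLinearMap.mul ℝ ℂ) (3 * z ^ 2 * w))) z := by
  have h1 := hasFDerivAt_normSq z
  have h2 := hasFDerivAt_re_cube w z
  have h3 : HasDerivAt (fun y : ℝ => a * (y / 2) + A * (y / 2) ^ 2)
      ((a + A * Complex.normSq z) / 2) (Complex.normSq z) := by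
    have := ((hasDerivAt_id (Complex.normSq z)).div_const 2)
    have h := (this.const_mul a).add ((this.pow 2).const_mul A)
    refine h.congr_deriv ?_
    simp; ring
  exact (h3.comp_hasFDerivAt z h1).add (h2.const_mul b)

/-- With `z = p + iq` Hamilton's equations are `z' = 2i ∂H/∂z̄`. -/
theorem hamVF_quarticHam (a A b : ℝ) (w z : ℂ) : hamVF (quarticHam a A b w) z
    = Complex.I * (a * z + A * (Complex.normSq z : ℂ) * z
      + 3 * b * (starRingEnd ℂ z) ^ 2 * starRingEnd ℂ w) := by
  unfold hamVF
  rw [(hasFDerivAt_quarticHam a A b w z).fderiv]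
  apply Complex.ext
  · simp [pow_two]; ring
  · simp [pow_two]; ring

theorem normalForm_eq_quarticHam (ε A B : ℝ) :
    normalForm ε A B = quarticHam ε A (B / (2 * √2)) 1 := by
  ext z; rw [normalForm_eq]; simp [quarticHam]

theorem resonantForm_eq_quarticHam (m : ℤ) (ε A B s : ℝ) :
    resonantForm m ε A B s = quarticHam (m / 3 + ε) A (B / (2 * √2))
      (Complex.exp (((-(m * s) : ℝ) : ℂ) * Complex.I)) := by
  ext z; rw [resonantForm_eq]; simp [quarticHam]

theorem hamVF_normalForm (ε A B : ℝ) (z : ℂ) : hamVF (normalForm ε A B) z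
    = Complex.I * (ε * z + A * (Complex.normSq z : ℂ) * z
      + 3 * (B / (2 * √2) : ℝ) * (starRingEnd ℂ z) ^ 2) := by
  rw [normalForm_eq_quarticHam, hamVF_quarticHam]; simp

/-- The determinant of a real-linear map of the plane. -/
theorem det_eq (L : ℂ →L[ℝ] ℂ) :
    L.det = (L 1).re * (L Complex.I).im - (L Complex.I).re * (L 1).im := by
  rw [ContinuousLinearMap.det, ← LinearMap.det_toMatrix Complex.basisOneI, Matrix.det_fin_two]
  simp [LinearMap.toMatrix_apply]

theorem det_mul_add_mul_conj (L : ℂ →L[ℝ] ℂ) (a b : ℂ)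
    (h : ∀ z, L z = a * z + b * starRingEnd ℂ z) :
    L.det = Complex.normSq a - Complex.normSq b := by
  rw [det_eq, h, h]
  simp [Complex.normSq_apply]; ring


/-! ### Complete elliptic integrals and the Legendre equation. -/

/-- Differentiation under the integral sign for jointly continuous derivatives. -/
theorem hasDerivAt_intervalIntegral_of_continuousOn {f f' : ℝ → ℝ → ℝ} {s : Set ℝ} {a b x : ℝ}
    (hs : IsOpen s) (hx : x ∈ s) (hf : ∀ y ∈ s, ContinuousOn (f y) (Set.uIcc a b))
    (hf' : ContinuousOn (fun p : ℝ × ℝ => f' p.1 p.2) (s ×ˢ Set.uIcc a b))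
    (hd : ∀ y ∈ s, ∀ t ∈ Set.uIcc a b, HasDerivAt (fun y => f y t) (f' y t) y) :
    HasDerivAt (fun y => ∫ t in a..b, f y t) (∫ t in a..b, f' x t) x := by
  obtain ⟨δ, hδ, hball⟩ := Metric.nhds_basis_closedBall.mem_iff.1 (hs.mem_nhds hx)
  have hcomp : IsCompact (Metric.closedBall x δ ×ˢ Set.uIcc a b) :=
    (isCompact_closedBall x δ).prod isCompact_uIcc
  obtain ⟨C, hC⟩ := hcomp.exists_bound_of_continuousOn
    (hf'.mono (Set.prod_mono hball subset_rfl))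
  have hsub : Set.uIoc a b ⊆ Set.uIcc a b := Set.uIoc_subset_uIcc
  refine (intervalIntegral.hasDerivAt_integral_of_dominated_loc_of_deriv_le (F := f) (F' := f')
    (bound := fun _ => C) (s := Metric.closedBall x δ) (Metric.closedBall_mem_nhds x hδ)
    ?_ ?_ ?_ ?_ ?_ ?_).2
  · filter_upwards [hs.mem_nhds hx] with y hy
    exact ((hf y hy).mono hsub).aestronglyMeasurable measurableSet_uIoc
  · exact (hf x hx).intervalIntegrable
  · refine ContinuousOn.aestronglyMeasurable ?_ measurableSet_uIoc
    exact hf'.comp (f := fun t => (x, t)) (by fun_prop) fun t ht => ⟨hx, hsub ht⟩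
  · exact Eventually.of_forall fun t ht y hy => hC (y, t) ⟨hy, hsub ht⟩
  · exact intervalIntegrable_const
  · exact Eventually.of_forall fun t ht y hy => hd y (hball hy) t (hsub ht)

/-- The radicand of the elliptic integrals, `x` being `1 - 2 k²` for the modulus `k`. -/
noncomputable def ellDen (x ψ : ℝ) : ℝ := 1 - (1 - x) / 2 * Real.sin ψ ^ 2

theorem ellDen_pos {x : ℝ} (hx : -1 < x) (ψ : ℝ) : 0 < ellDen x ψ := by
  unfold ellDen
  have h0 := sq_nonneg (Real.sin ψ)
  have h1 := Real.sin_sq_le_one ψ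
  rcases le_total x 1 with h | h <;> nlinarith

/-- Complete elliptic integrals `∫₀^π sin^{2n} ψ (1 - k² sin² ψ)^{-n-1/2} dψ`. -/
noncomputable def ellInt (n : ℕ) (x : ℝ) : ℝ :=
  ∫ ψ in (0 : ℝ)..Real.pi, Real.sin ψ ^ (2 * n) * ellDen x ψ ^ (-(n : ℝ) - 1 / 2)

theorem continuous_ellInt_integrand (n : ℕ) {x : ℝ} (hx : -1 < x) :
    Continuous fun ψ => Real.sin ψ ^ (2 * n) * ellDen x ψ ^ (-(n : ℝ) - 1 / 2) := by
  refine (by fun_prop : Continuous fun ψ : ℝ => Real.sin ψ ^ (2 * n)).mul ?_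
  refine Continuous.rpow_const (by unfold ellDen; fun_prop) fun ψ => Or.inl (ellDen_pos hx ψ).ne'

/-- The exponents in `ellInt` are chosen so that the family is closed under differentiation in `x`:
each derivative raises `n` by one. Thus `K`, `K'`, `K''` are multiples of `ellInt 0`, `ellInt 1`,
`ellInt 2`. -/
theorem hasDerivAt_ellInt (n : ℕ) {x : ℝ} (hx : -1 < x) :
    HasDerivAt (ellInt n) ((-(n : ℝ) - 1 / 2) / 2 * ellInt (n + 1) x) x := by
  have key := hasDerivAt_intervalIntegral_of_continuousOn (a := 0) (b := Real.pi)
    (f := fun x ψ => Real.sin ψ ^ (2 * n) * ellDen x ψ ^ (-(n : ℝ) - 1 / 2))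
    (f' := fun x ψ => (-(n : ℝ) - 1 / 2) / 2 *
      (Real.sin ψ ^ (2 * (n + 1)) * ellDen x ψ ^ (-((n + 1 : ℕ) : ℝ) - 1 / 2)))
    (s := Set.Ioi (-1)) isOpen_Ioi hx
    (fun y hy => (continuous_ellInt_integrand n hy).continuousOn) ?_ ?_
  · rw [intervalIntegral.integral_const_mul] at key
    exact key
  · refine continuousOn_const.mul (ContinuousOn.mul (by fun_prop) ?_)
    refine ContinuousOn.rpow_const ?_ fun p hp => Or.inl (ellDen_pos hp.1 p.2).ne'
    unfold ellDen; fun_prop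
  · intro y hy ψ _
    have h1 : HasDerivAt (fun y => ellDen y ψ) (Real.sin ψ ^ 2 / 2) y := by
      have := (((hasDerivAt_id y).const_sub 1).div_const 2).mul_const (Real.sin ψ ^ 2)
      refine (this.const_sub 1).congr_deriv ?_
      ring
    have h2 := (h1.rpow_const (p := -(n : ℝ) - 1 / 2)
      (Or.inl (ellDen_pos hy ψ).ne')).const_mul (Real.sin ψ ^ (2 * n))
    refine h2.congr_deriv ?_
    have : -((n + 1 : ℕ) : ℝ) - 1 / 2 = -(n : ℝ) - 1 / 2 - 1 := by push_cast; ring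
    rw [this, mul_add, pow_add]
    ring

theorem ellInt_pos (n : ℕ) {x : ℝ} (hx : -1 < x) : 0 < ellInt n x := by
  refine intervalIntegral.intervalIntegral_pos_of_pos_on
    ((continuous_ellInt_integrand n hx).intervalIntegrable _ _) (fun ψ hψ => ?_) Real.pi_pos
  exact mul_pos (pow_pos (Real.sin_pos_of_mem_Ioo hψ) _) (Real.rpow_pos_of_pos (ellDen_pos hx ψ) _)

/-- The Legendre equation of `ellInt 0`. -/
theorem ellInt_legendre {x : ℝ} (hx : -1 < x) :
    (1 - x ^ 2) * (3 / 16 * ellInt 2 x) - 2 * x * (-1 / 4 * ellInt 1 x) - ellInt 0 x / 4 = 0 := by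
  -- The integrand of the Legendre expression is an exact derivative of a function that vanishes at
  -- `0` and `π` because of the factor `sin ψ`.
  have hd : ∀ ψ, HasDerivAt
      (fun ψ => -1 / 4 * (Real.sin ψ * Real.cos ψ * ellDen x ψ ^ (-(3 / 2) : ℝ)))
      ((1 - x ^ 2) * (3 / 16 * (Real.sin ψ ^ (2 * 2) * ellDen x ψ ^ (-((2 : ℕ) : ℝ) - 1 / 2)))
        - 2 * x * (-1 / 4 * (Real.sin ψ ^ (2 * 1) * ellDen x ψ ^ (-((1 : ℕ) : ℝ) - 1 / 2)))
        - (Real.sin ψ ^ (2 * 0) * ellDen x ψ ^ (-((0 : ℕ) : ℝ) - 1 / 2)) / 4) ψ := by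
    intro ψ
    have hp := ellDen_pos hx ψ
    have h1 : HasDerivAt (fun ψ => ellDen x ψ) (-((1 - x) * Real.sin ψ * Real.cos ψ)) ψ := by
      refine ((((Real.hasDerivAt_sin ψ).pow 2).const_mul ((1 - x) / 2)).const_sub 1).congr_deriv ?_
      simp; ring
    have h2 := (((Real.hasDerivAt_sin ψ).mul (Real.hasDerivAt_cos ψ)).mul
      (h1.rpow_const (p := -(3 / 2)) (Or.inl hp.ne'))).const_mul (-1 / 4)
    refine h2.congr_deriv ?_
    have e1 : ellDen x ψ ^ (-((2 : ℕ) : ℝ) - 1 / 2) = ellDen x ψ ^ (-(5 / 2) : ℝ) := by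
      congr 1; norm_num
    have e2 : ellDen x ψ ^ (-((1 : ℕ) : ℝ) - 1 / 2)
        = ellDen x ψ * ellDen x ψ ^ (-(5 / 2) : ℝ) := by
      nth_rw 2 [← Real.rpow_one (ellDen x ψ)]
      rw [← Real.rpow_add hp]; congr 1; norm_num
    have e3 : ellDen x ψ ^ (-((0 : ℕ) : ℝ) - 1 / 2)
        = ellDen x ψ ^ 2 * ellDen x ψ ^ (-(5 / 2) : ℝ) := by
      rw [← Real.rpow_natCast, ← Real.rpow_add hp]; congr 1; norm_num
    have e4 : ellDen x ψ ^ (-(3 / 2) : ℝ) = ellDen x ψ * ellDen x ψ ^ (-(5 / 2) : ℝ) := by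
      nth_rw 2 [← Real.rpow_one (ellDen x ψ)]
      rw [← Real.rpow_add hp]; congr 1; norm_num
    have e5 : ellDen x ψ ^ (-(3 / 2) - 1 : ℝ) = ellDen x ψ ^ (-(5 / 2) : ℝ) := by
      congr 1; norm_num
    rw [e1, e2, e3, e4, e5]
    generalize ellDen x ψ ^ (-(5 / 2) : ℝ) = q
    have hc := Real.sin_sq_add_cos_sq ψ
    have hc' : Real.cos ψ ^ 2 = 1 - Real.sin ψ ^ 2 := by linarith
    unfold ellDen
    simp only [Pi.mul_apply]
    linear_combination (-1 / 4 * q * ((1 - (1 - x) / 2 * Real.sin ψ ^ 2)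
      + (3 / 2) * (1 - x) * Real.sin ψ ^ 2)) * hc'
  have hint := intervalIntegral.integral_eq_sub_of_hasDerivAt (a := 0) (b := Real.pi)
    (fun ψ _ => hd ψ) (Continuous.intervalIntegrable (by
      have h0 := continuous_ellInt_integrand 0 hx
      have h1 := continuous_ellInt_integrand 1 hx
      have h2 := continuous_ellInt_integrand 2 hx
      exact ((continuous_const.mul (continuous_const.mul h2)).sub
        (continuous_const.mul (continuous_const.mul h1))).sub (h0.div_const 4)) _ _)
  have i0 := (continuous_ellInt_integrand 0 hx).intervalIntegrable (μ := volume) 0 Real.pi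
  have i1 := (continuous_ellInt_integrand 1 hx).intervalIntegrable (μ := volume) 0 Real.pi
  have i2 := (continuous_ellInt_integrand 2 hx).intervalIntegrable (μ := volume) 0 Real.pi
  rw [intervalIntegral.integral_sub (((i2.const_mul _).const_mul _).sub
    ((i1.const_mul _).const_mul _)) (i0.div_const _), intervalIntegral.integral_sub
    ((i2.const_mul _).const_mul _) ((i1.const_mul _).const_mul _)] at hint
  simp only [intervalIntegral.integral_const_mul, intervalIntegral.integral_div] at hint
  unfold ellInt
  simpa using hint

/-- The complete elliptic integral of the first kind with `x = 1 - 2 k²`. -/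
noncomputable def ellK (x : ℝ) : ℝ := ellInt 0 x / 2

/-- Its derivative. -/
noncomputable def ellK' (x : ℝ) : ℝ := -(ellInt 1 x / 8)

theorem hasDerivAt_ellK {x : ℝ} (hx : -1 < x) : HasDerivAt ellK (ellK' x) x := by
  refine ((hasDerivAt_ellInt 0 hx).div_const 2).congr_deriv ?_
  simp [ellK']; ring

theorem hasDerivAt_ellK' {x : ℝ} (hx : -1 < x) :
    HasDerivAt ellK' (3 / 32 * ellInt 2 x) x := by
  refine ((hasDerivAt_ellInt 1 hx).div_const 8).neg.congr_deriv ?_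
  simp; ring

theorem continuousAt_ellInt (n : ℕ) {x : ℝ} (hx : -1 < x) : ContinuousAt (ellInt n) x :=
  (hasDerivAt_ellInt n hx).continuousAt

theorem hasStrictDerivAt_ellK {x : ℝ} (hx : -1 < x) : HasStrictDerivAt ellK (ellK' x) x := by
  refine hasStrictDerivAt_of_hasDerivAt_of_continuousAt
    ((lt_mem_nhds hx).mono fun y hy => hasDerivAt_ellK hy) (hasDerivAt_ellK' hx).continuousAt

theorem hasStrictDerivAt_ellK' {x : ℝ} (hx : -1 < x) :
    HasStrictDerivAt ellK' (3 / 32 * ellInt 2 x) x := by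
  refine hasStrictDerivAt_of_hasDerivAt_of_continuousAt
    ((lt_mem_nhds hx).mono fun y hy => hasDerivAt_ellK' hy)
    ((continuousAt_ellInt 2 hx).const_mul _)

theorem ellK_legendre {x : ℝ} (hx : -1 < x) :
    (1 - x ^ 2) * (3 / 32 * ellInt 2 x) = 2 * x * ellK' x + ellK x / 4 := by
  have := ellInt_legendre hx
  unfold ellK ellK'
  linarith

theorem ellK'_neg {x : ℝ} (hx : -1 < x) : ellK' x < 0 := by
  have := ellInt_pos 1 hx
  unfold ellK'; linarith

/-- Under a single integral, with the power `-3/2` of `ellDen` taken out, the remaining factor is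
`ellDen x ψ - (x/2) sin² ψ = 1 - sin² ψ / 2`, which does not depend on `x` and is positive. -/
theorem ellK_add_pos {x : ℝ} (hx : -1 < x) : 0 < ellK x + 2 * x * ellK' x := by
  have i0 := (continuous_ellInt_integrand 0 hx).intervalIntegrable (μ := volume) 0 Real.pi
  have i1 := (continuous_ellInt_integrand 1 hx).intervalIntegrable (μ := volume) 0 Real.pi
  have h : ellK x + 2 * x * ellK' x = (1 / 2) * ∫ ψ in (0 : ℝ)..Real.pi,
      (Real.sin ψ ^ (2 * 0) * ellDen x ψ ^ (-((0 : ℕ) : ℝ) - 1 / 2)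
        - x / 2 * (Real.sin ψ ^ (2 * 1) * ellDen x ψ ^ (-((1 : ℕ) : ℝ) - 1 / 2))) := by
    rw [intervalIntegral.integral_sub i0 (i1.const_mul _), intervalIntegral.integral_const_mul]
    unfold ellK ellK' ellInt
    ring
  rw [h]
  refine mul_pos (by norm_num) (intervalIntegral.intervalIntegral_pos_of_pos_on
    (i0.sub (i1.const_mul _)) (fun ψ hψ => ?_) Real.pi_pos)
  have hp := ellDen_pos hx ψ
  have e3 : ellDen x ψ ^ (-((0 : ℕ) : ℝ) - 1 / 2)
      = ellDen x ψ * ellDen x ψ ^ (-((1 : ℕ) : ℝ) - 1 / 2) := by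
    nth_rw 2 [← Real.rpow_one (ellDen x ψ)]
    rw [← Real.rpow_add hp]; congr 1; norm_num
  rw [e3]
  have hq : 0 < ellDen x ψ ^ (-((1 : ℕ) : ℝ) - 1 / 2) := Real.rpow_pos_of_pos hp _
  have : 0 < (ellDen x ψ - x / 2 * Real.sin ψ ^ 2) := by
    unfold ellDen
    nlinarith [Real.sin_sq_add_cos_sq ψ, sq_nonneg (Real.cos ψ)]
  simp only [mul_zero, pow_zero, one_mul, mul_one]
  nlinarith

theorem ellK_one : ellK 1 = Real.pi / 2 := by
  simp [ellK, ellInt, ellDen]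

theorem pi_div_two_le_ellK {x : ℝ} (hx : -1 < x) (hx1 : x ≤ 1) : Real.pi / 2 ≤ ellK x := by
  have hanti : AntitoneOn ellK (Set.Ioi (-1)) :=
    antitoneOn_of_deriv_nonpos (convex_Ioi _)
      (fun y hy => (hasDerivAt_ellK hy).continuousAt.continuousWithinAt)
      (fun y hy => (hasDerivAt_ellK (interior_subset hy)).differentiableAt.differentiableWithinAt)
      (fun y hy => by
        rw [(hasDerivAt_ellK (interior_subset hy)).deriv]
        exact (ellK'_neg (interior_subset hy)).le)
  rw [← ellK_one]
  exact hanti hx (by norm_num : (1 : ℝ) ∈ Set.Ioi (-1)) hx1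


/-! ### A polynomial inequality. -/

/-- A convex function lies below its chord. -/
theorem quadratic_neg_of_endpoints {a b c k₀ k₁ k : ℝ} (ha : 0 ≤ a)
    (h₀ : a * k₀ ^ 2 + b * k₀ + c ≤ 0) (h₁ : a * k₁ ^ 2 + b * k₁ + c < 0)
    (hk₀ : k₀ < k) (hk₁ : k < k₁) : a * k ^ 2 + b * k + c < 0 := by
  have e : (k₁ - k₀) * (a * k ^ 2 + b * k + c) = (k₁ - k) * (a * k₀ ^ 2 + b * k₀ + c)
      + (k - k₀) * (a * k₁ ^ 2 + b * k₁ + c) - a * (k - k₀) * (k₁ - k) * (k₁ - k₀) := by ring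
  have p0 : 0 < k - k₀ := sub_pos.2 hk₀
  have p1 : 0 < k₁ - k := sub_pos.2 hk₁
  have p2 : 0 < k₁ - k₀ := by linarith
  have h : (k₁ - k₀) * (a * k ^ 2 + b * k + c) < 0 := by
    rw [e]
    have t1 := mul_nonneg p1.le (neg_nonneg.2 h₀)
    have t2 := mul_pos p0 (neg_pos.2 h₁)
    have t3 : 0 ≤ a * (k - k₀) * (k₁ - k) * (k₁ - k₀) := by positivity
    linarith
  by_contra hcon
  exact absurd h (not_lt.2 (mul_nonneg p2.le (not_lt.1 hcon)))

/-- The sign condition behind the uniqueness of the critical point of the period. -/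
theorem period_polynomial_neg {k σ : ℝ} (hk : 0 < k) (hk1 : k < 1) (h1 : σ < 1 + k)
    (h2 : 3 * k < σ ^ 2 - σ + 1) (h3 : 1 < 8 * k * σ) :
    (1 + 4 * σ + 15 * σ ^ 2 + 22 * σ ^ 3 + 4 * σ ^ 4) * k ^ 2
      + (-2 - 2 * σ - 9 * σ ^ 2 - 14 * σ ^ 3 - 11 * σ ^ 4) * k
      + (1 - 2 * σ + 6 * σ ^ 2 - 2 * σ ^ 3 + σ ^ 4) < 0 := by
  have hσ0 : 0 < σ := by
    by_contra h
    have := mul_nonneg hk.le (neg_nonneg.2 (not_lt.1 h))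
    linarith
  have hσ2 : σ < 2 := by linarith
  have hσ : 1 / 2 < σ := by
    by_contra h
    have h' := not_lt.1 h
    have e : 8 * σ * (σ ^ 2 - σ + 1) ≤ 3 := by
      have : 0 ≤ (1 / 2 - σ) * (4 * σ ^ 2 - 2 * σ + 3) :=
        mul_nonneg (by linarith) (by nlinarith [sq_nonneg (σ - 1)])
      nlinarith
    have : 8 * σ * (3 * k) < 8 * σ * (σ ^ 2 - σ + 1) :=
      mul_lt_mul_of_pos_left h2 (by positivity)
    linarith
  have ha : 0 ≤ 1 + 4 * σ + 15 * σ ^ 2 + 22 * σ ^ 3 + 4 * σ ^ 4 := by positivity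
  -- The quadratic in `k` at the upper endpoint supplied by `h2`; as a polynomial in `σ` it contains
  -- the factor `(σ - 1/2)(σ - 2)`, and `hf` is the positivity of its cofactor.
  have hhi : (1 + 4 * σ + 15 * σ ^ 2 + 22 * σ ^ 3 + 4 * σ ^ 4) * ((σ ^ 2 - σ + 1) / 3) ^ 2
      + (-2 - 2 * σ - 9 * σ ^ 2 - 14 * σ ^ 3 - 11 * σ ^ 4) * ((σ ^ 2 - σ + 1) / 3)
      + (1 - 2 * σ + 6 * σ ^ 2 - 2 * σ ^ 3 + σ ^ 4) < 0 := by
    have hf : 0 < 4 - 6 * σ + 18 * σ ^ 2 + 14 * σ ^ 3 + 6 * σ ^ 4 + 24 * σ ^ 5 + 4 * σ ^ 6 := by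
      have : 0 < 4 - 6 * σ + 18 * σ ^ 2 := by nlinarith [sq_nonneg (σ - 1 / 6)]
      have : 0 < 14 * σ ^ 3 + 6 * σ ^ 4 + 24 * σ ^ 5 + 4 * σ ^ 6 := by positivity
      linarith
    have := mul_pos (mul_pos (sub_pos.2 hσ) (sub_pos.2 hσ2)) hf
    nlinarith
  have hk' : k < (σ ^ 2 - σ + 1) / 3 := by linarith
  -- Two lower bounds for `k` are available, `1/(8σ)` from `h3` and `σ - 1` from `h1`. The quadratic
  -- is nonpositive at the first for `σ ≤ 5/4` and at the second for `σ ≥ 5/4`.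
  rcases le_total σ (5 / 4) with hs | hs
  · have hlo : (1 + 4 * σ + 15 * σ ^ 2 + 22 * σ ^ 3 + 4 * σ ^ 4) * (1 / (8 * σ)) ^ 2
        + (-2 - 2 * σ - 9 * σ ^ 2 - 14 * σ ^ 3 - 11 * σ ^ 4) * (1 / (8 * σ))
        + (1 - 2 * σ + 6 * σ ^ 2 - 2 * σ ^ 3 + σ ^ 4) ≤ 0 := by
      have e : (1 + 4 * σ + 15 * σ ^ 2 + 22 * σ ^ 3 + 4 * σ ^ 4) * (1 / (8 * σ)) ^ 2
        + (-2 - 2 * σ - 9 * σ ^ 2 - 14 * σ ^ 3 - 11 * σ ^ 4) * (1 / (8 * σ))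
        + (1 - 2 * σ + 6 * σ ^ 2 - 2 * σ ^ 3 + σ ^ 4)
        = (2 * σ - 1) ^ 3 * (8 * σ ^ 3 - 15 * σ ^ 2 + 6 * σ - 1) / (64 * σ ^ 2) := by
        field_simp; ring
      rw [e]
      have hq : 8 * σ ^ 3 - 15 * σ ^ 2 + 6 * σ - 1 ≤ 0 := by
        nlinarith [mul_nonneg (sub_nonneg.2 hs) (sq_nonneg σ), mul_nonneg (sub_nonneg.2 hs) hσ0.le]
      have hp : 0 ≤ (2 * σ - 1) ^ 3 := pow_nonneg (by linarith) 3
      exact div_nonpos_of_nonpos_of_nonneg (mul_nonpos_of_nonneg_of_nonpos hp hq) (by positivity)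
    refine quadratic_neg_of_endpoints ha hlo hhi ?_ hk'
    rw [div_lt_iff₀ (by positivity)]
    linarith
  · have hlo : (1 + 4 * σ + 15 * σ ^ 2 + 22 * σ ^ 3 + 4 * σ ^ 4) * (σ - 1) ^ 2
        + (-2 - 2 * σ - 9 * σ ^ 2 - 14 * σ ^ 3 - 11 * σ ^ 4) * (σ - 1)
        + (1 - 2 * σ + 6 * σ ^ 2 - 2 * σ ^ 3 + σ ^ 4) ≤ 0 := by
      have hq : 0 ≤ -2 - σ - 11 * σ ^ 2 - 5 * σ ^ 3 + 11 * σ ^ 4 + 4 * σ ^ 5 := by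
        obtain ⟨t, ht, rfl⟩ : ∃ t, 0 ≤ t ∧ σ = t + 5 / 4 := ⟨σ - 5 / 4, by linarith, by ring⟩
        ring_nf; positivity
      have := mul_nonneg (sub_nonneg.2 hσ2.le) hq
      nlinarith
    exact quadratic_neg_of_endpoints ha hlo hhi (by linarith) hk'

/-! ### The period as a function of the level parameter -/

/-- The coefficient `X` of the elliptic integral `4 ∫₀^∞ (u⁴ + X u² + Y)^{-1/2} du` that gives the
period, in terms of the scaled parameter `e` and a parameter `v` on the levels. -/
noncomputable def lvX (e v : ℝ) : ℝ := 2 * (e - v) ^ 2 / (1 - 4 * v) - v ^ 2 - 2 * v * (e - v)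

/-- The coefficient `Y` of the elliptic integral. -/
noncomputable def lvY (e v : ℝ) : ℝ :=
  (e - v) ^ 3 * (e - v - 2 * v * (1 - 4 * v)) / (1 - 4 * v) ^ 2

/-- The scaled energy in terms of the scaled parameter and the level parameter. -/
noncomputable def lvEnergy (e v : ℝ) : ℝ := v * (e - v) ^ 2 / (1 - 4 * v)

/-- The derivative of `lvX` in `v`. -/
noncomputable def lvXd (e v : ℝ) : ℝ :=
  2 * (e - v) * (4 * (e - v) - 2 * (1 - 4 * v) - (1 - 4 * v) ^ 2) / (1 - 4 * v) ^ 2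

/-- The derivative of `lvY` in `v`. -/
noncomputable def lvYd (e v : ℝ) : ℝ :=
  2 * (e - v) ^ 2 * (4 * (e - v) ^ 2 - 3 * (e - v) * (1 - 4 * v) + 3 * v * (1 - 4 * v) ^ 2)
    / (1 - 4 * v) ^ 3

/-- The derivative of `lvXd` in `v`. -/
noncomputable def lvXdd (e v : ℝ) : ℝ :=
  (2 * (e - v) * (4 + 8 * (1 - 4 * v))
      - 2 * (4 * (e - v) - 2 * (1 - 4 * v) - (1 - 4 * v) ^ 2)) / (1 - 4 * v) ^ 2
    + 16 * (e - v) * (4 * (e - v) - 2 * (1 - 4 * v) - (1 - 4 * v) ^ 2) / (1 - 4 * v) ^ 3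

/-- The derivative of `lvYd` in `v`. -/
noncomputable def lvYdd (e v : ℝ) : ℝ :=
  (2 * (e - v) ^ 2 * (-8 * (e - v) + 3 * (1 - 4 * v) + 12 * (e - v) + 3 * (1 - 4 * v) ^ 2
      - 24 * v * (1 - 4 * v))
    - 4 * (e - v) * (4 * (e - v) ^ 2 - 3 * (e - v) * (1 - 4 * v) + 3 * v * (1 - 4 * v) ^ 2))
    / (1 - 4 * v) ^ 3
  + 24 * (e - v) ^ 2 * (4 * (e - v) ^ 2 - 3 * (e - v) * (1 - 4 * v) + 3 * v * (1 - 4 * v) ^ 2)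
    / (1 - 4 * v) ^ 4

section derivatives

variable {e v : ℝ}

theorem hasDerivAt_sub_self (e v : ℝ) : HasDerivAt (fun v : ℝ => e - v) (-1) v := by
  simpa using (hasDerivAt_id v).const_sub e

theorem hasDerivAt_one_sub_four_mul (v : ℝ) : HasDerivAt (fun v : ℝ => 1 - 4 * v) (-4) v := by
  simpa using ((hasDerivAt_id v).const_mul 4).const_sub 1

theorem hasDerivAt_lvX (hv : v < 1 / 4) : HasDerivAt (lvX e) (lvXd e v) v := by
  have hk : (1 - 4 * v) ≠ 0 := by linarith
  have hg := hasDerivAt_sub_self e v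
  have hK := hasDerivAt_one_sub_four_mul v
  have h := ((((hg.pow 2).const_mul 2).div hK hk).sub ((hasDerivAt_id v).pow 2)).sub
    (((hasDerivAt_id v).const_mul 2).mul hg)
  refine h.congr_deriv ?_
  obtain ⟨k, rfl⟩ : ∃ k, v = (1 - k) / 4 := ⟨1 - 4 * v, by ring⟩
  have hk' : 1 - 4 * ((1 - k) / 4) = k := by ring
  simp only [lvXd, id, Pi.pow_apply]
  rw [hk'] at hk ⊢
  field_simp
  ring

theorem hasDerivAt_lvY (hv : v < 1 / 4) : HasDerivAt (lvY e) (lvYd e v) v := by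
  have hk : (1 - 4 * v) ≠ 0 := by linarith
  have hg := hasDerivAt_sub_self e v
  have hK := hasDerivAt_one_sub_four_mul v
  have h := ((hg.pow 3).mul (hg.sub (((hasDerivAt_id v).const_mul 2).mul hK))).div (hK.pow 2)
    (pow_ne_zero 2 hk)
  refine h.congr_deriv ?_
  simp [lvYd]
  field_simp
  ring

theorem hasDerivAt_lvXd (hv : v < 1 / 4) : HasDerivAt (lvXd e) (lvXdd e v) v := by
  have hk : (1 - 4 * v) ≠ 0 := by linarith
  have hg := hasDerivAt_sub_self e v
  have hK := hasDerivAt_one_sub_four_mul v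
  have h := ((hg.const_mul 2).mul (((hg.const_mul 4).sub (hK.const_mul 2)).sub (hK.pow 2))).div
    (hK.pow 2) (pow_ne_zero 2 hk)
  refine h.congr_deriv ?_
  simp [lvXdd]
  field_simp
  ring

theorem hasDerivAt_lvYd (hv : v < 1 / 4) : HasDerivAt (lvYd e) (lvYdd e v) v := by
  have hk : (1 - 4 * v) ≠ 0 := by linarith
  have hg := hasDerivAt_sub_self e v
  have hK := hasDerivAt_one_sub_four_mul v
  have h := (((hg.pow 2).const_mul 2).mul ((((hg.pow 2).const_mul 4).sub
    ((hg.const_mul 3).mul hK)).add (((hasDerivAt_id v).const_mul 3).mul (hK.pow 2)))).div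
    (hK.pow 3) (pow_ne_zero 3 hk)
  refine h.congr_deriv ?_
  simp [lvYdd]
  field_simp
  ring

/-- The derivative of `lvEnergy` in `v`. -/
theorem hasDerivAt_lvEnergy (hv : v < 1 / 4) : HasDerivAt (lvEnergy e)
    ((e - v) * (e - 3 * v + 8 * v ^ 2) / (1 - 4 * v) ^ 2) v := by
  have hk : (1 - 4 * v) ≠ 0 := by linarith
  have hg := hasDerivAt_sub_self e v
  have hK := hasDerivAt_one_sub_four_mul v
  have h := ((hasDerivAt_id v).mul (hg.pow 2)).div hK hk
  refine h.congr_deriv ?_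
  simp
  field_simp
  ring

end derivatives

/-- The parameters of the nondegenerate levels: `v ∈ [0, 1/4)` and `e ≥ 9/32`, except for the
level through the degenerate equilibria. -/
structure IsLevel (e v : ℝ) : Prop where
  nonneg : 0 ≤ v
  lt : v < 1 / 4
  le : 9 / 32 ≤ e
  ne : 9 / 32 < e ∨ v ≠ 3 / 16

namespace IsLevel

variable {e v : ℝ} (h : IsLevel e v)

include h

theorem one_sub_pos : 0 < 1 - 4 * v := by have := h.lt; linarith

theorem sub_pos : 0 < e - v := by have := h.lt; have := h.le; linarith

/-- Completing the square gives `(e - 9/32) + 8(v - 3/16)²`, which vanishes only at the level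
through the degenerate equilibria. The same expression is a factor of `Y` and of the derivative of
the energy in `v`. -/
theorem cubic_pos : 0 < e - v - 2 * v * (1 - 4 * v) := by
  rcases h.ne with h1 | h1
  · nlinarith [sq_nonneg (v - 3 / 16)]
  · have : 0 < (v - 3 / 16) ^ 2 := by
      have := sub_ne_zero.2 h1
      positivity
    nlinarith [h.le]

theorem Y_pos : 0 < lvY e v := by
  have := h.one_sub_pos
  have := h.sub_pos
  have := h.cubic_pos
  unfold lvY; positivity

theorem disc_pos : 0 < 16 * (e - v) ^ 2 - 4 * (e - v) * (1 - 4 * v) - v * (1 - 4 * v) := by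
  have e1 : 16 * (e - v) ^ 2 - 4 * (e - v) * (1 - 4 * v) - v * (1 - 4 * v)
      = (4 * (e - 9 / 32) - 2 * (v - 3 / 16)) ^ 2 + 2 * (e - 9 / 32) := by ring
  rw [e1]
  rcases h.le.lt_or_eq with h1 | h1
  · have := sq_nonneg (4 * (e - 9 / 32) - 2 * (v - 3 / 16)); linarith
  · have h2 : v ≠ 3 / 16 := by
      rcases h.ne with h3 | h3
      · exact absurd h1 h3.ne
      · exact h3
    have := sub_ne_zero.2 h2
    rw [← h1]
    have : 0 < (v - 3 / 16) ^ 2 := by positivity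
    nlinarith

/-- The factor `v³` separates the two regimes: for `v > 0` the radicand `u⁴ + X u² + Y` has negative
discriminant, while at `v = 0`, the equilibrium at the origin, it is a perfect square and the period
is elementary. -/
theorem four_Y_sub : 4 * lvY e v - lvX e v ^ 2 = v ^ 3 *
    (16 * (e - v) ^ 2 - 4 * (e - v) * (1 - 4 * v) - v * (1 - 4 * v)) / (1 - 4 * v) := by
  have := h.one_sub_pos.ne'
  unfold lvX lvY
  field_simp
  ring

theorem sq_X_le : lvX e v ^ 2 ≤ 4 * lvY e v := by
  have h1 := h.four_Y_sub
  have h2 : 0 ≤ v ^ 3 * (16 * (e - v) ^ 2 - 4 * (e - v) * (1 - 4 * v) - v * (1 - 4 * v))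
      / (1 - 4 * v) :=
    div_nonneg (mul_nonneg (pow_nonneg h.nonneg 3) h.disc_pos.le) h.one_sub_pos.le
  linarith

theorem sq_X_lt (hv : 0 < v) : lvX e v ^ 2 < 4 * lvY e v := by
  have h1 := h.four_Y_sub
  have h2 : 0 < v ^ 3 * (16 * (e - v) ^ 2 - 4 * (e - v) * (1 - 4 * v) - v * (1 - 4 * v))
      / (1 - 4 * v) :=
    div_pos (mul_pos (pow_pos hv 3) h.disc_pos) h.one_sub_pos
  linarith

end IsLevel


/-! ### The derivative of the period and its sign at critical levels. -/

/-- The argument of `ellK`. -/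
noncomputable def lvArg (e v : ℝ) : ℝ := lvX e v / (2 * √(lvY e v))

/-- The period of the scaled normal form on the level of energy `lvEnergy e v`. -/
noncomputable def lvPeriod (e v : ℝ) : ℝ := 4 * lvY e v ^ (-(1 / 4) : ℝ) * ellK (lvArg e v)

/-- `2 Y X' - X Y'`. -/
noncomputable def lvE (e v : ℝ) : ℝ := 2 * lvY e v * lvXd e v - lvX e v * lvYd e v

/-- A positive multiple of the negative derivative of the period. -/
noncomputable def critFun (e v : ℝ) : ℝ :=
  lvYd e v * ellK (lvArg e v) - lvE e v * (ellK' (lvArg e v) / √(lvY e v))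

namespace IsLevel

variable {e v : ℝ} (h : IsLevel e v)

include h

theorem sqrtY_pos : 0 < √(lvY e v) := Real.sqrt_pos.2 h.Y_pos

theorem neg_one_lt_arg : -1 < lvArg e v := by
  have hs := h.sqrtY_pos
  have hY := Real.sq_sqrt h.Y_pos.le
  unfold lvArg
  rw [lt_div_iff₀ (by positivity)]
  -- At `v = 0` one has `X² = 4Y`, so the discriminant does not exclude the value `-1`; there the
  -- sign of `X` does.
  rcases h.nonneg.eq_or_lt with h0 | h0
  · have hX : 0 < lvX e v := by
      have h1 := h.sub_pos
      have h2 := h.one_sub_pos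
      rw [← h0] at h1 h2 ⊢
      unfold lvX
      have : 0 < 2 * (e - 0) ^ 2 / (1 - 4 * 0) := by positivity
      linarith
    linarith
  · have h1 := h.sq_X_lt h0
    by_contra hc
    nlinarith

theorem arg_le_one : lvArg e v ≤ 1 := by
  have hs := h.sqrtY_pos
  have hY := Real.sq_sqrt h.Y_pos.le
  unfold lvArg
  rw [div_le_one (by positivity)]
  have h1 := h.sq_X_le
  by_contra hc
  nlinarith

theorem hasDerivAt_sqrtY :
    HasDerivAt (fun v => √(lvY e v)) (lvYd e v / (2 * √(lvY e v))) v :=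
  (hasDerivAt_lvY h.lt).sqrt h.Y_pos.ne'

theorem hasDerivAt_arg :
    HasDerivAt (lvArg e) (lvE e v / (4 * lvY e v * √(lvY e v))) v := by
  have hs := h.sqrtY_pos
  have hY := Real.sq_sqrt h.Y_pos.le
  have h1 := (hasDerivAt_lvX (e := e) h.lt).div (h.hasDerivAt_sqrtY.const_mul 2) (by positivity)
  refine h1.congr_deriv ?_
  unfold lvE
  generalize √(lvY e v) = r at *
  rw [← hY]
  field_simp
  ring

theorem hasDerivAt_ellK_arg : HasDerivAt (fun v => ellK (lvArg e v))
    (ellK' (lvArg e v) * (lvE e v / (4 * lvY e v * √(lvY e v)))) v :=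
  (hasDerivAt_ellK h.neg_one_lt_arg).comp v h.hasDerivAt_arg

theorem hasDerivAt_period : HasDerivAt (lvPeriod e)
    (-(lvY e v ^ (-(5 / 4) : ℝ) * critFun e v)) v := by
  have hY := h.Y_pos
  have hs := h.sqrtY_pos
  have h1 := (((hasDerivAt_lvY (e := e) h.lt).rpow_const (p := -(1 / 4))
    (Or.inl hY.ne')).const_mul 4).mul h.hasDerivAt_ellK_arg
  refine h1.congr_deriv ?_
  have e1 : lvY e v ^ (-(1 / 4) : ℝ) = lvY e v * lvY e v ^ (-(5 / 4) : ℝ) := by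
    nth_rw 2 [← Real.rpow_one (lvY e v)]
    rw [← Real.rpow_add hY]; norm_num
  have e2 : (-(1 / 4) - 1 : ℝ) = -(5 / 4) := by norm_num
  rw [e2, e1]
  unfold critFun
  field_simp
  ring

theorem hasDerivAt_critFun : HasDerivAt (critFun e)
    (lvYdd e v * ellK (lvArg e v)
      + lvYd e v * (ellK' (lvArg e v) * (lvE e v / (4 * lvY e v * √(lvY e v))))
      - ((2 * lvY e v * lvXdd e v + lvYd e v * lvXd e v - lvX e v * lvYdd e v)
          * (ellK' (lvArg e v) / √(lvY e v))
        + lvE e v * ((3 / 32 * ellInt 2 (lvArg e v) * (lvE e v / (4 * lvY e v * √(lvY e v)))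
          * √(lvY e v) - ellK' (lvArg e v) * (lvYd e v / (2 * √(lvY e v)))) / √(lvY e v) ^ 2))) v
    := by
  have hK' := ((hasDerivAt_ellK' h.neg_one_lt_arg).comp v h.hasDerivAt_arg).div
    h.hasDerivAt_sqrtY h.sqrtY_pos.ne'
  have hE : HasDerivAt (lvE e)
      (2 * lvY e v * lvXdd e v + lvYd e v * lvXd e v - lvX e v * lvYdd e v) v := by
    refine ((((hasDerivAt_lvY h.lt).const_mul 2).mul (hasDerivAt_lvXd h.lt)).sub
      ((hasDerivAt_lvX h.lt).mul (hasDerivAt_lvYd h.lt))).congr_deriv ?_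
    ring
  exact ((hasDerivAt_lvYd h.lt).mul h.hasDerivAt_ellK_arg).sub (hE.mul hK')

/-- The factorization of the sign condition at critical points of the period. -/
theorem critical_bracket : 4 * lvY e v * (4 * lvY e v - lvX e v ^ 2)
      * (2 * lvY e v * (lvYdd e v * lvXd e v - lvXdd e v * lvYd e v) - lvYd e v ^ 2 * lvXd e v)
      + 3 * (4 * lvY e v - lvX e v ^ 2) * lvYd e v ^ 2 * lvE e v
      - 4 * lvE e v ^ 2 * lvX e v * lvYd e v - lvE e v ^ 3
    = (e - v) ^ 8 * (4 * v) ^ 4 * (e - v - 2 * v * (1 - 4 * v)) ^ 2 / (32 * (1 - 4 * v) ^ 6)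
      * ((4 * (e - v) / (1 - 4 * v)) ^ 4 * (4 * (1 - 4 * v) ^ 2 - 11 * (1 - 4 * v) + 1)
        + 6 * (4 * (e - v) / (1 - 4 * v)) ^ 3 * ((1 - 4 * v) ^ 2 + 5 * (1 - 4 * v) - 1)
        - 3 * (4 * (e - v) / (1 - 4 * v)) ^ 2 * (9 * (1 - 4 * v) ^ 2 + 11 * (1 - 4 * v) - 6)
        + 6 * (4 * (e - v) / (1 - 4 * v)) * (4 * (1 - 4 * v) ^ 2 + 3 * (1 - 4 * v) - 4)
        - 6 * ((1 - 4 * v) ^ 2 + (1 - 4 * v) - 2)) := by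
  have hk := h.one_sub_pos.ne'
  obtain ⟨g, hg⟩ : ∃ g, g = e - v := ⟨_, rfl⟩
  obtain ⟨k, hk'⟩ : ∃ k, k = 1 - 4 * v := ⟨_, rfl⟩
  have hv : v = (1 - k) / 4 := by linarith
  unfold lvE lvX lvY lvXd lvYd lvXdd lvYdd
  rw [← hk'] at hk ⊢
  rw [← hg]
  subst hv
  field_simp
  ring

theorem one_sub_sq_arg : 1 - lvArg e v ^ 2 = (4 * lvY e v - lvX e v ^ 2) / (4 * lvY e v) := by
  have hY := h.Y_pos
  unfold lvArg
  rw [div_pow, mul_pow, Real.sq_sqrt hY.le]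
  field_simp
  ring

theorem ellK_add_mul_pos :
    0 < ellK (lvArg e v) + lvX e v * (ellK' (lvArg e v) / √(lvY e v)) := by
  have h1 := ellK_add_pos h.neg_one_lt_arg
  have hs := h.sqrtY_pos
  have : lvX e v * (ellK' (lvArg e v) / √(lvY e v)) = 2 * lvArg e v * ellK' (lvArg e v) := by
    unfold lvArg
    field_simp
  rwa [this]

theorem ellK'_div_neg : ellK' (lvArg e v) / √(lvY e v) < 0 :=
  div_neg_of_neg_of_pos (ellK'_neg h.neg_one_lt_arg) h.sqrtY_pos

-- This grouping has factors of known sign: the bracket is positive by `ellK_add_mul_pos`, and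
-- `ellK'` is negative. Only the signs of the derivatives of `X` and `Y` stay open.
omit h in
theorem critFun_eq : critFun e v
    = lvYd e v * (ellK (lvArg e v) + lvX e v * (ellK' (lvArg e v) / √(lvY e v)))
      - 2 * lvY e v * lvXd e v * (ellK' (lvArg e v) / √(lvY e v)) := by
  unfold critFun lvE; ring

theorem Yd_pos_of_Xd_nonneg (hv : 0 < v)
    (h1 : 0 ≤ 4 * (e - v) - 2 * (1 - 4 * v) - (1 - 4 * v) ^ 2) : 0 < lvYd e v := by
  have hk := h.one_sub_pos
  have hg := h.sub_pos
  have h2 : 0 < 4 * (e - v) ^ 2 - 3 * (e - v) * (1 - 4 * v) + 3 * v * (1 - 4 * v) ^ 2 := by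
    obtain ⟨k, rfl⟩ : ∃ k, v = (1 - k) / 4 := ⟨1 - 4 * v, by ring⟩
    have hk' : 1 - 4 * ((1 - k) / 4) = k := by ring
    rw [hk'] at *
    -- With `k = 1 - 4v`, `t` is the excess of `e - v` over the value at which the derivative of `X`
    -- vanishes; in terms of it every summand is nonnegative.
    obtain ⟨t, ht, htg⟩ : ∃ t, 0 ≤ t ∧ e - (1 - k) / 4 = (2 * k + k ^ 2) / 4 + t :=
      ⟨_, (by linarith : 0 ≤ e - (1 - k) / 4 - (2 * k + k ^ 2) / 4), by ring⟩
    rw [htg]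
    have e1 : 4 * ((2 * k + k ^ 2) / 4 + t) ^ 2 - 3 * ((2 * k + k ^ 2) / 4 + t) * k
        + 3 * ((1 - k) / 4) * k ^ 2
        = k ^ 2 * (1 - k) ^ 2 / 4 + t * (k + 2 * k ^ 2) + 4 * t ^ 2 := by ring
    rw [e1]
    have h3 : 0 < 1 - k := by linarith
    have hk : 0 < k := by linarith
    have h4 := mul_pos (pow_pos hk 2) (pow_pos h3 2)
    have h5 : 0 ≤ t * (k + 2 * k ^ 2) := by positivity
    nlinarith [sq_nonneg t]
  unfold lvYd; positivity

theorem critFun_pos_of_Xd_nonneg (hv : 0 < v)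
    (h1 : 0 ≤ 4 * (e - v) - 2 * (1 - 4 * v) - (1 - 4 * v) ^ 2) : 0 < critFun e v := by
  have hk := h.one_sub_pos
  have hg := h.sub_pos
  have hX : 0 ≤ lvXd e v := by unfold lvXd; positivity
  rw [critFun_eq]
  have := mul_pos (h.Yd_pos_of_Xd_nonneg hv h1) h.ellK_add_mul_pos
  have := mul_nonneg (mul_nonneg h.Y_pos.le hX) (neg_nonneg.2 h.ellK'_div_neg.le)
  linarith

/-- Where `X' ≥ 0` the function `critFun` is positive, so a zero forces `X' < 0`. Then the `X'` term
in `critFun_eq` is negative and only `Y' > 0` can balance it. -/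
theorem Yd_pos_of_critFun_eq_zero (hv : 0 < v) (h0 : critFun e v = 0) :
    4 * (e - v) - 2 * (1 - 4 * v) - (1 - 4 * v) ^ 2 < 0 ∧ 0 < lvYd e v := by
  have hk := h.one_sub_pos
  have hg := h.sub_pos
  have h1 : 4 * (e - v) - 2 * (1 - 4 * v) - (1 - 4 * v) ^ 2 < 0 := by
    by_contra hc
    exact (h.critFun_pos_of_Xd_nonneg hv (not_lt.1 hc)).ne' h0
  refine ⟨h1, ?_⟩
  have hX : lvXd e v < 0 := by
    unfold lvXd
    refine div_neg_of_neg_of_pos (mul_neg_of_pos_of_neg (by positivity) h1) (by positivity)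
  rw [critFun_eq] at h0
  have h2 := mul_pos (mul_pos h.Y_pos (neg_pos.2 hX)) (neg_pos.2 h.ellK'_div_neg)
  have h3 := h.ellK_add_mul_pos
  by_contra hc
  have := mul_nonneg (neg_nonneg.2 (not_lt.1 hc)) h3.le
  linarith

/-- At a critical level the derivative of `critFun` is positive. -/
theorem exists_pos_hasDerivAt_critFun (he : 9 / 32 < e) (hv : 0 < v) (h0 : critFun e v = 0) :
    ∃ d, 0 < d ∧ HasDerivAt (critFun e) d v := by
  refine ⟨_, ?_, h.hasDerivAt_critFun⟩
  obtain ⟨h1, h2⟩ := h.Yd_pos_of_critFun_eq_zero hv h0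
  have hk := h.one_sub_pos
  have hg := h.sub_pos
  have hs := h.sqrtY_pos
  have hY := h.Y_pos
  have hΔ : 0 < 4 * lvY e v - lvX e v ^ 2 := by have := h.sq_X_lt hv; linarith
  have hB := h.ellK'_div_neg
  have hbr : 4 * lvY e v * (4 * lvY e v - lvX e v ^ 2)
      * (2 * lvY e v * (lvYdd e v * lvXd e v - lvXdd e v * lvYd e v) - lvYd e v ^ 2 * lvXd e v)
      + 3 * (4 * lvY e v - lvX e v ^ 2) * lvYd e v ^ 2 * lvE e v
      - 4 * lvE e v ^ 2 * lvX e v * lvYd e v - lvE e v ^ 3 < 0 := by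
    rw [h.critical_bracket]
    refine mul_neg_of_pos_of_neg ?_ ?_
    · have := h.cubic_pos
      positivity
    · have h2' : 0 < 4 * (e - v) ^ 2 - 3 * (e - v) * (1 - 4 * v) + 3 * v * (1 - 4 * v) ^ 2 := by
        have h3 := h2
        unfold lvYd at h3
        rw [div_pos_iff_of_pos_right (by positivity)] at h3
        exact pos_of_mul_pos_right h3 (by positivity)
      obtain ⟨k, hkv⟩ : ∃ k, k = 1 - 4 * v := ⟨_, rfl⟩
      obtain ⟨σ, hσ⟩ : ∃ σ, σ = 4 * (e - v) / (1 - 4 * v) - 1 := ⟨_, rfl⟩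
      have hgk : 4 * (e - v) = k * (1 + σ) := by
        rw [hσ, hkv]; field_simp; ring
      have hτ : 4 * (e - v) / (1 - 4 * v) = 1 + σ := by rw [hσ]; ring
      have hvk : v = (1 - k) / 4 := by rw [hkv]; ring
      rw [hτ, ← hkv]
      rw [← hkv] at hk h1 h2'
      -- With `k = 1 - 4v` and `4(e - v) = k(1 + σ)`, the three remaining hypotheses express `X' <
      -- 0`, `Y' > 0` and `e > 9/32`; the last one is `4e = 1 + kσ > 9/8`.
      have key := period_polynomial_neg (k := k) (σ := σ) hk (by linarith) ?_ ?_ ?_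
      · refine lt_of_eq_of_lt ?_ key
        ring
      · rw [hgk] at h1
        have : k * (σ - (1 + k)) < 0 := by nlinarith
        by_contra hc
        have := mul_nonneg hk.le (sub_nonneg.2 (not_lt.1 hc))
        linarith
      · have hg' : e - v = k * (1 + σ) / 4 := by linarith
        rw [hg', hvk] at h2'
        have : 0 < k ^ 2 * (σ ^ 2 - σ + 1 - 3 * k) := by nlinarith
        have := pos_of_mul_pos_right this (by positivity)
        linarith
      · nlinarith
  obtain ⟨K, hK⟩ : ∃ K, K = ellK (lvArg e v) := ⟨_, rfl⟩
  obtain ⟨B, hBdef⟩ : ∃ B, B = ellK' (lvArg e v) / √(lvY e v) := ⟨_, rfl⟩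
  have hKp : ellK' (lvArg e v) = B * √(lvY e v) := by rw [hBdef]; field_simp
  have hL := ellK_legendre h.neg_one_lt_arg
  -- Legendre's equation expresses the second derivative of `ellK` by `K` and `B = K'/√Y`.
  have hK2 : 3 / 32 * ellInt 2 (lvArg e v)
      = (lvX e v * B + K / 4) * (4 * lvY e v) / (4 * lvY e v - lvX e v ^ 2) := by
    rw [h.one_sub_sq_arg, hKp, ← hK] at hL
    have : 2 * lvArg e v * (B * √(lvY e v)) = lvX e v * B := by
      unfold lvArg; field_simp
    rw [this] at hL
    rw [← hL]
    field_simp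
  rw [hK2, hKp, ← hK]
  have h0' : lvYd e v * K - lvE e v * B = 0 := by rw [hK, hBdef]; exact h0
  rw [← hBdef] at hB
  have hr := Real.sq_sqrt hY.le
  -- After multiplication by the positive factor `4Y(4Y - X²)Y'`, the relation `Y'K = EB` (`h0'`)
  -- removes `K`. The derivative becomes `B` times the bracket `hbr`, a product of two negative
  -- numbers.
  refine pos_of_mul_pos_right (a := 4 * lvY e v * (4 * lvY e v - lvX e v ^ 2) * lvYd e v)
    (lt_of_lt_of_eq (mul_pos_of_neg_of_neg hB hbr) ?_) (by positivity)
  generalize √(lvY e v) = r at *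
  have hE : lvE e v = 2 * lvY e v * lvXd e v - lvX e v * lvYd e v := rfl
  generalize hD : 4 * lvY e v - lvX e v ^ 2 = D at *
  generalize lvE e v = E at *
  generalize lvX e v = X at *
  generalize lvXd e v = Xd at *
  generalize lvXdd e v = Xdd at *
  generalize lvYd e v = Yd at *
  generalize lvYdd e v = Ydd at *
  rw [← hr]
  generalize lvY e v = Y at *
  have e1 : Ydd * K + Yd * (B * r * (E / (4 * r ^ 2 * r)))
      - ((2 * r ^ 2 * Xdd + Yd * Xd - X * Ydd) * (B * r / r)
        + E * (((X * B + K / 4) * (4 * r ^ 2) / D * (E / (4 * r ^ 2 * r)) * r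
          - B * r * (Yd / (2 * r))) / r ^ 2))
      = Ydd * K + Yd * E * B / (4 * r ^ 2) - (2 * r ^ 2 * Xdd + Yd * Xd - X * Ydd) * B
        - E ^ 2 * (X * B + K / 4) / (r ^ 2 * D) + E * B * Yd / (2 * r ^ 2) := by
    field_simp
    ring
  have e2 : 4 * r ^ 2 * D * Yd * (Ydd * K + Yd * E * B / (4 * r ^ 2)
        - (2 * r ^ 2 * Xdd + Yd * Xd - X * Ydd) * B
        - E ^ 2 * (X * B + K / 4) / (r ^ 2 * D) + E * B * Yd / (2 * r ^ 2))
      = 4 * r ^ 2 * D * Yd * Ydd * K + 3 * D * Yd ^ 2 * E * B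
        - 4 * r ^ 2 * D * Yd * (2 * r ^ 2 * Xdd + Yd * Xd - X * Ydd) * B
        - 4 * E ^ 2 * Yd * (X * B + K / 4) := by
    field_simp
    ring
  rw [e1, e2]
  rw [← hr] at hE
  linear_combination (-(4 * r ^ 2 * D * Ydd) + E ^ 2) * h0' - 4 * r ^ 2 * D * Ydd * B * hE

end IsLevel


/-! ### Existence and uniqueness of the critical level. -/

/-- A continuous function that is increasing at each of its zeros changes sign exactly once. -/
theorem pos_of_pos_deriv_at_zeros {f : ℝ → ℝ} {c b : ℝ} (hf : ContinuousOn f (Set.Icc c b))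
    (hd : ∀ x ∈ Set.Icc c b, f x = 0 → ∃ d, 0 < d ∧ HasDerivAt f d x) (hc : f c = 0) :
    ∀ y ∈ Set.Ioc c b, 0 < f y := by
  intro y hy
  by_contra hfy
  have hfy' := not_lt.1 hfy
  obtain ⟨d, hd0, hdc⟩ := hd c ⟨le_rfl, hy.1.le.trans hy.2⟩ hc
  have hr : ∀ᶠ x in 𝓝[>] c, 0 < f x := by
    have h1 := (hasDerivAt_iff_tendsto_slope.1 hdc).eventually (lt_mem_nhds hd0)
    have h2 : 𝓝[>] c ≤ 𝓝[≠] c := nhdsWithin_mono c fun x hx => ne_of_gt hx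
    filter_upwards [h1.filter_mono h2, self_mem_nhdsWithin] with x hx hxc
    rw [slope_def_field, hc, sub_zero] at hx
    exact (div_pos_iff_of_pos_right (sub_pos.2 hxc)).1 hx
  obtain ⟨x1, hx1, hx1c, hx1y⟩ := (hr.and (Ioo_mem_nhdsGT hy.1)).exists
  have hsub : Set.Icc x1 y ⊆ Set.Icc c b := Set.Icc_subset_Icc hx1c.le hy.2
  -- The leftmost point `z` beyond `x1` at which `f ≤ 0`. As `f > 0` just to its left, `f z = 0` and
  -- the left difference quotients are not positive, against the positive derivative at a zero.
  have hcomp : IsCompact (Set.Icc x1 y ∩ f ⁻¹' Set.Iic 0) :=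
    isCompact_Icc.of_isClosed_subset ((hf.mono hsub).preimage_isClosed_of_isClosed isClosed_Icc
      isClosed_Iic) Set.inter_subset_left
  obtain ⟨z, hz, hzl⟩ := hcomp.exists_isLeast ⟨y, ⟨hx1y.le, le_rfl⟩, hfy'⟩
  have hzx : x1 < z := lt_of_le_of_ne hz.1.1 fun h => by
    have := hz.2; rw [← h] at this; exact absurd hx1 (not_lt.2 this)
  have hleft : ∀ t ∈ Set.Ioo x1 z, 0 < f t := by
    intro t ht
    by_contra hc'
    exact absurd (hzl ⟨⟨ht.1.le, ht.2.le.trans hz.1.2⟩, not_lt.1 hc'⟩) (not_le.2 ht.2)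
  have hmem : Set.Ioo x1 z ∈ 𝓝[<] z := Ioo_mem_nhdsLT hzx
  have hz0 : f z = 0 := by
    refine le_antisymm hz.2 ?_
    have hcz : ContinuousWithinAt f (Set.Ioo x1 z) z :=
      (hf z (hsub hz.1)).mono fun t ht => hsub ⟨ht.1.le, ht.2.le.trans hz.1.2⟩
    have : (𝓝[Set.Ioo x1 z] z).NeBot := by
      rw [nhdsWithin_Ioo_eq_nhdsLT hzx]; infer_instance
    exact ge_of_tendsto hcz (eventually_mem_nhdsWithin.mono fun t ht => (hleft t ht).le)
  obtain ⟨d', hd', hdz⟩ := hd z (hsub hz.1) hz0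
  have h1 := (hasDerivAt_iff_tendsto_slope.1 hdz).eventually (lt_mem_nhds hd')
  have h2 : 𝓝[<] z ≤ 𝓝[≠] z := nhdsWithin_mono z fun x hx => ne_of_lt hx
  obtain ⟨t, ht1, ht2⟩ := ((h1.filter_mono h2).and hmem).exists
  rw [slope_def_field, hz0, sub_zero] at ht1
  have h3 := hleft t ht2
  have h4 : t - z < 0 := sub_neg.2 ht2.2
  exact absurd ht1 (not_lt.2 (div_nonpos_of_nonneg_of_nonpos h3.le h4.le))

theorem isLevel_of_lt {e v : ℝ} (he : 9 / 32 < e) (h0 : 0 ≤ v) (h1 : v < 1 / 4) : IsLevel e v :=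
  ⟨h0, h1, he.le, Or.inl he⟩

/-- At `v = 0` the elliptic argument is `1`, where `K = π/2`, and the coefficient of `K'` vanishes.
The sign change at `e = 3/4` is the bifurcation value of the twist. -/
theorem critFun_zero {e : ℝ} (he : 0 < e) :
    critFun e 0 = Real.pi * (4 * e ^ 4 - 3 * e ^ 3) := by
  have hY : lvY e 0 = (e ^ 2) ^ 2 := by unfold lvY; ring
  have hX : lvX e 0 = 2 * e ^ 2 := by unfold lvX; ring
  have hs : √(lvY e 0) = e ^ 2 := by rw [hY, Real.sqrt_sq (by positivity)]
  have harg : lvArg e 0 = 1 := by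
    unfold lvArg; rw [hs, hX]; field_simp
  have hE : lvE e 0 = 0 := by
    unfold lvE lvX lvY lvXd lvYd; ring
  unfold critFun
  rw [harg, hE, ellK_one]
  unfold lvYd
  ring

/-- The period has at most one critical level, and it exists for `9/32 < e < 3/4`. -/
theorem exists_critical_level {e : ℝ} (he : e ∈ Set.Ioo (9 / 32 : ℝ) (3 / 4)) :
    ∃ v ∈ Set.Ioo (0 : ℝ) (1 / 4), critFun e v = 0 ∧ (∀ u ∈ Set.Ioo 0 v, critFun e u < 0) ∧
      ∀ u ∈ Set.Ioo v (1 / 4), 0 < critFun e u := by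
  have hlev : ∀ u, 0 ≤ u → u < 1 / 4 → IsLevel e u := fun u => isLevel_of_lt he.1
  have hcont : ∀ u, 0 ≤ u → u < 1 / 4 → ContinuousAt (critFun e) u :=
    fun u h0 h1 => (hlev u h0 h1).hasDerivAt_critFun.continuousAt
  have h0 : critFun e 0 < 0 := by
    rw [critFun_zero (by linarith [he.1])]
    have : 4 * e ^ 4 - 3 * e ^ 3 = e ^ 3 * (4 * e - 3) := by ring
    rw [this]
    have h1 : 0 < e ^ 3 := by have := he.1; positivity
    exact mul_neg_of_pos_of_neg Real.pi_pos (mul_neg_of_pos_of_neg h1 (by linarith [he.2]))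
  -- At `v = 15/64` the derivative of `X` is positive for every `e ≥ 9/32`; any point close enough
  -- to `1/4` would serve.
  have h1 : 0 < critFun e (15 / 64) :=
    (hlev _ (by norm_num) (by norm_num)).critFun_pos_of_Xd_nonneg (by norm_num)
      (by have := he.1; norm_num; linarith)
  have hsign : ∀ c ∈ Set.Ioo (0 : ℝ) (1 / 4), critFun e c = 0 →
      ∀ u ∈ Set.Ioo c (1 / 4), 0 < critFun e u := by
    intro c hc hc0 u hu
    refine pos_of_pos_deriv_at_zeros (c := c) (b := u) (fun x hx => (hcont x
      (hc.1.le.trans hx.1) (hx.2.trans_lt hu.2)).continuousWithinAt) (fun x hx hx0 => ?_) hc0 u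
      ⟨hu.1, le_rfl⟩
    exact (hlev x (hc.1.le.trans hx.1) (hx.2.trans_lt hu.2)).exists_pos_hasDerivAt_critFun he.1
      (hc.1.trans_le hx.1) hx0
  obtain ⟨c, hc, hc0⟩ := intermediate_value_Ioo (by norm_num : (0 : ℝ) ≤ 15 / 64)
    (fun x hx => (hcont x hx.1 (hx.2.trans_lt (by norm_num))).continuousWithinAt) ⟨h0, h1⟩
  have hc' : c ∈ Set.Ioo (0 : ℝ) (1 / 4) := ⟨hc.1, hc.2.trans (by norm_num)⟩
  refine ⟨c, hc', hc0, fun u hu => ?_, hsign c hc' hc0⟩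
  by_contra hcon
  rcases (not_lt.1 hcon).eq_or_lt with h | h
  · exact (hsign u ⟨hu.1, hu.2.trans hc'.2⟩ h.symm c ⟨hu.2, hc'.2⟩).ne' hc0
  · obtain ⟨w, hw, hw0⟩ := intermediate_value_Ioo hu.1.le
      (fun x hx => (hcont x hx.1 (hx.2.trans_lt (hu.2.trans hc'.2))).continuousWithinAt) ⟨h0, h⟩
    exact (hsign w ⟨hw.1, (hw.2.trans hu.2).trans hc'.2⟩ hw0 c
      ⟨hw.2.trans hu.2, hc'.2⟩).ne' hc0

open Classical in
/-- The level parameter of the twistless circle. -/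
noncomputable def critV (e : ℝ) : ℝ :=
  if he : e ∈ Set.Ioo (9 / 32 : ℝ) (3 / 4) then (exists_critical_level he).choose else 0

theorem critV_spec {e : ℝ} (he : e ∈ Set.Ioo (9 / 32 : ℝ) (3 / 4)) :
    critV e ∈ Set.Ioo (0 : ℝ) (1 / 4) ∧ critFun e (critV e) = 0 ∧
      (∀ u ∈ Set.Ioo 0 (critV e), critFun e u < 0) ∧
      ∀ u ∈ Set.Ioo (critV e) (1 / 4), 0 < critFun e u := by
  have h := (exists_critical_level he).choose_spec
  unfold critV
  rw [dif_pos he]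
  exact h

/-- Comparing `critV e` with a fixed level amounts to the sign of `critFun` there. Continuity and
limits of `critV` in `e` thus follow from continuity of `critFun` in `e` alone. -/
theorem critV_lt_iff {e u : ℝ} (he : e ∈ Set.Ioo (9 / 32 : ℝ) (3 / 4)) (h0 : 0 < u)
    (h1 : u < 1 / 4) : critV e < u ↔ 0 < critFun e u := by
  obtain ⟨-, h2, h3, h4⟩ := critV_spec he
  refine ⟨fun h => h4 u ⟨h, h1⟩, fun h => ?_⟩
  by_contra hc
  rcases (not_lt.1 hc).eq_or_lt with h5 | h5
  · rw [h5] at h; exact h.ne' h2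
  · exact absurd h (h3 u ⟨h0, h5⟩).not_gt

theorem lt_critV_iff {e u : ℝ} (he : e ∈ Set.Ioo (9 / 32 : ℝ) (3 / 4)) (h0 : 0 < u)
    (h1 : u < 1 / 4) : u < critV e ↔ critFun e u < 0 := by
  obtain ⟨-, h2, h3, h4⟩ := critV_spec he
  refine ⟨fun h => h3 u ⟨h0, h⟩, fun h => ?_⟩
  by_contra hc
  rcases (not_lt.1 hc).eq_or_lt with h5 | h5
  · rw [← h5] at h; exact h.ne h2
  · exact absurd h (h4 u ⟨h5, h1⟩).not_gt

/-- With `k = 1 - 4v`, the quantity deciding the sign of `X'` is at least `(1 - k)(2 + k)`, so `X' ≥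
0` at all levels and no critical one exists. -/
theorem critFun_pos_of_three_quarters_le {e v : ℝ} (he : 3 / 4 ≤ e) (h0 : 0 < v)
    (h1 : v < 1 / 4) : 0 < critFun e v := by
  refine (isLevel_of_lt (by linarith) h0.le h1).critFun_pos_of_Xd_nonneg h0 ?_
  nlinarith

theorem critFun_eq_zero_iff {e v : ℝ} (he : 9 / 32 < e) (h0 : 0 < v) (h1 : v < 1 / 4) :
    critFun e v = 0 ↔ e < 3 / 4 ∧ v = critV e := by
  rcases lt_or_ge e (3 / 4) with h | h
  · have hm : e ∈ Set.Ioo (9 / 32 : ℝ) (3 / 4) := ⟨he, h⟩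
    refine ⟨fun hz => ⟨h, ?_⟩, ?_⟩
    · rcases lt_trichotomy v (critV e) with h2 | h2 | h2
      · exact absurd hz ((lt_critV_iff hm h0 h1).1 h2).ne
      · exact h2
      · exact absurd hz ((critV_lt_iff hm h0 h1).1 h2).ne'
    · rintro ⟨-, rfl⟩
      exact (critV_spec hm).2.1
  · exact ⟨fun hz => absurd hz (critFun_pos_of_three_quarters_le h h0 h1).ne',
      fun hz => absurd hz.1 (not_lt.2 h)⟩

/-! ### Joint regularity -/

/-- Strictness is used at `(3/4, 0)`: it compares two nearby levels neither of which is the base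
point. -/
theorem IsLevel.exists_hasStrictFDerivAt_critFun {e v : ℝ} (h : IsLevel e v) :
    ∃ L : ℝ × ℝ →L[ℝ] ℝ, HasStrictFDerivAt (fun p : ℝ × ℝ => critFun p.1 p.2) L (e, v) := by
  have hk : (1 - 4 * v) ≠ 0 := h.one_sub_pos.ne'
  have hk2 : (1 - 4 * v) ^ 2 ≠ 0 := pow_ne_zero 2 hk
  have hk3 : (1 - 4 * v) ^ 3 ≠ 0 := pow_ne_zero 3 hk
  have hX : ContDiffAt ℝ 1 (fun p : ℝ × ℝ => lvX p.1 p.2) (e, v) := by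
    unfold lvX; fun_prop (disch := assumption)
  have hY : ContDiffAt ℝ 1 (fun p : ℝ × ℝ => lvY p.1 p.2) (e, v) := by
    unfold lvY; fun_prop (disch := assumption)
  have hXd : ContDiffAt ℝ 1 (fun p : ℝ × ℝ => lvXd p.1 p.2) (e, v) := by
    unfold lvXd; fun_prop (disch := assumption)
  have hYd : ContDiffAt ℝ 1 (fun p : ℝ × ℝ => lvYd p.1 p.2) (e, v) := by
    unfold lvYd; fun_prop (disch := assumption)
  have hE : ContDiffAt ℝ 1 (fun p : ℝ × ℝ => lvE p.1 p.2) (e, v) := by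
    unfold lvE; fun_prop
  have hS : ContDiffAt ℝ 1 (fun p : ℝ × ℝ => √(lvY p.1 p.2)) (e, v) :=
    hY.sqrt h.Y_pos.ne'
  have hA : ContDiffAt ℝ 1 (fun p : ℝ × ℝ => lvArg p.1 p.2) (e, v) := by
    unfold lvArg
    exact hX.div (contDiffAt_const.mul hS) (mul_pos two_pos h.sqrtY_pos).ne'
  have hA' := hA.hasStrictFDerivAt one_ne_zero
  have hK := (hasStrictDerivAt_ellK h.neg_one_lt_arg).comp_hasStrictFDerivAt
    (f := fun p : ℝ × ℝ => lvArg p.1 p.2) (e, v) hA'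
  have hK' := (hasStrictDerivAt_ellK' h.neg_one_lt_arg).comp_hasStrictFDerivAt
    (f := fun p : ℝ × ℝ => lvArg p.1 p.2) (e, v) hA'
  have hSi := (hS.inv h.sqrtY_pos.ne').hasStrictFDerivAt one_ne_zero
  exact ⟨_, ((hYd.hasStrictFDerivAt one_ne_zero).mul hK).sub
    ((hE.hasStrictFDerivAt one_ne_zero).mul (hK'.mul hSi))⟩

theorem IsLevel.continuousAt_critFun_left {e v : ℝ} (h : IsLevel e v) :
    ContinuousAt (fun e => critFun e v) e := by
  obtain ⟨L, hL⟩ := h.exists_hasStrictFDerivAt_critFun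
  exact hL.hasFDerivAt.continuousAt.comp (f := fun e : ℝ => (e, v)) (by fun_prop)

theorem continuous_lvX_left (v : ℝ) : Continuous fun e => lvX e v := by unfold lvX; fun_prop

theorem continuous_lvY_left (v : ℝ) : Continuous fun e => lvY e v := by unfold lvY; fun_prop

theorem IsLevel.continuousAt_lvPeriod_left {e v : ℝ} (h : IsLevel e v) :
    ContinuousAt (fun e => lvPeriod e v) e := by
  have hA : ContinuousAt (fun e => lvArg e v) e := by
    unfold lvArg
    exact (continuous_lvX_left v).continuousAt.div
      (continuousAt_const.mul (continuous_lvY_left v).sqrt.continuousAt)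
      (mul_pos two_pos h.sqrtY_pos).ne'
  refine (continuousAt_const.mul ((continuous_lvY_left v).continuousAt.rpow_const
    (Or.inl h.Y_pos.ne'))).mul ?_
  exact ContinuousAt.comp (f := fun e => lvArg e v) (hasDerivAt_ellK h.neg_one_lt_arg).continuousAt
    hA

theorem continuousOn_critV : ContinuousOn critV (Set.Ioo (9 / 32) (3 / 4)) := by
  intro e he
  refine ContinuousAt.continuousWithinAt ?_
  obtain ⟨⟨hv0, hv1⟩, -⟩ := critV_spec he
  have hnhds := Ioo_mem_nhds he.1 he.2
  refine tendsto_order.2 ⟨fun a ha => ?_, fun b hb => ?_⟩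
  · obtain ⟨u, hu1, hu2⟩ := exists_between (max_lt ha hv0)
    have hu0 := (le_max_right a 0).trans_lt hu1
    have hu4 := hu2.trans hv1
    filter_upwards [hnhds, (isLevel_of_lt he.1 hu0.le hu4).continuousAt_critFun_left.eventually
      (gt_mem_nhds ((lt_critV_iff he hu0 hu4).1 hu2))] with x hx hxu
    exact ((le_max_left a 0).trans_lt hu1).trans ((lt_critV_iff hx hu0 hu4).2 hxu)
  · obtain ⟨u, hu1, hu2⟩ := exists_between (lt_min hb hv1)
    have hu0 := hv0.trans hu1
    have hu4 := hu2.trans_le (min_le_right b _)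
    filter_upwards [hnhds, (isLevel_of_lt he.1 hu0.le hu4).continuousAt_critFun_left.eventually
      (lt_mem_nhds ((critV_lt_iff he hu0 hu4).1 hu1))] with x hx hxu
    exact ((critV_lt_iff hx hu0 hu4).2 hxu).trans (hu2.trans_le (min_le_left b _))

theorem tendsto_critV_three_quarters : Tendsto critV (𝓝[<] (3 / 4)) (𝓝 0) := by
  have hev : ∀ᶠ e in 𝓝[<] (3 / 4 : ℝ), e ∈ Set.Ioo (9 / 32 : ℝ) (3 / 4) :=
    Ioo_mem_nhdsLT (by norm_num)
  refine tendsto_order.2 ⟨fun a ha => ?_, fun b hb => ?_⟩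
  · filter_upwards [hev] with e he
    exact ha.trans (critV_spec he).1.1
  · obtain ⟨u, hu0, hu1⟩ := exists_between (lt_min hb (by norm_num : (0 : ℝ) < 1 / 4))
    have hu4 := hu1.trans_le (min_le_right b _)
    have hc := (isLevel_of_lt (by norm_num : (9 / 32 : ℝ) < 3 / 4) hu0.le
      hu4).continuousAt_critFun_left.eventually
      (lt_mem_nhds (critFun_pos_of_three_quarters_le le_rfl hu0 hu4))
    filter_upwards [hev, hc.filter_mono nhdsWithin_le_nhds] with e he hx
    exact ((critV_lt_iff he hu0 hu4).2 hx).trans (hu1.trans_le (min_le_left b _))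


/-! ### Monotonicity of the period and the limit at the saddle-center bifurcation. -/

theorem period_lt_of_critFun_neg {e a b : ℝ} (he : 9 / 32 < e) (ha : 0 < a) (hab : a < b)
    (hb : b < 1 / 4) (hneg : ∀ u ∈ Set.Ioo a b, critFun e u < 0) :
    lvPeriod e a < lvPeriod e b := by
  have hlev : ∀ u ∈ Set.Icc a b, IsLevel e u := fun u hu =>
    isLevel_of_lt he (ha.le.trans hu.1) (hu.2.trans_lt hb)
  refine strictMonoOn_of_deriv_pos (convex_Icc a b)
    (fun u hu => (hlev u hu).hasDerivAt_period.continuousAt.continuousWithinAt) (fun u hu => ?_)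
    ⟨le_rfl, hab.le⟩ ⟨hab.le, le_rfl⟩ hab
  rw [interior_Icc] at hu
  have h := hlev u (Set.Ioo_subset_Icc_self hu)
  rw [h.hasDerivAt_period.deriv]
  have := mul_pos (Real.rpow_pos_of_pos h.Y_pos (-(5 / 4))) (neg_pos.2 (hneg u hu))
  linarith

theorem period_lt_of_critFun_pos {e a b : ℝ} (he : 9 / 32 < e) (ha : 0 < a) (hab : a < b)
    (hb : b < 1 / 4) (hpos : ∀ u ∈ Set.Ioo a b, 0 < critFun e u) :
    lvPeriod e b < lvPeriod e a := by
  have hlev : ∀ u ∈ Set.Icc a b, IsLevel e u := fun u hu =>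
    isLevel_of_lt he (ha.le.trans hu.1) (hu.2.trans_lt hb)
  refine strictAntiOn_of_deriv_neg (convex_Icc a b)
    (fun u hu => (hlev u hu).hasDerivAt_period.continuousAt.continuousWithinAt) (fun u hu => ?_)
    ⟨le_rfl, hab.le⟩ ⟨hab.le, le_rfl⟩ hab
  rw [interior_Icc] at hu
  have h := hlev u (Set.Ioo_subset_Icc_self hu)
  rw [h.hasDerivAt_period.deriv]
  have := mul_pos (Real.rpow_pos_of_pos h.Y_pos (-(5 / 4))) (hpos u hu)
  linarith

/-- The period blows up at the saddle-center bifurcation. -/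
theorem tendsto_period_atTop :
    Tendsto (fun e => lvPeriod e (3 / 16)) (𝓝[>] (9 / 32)) atTop := by
  have hY : Tendsto (fun e => lvY e (3 / 16)) (𝓝[>] (9 / 32)) (𝓝[>] 0) := by
    refine tendsto_nhdsWithin_iff.2 ⟨?_, ?_⟩
    · have h := ((continuous_lvY_left (3 / 16)).tendsto (9 / 32)).mono_left
        (nhdsWithin_le_nhds (s := Set.Ioi (9 / 32)))
      have h0 : lvY (9 / 32) (3 / 16) = 0 := by unfold lvY; norm_num
      rwa [h0] at h
    · filter_upwards [self_mem_nhdsWithin] with e he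
      exact (isLevel_of_lt he (by norm_num) (by norm_num)).Y_pos
  have h1 : Tendsto (fun e => lvY e (3 / 16) ^ (-(1 / 4) : ℝ)) (𝓝[>] (9 / 32)) atTop :=
    (tendsto_rpow_neg_nhdsGT_zero (by norm_num)).comp hY
  have h2 := h1.const_mul_atTop (by positivity : 0 < 4 * (Real.pi / 2))
  refine tendsto_atTop_mono' _ ?_ h2
  filter_upwards [self_mem_nhdsWithin] with e he
  have h := isLevel_of_lt he (by norm_num : (0 : ℝ) ≤ 3 / 16) (by norm_num)
  have h3 := pi_div_two_le_ellK h.neg_one_lt_arg h.arg_le_one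
  have h4 := Real.rpow_pos_of_pos h.Y_pos (-(1 / 4))
  unfold lvPeriod
  nlinarith

/-- In `v` the period rises up to `critV e` and falls beyond it. For a fixed `u ≠ 3/16` it stays
bounded as `e ↓ 9/32`, while at `3/16` it tends to infinity. If `u` lay between `critV e` and
`3/16`, the period at `u` would be the larger one. -/
theorem tendsto_critV_saddleCenter : Tendsto critV (𝓝[>] (9 / 32)) (𝓝 (3 / 16)) := by
  have hev : ∀ᶠ e in 𝓝[>] (9 / 32 : ℝ), e ∈ Set.Ioo (9 / 32 : ℝ) (3 / 4) :=
    Ioo_mem_nhdsGT (by norm_num)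
  have hcmp : ∀ u : ℝ, 0 < u → u < 1 / 4 → u ≠ 3 / 16 →
      ∀ᶠ e in 𝓝[>] (9 / 32 : ℝ), lvPeriod e u < lvPeriod e (3 / 16) := by
    intro u h0 h1 hne
    have h : IsLevel (9 / 32) u := ⟨h0.le, h1, le_rfl, Or.inr hne⟩
    have h2 := (h.continuousAt_lvPeriod_left.eventually
      (gt_mem_nhds (lt_add_one (lvPeriod (9 / 32) u)))).filter_mono
      (nhdsWithin_le_nhds (s := Set.Ioi (9 / 32)))
    filter_upwards [h2, tendsto_period_atTop.eventually_ge_atTop (lvPeriod (9 / 32) u + 1)]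
      with e he1 he2
    exact he1.trans_le he2
  refine tendsto_order.2 ⟨fun a ha => ?_, fun b hb => ?_⟩
  · obtain ⟨u, hu1, hu2⟩ := exists_between (max_lt ha (by norm_num : (0 : ℝ) < 3 / 16))
    have hu0 := (le_max_right a 0).trans_lt hu1
    filter_upwards [hev, hcmp u hu0 (hu2.trans (by norm_num)) hu2.ne] with e he hlt
    refine ((le_max_left a 0).trans_lt hu1).trans ?_
    by_contra hc
    exact hlt.not_gt (period_lt_of_critFun_pos he.1 hu0 hu2 (by norm_num) fun w hw =>
      (critV_spec he).2.2.2 w ⟨(not_lt.1 hc).trans_lt hw.1, hw.2.trans (by norm_num)⟩)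
  · obtain ⟨u, hu1, hu2⟩ := exists_between (lt_min hb (by norm_num : (3 / 16 : ℝ) < 1 / 4))
    have hu4 := hu2.trans_le (min_le_right b _)
    filter_upwards [hev, hcmp u ((by norm_num : (0 : ℝ) < 3 / 16).trans hu1) hu4 hu1.ne']
      with e he hlt
    refine lt_trans ?_ (hu2.trans_le (min_le_left b _))
    by_contra hc
    exact hlt.not_gt (period_lt_of_critFun_neg he.1 (by norm_num) hu1 hu4 fun w hw =>
      (critV_spec he).2.2.1 w ⟨(by norm_num : (0 : ℝ) < 3 / 16).trans hw.1,
        hw.2.trans_le (not_lt.1 hc)⟩)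

/-! ### The energy as a function of the level parameter -/

theorem lvEnergy_deriv_pos {e v : ℝ} (he : 9 / 32 < e) (h1 : v < 1 / 4) :
    0 < (e - v) * (e - 3 * v + 8 * v ^ 2) / (1 - 4 * v) ^ 2 := by
  have h2 : 0 < 1 - 4 * v := by linarith
  have h3 : 0 < e - v := by linarith
  have h4 : 0 < e - 3 * v + 8 * v ^ 2 := by nlinarith [sq_nonneg (v - 3 / 16)]
  positivity

theorem strictMonoOn_lvEnergy {e : ℝ} (he : 9 / 32 < e) :
    StrictMonoOn (lvEnergy e) (Set.Iio (1 / 4)) := by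
  refine strictMonoOn_of_deriv_pos (convex_Iio _)
    (fun u hu => (hasDerivAt_lvEnergy hu).continuousAt.continuousWithinAt) (fun u hu => ?_)
  rw [interior_Iio] at hu
  rw [(hasDerivAt_lvEnergy hu).deriv]
  exact lvEnergy_deriv_pos he hu

theorem lvEnergy_zero (e : ℝ) : lvEnergy e 0 = 0 := by simp [lvEnergy]

theorem lvEnergy_pos {e v : ℝ} (he : 9 / 32 < e) (h0 : 0 < v) (h1 : v < 1 / 4) :
    0 < lvEnergy e v := by
  have h2 : 0 < 1 - 4 * v := by linarith
  have h3 : 0 < e - v := by linarith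
  unfold lvEnergy; positivity

theorem exists_lvEnergy_eq {e η : ℝ} (he : 9 / 32 < e) (hη : 0 < η) :
    ∃ v ∈ Set.Ioo (0 : ℝ) (1 / 4), lvEnergy e v = η := by
  have hg : 0 < e - 1 / 4 := by linarith
  -- near `1/4` the energy exceeds `η`
  obtain ⟨k, hk0, hk1, hk2⟩ : ∃ k : ℝ, 0 < k ∧ k < 1 / 2 ∧ η * k < 1 / 8 * (e - 1 / 4) ^ 2 := by
    refine ⟨min (1 / 4) ((e - 1 / 4) ^ 2 / (16 * η)), by positivity,
      (min_le_left _ _).trans_lt (by norm_num), ?_⟩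
    have h1 := mul_le_mul_of_nonneg_left (min_le_right (1 / 4) ((e - 1 / 4) ^ 2 / (16 * η))) hη.le
    have h2 : η * ((e - 1 / 4) ^ 2 / (16 * η)) = (e - 1 / 4) ^ 2 / 16 := by field_simp
    have h3 : 0 < (e - 1 / 4) ^ 2 := by positivity
    linarith
  have hbig : η < lvEnergy e ((1 - k) / 4) := by
    unfold lvEnergy
    have h1 : 1 - 4 * ((1 - k) / 4) = k := by ring
    rw [h1, lt_div_iff₀ hk0]
    have h2 : (e - 1 / 4) ^ 2 ≤ (e - (1 - k) / 4) ^ 2 :=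
      pow_le_pow_left₀ hg.le (by linarith) 2
    have h3 : 0 ≤ (e - (1 - k) / 4) ^ 2 := sq_nonneg _
    nlinarith
  obtain ⟨v, hv, hv1⟩ := intermediate_value_Ioo (by linarith : (0 : ℝ) ≤ (1 - k) / 4)
    (fun x hx => (hasDerivAt_lvEnergy (e := e)
      (hx.2.trans_lt (by linarith))).continuousAt.continuousWithinAt)
    (⟨by rw [lvEnergy_zero]; exact hη, hbig⟩ : η ∈ Set.Ioo (lvEnergy e 0) _)
  exact ⟨v, ⟨hv.1, hv.2.trans (by linarith)⟩, hv1⟩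

theorem lvEnergy_le_of_le {e₁ e₂ v : ℝ} (he : e₁ ≤ e₂) (h0 : 0 ≤ v) (h1 : v < 1 / 4)
    (hv : v ≤ e₁) : lvEnergy e₁ v ≤ lvEnergy e₂ v := by
  unfold lvEnergy
  have h2 : 0 < 1 - 4 * v := by linarith
  have h3 : (e₁ - v) ^ 2 ≤ (e₂ - v) ^ 2 := pow_le_pow_left₀ (by linarith) (by linarith) 2
  gcongr

/-- The energy of the twistless circle. -/
noncomputable def critEnergy (e : ℝ) : ℝ := lvEnergy e (critV e)

theorem critEnergy_pos {e : ℝ} (he : e ∈ Set.Ioo (9 / 32 : ℝ) (3 / 4)) : 0 < critEnergy e :=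
  lvEnergy_pos he.1 (critV_spec he).1.1 (critV_spec he).1.2

theorem continuousOn_critEnergy : ContinuousOn critEnergy (Set.Ioo (9 / 32) (3 / 4)) := by
  unfold critEnergy lvEnergy
  have h := continuousOn_critV
  refine (h.mul ((continuousOn_id.sub h).pow 2)).div
    (continuousOn_const.sub (continuousOn_const.mul h)) fun e he => ?_
  have := (critV_spec he).1.2
  linarith

theorem tendsto_lvEnergy {l : Filter ℝ} {f : ℝ → ℝ} {e v : ℝ} (hl : l ≤ 𝓝 e)
    (hf : Tendsto f l (𝓝 v)) (hv : v ≠ 1 / 4) :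
    Tendsto (fun e => lvEnergy e (f e)) l (𝓝 (lvEnergy e v)) := by
  have hi : Tendsto (fun e : ℝ => e) l (𝓝 e) := hl
  unfold lvEnergy
  refine (hf.mul ((hi.sub hf).pow 2)).div (tendsto_const_nhds.sub (tendsto_const_nhds.mul hf)) ?_
  intro h; exact hv (by linarith)

theorem tendsto_critEnergy_three_quarters : Tendsto critEnergy (𝓝[<] (3 / 4)) (𝓝 0) := by
  have := tendsto_lvEnergy nhdsWithin_le_nhds tendsto_critV_three_quarters (by norm_num)
  rwa [lvEnergy_zero] at this

theorem tendsto_critEnergy_saddleCenter :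
    Tendsto critEnergy (𝓝[>] (9 / 32)) (𝓝 (27 / 4096)) := by
  have := tendsto_lvEnergy nhdsWithin_le_nhds tendsto_critV_saddleCenter (by norm_num)
  have h : lvEnergy (9 / 32) (3 / 16) = 27 / 4096 := by unfold lvEnergy; norm_num
  rwa [h] at this

/-- Near its creation the energy of the twistless circle is decreasing. -/
theorem exists_strictAntiOn_critEnergy :
    ∃ δ : ℝ, 0 < δ ∧ δ < 3 / 4 - 9 / 32 ∧ StrictAntiOn critEnergy (Set.Ioo (3 / 4 - δ) (3 / 4)) := by
  obtain ⟨L, hL⟩ := (isLevel_of_lt (by norm_num : (9 / 32 : ℝ) < 3 / 4) le_rfl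
    (by norm_num : (0 : ℝ) < 1 / 4)).exists_hasStrictFDerivAt_critFun
  -- The partial derivative in `e` is read off from the closed form on `v = 0`, namely `(π(4e⁴ -
  -- 3e³))' = 27π/16` at `e = 3/4`.
  have hLe : 0 < L (1, 0) := by
    have h1 : HasDerivAt (fun e : ℝ => critFun e 0) (L (1, 0)) (3 / 4) := by
      have h2 : HasDerivAt (fun e : ℝ => (e, (0 : ℝ))) (1, 0) (3 / 4) :=
        (hasDerivAt_id _).prodMk (hasDerivAt_const _ _)
      exact hL.hasFDerivAt.comp_hasDerivAt (f := fun e : ℝ => (e, (0 : ℝ))) (3 / 4) h2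
    have h3 : HasDerivAt (fun e : ℝ => Real.pi * (4 * e ^ 4 - 3 * e ^ 3))
        (Real.pi * (27 / 16)) (3 / 4) := by
      refine ((((hasDerivAt_pow 4 (3 / 4 : ℝ)).const_mul 4).sub
        ((hasDerivAt_pow 3 (3 / 4 : ℝ)).const_mul 3)).const_mul Real.pi).congr_deriv ?_
      norm_num
    have h4 : (fun e : ℝ => critFun e 0) =ᶠ[𝓝 (3 / 4)]
        fun e : ℝ => Real.pi * (4 * e ^ 4 - 3 * e ^ 3) := by
      filter_upwards [lt_mem_nhds (by norm_num : (0 : ℝ) < 3 / 4)] with e he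
      exact critFun_zero he
    rw [h1.unique (h3.congr_of_eventuallyEq h4)]
    positivity
  have hη : HasStrictFDerivAt (fun p : ℝ × ℝ => lvEnergy p.1 p.2)
      ((9 / 16 : ℝ) • ContinuousLinearMap.snd ℝ ℝ ℝ) ((3 / 4, 0) : ℝ × ℝ) := by
    have h1 : HasStrictFDerivAt (fun p : ℝ × ℝ => p.2) (ContinuousLinearMap.snd ℝ ℝ ℝ)
        ((3 / 4, 0) : ℝ × ℝ) := hasStrictFDerivAt_snd
    have h2 : ContDiffAt ℝ 1 (fun p : ℝ × ℝ => (p.1 - p.2) ^ 2 / (1 - 4 * p.2))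
        ((3 / 4, 0) : ℝ × ℝ) := by
      have : (1 - 4 * ((3 / 4, 0) : ℝ × ℝ).2) ≠ 0 := by norm_num
      fun_prop (disch := assumption)
    have h3 := h1.mul (h2.hasStrictFDerivAt one_ne_zero)
    refine (h3.congr_fderiv ?_).congr_of_eventuallyEq (Eventually.of_forall fun p => ?_)
    · ext <;> norm_num
    · simp [lvEnergy]; ring
  -- `c` is the error allowed in both strict derivatives, so small that the gain `L (1, 0)` in `e`
  -- outweighs the errors and the effect of the shift of `v` at constant energy.
  obtain ⟨c, hc0, hc1, hc2⟩ : ∃ c : ℝ, 0 < c ∧ c ≤ 1 / 4 ∧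
      c * (4 * |L (0, 1)| + 5) < L (1, 0) := by
    refine ⟨min (1 / 4) (L (1, 0) / (2 * (4 * |L (0, 1)| + 5))), by positivity,
      min_le_left _ _, ?_⟩
    have h0 : 0 < 4 * |L (0, 1)| + 5 := by positivity
    have h1 := mul_le_mul_of_nonneg_right
      (min_le_right (1 / 4) (L (1, 0) / (2 * (4 * |L (0, 1)| + 5)))) h0.le
    have h2 : L (1, 0) / (2 * (4 * |L (0, 1)| + 5)) * (4 * |L (0, 1)| + 5) = L (1, 0) / 2 := by
      field_simp
    linarith
  have hb1 := hL.isLittleO.def hc0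
  have hb2 := hη.isLittleO.def hc0
  obtain ⟨r, hr, hball⟩ := Metric.eventually_nhds_iff.1 (hb1.and hb2)
  have hsmall : ∀ᶠ e in 𝓝[<] (3 / 4 : ℝ), critV e < r :=
    tendsto_critV_three_quarters.eventually (gt_mem_nhds hr)
  obtain ⟨l, hl, hlr⟩ := (mem_nhdsLT_iff_exists_Ioo_subset' (by norm_num : (0 : ℝ) < 3 / 4)).1
    hsmall
  refine ⟨min (min (3 / 4 - l) r) (1 / 4), by
    have : l < 3 / 4 := hl
    have : 0 < 3 / 4 - l := by linarith
    positivity, (min_le_right _ _).trans_lt (by norm_num), ?_⟩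
  intro e₁ he₁ e₂ he₂ he
  have hδ : ∀ x ∈ Set.Ioo (3 / 4 - min (min (3 / 4 - l) r) (1 / 4)) (3 / 4),
      x ∈ Set.Ioo (9 / 32 : ℝ) (3 / 4) ∧ |x - 3 / 4| < r ∧ critV x < r := by
    intro x hx
    have h1 := min_le_left (min (3 / 4 - l) r) (1 / 4)
    have h2 := min_le_right (min (3 / 4 - l) r) (1 / 4)
    have h3 := min_le_left (3 / 4 - l) r
    have h4 := min_le_right (3 / 4 - l) r
    have h5 := hx.1
    have h6 := hx.2
    refine ⟨⟨by linarith, hx.2⟩, ?_, hlr ⟨by linarith, hx.2⟩⟩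
    rw [abs_lt]; constructor <;> linarith
  obtain ⟨hm₁, hr₁, hv₁⟩ := hδ e₁ he₁
  obtain ⟨hm₂, hr₂, -⟩ := hδ e₂ he₂
  obtain ⟨⟨hp₁, hq₁⟩, hz₁, -⟩ := critV_spec hm₁
  -- The level of parameter `e₂` with the energy of the twistless circle of `e₁`. If `critFun` is
  -- positive there, the twistless circle of `e₂` has smaller energy.
  obtain ⟨v, ⟨hv0, hv4⟩, hveq⟩ := exists_lvEnergy_eq hm₂.1 (critEnergy_pos hm₁)
  have hvle : v ≤ critV e₁ := by
    have h1 : lvEnergy e₂ v ≤ lvEnergy e₂ (critV e₁) := by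
      rw [hveq]
      exact lvEnergy_le_of_le he.le hp₁.le hq₁ (by linarith [hm₁.1])
    exact ((strictMonoOn_lvEnergy hm₂.1).le_iff_le hv4 hq₁).1 h1
  have hdist : dist (((e₂, v), (e₁, critV e₁)) : (ℝ × ℝ) × (ℝ × ℝ)) ((3 / 4, 0), (3 / 4, 0)) < r := by
    simp only [Prod.dist_eq, Real.dist_eq, sub_zero, max_lt_iff]
    exact ⟨⟨hr₂, by rw [abs_of_pos hv0]; linarith⟩, hr₁, by rw [abs_of_pos hp₁]; exact hv₁⟩
  obtain ⟨h1, h2⟩ := hball hdist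
  have hnorm : ‖((e₂, v) : ℝ × ℝ) - (e₁, critV e₁)‖ ≤ (e₂ - e₁) + (critV e₁ - v) := by
    rw [Prod.mk_sub_mk, Prod.norm_mk, Real.norm_eq_abs, Real.norm_eq_abs,
      abs_of_pos (sub_pos.2 he), abs_of_nonpos (sub_nonpos.2 hvle)]
    refine max_le ?_ ?_ <;> linarith
  have hc' := mul_le_mul_of_nonneg_left hnorm hc0.le
  -- At `(3/4, 0)` the energy has derivative `9/16` in `v` and `0` in `e`. At constant energy `v`
  -- therefore moves by a small multiple of `e₂ - e₁` only: `(9/16 - c) Δv ≤ c Δe` with `c ≤ 1/4`.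
  have hb : critV e₁ - v ≤ 4 * c * (e₂ - e₁) := by
    have h3 : lvEnergy e₁ (critV e₁) = critEnergy e₁ := rfl
    simp only [hveq, h3, sub_self, zero_sub, norm_neg, Prod.mk_sub_mk] at h2
    simp only [FunLike.coe_smul, Pi.smul_apply, ContinuousLinearMap.coe_snd', smul_eq_mul,
      Real.norm_eq_abs] at h2
    rw [abs_of_nonpos (by linarith)] at h2
    rw [Prod.mk_sub_mk] at hc'
    nlinarith [sub_pos.2 he]
  have hpos : 0 < critFun e₂ v := by
    have h4 : L ((e₂, v) - (e₁, critV e₁)) = (e₂ - e₁) * L (1, 0) + (v - critV e₁) * L (0, 1) := by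
      have : ((e₂, v) : ℝ × ℝ) - (e₁, critV e₁)
          = (e₂ - e₁) • ((1, 0) : ℝ × ℝ) + (v - critV e₁) • ((0, 1) : ℝ × ℝ) := by
        ext <;> simp
      rw [this, map_add, map_smul, map_smul, smul_eq_mul, smul_eq_mul]
    simp only at h1
    rw [hz₁, sub_zero, h4, Real.norm_eq_abs] at h1
    have h5 := neg_abs_le (critFun e₂ v - ((e₂ - e₁) * L (1, 0) + (v - critV e₁) * L (0, 1)))
    have h6 : (critV e₁ - v) * L (0, 1) ≤ 4 * c * (e₂ - e₁) * |L (0, 1)| :=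
      (mul_le_mul_of_nonneg_left (le_abs_self _) (by linarith)).trans
        (mul_le_mul_of_nonneg_right hb (abs_nonneg _))
    have h7 := mul_lt_mul_of_pos_left hc2 (sub_pos.2 he)
    have h8 : c * (critV e₁ - v) ≤ 1 / 4 * (4 * c * (e₂ - e₁)) :=
      mul_le_mul hc1 hb (by linarith) (by norm_num)
    have h9 := mul_pos hc0 (sub_pos.2 he)
    nlinarith
  have hlt := (critV_lt_iff hm₂ hv0 hv4).2 hpos
  change critEnergy e₂ < critEnergy e₁
  rw [← hveq]
  exact strictMonoOn_lvEnergy hm₂.1 (critV_spec hm₂).1.2 hv4 hlt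


/-! ### Level curves in polar coordinates -/

/-- The scaled normal form at the point `√2 x e^{iφ}` with `c = cos 3φ`. -/
def polarForm (e c x : ℝ) : ℝ := x ^ 4 + c * x ^ 3 + e * x ^ 2

/-- `2 ∂K/∂I`, twice the angular velocity. -/
def polarFreq (e c x : ℝ) : ℝ := 4 * x ^ 2 + 3 * c * x + 2 * e

/-- The discriminant of the quadratic in `x` is `9c² - 32e`, negative for all `|c| ≤ 1` exactly when
`e > 9/32`. Beyond the saddle-center bifurcation all orbits thus turn in one direction and level
curves are graphs over the angle. -/
theorem polarFreq_pos {e c x : ℝ} (he : 9 / 32 < e) (hc : |c| ≤ 1) : 0 < polarFreq e c x := by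
  have h := sq_le_one_iff_abs_le_one c |>.2 hc
  unfold polarFreq
  nlinarith [sq_nonneg (2 * x + 3 / 4 * c)]

theorem strictMonoOn_polarForm {e c : ℝ} (he : 9 / 32 < e) (hc : |c| ≤ 1) :
    StrictMonoOn (polarForm e c) (Set.Ici 0) := by
  refine strictMonoOn_of_deriv_pos (convex_Ici 0)
    (by unfold polarForm; fun_prop) (fun x hx => ?_)
  rw [interior_Ici] at hx
  have h : HasDerivAt (polarForm e c) (x * polarFreq e c x) x := by
    refine (((hasDerivAt_pow 4 x).add ((hasDerivAt_pow 3 x).const_mul c)).add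
      ((hasDerivAt_pow 2 x).const_mul e)).congr_deriv ?_
    unfold polarFreq; norm_num; ring
  rw [h.deriv]
  exact mul_pos hx (polarFreq_pos he hc)

theorem exists_polarForm_eq {e c η : ℝ} (he : 9 / 32 < e) (hc : |c| ≤ 1) (hη : 0 < η) :
    ∃ x, 0 < x ∧ polarForm e c x = η := by
  have h1 : η < polarForm e c (2 + η) := by
    have h2 := (abs_le.1 hc).1
    have h3 : 0 ≤ (c + 1) * (2 + η) ^ 3 := mul_nonneg (by linarith) (by positivity)
    have h4 : 0 ≤ e * (2 + η) ^ 2 := by have : 0 < e := by linarith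
                                        positivity
    have h5 : (2 + η) ^ 4 - (2 + η) ^ 3 = (2 + η) ^ 3 * (1 + η) := by ring
    have h6 : η < (2 + η) ^ 3 * (1 + η) := by
      have : (1 : ℝ) ≤ (2 + η) ^ 3 := one_le_pow₀ (by linarith)
      nlinarith
    unfold polarForm
    nlinarith
  obtain ⟨x, hx, hxe⟩ := intermediate_value_Ioo (by linarith : (0 : ℝ) ≤ 2 + η)
    (f := polarForm e c) (by unfold polarForm; fun_prop)
    (⟨by simpa [polarForm] using hη, h1⟩ : η ∈ Set.Ioo (polarForm e c 0) _)
  exact ⟨x, hx.1, hxe⟩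

theorem abs_cos_le_one' (t : ℝ) : |Real.cos t| ≤ 1 := Real.abs_cos_le_one t

open Classical in
/-- The positive root of `polarForm e c x = η`. -/
noncomputable def polarRoot (e c η : ℝ) : ℝ :=
  if h : ∃ x, 0 < x ∧ polarForm e c x = η then h.choose else 0

/-- The level curve `{K = η}` of the scaled normal form in polar coordinates, `√I` as a function
of the angle and the energy. -/
noncomputable def lev (e φ η : ℝ) : ℝ := polarRoot e (Real.cos (3 * φ)) η

section lev

variable {e φ η : ℝ}

theorem lev_spec (he : 9 / 32 < e) (hη : 0 < η) (φ : ℝ) :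
    0 < lev e φ η ∧ polarForm e (Real.cos (3 * φ)) (lev e φ η) = η := by
  have h := exists_polarForm_eq he (abs_cos_le_one' (3 * φ)) hη
  unfold lev polarRoot
  rw [dif_pos h]
  exact h.choose_spec

theorem lev_pos (he : 9 / 32 < e) (hη : 0 < η) (φ : ℝ) : 0 < lev e φ η := (lev_spec he hη φ).1

theorem polarForm_lev (he : 9 / 32 < e) (hη : 0 < η) (φ : ℝ) :
    polarForm e (Real.cos (3 * φ)) (lev e φ η) = η := (lev_spec he hη φ).2

theorem lev_le_iff (he : 9 / 32 < e) (hη : 0 < η) {x : ℝ} (hx : 0 ≤ x) :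
    x ≤ lev e φ η ↔ polarForm e (Real.cos (3 * φ)) x ≤ η := by
  conv_rhs => rw [← polarForm_lev he hη φ]
  exact ((strictMonoOn_polarForm he (abs_cos_le_one' _)).le_iff_le hx
    (lev_pos he hη φ).le).symm

theorem lt_lev_iff (he : 9 / 32 < e) (hη : 0 < η) {x : ℝ} (hx : 0 ≤ x) :
    x < lev e φ η ↔ polarForm e (Real.cos (3 * φ)) x < η := by
  conv_rhs => rw [← polarForm_lev he hη φ]
  exact ((strictMonoOn_polarForm he (abs_cos_le_one' _)).lt_iff_lt hx
    (lev_pos he hη φ).le).symm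

theorem lev_lt_iff (he : 9 / 32 < e) (hη : 0 < η) {x : ℝ} (hx : 0 ≤ x) :
    lev e φ η < x ↔ η < polarForm e (Real.cos (3 * φ)) x := by
  rw [← not_le, ← not_le, lev_le_iff he hη hx]

theorem lev_unique (he : 9 / 32 < e) (hη : 0 < η) {x : ℝ} (hx : 0 ≤ x)
    (h : polarForm e (Real.cos (3 * φ)) x = η) : lev e φ η = x :=
  le_antisymm (not_lt.1 fun hc => ((lt_lev_iff he hη hx).1 hc).ne h)
    ((lev_le_iff he hη hx).2 h.le)

theorem continuousAt_lev (he : 9 / 32 < e) (hη : 0 < η) (φ : ℝ) :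
    ContinuousAt (fun p : ℝ × ℝ => lev e p.1 p.2) (φ, η) := by
  have hx := lev_pos he hη φ
  have hcont : ∀ x : ℝ, Continuous fun p : ℝ × ℝ =>
      polarForm e (Real.cos (3 * p.1)) x - p.2 := by
    intro x; unfold polarForm; fun_prop
  have hpos : ∀ᶠ p : ℝ × ℝ in 𝓝 (φ, η), 0 < p.2 :=
    (continuous_snd.tendsto (φ, η)).eventually (lt_mem_nhds hη)
  refine tendsto_order.2 ⟨fun a ha => ?_, fun b hb => ?_⟩
  · obtain ⟨x, hx1, hx2⟩ := exists_between (max_lt ha hx)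
    have hx0 := (le_max_right a 0).trans_lt hx1
    have h1 := (hcont x).tendsto (φ, η) |>.eventually
      (gt_mem_nhds (sub_neg.2 ((lt_lev_iff he hη hx0.le).1 hx2)))
    filter_upwards [hpos, h1] with p hp h2
    exact ((le_max_left a 0).trans_lt hx1).trans ((lt_lev_iff he hp hx0.le).2 (sub_neg.1 h2))
  · have hb0 := hx.trans hb
    have h1 := (hcont b).tendsto (φ, η) |>.eventually
      (lt_mem_nhds (sub_pos.2 ((lev_lt_iff he hη hb0.le).1 hb)))
    filter_upwards [hpos, h1] with p hp h2
    exact (lev_lt_iff he hp hb0.le).2 (sub_pos.1 h2)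

/-- The divided difference of `polarForm`. -/
def polarSlope (e c x y : ℝ) : ℝ :=
  (y ^ 3 + y ^ 2 * x + y * x ^ 2 + x ^ 3) + c * (y ^ 2 + y * x + x ^ 2) + e * (y + x)

theorem polarSlope_self (e c x : ℝ) : polarSlope e c x x = x * polarFreq e c x := by
  unfold polarSlope polarFreq; ring

/-- Both points lie on their levels, so the difference quotient of `lev` is exactly the reciprocal
of the divided difference `polarSlope`. Continuity of `lev` then gives the limit. -/
theorem hasDerivAt_lev_energy (he : 9 / 32 < e) (hη : 0 < η) (φ : ℝ) :
    HasDerivAt (fun η => lev e φ η)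
      (1 / (lev e φ η * polarFreq e (Real.cos (3 * φ)) (lev e φ η))) η := by
  have hx := lev_pos he hη φ
  have hD : 0 < lev e φ η * polarFreq e (Real.cos (3 * φ)) (lev e φ η) :=
    mul_pos hx (polarFreq_pos he (abs_cos_le_one' _))
  have hc : ContinuousAt (fun η => lev e φ η) η :=
    (continuousAt_lev he hη φ).comp (f := fun η : ℝ => (φ, η)) (by fun_prop)
  have hs : ContinuousAt (fun y => polarSlope e (Real.cos (3 * φ)) (lev e φ η) (lev e φ y)) η := by
    unfold polarSlope; fun_prop
  have hs' : polarSlope e (Real.cos (3 * φ)) (lev e φ η) (lev e φ η)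
      = lev e φ η * polarFreq e (Real.cos (3 * φ)) (lev e φ η) := polarSlope_self _ _ _
  rw [hasDerivAt_iff_tendsto_slope]
  have hinv : Tendsto (fun y => 1 / polarSlope e (Real.cos (3 * φ)) (lev e φ η) (lev e φ y))
      (𝓝[≠] η) (𝓝 (1 / (lev e φ η * polarFreq e (Real.cos (3 * φ)) (lev e φ η)))) := by
    rw [← hs'] at hD ⊢
    exact (tendsto_const_nhds.div hs hD.ne').mono_left nhdsWithin_le_nhds
  refine hinv.congr' ?_
  have hev : ∀ᶠ y in 𝓝[≠] η, 0 < polarSlope e (Real.cos (3 * φ)) (lev e φ η) (lev e φ y) := by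
    rw [← hs'] at hD
    exact (hs.eventually (lt_mem_nhds hD)).filter_mono nhdsWithin_le_nhds
  filter_upwards [hev, self_mem_nhdsWithin,
    (lt_mem_nhds hη).filter_mono nhdsWithin_le_nhds] with y hy hne hy0
  have h1 := polarForm_lev he hη φ
  have h2 := polarForm_lev he hy0 φ
  have hne' : y - η ≠ 0 := sub_ne_zero.2 hne
  rw [slope_def_field, div_eq_div_iff hy.ne' hne', one_mul]
  unfold polarForm at h1 h2
  unfold polarSlope
  linear_combination h1 - h2

theorem hasDerivAt_lev_angle (he : 9 / 32 < e) (hη : 0 < η) (φ : ℝ) :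
    HasDerivAt (fun φ => lev e φ η)
      (3 * Real.sin (3 * φ) * lev e φ η ^ 2 / polarFreq e (Real.cos (3 * φ)) (lev e φ η)) φ := by
  have hx := lev_pos he hη φ
  have hF := polarFreq_pos (x := lev e φ η) he (abs_cos_le_one' (3 * φ))
  have hD : 0 < lev e φ η * polarFreq e (Real.cos (3 * φ)) (lev e φ η) := mul_pos hx hF
  have hc : ContinuousAt (fun φ => lev e φ η) φ :=
    (continuousAt_lev he hη φ).comp (f := fun φ : ℝ => (φ, η)) (by fun_prop)
  have hs : ContinuousAt (fun y => polarSlope e (Real.cos (3 * φ)) (lev e φ η) (lev e y η)) φ := by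
    unfold polarSlope; fun_prop
  have hs' : polarSlope e (Real.cos (3 * φ)) (lev e φ η) (lev e φ η)
      = lev e φ η * polarFreq e (Real.cos (3 * φ)) (lev e φ η) := polarSlope_self _ _ _
  have hcos : HasDerivAt (fun φ => Real.cos (3 * φ)) (-Real.sin (3 * φ) * 3) φ := by
    simpa using ((hasDerivAt_id φ).const_mul 3).cos
  rw [hasDerivAt_iff_tendsto_slope] at hcos ⊢
  have hlim : Tendsto (fun y => slope (fun φ => Real.cos (3 * φ)) φ y
      * (-(lev e y η) ^ 3 / polarSlope e (Real.cos (3 * φ)) (lev e φ η) (lev e y η)))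
      (𝓝[≠] φ) (𝓝 (3 * Real.sin (3 * φ) * lev e φ η ^ 2
        / polarFreq e (Real.cos (3 * φ)) (lev e φ η))) := by
    have h1 : Tendsto (fun y => -(lev e y η) ^ 3 /
        polarSlope e (Real.cos (3 * φ)) (lev e φ η) (lev e y η)) (𝓝[≠] φ)
        (𝓝 (-(lev e φ η) ^ 3 / (lev e φ η * polarFreq e (Real.cos (3 * φ)) (lev e φ η)))) := by
      rw [← hs'] at hD ⊢
      exact ((hc.pow 3).neg.div hs hD.ne').mono_left nhdsWithin_le_nhds
    have h2 := hcos.mul h1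
    have h3 : -Real.sin (3 * φ) * 3 * (-(lev e φ η) ^ 3
        / (lev e φ η * polarFreq e (Real.cos (3 * φ)) (lev e φ η)))
        = 3 * Real.sin (3 * φ) * lev e φ η ^ 2 / polarFreq e (Real.cos (3 * φ)) (lev e φ η) := by
      field_simp
    rwa [h3] at h2
  refine hlim.congr' ?_
  have hev : ∀ᶠ y in 𝓝[≠] φ, 0 < polarSlope e (Real.cos (3 * φ)) (lev e φ η) (lev e y η) := by
    rw [← hs'] at hD
    exact (hs.eventually (lt_mem_nhds hD)).filter_mono nhdsWithin_le_nhds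
  filter_upwards [hev, self_mem_nhdsWithin] with y hy hne
  have h1 := polarForm_lev he hη φ
  have h2 := polarForm_lev he hη y
  have hne' : y - φ ≠ 0 := sub_ne_zero.2 hne
  rw [slope_def_field, slope_def_field, div_mul_div_comm, div_eq_div_iff (by positivity) hne']
  unfold polarForm at h1 h2
  unfold polarSlope
  linear_combination (y - φ) * (h1 - h2)

/-- The level curves depend continuously on the parameter, also at the saddle-center bifurcation. -/
theorem continuous_lev (he : 9 / 32 < e) (hη : 0 < η) : Continuous fun φ => lev e φ η :=
  continuous_iff_continuousAt.2 fun φ => (hasDerivAt_lev_angle he hη φ).continuousAt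

/-- The reciprocal angular velocity on the level curve, `∂(I)/∂η`. -/
noncomputable def levSlow (e φ η : ℝ) : ℝ := 2 / polarFreq e (Real.cos (3 * φ)) (lev e φ η)

theorem levSlow_pos (he : 9 / 32 < e) : 0 < levSlow e φ η :=
  div_pos two_pos (polarFreq_pos he (abs_cos_le_one' _))

theorem continuousAt_levSlow (he : 9 / 32 < e) (hη : 0 < η) (φ : ℝ) :
    ContinuousAt (fun p : ℝ × ℝ => levSlow e p.1 p.2) (φ, η) := by
  have h := continuousAt_lev he hη φ
  unfold levSlow
  refine continuousAt_const.div ?_ (polarFreq_pos he (abs_cos_le_one' _)).ne'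
  unfold polarFreq
  fun_prop

theorem continuous_levSlow (he : 9 / 32 < e) (hη : 0 < η) : Continuous fun φ => levSlow e φ η :=
  continuous_iff_continuousAt.2 fun φ =>
    (continuousAt_levSlow he hη φ).comp (f := fun φ : ℝ => (φ, η)) (by fun_prop)

theorem hasDerivAt_lev_sq (he : 9 / 32 < e) (hη : 0 < η) (φ : ℝ) :
    HasDerivAt (fun η => lev e φ η ^ 2) (levSlow e φ η) η := by
  have hx := lev_pos he hη φ
  have hF := polarFreq_pos (x := lev e φ η) he (abs_cos_le_one' (3 * φ))
  refine ((hasDerivAt_lev_energy he hη φ).pow 2).congr_deriv ?_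
  unfold levSlow
  field_simp
  norm_num
  ring

theorem lev_add_two_pi_div_three (e φ η : ℝ) : lev e (φ + 2 * Real.pi / 3) η = lev e φ η := by
  unfold lev
  have : 3 * (φ + 2 * Real.pi / 3) = 3 * φ + 2 * Real.pi := by ring
  rw [this, Real.cos_add_two_pi]

theorem lev_neg (e φ η : ℝ) : lev e (-φ) η = lev e φ η := by
  unfold lev
  rw [mul_neg, Real.cos_neg]

theorem levSlow_add_two_pi_div_three (e φ η : ℝ) :
    levSlow e (φ + 2 * Real.pi / 3) η = levSlow e φ η := by
  unfold levSlow
  rw [lev_add_two_pi_div_three]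
  have : 3 * (φ + 2 * Real.pi / 3) = 3 * φ + 2 * Real.pi := by ring
  rw [this, Real.cos_add_two_pi]

theorem levSlow_neg (e φ η : ℝ) : levSlow e (-φ) η = levSlow e φ η := by
  unfold levSlow
  rw [lev_neg]
  simp only [mul_neg, Real.cos_neg]

/-- The period of the level curve of energy `η`. -/
noncomputable def levPeriod (e η : ℝ) : ℝ := ∫ φ in (0 : ℝ)..(2 * Real.pi), levSlow e φ η

/-- The threefold symmetry and the reflection `φ ↦ -φ` cut the circle into six equal arcs. On one of
them the radius is monotone and can serve as the integration variable. -/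
theorem levPeriod_eq (he : 9 / 32 < e) (hη : 0 < η) :
    levPeriod e η = 6 * ∫ φ in (0 : ℝ)..(Real.pi / 3), levSlow e φ η := by
  have hint : ∀ a b, IntervalIntegrable (fun φ => levSlow e φ η) volume a b :=
    fun a b => (continuous_levSlow he hη).intervalIntegrable a b
  have hper : Function.Periodic (fun φ => levSlow e φ η) (2 * Real.pi / 3) :=
    fun φ => levSlow_add_two_pi_div_three e φ η
  have h1 : levPeriod e η = (3 : ℤ) • ∫ φ in (0 : ℝ)..(2 * Real.pi / 3), levSlow e φ η := by
    have := hper.intervalIntegral_add_zsmul_eq 3 0 hint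
    rw [zero_add, zero_add] at this
    rw [← this, levPeriod]
    congr 1
    simp; ring
  have h2 : ∫ φ in (0 : ℝ)..(2 * Real.pi / 3), levSlow e φ η
      = ∫ φ in (-(Real.pi / 3))..(Real.pi / 3), levSlow e φ η := by
    have := hper.intervalIntegral_add_eq 0 (-(Real.pi / 3))
    rw [zero_add] at this
    rw [this]; congr 1; ring
  have h3 : ∫ φ in (-(Real.pi / 3))..0, levSlow e φ η
      = ∫ φ in (0 : ℝ)..(Real.pi / 3), levSlow e φ η := by
    have := intervalIntegral.integral_comp_neg (a := -(Real.pi / 3)) (b := 0)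
      (f := fun φ => levSlow e φ η)
    simp only [levSlow_neg, neg_zero, neg_neg] at this
    exact this
  rw [h1, h2, ← intervalIntegral.integral_add_adjacent_intervals (hint _ 0) (hint _ _), h3]
  simp; ring

theorem levPeriod_pos (he : 9 / 32 < e) (hη : 0 < η) : 0 < levPeriod e η :=
  intervalIntegral.intervalIntegral_pos_of_pos_on
    ((continuous_levSlow he hη).intervalIntegrable _ _) (fun _ _ => levSlow_pos he)
    Real.two_pi_pos

/-- The area inside a level curve has the period as its derivative. -/
theorem hasDerivAt_integral_lev_sq (he : 9 / 32 < e) (hη : 0 < η) :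
    HasDerivAt (fun η => ∫ φ in (0 : ℝ)..(2 * Real.pi), lev e φ η ^ 2) (levPeriod e η) η := by
  refine hasDerivAt_intervalIntegral_of_continuousOn (f := fun η φ => lev e φ η ^ 2)
    (f' := fun η φ => levSlow e φ η) (s := Set.Ioi 0) isOpen_Ioi hη
    (fun y hy => ((continuous_lev he hy).pow 2).continuousOn) ?_
    (fun y hy t _ => hasDerivAt_lev_sq he hy t)
  intro p hp
  refine ContinuousAt.continuousWithinAt ?_
  exact (continuousAt_levSlow he hp.1 p.2).comp (f := fun p : ℝ × ℝ => (p.2, p.1))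
    (by fun_prop)

end lev

theorem normalForm_polar (e x φ : ℝ) :
    normalForm e 1 1 (((√2 * x : ℝ) : ℂ) * Complex.exp ((φ : ℂ) * Complex.I))
      = polarForm e (Real.cos (3 * φ)) x := by
  have h2 := Real.sq_sqrt (show (0 : ℝ) ≤ 2 by norm_num)
  have h1 : (((√2 * x : ℝ) : ℂ) * Complex.exp ((φ : ℂ) * Complex.I)) ^ 3
      = (((√2 * x) ^ 3 : ℝ) : ℂ) * Complex.exp (((3 * φ : ℝ) : ℂ) * Complex.I) := by
    rw [mul_pow, ← Complex.exp_nat_mul]; push_cast; ring_nf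
  rw [normalForm_eq, h1, Complex.re_ofReal_mul, Complex.exp_ofReal_mul_I_re, map_mul,
    Complex.normSq_ofReal, Complex.normSq_eq_norm_sq, Complex.norm_exp_ofReal_mul_I]
  have h3 : √2 * x * (√2 * x) = 2 * x ^ 2 := by
    linear_combination x ^ 2 * h2
  have h4 : 1 / (2 * √2) * ((√2 * x) ^ 3 * Real.cos (3 * φ)) = Real.cos (3 * φ) * x ^ 3 := by
    have : (√2 * x) ^ 3 = 2 * √2 * x ^ 3 := by rw [mul_pow, pow_succ, h2]
    rw [this]; field_simp
  rw [h3, h4]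
  unfold polarForm; ring


/-! ### Reduction of the period to a complete elliptic integral. -/

/-- The factorization of the level polynomial by means of the level parameter: `α`, `-(α + s)` are
the real roots and `x² + (1 - s) x + q` is the remaining factor. -/
theorem exists_level_roots {e v : ℝ} (he : 9 / 32 < e) (h0 : 0 < v) (h1 : v < 1 / 4) :
    ∃ α s : ℝ, 0 < α ∧ 0 < s ∧ s < 1 / 2 ∧ v = s * (1 - s) ∧
      e = s * (1 - s) + α * (α + s) * (1 - 2 * s) / s := by
  have hk := Real.sqrt_pos.2 (show 0 < 1 - 4 * v by linarith)
  have hk2 := Real.sq_sqrt (show 0 ≤ 1 - 4 * v by linarith)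
  have hk1 : √(1 - 4 * v) < 1 := by
    by_contra hc
    nlinarith [not_lt.1 hc]
  obtain ⟨κ, hκ⟩ : ∃ κ, κ = √(1 - 4 * v) := ⟨_, rfl⟩
  rw [← hκ] at hk hk1 hk2
  have hg : 0 < e - v := by linarith
  obtain ⟨s, hs⟩ : ∃ s, s = (1 - κ) / 2 := ⟨_, rfl⟩
  have hs0 : 0 < s := by linarith
  -- `P` is the prescribed value of `α(α + s)`; `α` is then the positive root of `α² + sα = P`.
  have hP : 0 < s * (e - v) / κ := by positivity
  obtain ⟨P, hPdef⟩ : ∃ P, P = s * (e - v) / κ := ⟨_, rfl⟩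
  rw [← hPdef] at hP
  have hd2 := Real.sq_sqrt (show 0 ≤ s ^ 2 + 4 * P by positivity)
  have hds : s < √(s ^ 2 + 4 * P) := Real.lt_sqrt_of_sq_lt (by linarith)
  refine ⟨(√(s ^ 2 + 4 * P) - s) / 2, s, by linarith, hs0, by linarith, ?_, ?_⟩
  · rw [hs]; linarith
  · have e1 : (√(s ^ 2 + 4 * P) - s) / 2 * ((√(s ^ 2 + 4 * P) - s) / 2 + s) = P := by
      linarith
    have e2 : 1 - 2 * s = κ := by rw [hs]; ring
    have e3 : s * (1 - s) = v := by rw [hs]; linarith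
    rw [e1, e2, e3, hPdef]
    field_simp
    ring

/-- The half-angle substitution `tan²(ψ/2) = N₂/N₁`, written through `cos ψ` so as to be continuous
where `N₁` or `N₂` vanishes. -/
theorem arccos_hasDerivAt_of_sum {N₁ N₂ : ℝ → ℝ} {d₁ d₂ t : ℝ} (h₁ : HasDerivAt N₁ d₁ t)
    (h₂ : HasDerivAt N₂ d₂ t) (p₁ : 0 < N₁ t) (p₂ : 0 < N₂ t) :
    HasDerivAt (fun t => Real.arccos ((N₁ t - N₂ t) / (N₁ t + N₂ t)))
      ((d₂ * N₁ t - d₁ * N₂ t) / ((N₁ t + N₂ t) * √(N₁ t * N₂ t))) t := by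
  have hs : 0 < N₁ t + N₂ t := by positivity
  have hw : HasDerivAt (fun t => (N₁ t - N₂ t) / (N₁ t + N₂ t))
      (2 * (d₁ * N₂ t - d₂ * N₁ t) / (N₁ t + N₂ t) ^ 2) t := by
    refine ((h₁.sub h₂).div (h₁.add h₂) hs.ne').congr_deriv ?_
    simp only [Pi.add_apply, Pi.sub_apply]
    congr 1; ring
  have hm : (N₁ t - N₂ t) / (N₁ t + N₂ t) ≠ -1 := by
    rw [Ne, div_eq_iff hs.ne']; intro h; linarith
  have hp : (N₁ t - N₂ t) / (N₁ t + N₂ t) ≠ 1 := by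
    rw [Ne, div_eq_iff hs.ne']; intro h; linarith
  refine ((Real.hasDerivAt_arccos hm hp).comp t hw).congr_deriv ?_
  have h4 : 1 - ((N₁ t - N₂ t) / (N₁ t + N₂ t)) ^ 2
      = (2 * √(N₁ t * N₂ t) / (N₁ t + N₂ t)) ^ 2 := by
    rw [div_pow (2 * _), mul_pow, Real.sq_sqrt (by positivity)]
    field_simp; ring
  have hq : 0 < √(N₁ t * N₂ t) := Real.sqrt_pos.2 (by positivity)
  rw [h4, Real.sqrt_sq (by positivity)]
  field_simp
  ring

set_option maxHeartbeats 4000000 in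
/-- The period of a level curve is a complete elliptic integral. -/
theorem levPeriod_lvEnergy {e v : ℝ} (he : 9 / 32 < e) (h0 : 0 < v) (h1 : v < 1 / 4) :
    levPeriod e (lvEnergy e v) = lvPeriod e v := by
  have hlev := isLevel_of_lt he h0.le h1
  have hη := lvEnergy_pos he h0 h1
  obtain ⟨α, s, hα, hs, hs2, hv, hes⟩ := exists_level_roots he h0 h1
  have h2s : 0 < 1 - 2 * s := by linarith
  have h2s' : 1 - s * 2 ≠ 0 := by linarith
  have hk : 1 - 4 * v = (1 - 2 * s) ^ 2 := by rw [hv]; ring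
  have hg : e - v = α * (α + s) * (1 - 2 * s) / s := by rw [hv]; linarith
  obtain ⟨η, hηd⟩ : ∃ η, η = lvEnergy e v := ⟨_, rfl⟩
  have hηe : η = (α * (α + s)) ^ 2 * (1 - s) / s := by
    rw [hηd, lvEnergy, hk, hg, hv]; field_simp
  rw [← hηd] at hη ⊢
  obtain ⟨q₀, hq₀⟩ : ∃ q₀, q₀ = α * (α + s) * (1 - s) / s := ⟨_, rfl⟩
  have hq₀s : q₀ * s = α * (α + s) * (1 - s) := by rw [hq₀]; field_simp
  -- the quadratic factor in `I = x²`
  obtain ⟨q, hq⟩ : ∃ q : ℝ → ℝ, q = fun I => (I + q₀) ^ 2 - I * (1 - s) ^ 2 := ⟨_, rfl⟩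
  obtain ⟨a, ha⟩ : ∃ a, a = α ^ 2 := ⟨_, rfl⟩
  obtain ⟨b, hb⟩ : ∃ b, b = (α + s) ^ 2 := ⟨_, rfl⟩
  have hab : a < b := by rw [ha, hb]; nlinarith
  have hX : lvX e v = 2 * (α * (α + s) / s) ^ 2 - (s * (1 - s)) ^ 2
      - 2 * (1 - s) * (α * (α + s) * (1 - 2 * s)) := by
    unfold lvX; rw [hk, hg, hv]; field_simp
  have hY : lvY e v = q a * q b := by
    unfold lvY; rw [hk, hg, hv, hq, ha, hb, hq₀]; field_simp; ring
  -- Under `u² = (I - a)/(b - I)` the factor `q` becomes `q(b)u⁴ + Xu² + q(a)`, up to a square;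
  -- scaling `u` gives the radicand `u⁴ + Xu² + Y` with `Y = q(a)q(b)`.
  have hid : ∀ I, q b * (I - a) ^ 2 + lvX e v * (I - a) * (b - I) + q a * (b - I) ^ 2
      = (b - a) ^ 2 * q I := by
    intro I
    rw [hX, hq, ha, hb, hq₀]
    field_simp
    ring
  -- On the level the right side is `I³ sin² 3φ`, so along orbits it is `(I'/3)²`: the period is an
  -- integral in `I` between the turning points `a` and `b`.
  have hQ : ∀ I, (I - a) * (b - I) * q I = I ^ 3 - (η - e * I - I ^ 2) ^ 2 := by
    intro I
    rw [hq, ha, hb, hq₀, hηe, hes]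
    field_simp
    ring
  -- At a square, `q(x²) = (x² + q₀)² - x²(1 - s)²` splits into two factors. The one of unclear sign
  -- at `x = α` is positive because its product with a positive number is a square; `q b` then
  -- inherits its sign from `Y = q(a)q(b) > 0`.
  have hqb : 0 < q b := by
    have h2 : (((α + s) ^ 2 + (1 - s) * (α + s) + q₀) * (α ^ 2 - (1 - s) * α + q₀))
        = (α * (α + s) / s) ^ 2 := by
      rw [hq₀]; field_simp; ring
    have hf1 : 0 < (α + s) ^ 2 + (1 - s) * (α + s) + q₀ := by
      have : 0 < 1 - s := by linarith
      have : 0 < q₀ := by rw [hq₀]; positivity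
      positivity
    have hf2 : 0 < α ^ 2 - (1 - s) * α + q₀ :=
      pos_of_mul_pos_right (by rw [h2]; positivity) hf1.le
    have hf3 : 0 < α ^ 2 + (1 - s) * α + q₀ := by
      have : 0 < (1 - s) * α := mul_pos (by linarith) hα
      linarith
    have hqa : 0 < q a := by
      have : q a = (α ^ 2 - (1 - s) * α + q₀) * (α ^ 2 + (1 - s) * α + q₀) := by
        rw [hq, ha]; ring
      rw [this]; positivity
    have h3 := hlev.Y_pos
    rw [hY] at h3
    exact pos_of_mul_pos_right h3 hqa.le
  obtain ⟨r, hr⟩ : ∃ r, r = √(lvY e v) := ⟨_, rfl⟩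
  have hr0 : 0 < r := hr ▸ hlev.sqrtY_pos
  have hr2 : r ^ 2 = lvY e v := by rw [hr]; exact Real.sq_sqrt hlev.Y_pos.le
  have hx1 := hlev.neg_one_lt_arg
  have harg : lvArg e v = lvX e v / (2 * r) := by rw [hr, lvArg]
  -- end points
  have hl0 : lev e 0 η = α := by
    refine lev_unique he hη hα.le ?_
    rw [mul_zero, Real.cos_zero, polarForm, hηe, hes]; field_simp; ring
  have hl1 : lev e (Real.pi / 3) η = α + s := by
    refine lev_unique he hη (by positivity) ?_
    rw [mul_div_cancel₀ _ (by norm_num), Real.cos_pi, polarForm, hηe, hes]; field_simp; ring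
  -- the functions
  obtain ⟨N₁, hN₁⟩ : ∃ N₁ : ℝ → ℝ, N₁ = fun φ => r * (b - lev e φ η ^ 2) := ⟨_, rfl⟩
  obtain ⟨N₂, hN₂⟩ : ∃ N₂ : ℝ → ℝ, N₂ = fun φ => q b * (lev e φ η ^ 2 - a) := ⟨_, rfl⟩
  have hmono : StrictMonoOn (fun φ => lev e φ η) (Set.Icc 0 (Real.pi / 3)) := by
    refine strictMonoOn_of_deriv_pos (convex_Icc _ _) (continuous_lev he hη).continuousOn
      fun φ hφ => ?_
    rw [interior_Icc] at hφ
    rw [(hasDerivAt_lev_angle he hη φ).deriv]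
    have hsin : 0 < Real.sin (3 * φ) :=
      Real.sin_pos_of_pos_of_lt_pi (by linarith [hφ.1]) (by linarith [hφ.2])
    have := polarFreq_pos (x := lev e φ η) he (abs_cos_le_one' (3 * φ))
    have := lev_pos he hη φ
    positivity
  have hpi3 : (0 : ℝ) < Real.pi / 3 := by positivity
  have hNpos : ∀ φ ∈ Set.Ioo 0 (Real.pi / 3), 0 < N₁ φ ∧ 0 < N₂ φ := by
    intro φ hφ
    have h2 := hmono ⟨le_rfl, hpi3.le⟩ (Set.Ioo_subset_Icc_self hφ) hφ.1
    have h3 := hmono (Set.Ioo_subset_Icc_self hφ) ⟨hpi3.le, le_rfl⟩ hφ.2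
    simp only [hl0, hl1] at h2 h3
    rw [hN₁, hN₂]
    constructor
    · refine mul_pos hr0 ?_; rw [hb]; nlinarith
    · refine mul_pos hqb ?_; rw [ha]; nlinarith
  have hN10 : N₁ 0 = r * (b - a) := by rw [hN₁]; simp only [hl0, ha]
  have hN20 : N₂ 0 = 0 := by rw [hN₂]; simp only [hl0, ha]; ring
  have hN11 : N₁ (Real.pi / 3) = 0 := by rw [hN₁]; simp only [hl1, hb]; ring
  have hN21 : N₂ (Real.pi / 3) = q b * (b - a) := by rw [hN₂]; simp only [hl1, ← hb]
  have hba : 0 < b - a := sub_pos.2 hab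
  have hden : ∀ φ ∈ Set.Icc 0 (Real.pi / 3), N₁ φ + N₂ φ ≠ 0 := by
    intro φ hφ
    rcases hφ.1.eq_or_lt with h2 | h2
    · rw [← h2, hN10, hN20, add_zero]; positivity
    rcases hφ.2.eq_or_lt with h3 | h3
    · rw [h3, hN11, hN21, zero_add]; positivity
    have := hNpos φ ⟨h2, h3⟩
    exact (add_pos this.1 this.2).ne'
  have hlc := continuous_lev he hη
  have hN₁c : Continuous N₁ := by rw [hN₁]; fun_prop
  have hN₂c : Continuous N₂ := by rw [hN₂]; fun_prop
  obtain ⟨ψ, hψ⟩ : ∃ ψ : ℝ → ℝ, ψ = fun φ =>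
    Real.arccos ((N₁ φ - N₂ φ) / (N₁ φ + N₂ φ)) := ⟨_, rfl⟩
  have hψc : ContinuousOn ψ (Set.Icc 0 (Real.pi / 3)) := by
    rw [hψ]
    exact Real.continuous_arccos.comp_continuousOn
      ((hN₁c.sub hN₂c).continuousOn.div (hN₁c.add hN₂c).continuousOn hden)
  have hψ0 : ψ 0 = 0 := by
    rw [hψ]; simp only [hN20, sub_zero, add_zero]
    rw [div_self (by rw [hN10]; positivity), Real.arccos_one]
  have hψ1 : ψ (Real.pi / 3) = Real.pi := by
    rw [hψ]; simp only [hN11, zero_sub, zero_add]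
    rw [neg_div, div_self (by rw [hN21]; positivity), Real.arccos_neg_one]
  have hell : Continuous fun t => ellDen (lvArg e v) t ^ (-(1 / 2) : ℝ) := by
    have := continuous_ellInt_integrand 0 hx1
    simpa using this
  have hslow := continuous_levSlow he hη
  have hG : ∀ t, HasDerivAt (fun y => ∫ t in (0 : ℝ)..y, ellDen (lvArg e v) t ^ (-(1 / 2) : ℝ))
      (ellDen (lvArg e v) t ^ (-(1 / 2) : ℝ)) t := fun t =>
    intervalIntegral.integral_hasDerivAt_right (hell.intervalIntegrable _ _)
      (hell.stronglyMeasurableAtFilter _ _) hell.continuousAt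
  have hH : ∀ t, HasDerivAt (fun y => ∫ t in (0 : ℝ)..y, levSlow e t η) (levSlow e t η) t :=
    fun t => intervalIntegral.integral_hasDerivAt_right (hslow.intervalIntegrable _ _)
      (hslow.stronglyMeasurableAtFilter _ _) hslow.continuousAt
  -- The incomplete elliptic integral up to `ψ φ` is compared with `3√r` times the travel time.
  -- Their difference has zero derivative inside the interval; `arccos` excludes the end points, so
  -- the conclusion uses the mean value theorem, which requires only continuity there.
  have hderiv : ∀ φ ∈ Set.Ioo 0 (Real.pi / 3), HasDerivAt (fun φ =>
      (∫ t in (0 : ℝ)..ψ φ, ellDen (lvArg e v) t ^ (-(1 / 2) : ℝ))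
        - 3 * √r * ∫ t in (0 : ℝ)..φ, levSlow e t η) 0 φ := by
    intro φ hφ
    obtain ⟨p₁, p₂⟩ := hNpos φ hφ
    have hx := lev_pos he hη φ
    have hD := polarFreq_pos (x := lev e φ η) he (abs_cos_le_one' (3 * φ))
    have hsin : 0 < Real.sin (3 * φ) :=
      Real.sin_pos_of_pos_of_lt_pi (by linarith [hφ.1]) (by linarith [hφ.2])
    have hI := (hasDerivAt_lev_angle he hη φ).pow 2
    obtain ⟨I', hI'⟩ : ∃ I', I' = 3 * lev e φ η ^ 3 * Real.sin (3 * φ) * levSlow e φ η := ⟨_, rfl⟩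
    have hId : HasDerivAt (fun φ => lev e φ η ^ 2) I' φ := by
      refine hI.congr_deriv ?_
      rw [hI', levSlow]; field_simp; norm_num; ring
    have hd₁ : HasDerivAt N₁ (-(r * I')) φ := by
      rw [hN₁]; exact ((hId.const_sub b).const_mul r).congr_deriv (by ring)
    have hd₂ : HasDerivAt N₂ (q b * I') φ := by
      rw [hN₂]; exact (hId.sub_const a).const_mul (q b)
    have hψd : HasDerivAt ψ ((q b * I' * N₁ φ - -(r * I') * N₂ φ)
        / ((N₁ φ + N₂ φ) * √(N₁ φ * N₂ φ))) φ := by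
      rw [hψ]; exact arccos_hasDerivAt_of_sum hd₁ hd₂ p₁ p₂
    have hGd := (hG (ψ φ)).comp φ hψd
    refine (hGd.sub ((hH φ).const_mul (3 * √r))).congr_deriv ?_
    have hsum : 0 < N₁ φ + N₂ φ := by positivity
    -- the radicand
    have hQl : (lev e φ η ^ 2 - a) * (b - lev e φ η ^ 2) * q (lev e φ η ^ 2)
        = (lev e φ η ^ 3 * Real.sin (3 * φ)) ^ 2 := by
      rw [hQ]
      have h2 := polarForm_lev he hη φ
      unfold polarForm at h2
      have h3 : η - e * lev e φ η ^ 2 - (lev e φ η ^ 2) ^ 2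
          = Real.cos (3 * φ) * lev e φ η ^ 3 := by linarith
      rw [h3]
      have := Real.sin_sq_add_cos_sq (3 * φ)
      linear_combination -(lev e φ η ^ 6) * this
    have hn1 : N₁ φ = r * (b - lev e φ η ^ 2) := by rw [hN₁]
    have hn2 : N₂ φ = q b * (lev e φ η ^ 2 - a) := by rw [hN₂]
    have hqpos : 0 < q (lev e φ η ^ 2) := by
      have h3 : 0 < b - lev e φ η ^ 2 := by
        rw [hn1] at p₁; exact pos_of_mul_pos_right p₁ hr0.le
      have h4 : 0 < lev e φ η ^ 2 - a := by
        rw [hn2] at p₂; exact pos_of_mul_pos_right p₂ hqb.le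
      exact pos_of_mul_pos_right (by rw [hQl]; positivity) (mul_pos h4 h3).le
    have hEll : ellDen (lvArg e v) (ψ φ)
        = q b * (b - a) ^ 2 * q (lev e φ η ^ 2) / (N₁ φ + N₂ φ) ^ 2 := by
      have hw1 : -1 ≤ (N₁ φ - N₂ φ) / (N₁ φ + N₂ φ) := by
        rw [le_div_iff₀ hsum]; linarith
      have hw2 : (N₁ φ - N₂ φ) / (N₁ φ + N₂ φ) ≤ 1 := by
        rw [div_le_one hsum]; linarith
      have hcos : Real.cos (ψ φ) = (N₁ φ - N₂ φ) / (N₁ φ + N₂ φ) := by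
        rw [hψ]; exact Real.cos_arccos hw1 hw2
      have hsin2 : Real.sin (ψ φ) ^ 2 = 4 * N₁ φ * N₂ φ / (N₁ φ + N₂ φ) ^ 2 := by
        rw [Real.sin_sq, hcos]; field_simp; ring
      have e1 : q b * (b - a) ^ 2 * q (lev e φ η ^ 2)
          = N₁ φ ^ 2 + lvX e v / r * (N₁ φ * N₂ φ) + N₂ φ ^ 2 := by
        have h3 := hid (lev e φ η ^ 2)
        have h4 : N₁ φ ^ 2 = q a * q b * (b - lev e φ η ^ 2) ^ 2 := by
          rw [hn1, mul_pow, hr2, hY]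
        rw [h4, hn2, hn1]
        field_simp
        linear_combination -h3
      rw [e1, ellDen, hsin2, harg]
      field_simp
      ring
    have hpow : ellDen (lvArg e v) (ψ φ) ^ (-(1 / 2) : ℝ)
        = (N₁ φ + N₂ φ) / (√(q b * q (lev e φ η ^ 2)) * (b - a)) := by
      rw [hEll, Real.rpow_neg (by positivity), ← Real.sqrt_eq_rpow]
      have : q b * (b - a) ^ 2 * q (lev e φ η ^ 2) / (N₁ φ + N₂ φ) ^ 2
          = (√(q b * q (lev e φ η ^ 2)) * (b - a) / (N₁ φ + N₂ φ)) ^ 2 := by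
        rw [div_pow, mul_pow, Real.sq_sqrt (by positivity)]; ring
      rw [this, Real.sqrt_sq (by positivity), inv_div]
    have hnum : q b * I' * N₁ φ - -(r * I') * N₂ φ = r * q b * (b - a) * I' := by
      rw [hn1, hn2]; ring
    have hroot : √(N₁ φ * N₂ φ) * √(q b * q (lev e φ η ^ 2))
        = √r * q b * (lev e φ η ^ 3 * Real.sin (3 * φ)) := by
      rw [← Real.sqrt_mul (by positivity)]
      have : N₁ φ * N₂ φ * (q b * q (lev e φ η ^ 2))
          = r * (q b * (lev e φ η ^ 3 * Real.sin (3 * φ))) ^ 2 := by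
        rw [hn1, hn2]
        linear_combination r * q b ^ 2 * hQl
      rw [this, Real.sqrt_mul hr0.le, Real.sqrt_sq (by positivity)]
      ring
    rw [hpow, hnum, hI']
    have hrr := Real.sq_sqrt hr0.le
    have hrs : 0 < √r := Real.sqrt_pos.2 hr0
    have e2 : (N₁ φ + N₂ φ) / (√(q b * q (lev e φ η ^ 2)) * (b - a))
        * (r * q b * (b - a) * (3 * lev e φ η ^ 3 * Real.sin (3 * φ) * levSlow e φ η)
          / ((N₁ φ + N₂ φ) * √(N₁ φ * N₂ φ)))
        = r * q b * (3 * lev e φ η ^ 3 * Real.sin (3 * φ) * levSlow e φ η)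
          / (√(N₁ φ * N₂ φ) * √(q b * q (lev e φ η ^ 2))) := by
      field_simp
    rw [e2, hroot]
    have : r * q b * (3 * lev e φ η ^ 3 * Real.sin (3 * φ) * levSlow e φ η)
        / (√r * q b * (lev e φ η ^ 3 * Real.sin (3 * φ))) = 3 * √r * levSlow e φ η := by
      rw [div_eq_iff (by positivity)]
      linear_combination -(3 * q b * lev e φ η ^ 3 * Real.sin (3 * φ) * levSlow e φ η) * hrr
    rw [this]; ring
  obtain ⟨c, hc, hslope⟩ := exists_hasDerivAt_eq_slope (fun φ =>
      (∫ t in (0 : ℝ)..ψ φ, ellDen (lvArg e v) t ^ (-(1 / 2) : ℝ))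
        - 3 * √r * ∫ t in (0 : ℝ)..φ, levSlow e t η) (fun _ => 0) hpi3 (by
      refine ContinuousOn.sub ?_ (continuousOn_const.mul ?_)
      · exact (continuous_iff_continuousAt.2 fun t => (hG t).continuousAt).comp_continuousOn hψc
      · exact (continuous_iff_continuousAt.2 fun t => (hH t).continuousAt).continuousOn) hderiv
  have hzero := (eq_div_iff (by linarith)).1 hslope
  simp only [hψ0, hψ1, intervalIntegral.integral_same, mul_zero, sub_zero, zero_mul] at hzero
  have hellK : ∫ t in (0 : ℝ)..Real.pi, ellDen (lvArg e v) t ^ (-(1 / 2) : ℝ)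
      = 2 * ellK (lvArg e v) := by
    unfold ellK ellInt; simp; ring
  rw [hellK] at hzero
  rw [levPeriod_eq he hη, lvPeriod]
  have hrs : 0 < √r := Real.sqrt_pos.2 hr0
  have hpow : lvY e v ^ (-(1 / 4) : ℝ) = (√r)⁻¹ := by
    rw [hr, Real.rpow_neg hlev.Y_pos.le, Real.sqrt_eq_rpow, Real.sqrt_eq_rpow,
      ← Real.rpow_mul hlev.Y_pos.le]
    norm_num
  rw [hpow]
  field_simp
  linarith


/-! ### The twist of the level curves -/

open Classical in
/-- The level parameter of a level curve as a function of the energy. -/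
noncomputable def lvParam (e η : ℝ) : ℝ :=
  if h : ∃ v ∈ Set.Ioo (0 : ℝ) (1 / 4), lvEnergy e v = η then h.choose else 0

theorem lvParam_spec {e η : ℝ} (he : 9 / 32 < e) (hη : 0 < η) :
    lvParam e η ∈ Set.Ioo (0 : ℝ) (1 / 4) ∧ lvEnergy e (lvParam e η) = η := by
  have h := exists_lvEnergy_eq he hη
  unfold lvParam
  rw [dif_pos h]
  exact h.choose_spec

theorem lvParam_lt_iff {e η u : ℝ} (he : 9 / 32 < e) (hη : 0 < η) (hu : u < 1 / 4) :
    lvParam e η < u ↔ η < lvEnergy e u := by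
  obtain ⟨h1, h2⟩ := lvParam_spec he hη
  conv_rhs => rw [← h2]
  exact ((strictMonoOn_lvEnergy he).lt_iff_lt h1.2 hu).symm

theorem lt_lvParam_iff {e η u : ℝ} (he : 9 / 32 < e) (hη : 0 < η) (hu : u < 1 / 4) :
    u < lvParam e η ↔ lvEnergy e u < η := by
  obtain ⟨h1, h2⟩ := lvParam_spec he hη
  conv_rhs => rw [← h2]
  exact ((strictMonoOn_lvEnergy he).lt_iff_lt hu h1.2).symm

theorem lvParam_eq_iff {e η u : ℝ} (he : 9 / 32 < e) (hη : 0 < η) (hu : u < 1 / 4) :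
    lvParam e η = u ↔ η = lvEnergy e u := by
  obtain ⟨h1, h2⟩ := lvParam_spec he hη
  conv_rhs => rw [← h2]
  exact ((strictMonoOn_lvEnergy he).injOn.eq_iff h1.2 hu).symm

theorem continuousAt_lvParam {e η : ℝ} (he : 9 / 32 < e) (hη : 0 < η) :
    ContinuousAt (lvParam e) η := by
  have h := (lvParam_spec he hη).1
  refine tendsto_order.2 ⟨fun a ha => ?_, fun b hb => ?_⟩
  · have h1 := (lt_lvParam_iff he hη (ha.trans h.2)).1 ha
    filter_upwards [lt_mem_nhds hη, lt_mem_nhds h1] with y hy hy1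
    exact (lt_lvParam_iff he hy (ha.trans h.2)).2 hy1
  · obtain ⟨c, hc1, hc2⟩ := exists_between (lt_min hb h.2)
    have hc := hc2.trans_le (min_le_right _ _)
    filter_upwards [lt_mem_nhds hη, gt_mem_nhds ((lvParam_lt_iff he hη hc).1 hc1)] with y hy hy1
    exact ((lvParam_lt_iff he hy hc).2 hy1).trans (hc2.trans_le (min_le_left _ _))

theorem tendsto_lvParam_zero {e : ℝ} (he : 9 / 32 < e) :
    Tendsto (lvParam e) (𝓝[>] 0) (𝓝 0) := by
  refine tendsto_order.2 ⟨fun a ha => ?_, fun b hb => ?_⟩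
  · filter_upwards [self_mem_nhdsWithin] with y hy
    exact ha.trans (lvParam_spec he hy).1.1
  · obtain ⟨c, hc1, hc2⟩ := exists_between (lt_min hb (by norm_num : (0 : ℝ) < 1 / 4))
    have hc := hc2.trans_le (min_le_right _ _)
    filter_upwards [Ioo_mem_nhdsGT (lvEnergy_pos he hc1 hc)] with y hy
    exact ((lvParam_lt_iff he hy.1 hc).2 hy.2).trans (hc2.trans_le (min_le_left _ _))

theorem hasDerivAt_lvParam {e η : ℝ} (he : 9 / 32 < e) (hη : 0 < η) :
    HasDerivAt (lvParam e) ((e - lvParam e η) * (e - 3 * lvParam e η + 8 * lvParam e η ^ 2)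
      / (1 - 4 * lvParam e η) ^ 2)⁻¹ η := by
  have h := lvParam_spec he hη
  refine HasDerivAt.of_local_left_inverse (continuousAt_lvParam he hη)
    (hasDerivAt_lvEnergy h.1.2) (lvEnergy_deriv_pos he h.1.2).ne' ?_
  filter_upwards [lt_mem_nhds hη] with y hy
  exact (lvParam_spec he hy).2

theorem levPeriod_eq_lvPeriod {e η : ℝ} (he : 9 / 32 < e) (hη : 0 < η) :
    levPeriod e η = lvPeriod e (lvParam e η) := by
  have h := lvParam_spec he hη
  rw [← levPeriod_lvEnergy he h.1.1 h.1.2, h.2]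

/-- The derivative of the period by the energy in terms of the level parameter. -/
noncomputable def lvPeriodSlope (e v : ℝ) : ℝ :=
  -(lvY e v ^ (-(5 / 4) : ℝ) * critFun e v)
    * ((e - v) * (e - 3 * v + 8 * v ^ 2) / (1 - 4 * v) ^ 2)⁻¹

theorem hasDerivAt_levPeriod {e η : ℝ} (he : 9 / 32 < e) (hη : 0 < η) :
    HasDerivAt (levPeriod e) (lvPeriodSlope e (lvParam e η)) η := by
  have h := lvParam_spec he hη
  have h1 := (isLevel_of_lt he h.1.1.le h.1.2).hasDerivAt_period.comp η (hasDerivAt_lvParam he hη)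
  refine h1.congr_of_eventuallyEq ?_
  filter_upwards [lt_mem_nhds hη] with y hy
  exact levPeriod_eq_lvPeriod he hy

/-- The twist `dΩ/dJ` of a level curve of the scaled normal form, where `Ω = 2π / T` and
`dJ/dη = T / 2π` with the period `T`. -/
noncomputable def levTwist (e η : ℝ) : ℝ :=
  -(2 * Real.pi) ^ 2 * deriv (levPeriod e) η / levPeriod e η ^ 3

theorem levTwist_eq_zero_iff {e η : ℝ} (he : 9 / 32 < e) (hη : 0 < η) :
    levTwist e η = 0 ↔ e < 3 / 4 ∧ η = critEnergy e := by
  have h := lvParam_spec he hη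
  have hT := levPeriod_pos he hη
  have hlev := isLevel_of_lt he h.1.1.le h.1.2
  have hY : lvY e (lvParam e η) ^ (-(5 / 4) : ℝ) ≠ 0 := (Real.rpow_pos_of_pos hlev.Y_pos _).ne'
  have hd := lvEnergy_deriv_pos he h.1.2
  have h1 : levTwist e η = 0 ↔ critFun e (lvParam e η) = 0 := by
    rw [levTwist, (hasDerivAt_levPeriod he hη).deriv, lvPeriodSlope]
    obtain ⟨d, hd'⟩ : ∃ d, d = ((e - lvParam e η) * (e - 3 * lvParam e η + 8 * lvParam e η ^ 2)
      / (1 - 4 * lvParam e η) ^ 2)⁻¹ := ⟨_, rfl⟩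
    have hd0 : d ≠ 0 := hd' ▸ (inv_pos.2 hd).ne'
    rw [← hd']
    have hpi := Real.pi_ne_zero
    constructor
    · intro h0
      simpa [hT.ne', hY, hd0, hpi] using h0
    · intro h0; rw [h0]; simp
  rw [h1, critFun_eq_zero_iff he h.1.1 h.1.2]
  refine and_congr_right fun he2 => ?_
  exact lvParam_eq_iff he hη (critV_spec ⟨he, he2⟩).1.2

/-- Through the parameter `v` the period and its slope extend continuously to the equilibrium `v =
0`, where `T = 2π/e`, although the level curve degenerates to a point. -/
theorem tendsto_levTwist_zero {e : ℝ} (he : 9 / 32 < e) :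
    Tendsto (levTwist e) (𝓝[>] 0) (𝓝 (2 - 3 / (2 * e))) := by
  have he0 : 0 < e := by linarith
  have hlev := isLevel_of_lt he le_rfl (by norm_num : (0 : ℝ) < 1 / 4)
  have hY : lvY e 0 = e ^ 4 := by unfold lvY; ring
  have hX : lvX e 0 = 2 * e ^ 2 := by unfold lvX; ring
  have hs : √(lvY e 0) = e ^ 2 := by
    rw [hY, show e ^ 4 = (e ^ 2) ^ 2 by ring, Real.sqrt_sq (by positivity)]
  have harg : lvArg e 0 = 1 := by
    rw [lvArg, hX, hs]; field_simp
  have hpow : ∀ n : ℕ, lvY e 0 ^ (-((n : ℝ) / 4)) = (e ^ n)⁻¹ := by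
    intro n
    rw [hY, Real.rpow_neg (by positivity), ← Real.rpow_natCast e 4, ← Real.rpow_mul he0.le,
      ← Real.rpow_natCast e n]
    congr 2; push_cast; ring
  have hT0 : lvPeriod e 0 = 2 * Real.pi / e := by
    have := hpow 1
    rw [lvPeriod, harg, ellK_one]
    norm_num at this ⊢
    rw [this]; field_simp; norm_num
  have hS0 : lvPeriodSlope e 0 = -(Real.pi * (4 * e - 3) / e ^ 4) := by
    have := hpow 5
    rw [lvPeriodSlope, critFun_zero he0]
    norm_num at this ⊢
    rw [this]; field_simp
  have hSc : ContinuousAt (lvPeriodSlope e) 0 := by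
    unfold lvPeriodSlope
    have h1 := hlev.hasDerivAt_critFun.continuousAt
    have h2 := (hasDerivAt_lvY (e := e) hlev.lt).continuousAt.rpow_const (p := (-(5 / 4) : ℝ))
      (Or.inl hlev.Y_pos.ne')
    refine (h2.mul h1).neg.mul (ContinuousAt.inv₀ (ContinuousAt.div (by fun_prop) (by fun_prop)
      (by norm_num)) ?_)
    exact (lvEnergy_deriv_pos he hlev.lt).ne'
  have hTc := hlev.hasDerivAt_period.continuousAt
  have hlim : Tendsto (fun η => -(2 * Real.pi) ^ 2 * lvPeriodSlope e (lvParam e η)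
      / lvPeriod e (lvParam e η) ^ 3) (𝓝[>] 0) (𝓝 (-(2 * Real.pi) ^ 2 * lvPeriodSlope e 0
      / lvPeriod e 0 ^ 3)) := by
    have hp := tendsto_lvParam_zero he
    refine Tendsto.div ((hSc.tendsto.comp hp).const_mul _) ((hTc.tendsto.comp hp).pow 3) ?_
    rw [hT0]; positivity
  have hval : -(2 * Real.pi) ^ 2 * lvPeriodSlope e 0 / lvPeriod e 0 ^ 3 = 2 - 3 / (2 * e) := by
    rw [hS0, hT0]; field_simp; norm_num
  rw [← hval]
  refine hlim.congr' ?_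
  filter_upwards [self_mem_nhdsWithin] with η hη
  rw [levTwist, (hasDerivAt_levPeriod he hη).deriv, levPeriod_eq_lvPeriod he hη]

theorem continuousAt_levPeriod {e η : ℝ} (he : 9 / 32 < e) (hη : 0 < η) :
    ContinuousAt (levPeriod e) η := (hasDerivAt_levPeriod he hη).continuousAt


/-! ### Rotation numbers -/

/-- The time in which an orbit of energy `η` reaches the angle `x`. -/
noncomputable def levTime (e η x : ℝ) : ℝ := ∫ t in (0 : ℝ)..x, levSlow e t η

section time

variable {e η : ℝ} (he : 9 / 32 < e) (hη : 0 < η)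

include he hη

theorem hasDerivAt_levTime (x : ℝ) : HasDerivAt (levTime e η) (levSlow e x η) x :=
  have h := continuous_levSlow he hη
  intervalIntegral.integral_hasDerivAt_right (h.intervalIntegrable _ _)
    (h.stronglyMeasurableAtFilter _ _) h.continuousAt

theorem continuous_levTime : Continuous (levTime e η) :=
  continuous_iff_continuousAt.2 fun x => (hasDerivAt_levTime he hη x).continuousAt

theorem strictMono_levTime : StrictMono (levTime e η) :=
  strictMono_of_deriv_pos fun x => by
    rw [(hasDerivAt_levTime he hη x).deriv]; exact levSlow_pos he

theorem levTime_add_two_pi (x : ℝ) :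
    levTime e η (x + 2 * Real.pi) = levTime e η x + levPeriod e η := by
  have hint : ∀ a b, IntervalIntegrable (fun φ => levSlow e φ η) volume a b :=
    fun a b => (continuous_levSlow he hη).intervalIntegrable a b
  have hper : Function.Periodic (fun φ => levSlow e φ η) (2 * Real.pi) := by
    have := (show Function.Periodic (fun φ => levSlow e φ η) (2 * Real.pi / 3) from
      fun φ => levSlow_add_two_pi_div_three e φ η).nat_mul 3
    have h3 : ((3 : ℕ) : ℝ) * (2 * Real.pi / 3) = 2 * Real.pi := by push_cast; ring
    rwa [h3] at this
  have h := hper.intervalIntegral_add_eq x 0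
  rw [zero_add] at h
  rw [levTime, ← intervalIntegral.integral_add_adjacent_intervals (hint 0 x) (hint x _), h]
  rfl

/-- The time gained per turn is constant, so the deviation from a linear function is periodic in the
angle. -/
theorem exists_bound_levTime : ∃ C : ℝ, ∀ x,
    |levTime e η x - levPeriod e η / (2 * Real.pi) * x| ≤ C := by
  have hper : Function.Periodic (fun x => levTime e η x - levPeriod e η / (2 * Real.pi) * x)
      (2 * Real.pi) := by
    intro x
    simp only
    rw [levTime_add_two_pi he hη]
    have := Real.pi_ne_zero
    field_simp
    ring
  have hc : Continuous fun x => levTime e η x - levPeriod e η / (2 * Real.pi) * x :=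
    (continuous_levTime he hη).sub (by fun_prop)
  obtain ⟨C, hC⟩ := isCompact_Icc.exists_bound_of_continuousOn
    (s := Set.Icc 0 (2 * Real.pi)) hc.continuousOn
  refine ⟨C, fun x => ?_⟩
  obtain ⟨y, hy, hxy⟩ := hper.exists_mem_Ico₀ Real.two_pi_pos x
  have h := hC y (Set.Ico_subset_Icc_self hy)
  rw [← hxy, Real.norm_eq_abs] at h
  exact h

theorem surjective_levTime : Function.Surjective (levTime e η) := by
  obtain ⟨C, hC⟩ := exists_bound_levTime he hη
  have hT : 0 < levPeriod e η / (2 * Real.pi) :=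
    div_pos (levPeriod_pos he hη) Real.two_pi_pos
  refine (continuous_levTime he hη).surjective ?_ ?_
  · refine tendsto_atTop_mono (f := fun x => levPeriod e η / (2 * Real.pi) * x + -C)
      (fun x => by linarith [(abs_le.1 (hC x)).1])
      (tendsto_atTop_add_const_right _ _ (tendsto_id.const_mul_atTop hT))
  · refine tendsto_atBot_mono (f := fun x => levPeriod e η / (2 * Real.pi) * x + C)
      (fun x => by linarith [(abs_le.1 (hC x)).2])
      (tendsto_atBot_add_const_right _ _ (tendsto_id.const_mul_atBot hT))

/-- The angle along an orbit has mean velocity `2π / T`. -/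
theorem tendsto_angle_div {φ : ℝ → ℝ} {c : ℝ}
    (hφ : ∀ t, HasDerivAt φ (c / levSlow e (φ t) η) t) :
    Tendsto (fun t => φ t / t) atTop (𝓝 (2 * Real.pi * c / levPeriod e η)) := by
  obtain ⟨C, hC⟩ := exists_bound_levTime he hη
  have hT := levPeriod_pos he hη
  -- `levTime` is a time coordinate along the level: it grows at the constant rate `c` on any orbit.
  have hconst : ∀ t, levTime e η (φ t) - c * t = levTime e η (φ 0) := by
    have hd : ∀ t, HasDerivAt (fun t => levTime e η (φ t) - c * t) 0 t := fun t => by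
      refine (((hasDerivAt_levTime he hη (φ t)).comp t (hφ t)).sub
        ((hasDerivAt_id t).const_mul c)).congr_deriv ?_
      have := (levSlow_pos (φ := φ t) (η := η) he).ne'
      field_simp; ring
    intro t
    have := is_const_of_deriv_eq_zero (fun t => (hd t).differentiableAt)
      (fun t => (hd t).deriv) t 0
    simpa using this
  have hlim : Tendsto (fun t : ℝ => 2 * Real.pi / levPeriod e η *
      (c + (levTime e η (φ 0) - (levTime e η (φ t)
        - levPeriod e η / (2 * Real.pi) * φ t)) * t⁻¹)) atTop
      (𝓝 (2 * Real.pi / levPeriod e η * (c + 0))) := by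
    refine (tendsto_const_nhds.add ?_).const_mul _
    refine squeeze_zero_norm (a := fun t : ℝ => (|levTime e η (φ 0)| + C) * |t⁻¹|)
      (fun t => ?_) ?_
    · rw [norm_mul, Real.norm_eq_abs, Real.norm_eq_abs]
      exact mul_le_mul_of_nonneg_right ((abs_sub _ _).trans (add_le_add_right (hC _) _))
        (abs_nonneg _)
    · have := (tendsto_inv_atTop_zero (𝕜 := ℝ)).abs.const_mul (|levTime e η (φ 0)| + C)
      simpa using this
  have hv : 2 * Real.pi / levPeriod e η * (c + 0) = 2 * Real.pi * c / levPeriod e η := by ring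
  rw [hv] at hlim
  refine hlim.congr' ?_
  filter_upwards [eventually_gt_atTop 0] with t ht
  have h1 := hconst t
  have hpi := Real.pi_ne_zero
  have h2 : levTime e η (φ t) = levTime e η (φ 0) + c * t := by linarith
  rw [h2]
  field_simp
  ring

/-- The angle as a function of time is the inverse of the time as a function of the angle, so the
solution is global and explicit. -/
theorem exists_angle (c φ₀ : ℝ) : ∃ φ : ℝ → ℝ, φ 0 = φ₀ ∧
    ∀ t, HasDerivAt φ (c / levSlow e (φ t) η) t := by
  obtain ⟨g, hg⟩ : ∃ g : ℝ ≃o ℝ, g = (strictMono_levTime he hη).orderIsoOfSurjective _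
    (surjective_levTime he hη) := ⟨_, rfl⟩
  have hgv : ∀ x, g x = levTime e η x := fun x => by rw [hg]; rfl
  have hgs : ∀ y, levTime e η (g.symm y) = y := fun y => by rw [← hgv, g.apply_symm_apply]
  refine ⟨fun t => g.symm (c * t + levTime e η φ₀), ?_, fun t => ?_⟩
  · simp [← hgv]
  · have h1 : HasDerivAt g.symm (levSlow e (g.symm (c * t + levTime e η φ₀)) η)⁻¹
        (c * t + levTime e η φ₀) :=
      HasDerivAt.of_local_left_inverse g.symm.continuous.continuousAt (hasDerivAt_levTime he hη _)
        (levSlow_pos he).ne' (Eventually.of_forall hgs)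
    have h2 := h1.comp t (((hasDerivAt_id t).const_mul c).add_const (levTime e η φ₀))
    refine h2.congr_deriv ?_
    simp; ring

end time

/-- The angular velocity of a curve with a continuous angle. -/
theorem hasDerivAt_angle {z : ℝ → ℂ} {φ : ℝ → ℝ} {t : ℝ} {z' : ℂ} (hz : HasDerivAt z z' t)
    (hφ : ContinuousAt φ t)
    (h : ∀ t, z t ≠ 0 ∧ z t = (‖z t‖ : ℂ) * Complex.exp ((φ t : ℂ) * Complex.I)) :
    HasDerivAt φ (z' / z t).im t := by
  have h0 := (h t).1
  have hq : HasDerivAt (fun s => z s / z t) (z' / z t) t := hz.div_const _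
  have hl : HasDerivAt (fun s => Complex.log (z s / z t)) (z' / z t) t := by
    have := hq.clog_real (by rw [div_self h0]; exact Complex.one_mem_slitPlane)
    rwa [div_self h0, div_one] at this
  have him : HasDerivAt (fun s => φ t + (Complex.log (z s / z t)).im) (z' / z t).im t := by
    have := (Complex.imCLM.hasFDerivAt (x := Complex.log (z t / z t))).comp_hasDerivAt t hl
    simpa using this.const_add (φ t)
  refine him.congr_of_eventuallyEq ?_
  -- Continuity of `φ` excludes jumps by multiples of `2π`, so that the principal logarithm of `z s
  -- / z t` recovers the increment of `φ`.
  have hnear : ∀ᶠ s in 𝓝 t, |φ s - φ t| < Real.pi := by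
    have h1 : Tendsto (fun s => |φ s - φ t|) (𝓝 t) (𝓝 |φ t - φ t|) :=
      (hφ.tendsto.sub_const _).abs
    rw [sub_self, abs_zero] at h1
    exact h1.eventually (gt_mem_nhds Real.pi_pos)
  filter_upwards [hnear] with s hs
  have hs' := abs_lt.1 hs
  have hr : (0 : ℝ) < ‖z s‖ / ‖z t‖ := div_pos (norm_pos_iff.2 (h s).1) (norm_pos_iff.2 h0)
  have e1 : z s / z t = ((‖z s‖ / ‖z t‖ : ℝ) : ℂ)
      * Complex.exp (((φ s - φ t : ℝ) : ℂ) * Complex.I) := by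
    conv_lhs => rw [(h s).2, (h t).2]
    have e2 : Complex.exp (((φ s - φ t : ℝ) : ℂ) * Complex.I)
        = Complex.exp ((φ s : ℂ) * Complex.I) / Complex.exp ((φ t : ℂ) * Complex.I) := by
      rw [← Complex.exp_sub]; push_cast; congr 1; ring
    rw [e2, Complex.ofReal_div]
    rw [mul_div_mul_comm]
  have hlog : (Complex.log (z s / z t)).im = φ s - φ t := by
    rw [Complex.log_im, e1, Complex.exp_mul_I, Complex.arg_mul_cos_add_sin_mul_I hr ⟨hs'.1, hs'.2.le⟩]
  rw [hlog]; ring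


/-! ### The scaled normal form -/

/-- The dilation by `B/A` removes `A` and `B`. It multiplies the energy by `B⁴/A³` and, in
`hamVF_scaledForm_mul`, the speed by `B²/A`; either factor may be negative. -/
theorem scaledForm_mul {A : ℝ} (hA : A ≠ 0) (B e : ℝ) (y : ℂ) :
    scaledForm A B e (((B / A : ℝ) : ℂ) * y) = B ^ 4 / A ^ 3 * normalForm e 1 1 y := by
  have h3 : (((B / A : ℝ) : ℂ) * y) ^ 3 = (((B / A) ^ 3 : ℝ) : ℂ) * y ^ 3 := by
    push_cast; ring
  rw [scaledForm, normalForm_eq, normalForm_eq, h3, Complex.re_ofReal_mul, map_mul,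
    Complex.normSq_ofReal]
  field_simp

theorem hamVF_scaledForm_mul {A : ℝ} (hA : A ≠ 0) (B e : ℝ) (y : ℂ) :
    hamVF (scaledForm A B e) (((B / A : ℝ) : ℂ) * y)
      = ((B / A : ℝ) : ℂ) * (((B ^ 2 / A : ℝ) : ℂ) * hamVF (normalForm e 1 1) y) := by
  have hA' : (A : ℂ) ≠ 0 := by exact_mod_cast hA
  rw [scaledForm, hamVF_normalForm, hamVF_normalForm, map_mul, map_mul, Complex.conj_ofReal,
    Complex.normSq_ofReal]
  push_cast
  field_simp

theorem differentiable_scaledForm (A B e : ℝ) : Differentiable ℝ (scaledForm A B e) := by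
  intro z
  rw [scaledForm, normalForm_eq_quarticHam]
  exact (hasFDerivAt_quarticHam _ _ _ _ z).differentiableAt

theorem fderiv_hamVF_self (H : ℂ → ℝ) (z : ℂ) : fderiv ℝ H z (hamVF H z) = 0 := by
  have h : ∀ a b : ℝ, fderiv ℝ H z ((a : ℂ) + (b : ℂ) * Complex.I)
      = a * fderiv ℝ H z 1 + b * fderiv ℝ H z Complex.I := by
    intro a b
    have : (a : ℂ) + (b : ℂ) * Complex.I = a • (1 : ℂ) + b • Complex.I := by simp
    rw [this, map_add, map_smul, map_smul]; rfl
  rw [hamVF, ← Complex.ofReal_neg, h]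
  ring

theorem energy_eq_of_hamVF {H : ℂ → ℝ} (hH : Differentiable ℝ H) {z : ℝ → ℂ}
    (hz : ∀ t, HasDerivAt z (hamVF H (z t)) t) (t : ℝ) : H (z t) = H (z 0) := by
  have hd : ∀ t, HasDerivAt (fun t => H (z t)) 0 t := fun t => by
    have := (hH (z t)).hasFDerivAt.comp_hasDerivAt t (hz t)
    rwa [fderiv_hamVF_self] at this
  exact is_const_of_deriv_eq_zero (fun t => (hd t).differentiableAt) (fun t => (hd t).deriv) t 0

theorem exp_three_mul_angle (φ : ℝ) : (starRingEnd ℂ (Complex.exp ((φ : ℂ) * Complex.I))) ^ 2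
    = ((Real.cos (3 * φ) : ℂ) - (Real.sin (3 * φ) : ℂ) * Complex.I)
      * Complex.exp ((φ : ℂ) * Complex.I) := by
  have h1 : ((Real.cos (3 * φ) : ℂ) - (Real.sin (3 * φ) : ℂ) * Complex.I)
      = Complex.exp (((-(3 * φ) : ℝ) : ℂ) * Complex.I) := by
    rw [Complex.exp_mul_I, ← Complex.ofReal_cos, ← Complex.ofReal_sin, Real.cos_neg, Real.sin_neg]
    push_cast; ring
  rw [h1, ← Complex.exp_add, ← Complex.exp_conj, ← Complex.exp_nat_mul]
  congr 1
  simp only [map_mul, Complex.conj_ofReal, Complex.conj_I]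
  push_cast; ring

/-- Division by the point itself gives the logarithmic derivative of the radius as real part and the
angular velocity as imaginary part. -/
theorem hamVF_polar (e x φ : ℝ) :
    hamVF (normalForm e 1 1) (((√2 * x : ℝ) : ℂ) * Complex.exp ((φ : ℂ) * Complex.I))
      = ((3 / 2 * x * Real.sin (3 * φ) : ℝ)
          + ((polarFreq e (Real.cos (3 * φ)) x / 2 : ℝ) : ℂ) * Complex.I)
        * (((√2 * x : ℝ) : ℂ) * Complex.exp ((φ : ℂ) * Complex.I)) := by
  have h2 : ((√2 : ℝ) : ℂ) ^ 2 = 2 := by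
    exact_mod_cast Real.sq_sqrt (show (0 : ℝ) ≤ 2 by norm_num)
  have h20 : ((√2 : ℝ) : ℂ) ≠ 0 := by
    exact_mod_cast (Real.sqrt_pos.2 two_pos).ne'
  rw [hamVF_normalForm, map_mul, map_mul, Complex.conj_ofReal, mul_pow, exp_three_mul_angle,
    Complex.normSq_eq_norm_sq (Complex.exp _), Complex.norm_exp_ofReal_mul_I,
    Complex.normSq_ofReal]
  generalize Complex.exp ((φ : ℂ) * Complex.I) = E
  unfold polarFreq
  generalize Real.cos (3 * φ) = u
  generalize Real.sin (3 * φ) = v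
  push_cast
  have hI : Complex.I ^ 2 = -1 := Complex.I_sq
  field_simp
  ring_nf
  simp only [hI, h2]
  ring

/-- If `B/A < 0` the dilation also turns the plane by `π`; the shift `κ` of the angle accounts for
this. -/
theorem exists_exp_eq_sign {r : ℝ} (hr : r ≠ 0) :
    ∃ κ : ℝ, Complex.exp ((κ : ℂ) * Complex.I) = ((|r| / r : ℝ) : ℂ) := by
  rcases lt_or_gt_of_ne hr with h | h
  · exact ⟨Real.pi, by rw [Complex.exp_pi_mul_I, abs_of_neg h, neg_div, div_self hr]; simp⟩
  · exact ⟨0, by rw [abs_of_pos h, div_self hr]; simp⟩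

/-- Points of a level in polar coordinates. -/
theorem norm_eq_lev {e η φ : ℝ} (he : 9 / 32 < e) (hη : 0 < η) {y : ℂ}
    (hy : y = (‖y‖ : ℂ) * Complex.exp ((φ : ℂ) * Complex.I)) (h : normalForm e 1 1 y = η) :
    y = ((√2 * lev e φ η : ℝ) : ℂ) * Complex.exp ((φ : ℂ) * Complex.I) := by
  have h2 : (0 : ℝ) < √2 := Real.sqrt_pos.2 two_pos
  have hn : ‖y‖ = √2 * (‖y‖ / √2) := by field_simp
  have hl : lev e φ η = ‖y‖ / √2 := by
    refine lev_unique he hη (by positivity) ?_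
    rw [← normalForm_polar, ← hn, ← hy, h]
  rw [hl, ← hn]; exact hy

/-- `HasRotationNumber` only asserts that some solution exists. Conservation of energy confines any
such solution to the level, where its angle obeys a scalar equation with a determined mean velocity.
-/
theorem hasRotationNumber_unique {A B e η Ω : ℝ} (hA : A ≠ 0) (hB : B ≠ 0) (he : 9 / 32 < e)
    (hη : 0 < η) {z₀ : ℂ} (h₀ : scaledForm A B e z₀ = scaledEnergy A B η)
    (h : HasRotationNumber (scaledForm A B e) z₀ Ω) :
    Ω = 2 * Real.pi * (B ^ 2 / A) / levPeriod e η := by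
  obtain ⟨z, φ, hz0, hz, hφ, hpol, hlim⟩ := h
  have hr : B / A ≠ 0 := div_ne_zero hB hA
  have hr' : ((B / A : ℝ) : ℂ) ≠ 0 := by exact_mod_cast hr
  obtain ⟨κ, hκ⟩ := exists_exp_eq_sign hr
  obtain ⟨y, hy⟩ : ∃ y : ℝ → ℂ, y = fun t => z t / ((B / A : ℝ) : ℂ) := ⟨_, rfl⟩
  have hzy : ∀ t, z t = ((B / A : ℝ) : ℂ) * y t := fun t => by rw [hy]; field_simp
  have hypol : ∀ t, y t = (‖y t‖ : ℂ) * Complex.exp (((φ t + κ : ℝ) : ℂ) * Complex.I) := by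
    intro t
    have h1 := (hpol t).2
    rw [hzy] at h1
    rw [norm_mul, Complex.norm_real, Real.norm_eq_abs] at h1
    have h2 : Complex.exp (((φ t + κ : ℝ) : ℂ) * Complex.I)
        = Complex.exp ((φ t : ℂ) * Complex.I) * ((|B / A| / (B / A) : ℝ) : ℂ) := by
      rw [← hκ, ← Complex.exp_add]; push_cast; congr 1; ring
    refine mul_left_cancel₀ hr' (h1.trans ?_)
    rw [h2, Complex.ofReal_div |B / A|, Complex.ofReal_mul |B / A|]
    generalize ((|B / A| : ℝ) : ℂ) = u
    generalize ((B / A : ℝ) : ℂ) = r at hr' ⊢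
    field_simp
  have hen : ∀ t, normalForm e 1 1 (y t) = η := by
    intro t
    have h1 := energy_eq_of_hamVF (differentiable_scaledForm A B e) hz t
    rw [hz0, h₀, hzy, scaledForm_mul hA, scaledEnergy] at h1
    exact mul_left_cancel₀ (div_ne_zero (pow_ne_zero 4 hB) (pow_ne_zero 3 hA)) h1
  have hφd : ∀ t, HasDerivAt (fun t => φ t + κ)
      ((B ^ 2 / A) / levSlow e (φ t + κ) η) t := by
    intro t
    refine ((hasDerivAt_angle (hz t) hφ.continuousAt hpol).add_const κ).congr_deriv ?_
    have hy0 : y t ≠ 0 := fun h => (hpol t).1 (by rw [hzy, h, mul_zero])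
    have h1 := norm_eq_lev he hη (hypol t) (hen t)
    have h2 := hamVF_polar e (lev e (φ t + κ) η) (φ t + κ)
    rw [← h1] at h2
    rw [hzy, hamVF_scaledForm_mul hA, h2, mul_div_mul_left _ _ hr', mul_div_assoc,
      mul_div_assoc, div_self hy0, mul_one, Complex.im_ofReal_mul]
    rw [levSlow, div_div_eq_mul_div, Complex.add_im, Complex.ofReal_im, Complex.im_ofReal_mul,
      Complex.I_im]
    ring
  have h1 := tendsto_angle_div he hη hφd
  have h2 : Tendsto (fun t => (φ t + κ) / t) atTop (𝓝 (Ω + 0)) := by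
    have : (fun t => (φ t + κ) / t) = fun t => φ t / t + κ / t := by ext t; rw [add_div]
    rw [this]
    exact hlim.add (tendsto_const_nhds.div_atTop tendsto_id)
  rw [add_zero] at h2
  exact tendsto_nhds_unique h2 h1

/-- The orbit is built from the angle of `exists_angle` and the radius of the level curve. -/
theorem hasRotationNumber_level {A B e η : ℝ} (hA : A ≠ 0) (hB : B ≠ 0) (he : 9 / 32 < e)
    (hη : 0 < η) {z₀ : ℂ} (h₀ : scaledForm A B e z₀ = scaledEnergy A B η) :
    HasRotationNumber (scaledForm A B e) z₀ (2 * Real.pi * (B ^ 2 / A) / levPeriod e η) := by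
  have hr : B / A ≠ 0 := div_ne_zero hB hA
  have hr' : ((B / A : ℝ) : ℂ) ≠ 0 := by exact_mod_cast hr
  have h2 : (0 : ℝ) < √2 := Real.sqrt_pos.2 two_pos
  obtain ⟨κ, hκ⟩ := exists_exp_eq_sign hr
  have hzy : z₀ = ((B / A : ℝ) : ℂ) * (z₀ / ((B / A : ℝ) : ℂ)) := by field_simp
  have hen : normalForm e 1 1 (z₀ / ((B / A : ℝ) : ℂ)) = η := by
    rw [hzy, scaledForm_mul hA, scaledEnergy] at h₀
    exact mul_left_cancel₀ (div_ne_zero (pow_ne_zero 4 hB) (pow_ne_zero 3 hA)) h₀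
  have hpol := norm_eq_lev he hη (Complex.norm_mul_exp_arg_mul_I _).symm hen
  obtain ⟨φ, hφ0, hφ⟩ := exists_angle he hη (B ^ 2 / A) (z₀ / ((B / A : ℝ) : ℂ)).arg
  have hφc : Continuous φ := continuous_iff_continuousAt.2 fun t => (hφ t).continuousAt
  refine ⟨fun t => ((B / A : ℝ) : ℂ) * (((√2 * lev e (φ t) η : ℝ) : ℂ)
    * Complex.exp ((φ t : ℂ) * Complex.I)), fun t => φ t - κ, ?_, fun t => ?_,
    hφc.sub continuous_const, fun t => ⟨?_, ?_⟩, ?_⟩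
  · simp only [hφ0]; rw [← hpol, ← hzy]
  · rw [hamVF_scaledForm_mul hA, hamVF_polar]
    have h3 := (((hasDerivAt_lev_angle he hη (φ t)).comp t (hφ t)).const_mul √2).ofReal_comp
    have h4 := ((hφ t).ofReal_comp.mul_const Complex.I).cexp
    refine ((h3.mul h4).const_mul ((B / A : ℝ) : ℂ)).congr_deriv ?_
    have hF := (polarFreq_pos (x := lev e (φ t) η) he (abs_cos_le_one' (3 * φ t))).ne'
    simp only [levSlow, Function.comp]
    generalize lev e (φ t) η = x at hF ⊢
    generalize polarFreq e (Real.cos (3 * φ t)) x = F at hF ⊢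
    generalize Real.sin (3 * φ t) = v
    generalize Complex.exp ((φ t : ℂ) * Complex.I) = E
    have hF' : (F : ℂ) ≠ 0 := by exact_mod_cast hF
    have hA' : (A : ℂ) ≠ 0 := by exact_mod_cast hA
    push_cast
    field_simp
  · have := lev_pos he hη (φ t)
    refine mul_ne_zero hr' (mul_ne_zero ?_ (Complex.exp_ne_zero _))
    exact_mod_cast (by positivity : √2 * lev e (φ t) η ≠ 0)
  · have hx := lev_pos he hη (φ t)
    have h3 : Complex.exp (((φ t - κ : ℝ) : ℂ) * Complex.I)
        = Complex.exp ((φ t : ℂ) * Complex.I) / ((|B / A| / (B / A) : ℝ) : ℂ) := by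
      rw [← hκ, ← Complex.exp_sub]; push_cast; congr 1; ring
    rw [h3, norm_mul, norm_mul, Complex.norm_exp_ofReal_mul_I, Complex.norm_real,
      Complex.norm_real, Real.norm_eq_abs, Real.norm_eq_abs, abs_of_pos (by positivity :
      0 < √2 * lev e (φ t) η), mul_one]
    have habs : ((|B / A| : ℝ) : ℂ) ≠ 0 := by exact_mod_cast (abs_pos.2 hr).ne'
    rw [Complex.ofReal_div (|B / A|), Complex.ofReal_mul (|B / A|)]
    generalize ((|B / A| : ℝ) : ℂ) = u at habs ⊢
    generalize ((B / A : ℝ) : ℂ) = r at hr' ⊢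
    field_simp
  · have h3 := tendsto_angle_div he hη hφ
    have h4 : (fun t => (φ t - κ) / t) = fun t => φ t / t - κ / t := by ext t; rw [sub_div]
    rw [h4]
    simpa using h3.sub (tendsto_const_nhds.div_atTop tendsto_id (a := κ))


/-! ### The action -/

theorem continuous_normalForm (ε A B : ℝ) : Continuous (normalForm ε A B) := by
  rw [normalForm_eq_quarticHam]
  exact continuous_iff_continuousAt.2 fun z =>
    (hasFDerivAt_quarticHam _ _ _ _ z).continuousAt

theorem normalForm_mem_Icc_iff {e η r φ : ℝ} (he : 9 / 32 < e) (hη : 0 < η) (hr : 0 < r) :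
    normalForm e 1 1 ((r : ℂ) * Complex.exp ((φ : ℂ) * Complex.I)) ∈ Set.Icc 0 η
      ↔ r ≤ √2 * lev e φ η := by
  have h2 : (0 : ℝ) < √2 := Real.sqrt_pos.2 two_pos
  have hn : r = √2 * (r / √2) := by field_simp
  have hx : 0 < r / √2 := by positivity
  have hpos : 0 ≤ polarForm e (Real.cos (3 * φ)) (r / √2) := by
    have := (strictMonoOn_polarForm he (abs_cos_le_one' (3 * φ))).monotoneOn
      (Set.mem_Ici.2 le_rfl) (Set.mem_Ici.2 hx.le) hx.le
    simpa [polarForm] using this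
  rw [hn, normalForm_polar, Set.mem_Icc, ← lev_le_iff he hη hx.le]
  simp only [hpos, true_and]
  exact (mul_le_mul_iff_right₀ h2).symm

theorem lintegral_Ioc_ofReal {R : ℝ} (hR : 0 ≤ R) :
    ∫⁻ r in Set.Ioc 0 R, ENNReal.ofReal r = ENNReal.ofReal (R ^ 2 / 2) := by
  have h1 : ∫ r in Set.Ioc 0 R, r = R ^ 2 / 2 := by
    rw [← intervalIntegral.integral_of_le hR, integral_id]; ring
  rw [← h1, ofReal_integral_eq_lintegral_ofReal]
  · exact (continuous_id.integrableOn_Icc (a := 0) (b := R)).mono_set Set.Ioc_subset_Icc_self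
  · refine (ae_restrict_iff' measurableSet_Ioc).2 (Eventually.of_forall fun r hr => hr.1.le)

theorem volume_sublevel {e η : ℝ} (he : 9 / 32 < e) (hη : 0 < η) :
    volume {y : ℂ | normalForm e 1 1 y ∈ Set.Icc 0 η}
      = ENNReal.ofReal (∫ φ in (0 : ℝ)..(2 * Real.pi), lev e φ η ^ 2) := by
  have hS : MeasurableSet {y : ℂ | normalForm e 1 1 y ∈ Set.Icc 0 η} :=
    (isClosed_Icc.preimage (continuous_normalForm e 1 1)).measurableSet
  obtain ⟨S, hSd⟩ : ∃ S, S = {y : ℂ | normalForm e 1 1 y ∈ Set.Icc 0 η} := ⟨_, rfl⟩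
  rw [← hSd] at hS ⊢
  have hper : Function.Periodic (fun φ => lev e φ η ^ 2) (2 * Real.pi) := by
    have := (show Function.Periodic (fun φ => lev e φ η ^ 2) (2 * Real.pi / 3) from
      fun φ => by simp only [lev_add_two_pi_div_three]).nat_mul 3
    have h3 : ((3 : ℕ) : ℝ) * (2 * Real.pi / 3) = 2 * Real.pi := by push_cast; ring
    rwa [h3] at this
  -- The polar coordinates used below run over `(-π, π)`, the period integral over `(0, 2π)`.
  have hshift := hper.intervalIntegral_add_eq 0 (-Real.pi)
  rw [zero_add, show -Real.pi + 2 * Real.pi = Real.pi by ring] at hshift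
  have hc : Continuous fun φ => lev e φ η ^ 2 := (continuous_lev he hη).pow 2
  -- The radius is `√2 · lev`, so the area element `r²/2 dφ` is `lev² dφ = I dφ`.
  have h2 := Real.sq_sqrt (show (0 : ℝ) ≤ 2 by norm_num)
  have hin : ∀ φ : ℝ, ∫⁻ r in Set.Ioi (0 : ℝ), ENNReal.ofReal r
      • S.indicator (1 : ℂ → ENNReal) (Complex.polarCoord.symm (r, φ))
      = ENNReal.ofReal (lev e φ η ^ 2) := by
    intro φ
    have hR : 0 ≤ √2 * lev e φ η := by have := lev_pos he hη φ; positivity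
    have h3 := lintegral_Ioc_ofReal hR
    rw [mul_pow, h2, mul_div_cancel_left₀ _ (two_ne_zero)] at h3
    rw [← h3, ← lintegral_indicator measurableSet_Ioi, ← lintegral_indicator measurableSet_Ioc]
    refine lintegral_congr fun r => ?_
    by_cases hr : 0 < r
    · have hm := normalForm_mem_Icc_iff (φ := φ) he hη hr
      have hpc : Complex.polarCoord.symm (r, φ) = (r : ℂ) * Complex.exp ((φ : ℂ) * Complex.I) := by
        rw [Complex.polarCoord_symm_apply, Complex.exp_mul_I]
        push_cast; rfl
      have hmS : Complex.polarCoord.symm (r, φ) ∈ S ↔ r ≤ √2 * lev e φ η := by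
        rw [hpc, hSd]; exact hm
      rw [Set.indicator_of_mem (Set.mem_Ioi.2 hr)]
      by_cases hl : r ≤ √2 * lev e φ η
      · rw [Set.indicator_of_mem (hmS.2 hl), Set.indicator_of_mem (Set.mem_Ioc.2 ⟨hr, hl⟩)]
        simp
      · rw [Set.indicator_of_notMem (mt hmS.1 hl), Set.indicator_of_notMem fun h => hl h.2]
        simp
    · simp [Set.indicator, hr]
  calc volume S = ∫⁻ y, S.indicator (1 : ℂ → ENNReal) y := (lintegral_indicator_one hS).symm
    _ = ∫⁻ p in polarCoord.target, ENNReal.ofReal p.1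
          • S.indicator (1 : ℂ → ENNReal) (Complex.polarCoord.symm p) :=
        (Complex.lintegral_comp_polarCoord_symm _).symm
    _ = ∫⁻ φ in Set.Ioo (-Real.pi) Real.pi, ∫⁻ r in Set.Ioi (0 : ℝ), ENNReal.ofReal r
          • S.indicator (1 : ℂ → ENNReal) (Complex.polarCoord.symm (r, φ)) := by
        rw [polarCoord_target, Measure.volume_eq_prod, ← Measure.prod_restrict]
        refine lintegral_prod_symm _ (Measurable.aemeasurable ?_)
        refine Measurable.smul (measurable_fst.ennreal_ofReal) ?_
        exact (measurable_one.indicator hS).comp (by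
          have : (Complex.polarCoord.symm : ℝ × ℝ → ℂ)
              = fun p : ℝ × ℝ => (p.1 : ℂ) * (Real.cos p.2 + Real.sin p.2 * Complex.I) := by
            ext1 p; exact Complex.polarCoord_symm_apply p
          rw [this]; fun_prop)
    _ = ∫⁻ φ in Set.Ioo (-Real.pi) Real.pi, ENNReal.ofReal (lev e φ η ^ 2) := by
        simp only [hin]
    _ = ENNReal.ofReal (∫ φ in (0 : ℝ)..(2 * Real.pi), lev e φ η ^ 2) := by
        rw [hshift, intervalIntegral.integral_of_le (by linarith [Real.pi_pos]),
          integral_Ioc_eq_integral_Ioo, ofReal_integral_eq_lintegral_ofReal]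
        · exact (hc.integrableOn_Icc (a := -Real.pi) (b := Real.pi)).mono_set
            Set.Ioo_subset_Icc_self
        · exact Eventually.of_forall fun φ => sq_nonneg _

theorem action_scaledForm {A B e η : ℝ} (hA : A ≠ 0) (hB : B ≠ 0) (he : 9 / 32 < e) (hη : 0 < η) :
    action (scaledForm A B e) (scaledEnergy A B η)
      = (B / A) ^ 2 / (2 * Real.pi) * ∫ φ in (0 : ℝ)..(2 * Real.pi), lev e φ η ^ 2 := by
  have hr : B / A ≠ 0 := div_ne_zero hB hA
  have hσ : B ^ 4 / A ^ 3 ≠ 0 := div_ne_zero (pow_ne_zero 4 hB) (pow_ne_zero 3 hA)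
  have hset : {z : ℂ | scaledForm A B e z ∈ Set.uIcc 0 (scaledEnergy A B η)}
      = ((B / A)⁻¹ • ·) ⁻¹' {y : ℂ | normalForm e 1 1 y ∈ Set.Icc 0 η} := by
    ext z
    rw [Set.mem_preimage, Set.mem_ofPred_eq, Set.mem_ofPred_eq]
    have hz : z = ((B / A : ℝ) : ℂ) * ((B / A)⁻¹ • z) := by
      rw [← Complex.real_smul, smul_inv_smul₀ hr]
    conv_lhs => rw [hz, scaledForm_mul hA, scaledEnergy]
    generalize normalForm e 1 1 ((B / A)⁻¹ • z) = k
    generalize B ^ 4 / A ^ 3 = σ at hσ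
    -- For `A < 0` the energies are negative and the interval between `0` and the level is reversed.
    rcases lt_or_gt_of_ne hσ with h | h
    · rw [Set.uIcc_of_ge (by nlinarith), Set.mem_Icc, Set.mem_Icc, and_comm]
      refine and_congr ?_ ?_
      · exact ⟨fun h1 => by_contra fun h2 => by nlinarith [not_le.1 h2], fun h1 => by nlinarith⟩
      · exact mul_le_mul_left_of_neg h
    · rw [Set.uIcc_of_le (by positivity), Set.mem_Icc, Set.mem_Icc, mul_nonneg_iff_of_pos_left h,
        mul_le_mul_iff_right₀ h]
  rw [action, hset, Measure.addHaar_preimage_smul _ (inv_ne_zero hr), Complex.finrank_real_complex, volume_sublevel he hη,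
    ENNReal.toReal_mul, ENNReal.toReal_ofReal (abs_nonneg _), abs_of_nonneg (by positivity),
    inv_pow, inv_inv,
    ENNReal.toReal_ofReal]
  · ring
  · exact intervalIntegral.integral_nonneg (by positivity) fun _ _ => sq_nonneg _


/-! ### The twist of the invariant circles -/

theorem exists_scaledForm_eq {A B e η : ℝ} (hA : A ≠ 0) (he : 9 / 32 < e) (hη : 0 < η) :
    ∃ z, scaledForm A B e z = scaledEnergy A B η := by
  refine ⟨((B / A : ℝ) : ℂ) * (((√2 * lev e 0 η : ℝ) : ℂ)
    * Complex.exp (((0 : ℝ) : ℂ) * Complex.I)), ?_⟩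
  rw [scaledForm_mul hA, normalForm_polar, polarForm_lev he hη, scaledEnergy]

theorem hasDerivAt_action {A B e η : ℝ} (hA : A ≠ 0) (hB : B ≠ 0) (he : 9 / 32 < e)
    (hη : 0 < η) :
    HasDerivAt (fun η => action (scaledForm A B e) (scaledEnergy A B η))
      ((B / A) ^ 2 / (2 * Real.pi) * levPeriod e η) η := by
  refine ((hasDerivAt_integral_lev_sq he hη).const_mul
    ((B / A) ^ 2 / (2 * Real.pi))).congr_of_eventuallyEq ?_
  filter_upwards [lt_mem_nhds hη] with y hy
  exact action_scaledForm hA hB he hy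

theorem hasDerivAt_rotation {e η : ℝ} (c : ℝ) (he : 9 / 32 < e) (hη : 0 < η) :
    HasDerivAt (fun η => 2 * Real.pi * c / levPeriod e η)
      (-(2 * Real.pi * c * deriv (levPeriod e) η) / levPeriod e η ^ 2) η := by
  have hT := levPeriod_pos he hη
  have h1 := (hasDerivAt_levPeriod he hη).differentiableAt.hasDerivAt
  exact ((hasDerivAt_const η (2 * Real.pi * c)).div h1 hT.ne').congr_deriv (by ring)

/-- The twist of the invariant circles. -/
theorem hasTorusTwist_iff {A B e η t : ℝ} (hA : A ≠ 0) (hB : B ≠ 0) (he : 9 / 32 < e)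
    (hη : 0 < η) :
    HasTorusTwist (scaledForm A B e) (scaledEnergy A B η) t ↔ t = A * levTwist e η := by
  have hT := levPeriod_pos he hη
  have hσ : B ^ 4 / A ^ 3 ≠ 0 := div_ne_zero (pow_ne_zero 4 hB) (pow_ne_zero 3 hA)
  obtain ⟨N, hN⟩ : ∃ N : ℝ → ℝ,
    N = fun η => action (scaledForm A B e) (scaledEnergy A B η) := ⟨_, rfl⟩
  have hNd : ∀ᶠ y in 𝓝 η, HasDerivAt N ((B / A) ^ 2 / (2 * Real.pi) * levPeriod e y) y := by
    filter_upwards [lt_mem_nhds hη] with y hy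
    rw [hN]; exact hasDerivAt_action hA hB he hy
  have hN0 : (B / A) ^ 2 / (2 * Real.pi) * levPeriod e η ≠ 0 := by
    have := Real.pi_ne_zero
    have := div_ne_zero hB hA
    positivity
  have hrot := hasDerivAt_rotation (B ^ 2 / A) he hη
  have hval : -(2 * Real.pi * (B ^ 2 / A) * deriv (levPeriod e) η) / levPeriod e η ^ 2
      = A * levTwist e η * ((B / A) ^ 2 / (2 * Real.pi) * levPeriod e η) := by
    have := Real.pi_ne_zero
    rw [levTwist]
    generalize deriv (levPeriod e) η = d
    have := hT.ne'
    field_simp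
  constructor
  · rintro ⟨Ω, h1, h2⟩
    -- Near the action of the circle, `Ω` composed with the action is forced to be `2π(B²/A)/T`, so
    -- the chain rule determines its derivative.
    have h3 : HasDerivAt (fun y => Ω (N y))
        (t * ((B / A) ^ 2 / (2 * Real.pi) * levPeriod e η)) η := by
      refine HasDerivAt.comp η ?_ hNd.self_of_nhds
      rw [hN]; exact h2
    have hcont : Tendsto (fun y => scaledEnergy A B y) (𝓝 η) (𝓝 (scaledEnergy A B η)) := by
      unfold scaledEnergy
      exact (continuous_const.mul continuous_id).tendsto η
    have h4 : (fun y => 2 * Real.pi * (B ^ 2 / A) / levPeriod e y) =ᶠ[𝓝 η] fun y => Ω (N y) := by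
      filter_upwards [lt_mem_nhds hη, hcont.eventually h1] with y hy hy1
      obtain ⟨z, hz⟩ := exists_scaledForm_eq (B := B) hA he hy
      rw [hN]
      exact (hasRotationNumber_unique hA hB he hy hz (hy1 z hz)).symm
    have h5 := h3.unique (hrot.congr_of_eventuallyEq h4.symm)
    rw [hval] at h5
    exact mul_right_cancel₀ hN0 h5
  · rintro rfl
    -- The action has a nonzero strict derivative in the energy, so it has a local inverse `G`, and
    -- `Ω` can be defined as a function of the action.
    have hstrict : HasStrictDerivAt N ((B / A) ^ 2 / (2 * Real.pi) * levPeriod e η) η :=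
      hasStrictDerivAt_of_hasDerivAt_of_continuousAt hNd
        (continuousAt_const.mul (continuousAt_levPeriod he hη))
    have hG := hstrict.to_localInverse hN0
    have hinv := hstrict.eventually_left_inverse hN0
    obtain ⟨G, hGd⟩ : ∃ G, G = hstrict.localInverse N _ η hN0 := ⟨_, rfl⟩
    rw [← hGd] at hG hinv
    refine ⟨fun J => 2 * Real.pi * (B ^ 2 / A) / levPeriod e (G J), ?_, ?_⟩
    · have hdiv : Tendsto (fun k => k / (B ^ 4 / A ^ 3)) (𝓝 (scaledEnergy A B η)) (𝓝 η) := by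
        have h := (continuous_id.div_const (B ^ 4 / A ^ 3)).tendsto (scaledEnergy A B η)
        have h2 : scaledEnergy A B η / (B ^ 4 / A ^ 3) = η := by
          rw [scaledEnergy, mul_div_cancel_left₀ _ hσ]
        simp only [id] at h
        rwa [h2] at h
      filter_upwards [hdiv.eventually hinv, hdiv.eventually (lt_mem_nhds hη)] with k hk hk0 z hz
      have hk2 : scaledEnergy A B (k / (B ^ 4 / A ^ 3)) = k := by
        rw [scaledEnergy, mul_div_cancel₀ _ hσ]
      rw [hN] at hk
      simp only [hk2] at hk
      rw [hk]
      exact hasRotationNumber_level hA hB he hk0 (hz.trans hk2.symm)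
    · have hGη : G (N η) = η := hinv.self_of_nhds
      have h6 : HasDerivAt (fun y => 2 * Real.pi * (B ^ 2 / A) / levPeriod e y)
          (A * levTwist e η * ((B / A) ^ 2 / (2 * Real.pi) * levPeriod e η)) (G (N η)) := by
        rw [hGη, ← hval]; exact hrot
      have h7 := h6.comp (N η) hG.hasDerivAt
      rw [mul_inv_cancel_right₀ hN0] at h7
      rw [hN] at h7
      exact h7


/-! ### Equilibria -/

theorem exp_two_pi_div_three_pow (k : ℤ) :
    Complex.exp (((2 * Real.pi * k / 3 : ℝ) : ℂ) * Complex.I) ^ 3 = 1 := by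
  rw [← Complex.exp_nat_mul, Complex.exp_eq_one_iff]
  exact ⟨k, by push_cast; ring⟩

theorem exists_eq_exp_of_cube_eq_one {w : ℂ} (hw : w ^ 3 = 1) :
    ∃ k : ℤ, w = Complex.exp (((2 * Real.pi * k / 3 : ℝ) : ℂ) * Complex.I) := by
  have hn : ‖w‖ = 1 := by
    have h : ‖w‖ ^ 3 = 1 := by rw [← norm_pow, hw, norm_one]
    exact (pow_eq_one_iff_of_nonneg (norm_nonneg w) (by norm_num)).1 h
  have hwe : w = Complex.exp ((w.arg : ℂ) * Complex.I) := by
    have := Complex.norm_mul_exp_arg_mul_I w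
    rw [hn] at this; simpa using this.symm
  have h3 : Complex.exp ((3 : ℕ) * ((w.arg : ℂ) * Complex.I)) = 1 := by
    rw [Complex.exp_nat_mul, ← hwe, hw]
  obtain ⟨k, hk⟩ := Complex.exp_eq_one_iff.1 h3
  refine ⟨k, ?_⟩
  have h4 : (w.arg : ℂ) * Complex.I = ((2 * Real.pi * k / 3 : ℝ) : ℂ) * Complex.I := by
    push_cast at hk ⊢
    linear_combination hk / 3
  rw [← h4]; exact hwe

/-- The equilibria of the normal form lie on the symmetry axes. -/
theorem mem_equilibria_iff {ε A B : ℝ} (hB : B ≠ 0) {z : ℂ} :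
    z ∈ equilibria (normalForm ε A B) ↔
      ∃ x : ℝ, x ≠ 0 ∧ A * x ^ 2 + 3 * (B / (2 * √2)) * x + ε = 0 ∧ z ∈ tripleOrbit x := by
  have hb : B / (2 * √2) ≠ 0 := div_ne_zero hB two_mul_sqrt_two_pos.ne'
  generalize hbd : B / (2 * √2) = b at hb
  constructor
  · rintro ⟨hz, hv⟩
    rw [hamVF_normalForm, hbd, mul_eq_zero] at hv
    have hv' := hv.resolve_left Complex.I_ne_zero
    obtain ⟨r, hr⟩ : ∃ r, r = ‖z‖ := ⟨_, rfl⟩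
    have hr0 : 0 < r := hr ▸ norm_pos_iff.2 hz
    have hsq : Complex.normSq z = r ^ 2 := by rw [hr, Complex.sq_norm]
    have hzz : z * starRingEnd ℂ z = ((r ^ 2 : ℝ) : ℂ) := by rw [Complex.mul_conj, hsq]
    rw [hsq] at hv'
    -- Multiplying the equilibrium equation by `z²` leaves only real coefficients, so `z³` is real
    -- and `z` lies on a symmetry axis.
    have h3 : ((ε + A * r ^ 2 : ℝ) : ℂ) * z ^ 3 = ((-(3 * b * r ^ 4) : ℝ) : ℂ) := by
      push_cast at hzz hv' ⊢
      linear_combination z ^ 2 * hv' - 3 * (b : ℂ) * (z * starRingEnd ℂ z + (r : ℂ) ^ 2) * hzz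
    have hne : ε + A * r ^ 2 ≠ 0 := by
      intro h0
      rw [h0, Complex.ofReal_zero, zero_mul] at h3
      have : -(3 * b * r ^ 4) = 0 := by exact_mod_cast h3.symm
      have h5 : (3 * b * r ^ 4) ≠ 0 := by positivity
      exact h5 (neg_eq_zero.1 this)
    obtain ⟨q, hq⟩ : ∃ q : ℝ, q = -(3 * b * r ^ 4) / (ε + A * r ^ 2) := ⟨_, rfl⟩
    have hzq : z ^ 3 = (q : ℂ) := by
      have hne' : ((ε + A * r ^ 2 : ℝ) : ℂ) ≠ 0 := by exact_mod_cast hne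
      rw [hq, Complex.ofReal_div, eq_div_iff hne', mul_comm]; exact h3
    have hqr : |q| = r ^ 3 := by
      rw [← Real.norm_eq_abs, ← Complex.norm_real, ← hzq, norm_pow, hr]
    -- `x` is the real cube root of `z³`; its sign tells which half of the axis contains `z`.
    obtain ⟨x, hx2, hx3⟩ : ∃ x : ℝ, x ^ 2 = r ^ 2 ∧ x ^ 3 = q := by
      rcases abs_choice q with h | h
      · exact ⟨r, rfl, by rw [← hqr, h]⟩
      · exact ⟨-r, by ring, by linear_combination -h + hqr⟩
    have hx0 : x ≠ 0 := by
      rintro rfl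
      have : r ^ 2 = 0 := by rw [← hx2]; norm_num
      exact (pow_pos hr0 2).ne' this
    refine ⟨x, hx0, ?_, ?_⟩
    · have h4 : (ε + A * r ^ 2) * q = -(3 * b * r ^ 4) := by rw [hq]; field_simp
      have h5 : r ^ 4 = x ^ 4 := by
        rw [show r ^ 4 = (r ^ 2) ^ 2 by ring, ← hx2]; ring
      rw [h5, ← hx3, ← hx2] at h4
      have h6 : x ^ 3 * (A * x ^ 2 + 3 * b * x + ε) = 0 := by linear_combination h4
      exact (mul_eq_zero.1 h6).resolve_left (pow_ne_zero 3 hx0)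
    · have hx0' : (x : ℂ) ≠ 0 := by exact_mod_cast hx0
      have hw : (z / x) ^ 3 = 1 := by
        rw [div_pow, hzq, ← hx3]; push_cast; exact div_self (pow_ne_zero 3 hx0')
      obtain ⟨k, hk⟩ := exists_eq_exp_of_cube_eq_one hw
      exact ⟨k, by rw [← hk]; field_simp⟩
  · rintro ⟨x, hx0, hx, k, rfl⟩
    have hw := exp_two_pi_div_three_pow k
    have hn := Complex.norm_exp_ofReal_mul_I (2 * Real.pi * k / 3)
    have hw0 := Complex.exp_ne_zero (((2 * Real.pi * k / 3 : ℝ) : ℂ) * Complex.I)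
    generalize Complex.exp (((2 * Real.pi * k / 3 : ℝ) : ℂ) * Complex.I) = w at hw hn hw0
    refine ⟨mul_ne_zero hw0 (by exact_mod_cast hx0), ?_⟩
    have hww : w * starRingEnd ℂ w = 1 := by
      rw [Complex.mul_conj, Complex.normSq_eq_norm_sq, hn]; simp
    have hc2 : (starRingEnd ℂ w) ^ 2 = w := by
      linear_combination (starRingEnd ℂ w ^ 2) * (-hw) + w * (w * starRingEnd ℂ w + 1) * hww
    rw [hamVF_normalForm, hbd, map_mul, map_mul, Complex.conj_ofReal, mul_pow, hc2,
      Complex.normSq_ofReal, Complex.normSq_eq_norm_sq, hn]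
    have hx' : (A : ℂ) * x ^ 2 + 3 * b * x + ε = 0 := by exact_mod_cast hx
    push_cast
    linear_combination Complex.I * w * x * hx'

/-- The linearization has the form `v ↦ αv + βv̄` with determinant `|α|² - |β|²`, and the
equilibrium equation eliminates `ε`. -/
theorem linDet_normalForm {ε A B x : ℝ}
    (hx : A * x ^ 2 + 3 * (B / (2 * √2)) * x + ε = 0) :
    linDet (normalForm ε A B) x
      = -(9 * (B / (2 * √2)) * x ^ 2 * (2 * A * x + 3 * (B / (2 * √2)))) := by
  have hfun : hamVF (normalForm ε A B) = fun z => Complex.I * (ε * z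
      + A * (Complex.normSq z : ℂ) * z + 3 * (B / (2 * √2) : ℝ) * (starRingEnd ℂ z) ^ 2) := by
    ext z; exact hamVF_normalForm ε A B z
  generalize B / (2 * √2) = b at *
  have hconj : ∀ z : ℂ, HasFDerivAt (fun z => starRingEnd ℂ z) (Complex.conjCLE : ℂ →L[ℝ] ℂ) z :=
    fun z => Complex.conjCLE.hasFDerivAt
  have hfun2 : hamVF (normalForm ε A B) = fun z => Complex.I * (ε * z
      + A * (z * starRingEnd ℂ z) * z + 3 * b * (starRingEnd ℂ z * starRingEnd ℂ z)) := by
    rw [hfun]; ext z; rw [Complex.mul_conj, pow_two]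
  have hid : HasFDerivAt (fun z : ℂ => z) (ContinuousLinearMap.id ℝ ℂ) (x : ℂ) := hasFDerivAt_id _
  have hd := (((hid.const_mul (ε : ℂ)).add
    (((hid.mul (hconj x)).const_mul (A : ℂ)).mul hid)).add
    (((hconj x).mul (hconj x)).const_mul (3 * (b : ℂ)))).const_mul Complex.I
  have hd2 : HasFDerivAt (fun z : ℂ => Complex.I * (ε * z
      + A * (z * starRingEnd ℂ z) * z + 3 * b * (starRingEnd ℂ z * starRingEnd ℂ z))) _ (x : ℂ) := hd
  rw [linDet, hfun2, hd2.fderiv, det_mul_add_mul_conj _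
    (((ε + 2 * A * x ^ 2 : ℝ) : ℂ) * Complex.I) (((A * x ^ 2 + 6 * b * x : ℝ) : ℂ) * Complex.I)]
  · rw [Complex.normSq_mul, Complex.normSq_mul, Complex.normSq_ofReal, Complex.normSq_ofReal,
      Complex.normSq_I]
    have : ε = -(A * x ^ 2 + 3 * b * x) := by linarith
    rw [this]; ring
  · intro z
    simp
    ring

theorem scaledForm_root_iff {A B e x : ℝ} (hA : A ≠ 0) :
    A * x ^ 2 + 3 * (B / (2 * √2)) * x + B ^ 2 / A * e = 0
      ↔ (2 * A * x + 3 * (B / (2 * √2))) ^ 2 = B ^ 2 * (9 / 8 - 4 * e) := by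
  have h2 := Real.sq_sqrt (show (0 : ℝ) ≤ 2 by norm_num)
  have hb2 : (B / (2 * √2)) ^ 2 = B ^ 2 / 8 := by
    rw [div_pow, mul_pow, h2]; norm_num
  generalize B / (2 * √2) = b at *
  have h : (2 * A * x + 3 * b) ^ 2 - B ^ 2 * (9 / 8 - 4 * e)
      = 4 * A * (A * x ^ 2 + 3 * b * x + B ^ 2 / A * e) := by
    field_simp
    linear_combination 72 * hb2
  rw [← sub_eq_zero (a := _ ^ 2), h]
  simp [hA]

theorem equilibria_scaledForm_of_lt {A B e : ℝ} (hA : A ≠ 0) (hB : B ≠ 0) (he : 9 / 32 < e) :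
    equilibria (scaledForm A B e) = ∅ := by
  refine Set.eq_empty_iff_forall_notMem.2 fun z hz => ?_
  obtain ⟨x, -, hx, -⟩ := (mem_equilibria_iff hB).1 hz
  have h := (scaledForm_root_iff hA).1 hx
  have hB2 : 0 < B ^ 2 := by positivity
  nlinarith [sq_nonneg (2 * A * x + 3 * (B / (2 * √2)))]

/-- The saddle on the real axis for `σ = 1`, and the center for `σ = -1`. -/
noncomputable def axisRoot (A B σ e : ℝ) : ℝ :=
  (-(3 * (B / (2 * √2))) + σ * B * √(9 / 8 - 4 * e)) / (2 * A)

theorem axisRoot_spec {A : ℝ} (hA : A ≠ 0) (B σ e : ℝ) :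
    2 * A * axisRoot A B σ e + 3 * (B / (2 * √2)) = σ * B * √(9 / 8 - 4 * e) := by
  unfold axisRoot; field_simp; ring

theorem axisRoot_root {A B σ e : ℝ} (hA : A ≠ 0) (hσ : σ ^ 2 = 1) (he : e ≤ 9 / 32) :
    A * axisRoot A B σ e ^ 2 + 3 * (B / (2 * √2)) * axisRoot A B σ e + B ^ 2 / A * e = 0 := by
  rw [scaledForm_root_iff hA, axisRoot_spec hA, mul_pow, mul_pow, hσ,
    Real.sq_sqrt (by linarith), one_mul]

theorem axisRoot_ne_zero {A B σ e : ℝ} (hA : A ≠ 0) (hB : B ≠ 0) (hσ : σ ^ 2 = 1) (h0 : 0 < e)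
    (he : e ≤ 9 / 32) : axisRoot A B σ e ≠ 0 := by
  intro h
  have h1 := axisRoot_root (B := B) hA hσ he
  rw [h] at h1
  have : B ^ 2 / A * e ≠ 0 := by positivity
  exact this (by simpa using h1)

theorem equilibria_scaledForm {A B e : ℝ} (hA : A ≠ 0) (hB : B ≠ 0) (h0 : 0 < e)
    (he : e ≤ 9 / 32) : equilibria (scaledForm A B e)
      = tripleOrbit (axisRoot A B 1 e) ∪ tripleOrbit (axisRoot A B (-1) e) := by
  ext z
  rw [scaledForm, mem_equilibria_iff hB, Set.mem_union]
  constructor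
  · rintro ⟨x, -, hx, hz⟩
    have h := (scaledForm_root_iff hA).1 hx
    have hs := Real.sq_sqrt (show 0 ≤ 9 / 8 - 4 * e by linarith)
    have h2 : (2 * A * x + 3 * (B / (2 * √2))) ^ 2 = (B * √(9 / 8 - 4 * e)) ^ 2 := by
      rw [h, mul_pow, hs]
    rcases sq_eq_sq_iff_eq_or_eq_neg.1 h2 with h3 | h3
    · left
      have : x = axisRoot A B 1 e := by
        unfold axisRoot; rw [eq_div_iff (by positivity)]; linarith
      rwa [← this]
    · right
      have : x = axisRoot A B (-1) e := by
        unfold axisRoot; rw [eq_div_iff (by positivity)]; linarith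
      rwa [← this]
  · rintro (h | h)
    · exact ⟨_, axisRoot_ne_zero hA hB (by norm_num) h0 he, axisRoot_root hA (by norm_num) he, h⟩
    · exact ⟨_, axisRoot_ne_zero hA hB (by norm_num) h0 he, axisRoot_root hA (by norm_num) he, h⟩

/-- The square root of the discriminant appears linearly, so the branches `σ = ±1` are a saddle and
a center that degenerate together. -/
theorem linDet_axisRoot {A B σ e : ℝ} (hA : A ≠ 0) (hσ : σ ^ 2 = 1) (he : e ≤ 9 / 32) :
    linDet (scaledForm A B e) (axisRoot A B σ e)
      = -(9 * B ^ 2 / (2 * √2) * axisRoot A B σ e ^ 2 * √(9 / 8 - 4 * e)) * σ := by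
  rw [scaledForm, linDet_normalForm (axisRoot_root hA hσ he), axisRoot_spec hA]
  ring

theorem axisRoot_saddleCenter {A : ℝ} (B σ : ℝ) :
    axisRoot A B σ (9 / 32) = B / A * (-(√2 * (3 / 8))) := by
  have h2 := Real.sq_sqrt (show (0 : ℝ) ≤ 2 by norm_num)
  have h20 : (0 : ℝ) < √2 := Real.sqrt_pos.2 two_pos
  have h : (9 / 8 - 4 * (9 / 32) : ℝ) = 0 := by norm_num
  rw [axisRoot, h, Real.sqrt_zero, mul_zero, add_zero]
  have : 3 * (B / (2 * √2)) = B * (3 / 4 * √2) := by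
    field_simp; rw [h2]; ring
  rw [this]; ring

theorem tendsto_axisRoot (A B σ : ℝ) :
    Tendsto (fun e => (axisRoot A B σ e : ℂ)) (𝓝[<] (9 / 32))
      (𝓝 (axisRoot A B σ (9 / 32) : ℂ)) := by
  have h : Continuous fun e => (axisRoot A B σ e : ℂ) := by unfold axisRoot; fun_prop
  exact (h.tendsto _).mono_left nhdsWithin_le_nhds

theorem scaledForm_saddleCenter {A : ℝ} (hA : A ≠ 0) (B σ : ℝ) :
    scaledForm A B (9 / 32) (axisRoot A B σ (9 / 32)) = scaledEnergy A B (27 / 4096) := by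
  have h := normalForm_polar (9 / 32) (-(3 / 8)) 0
  simp only [Complex.ofReal_zero, zero_mul, Complex.exp_zero, mul_one, mul_zero, Real.cos_zero]
    at h
  rw [axisRoot_saddleCenter, Complex.ofReal_mul, scaledForm_mul hA,
    show -(√2 * (3 / 8)) = √2 * -(3 / 8) by ring, h, scaledEnergy, polarForm]
  norm_num


/-! ### The twistless curve -/

theorem scaledEnergy_ne {A B : ℝ} (hA : A ≠ 0) (hB : B ≠ 0) : B ^ 4 / A ^ 3 ≠ 0 :=
  div_ne_zero (pow_ne_zero 4 hB) (pow_ne_zero 3 hA)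

/-- Every level set meets each ray exactly once. -/
theorem existsUnique_radius {A B e η : ℝ} (hA : A ≠ 0) (hB : B ≠ 0) (he : 9 / 32 < e)
    (hη : 0 < η) (φ : ℝ) : ∃! r : ℝ, 0 < r ∧
      scaledForm A B e ((r : ℂ) * Complex.exp ((φ : ℂ) * Complex.I)) = scaledEnergy A B η := by
  have hr : B / A ≠ 0 := div_ne_zero hB hA
  have hr' : ((B / A : ℝ) : ℂ) ≠ 0 := by exact_mod_cast hr
  have habs : 0 < |B / A| := abs_pos.2 hr
  have habs' : ((|B / A| : ℝ) : ℂ) ≠ 0 := by exact_mod_cast habs.ne'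
  have h2 : (0 : ℝ) < √2 := Real.sqrt_pos.2 two_pos
  obtain ⟨κ, hκ⟩ := exists_exp_eq_sign hr
  have hkey : ∀ x : ℝ, scaledForm A B e (((|B / A| * (√2 * x) : ℝ) : ℂ)
      * Complex.exp ((φ : ℂ) * Complex.I))
      = B ^ 4 / A ^ 3 * polarForm e (Real.cos (3 * (φ + κ))) x := by
    intro x
    rw [← normalForm_polar, ← scaledForm_mul hA]
    congr 1
    have h3 : Complex.exp (((φ + κ : ℝ) : ℂ) * Complex.I)
        = Complex.exp ((φ : ℂ) * Complex.I) * ((|B / A| / (B / A) : ℝ) : ℂ) := by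
      rw [← hκ, ← Complex.exp_add]; push_cast; congr 1; ring
    rw [h3, Complex.ofReal_mul |B / A|, Complex.ofReal_div |B / A|]
    generalize ((|B / A| : ℝ) : ℂ) = u
    generalize ((B / A : ℝ) : ℂ) = r at hr' ⊢
    field_simp
  have hl := lev_pos he hη (φ + κ)
  refine ⟨|B / A| * (√2 * lev e (φ + κ) η), ⟨by positivity, ?_⟩, ?_⟩
  · rw [hkey, polarForm_lev he hη, scaledEnergy]
  · rintro r ⟨hr0, hre⟩
    have hrx : r = |B / A| * (√2 * (r / (|B / A| * √2))) := by field_simp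
    rw [hrx, hkey, scaledEnergy] at hre
    have h3 := lev_unique he hη (by positivity) (mul_left_cancel₀ (scaledEnergy_ne hA hB) hre)
    rw [h3, ← hrx]

/-- For `e ≥ 1/2` the energy is at least `x²((x - 1/2)² + 1/4)`. The bound lets the action tend to
zero with the energy. -/
theorem lev_sq_le {e η : ℝ} (he : 1 / 2 ≤ e) (hη : 0 < η) (φ : ℝ) : lev e φ η ^ 2 ≤ 4 * η := by
  have he' : 9 / 32 < e := by linarith
  have h := polarForm_lev he' hη φ
  have hx := lev_pos he' hη φ
  have hc := Real.neg_one_le_cos (3 * φ)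
  unfold polarForm at h
  have h1 : 0 ≤ (Real.cos (3 * φ) + 1) * lev e φ η ^ 3 := mul_nonneg (by linarith) (by positivity)
  have h2 : 0 ≤ (e - 1 / 2) * lev e φ η ^ 2 := mul_nonneg (by linarith) (by positivity)
  nlinarith [sq_nonneg (lev e φ η * (lev e φ η - 1 / 2))]

theorem tendsto_action_critEnergy {A B : ℝ} (hA : A ≠ 0) (hB : B ≠ 0) :
    Tendsto (fun e => action (scaledForm A B e) (scaledEnergy A B (critEnergy e)))
      (𝓝[<] (3 / 4)) (𝓝 0) := by
  have hlim : Tendsto (fun e => (B / A) ^ 2 * (4 * critEnergy e)) (𝓝[<] (3 / 4)) (𝓝 0) := by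
    have := (tendsto_critEnergy_three_quarters.const_mul 4).const_mul ((B / A) ^ 2)
    simpa using this
  refine tendsto_of_tendsto_of_tendsto_of_le_of_le' tendsto_const_nhds hlim ?_ ?_
  · exact Eventually.of_forall fun e => div_nonneg ENNReal.toReal_nonneg Real.two_pi_pos.le
  · filter_upwards [Ioo_mem_nhdsLT (show (1 / 2 : ℝ) < 3 / 4 by norm_num)] with e he
    have he' : 9 / 32 < e := by linarith [he.1]
    have hη := critEnergy_pos ⟨he', he.2⟩
    rw [action_scaledForm hA hB he' hη]
    have h1 : ∫ φ in (0 : ℝ)..(2 * Real.pi), lev e φ (critEnergy e) ^ 2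
        ≤ ∫ φ in (0 : ℝ)..(2 * Real.pi), 4 * critEnergy e := by
      refine intervalIntegral.integral_mono_on Real.two_pi_pos.le
        (((continuous_lev he' hη).pow 2).intervalIntegrable _ _)
        (continuous_const.intervalIntegrable _ _) fun φ _ => lev_sq_le he.1.le hη φ
    rw [intervalIntegral.integral_const, smul_eq_mul, sub_zero] at h1
    have hpi := Real.pi_pos
    calc (B / A) ^ 2 / (2 * Real.pi) * ∫ φ in (0 : ℝ)..(2 * Real.pi), lev e φ (critEnergy e) ^ 2
        ≤ (B / A) ^ 2 / (2 * Real.pi) * (2 * Real.pi * (4 * critEnergy e)) :=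
          mul_le_mul_of_nonneg_left h1 (by positivity)
      _ = (B / A) ^ 2 * (4 * critEnergy e) := by field_simp

/-- Lowering `e` and raising the energy both push the level curve outwards along every ray. -/
theorem strictAntiOn_action {A B δ : ℝ} (hA : A ≠ 0) (hB : B ≠ 0) (hδ : δ < 3 / 4 - 9 / 32)
    (h : StrictAntiOn critEnergy (Set.Ioo (3 / 4 - δ) (3 / 4))) :
    StrictAntiOn (fun e => action (scaledForm A B e) (scaledEnergy A B (critEnergy e)))
      (Set.Ioo (3 / 4 - δ) (3 / 4)) := by
  intro a ha b hb hab
  have ha' : 9 / 32 < a := by linarith [ha.1]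
  have hb' : 9 / 32 < b := by linarith [hb.1]
  have hηa := critEnergy_pos ⟨ha', ha.2⟩
  have hηb := critEnergy_pos ⟨hb', hb.2⟩
  have hlt : ∀ φ, lev b φ (critEnergy b) < lev a φ (critEnergy a) := by
    intro φ
    have hx := lev_pos hb' hηb φ
    rw [lt_lev_iff ha' hηa hx.le]
    have h1 := polarForm_lev hb' hηb φ
    have h2 : (b - a) * lev b φ (critEnergy b) ^ 2 ≥ 0 := mul_nonneg (by linarith) (by positivity)
    have h3 := h ha hb hab
    unfold polarForm at h1 ⊢
    linarith
  have hsq : ∀ φ, lev b φ (critEnergy b) ^ 2 < lev a φ (critEnergy a) ^ 2 := fun φ =>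
    pow_lt_pow_left₀ (hlt φ) (lev_pos hb' hηb φ).le two_ne_zero
  simp only
  rw [action_scaledForm hA hB ha' hηa, action_scaledForm hA hB hb' hηb]
  have hr : B / A ≠ 0 := div_ne_zero hB hA
  have hpi := Real.pi_pos
  refine mul_lt_mul_of_pos_left ?_ (by positivity)
  exact intervalIntegral.integral_lt_integral_of_continuousOn_of_le_of_exists_lt Real.two_pi_pos
    ((continuous_lev hb' hηb).pow 2).continuousOn ((continuous_lev ha' hηa).pow 2).continuousOn
    (fun φ _ => (hsq φ).le) ⟨0, ⟨le_rfl, Real.two_pi_pos.le⟩, hsq 0⟩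

/-- At `e = 9/32` and energy `27/4096` the level polynomial on this ray is `(x - 3/8)³(x + 1/8)`. It
changes sign at the triple root `3/8`, so the roots of nearby polynomials converge to it. -/
theorem tendsto_lev_saddleCenter {φ : ℝ} (hφ : Real.cos (3 * φ) = -1) :
    Tendsto (fun e => lev e φ (critEnergy e)) (𝓝[>] (9 / 32)) (𝓝 (3 / 8)) := by
  have hev : ∀ᶠ e in 𝓝[>] (9 / 32 : ℝ), e ∈ Set.Ioo (9 / 32 : ℝ) (3 / 4) :=
    Ioo_mem_nhdsGT (by norm_num)
  have hlim : ∀ x : ℝ, Tendsto (fun e => polarForm e (-1) x - critEnergy e) (𝓝[>] (9 / 32))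
      (𝓝 ((x - 3 / 8) ^ 3 * (x + 1 / 8))) := by
    intro x
    have h1 : Tendsto (fun e => polarForm e (-1) x) (𝓝[>] (9 / 32))
        (𝓝 (polarForm (9 / 32) (-1) x)) := by
      have : Continuous fun e => polarForm e (-1) x := by unfold polarForm; fun_prop
      exact (this.tendsto _).mono_left nhdsWithin_le_nhds
    have h2 := h1.sub tendsto_critEnergy_saddleCenter
    have h3 : polarForm (9 / 32) (-1) x - 27 / 4096 = (x - 3 / 8) ^ 3 * (x + 1 / 8) := by
      unfold polarForm; ring
    rwa [h3] at h2
  refine tendsto_order.2 ⟨fun a ha => ?_, fun b hb => ?_⟩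
  · have hm : max a 0 < 3 / 8 := max_lt ha (by norm_num)
    have hm0 : 0 ≤ max a 0 := le_max_right _ _
    have hneg : (max a 0 - 3 / 8) ^ 3 * (max a 0 + 1 / 8) < 0 :=
      mul_neg_of_neg_of_pos (Odd.pow_neg (by decide) (by linarith)) (by linarith)
    filter_upwards [hev, (hlim (max a 0)).eventually (gt_mem_nhds hneg)] with e he h
    refine (le_max_left a 0).trans_lt ((lt_lev_iff he.1 (critEnergy_pos he) hm0).2 ?_)
    rw [hφ]; linarith
  · have hpos : 0 < (b - 3 / 8) ^ 3 * (b + 1 / 8) :=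
      mul_pos (pow_pos (by linarith) 3) (by linarith)
    filter_upwards [hev, (hlim b).eventually (lt_mem_nhds hpos)] with e he h
    refine (lev_lt_iff he.1 (critEnergy_pos he) (by linarith)).2 ?_
    rw [hφ]; linarith

theorem tendsto_infDist_saddleCenter {A : ℝ} (hA : A ≠ 0) (B σ : ℝ) {z : ℂ}
    (hz : z ∈ tripleOrbit (axisRoot A B σ (9 / 32))) :
    Tendsto (fun e => Metric.infDist z
      {w | scaledForm A B e w = scaledEnergy A B (critEnergy e)}) (𝓝[>] (9 / 32)) (𝓝 0) := by
  obtain ⟨k, hk⟩ := hz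
  -- In the scaled plane the degenerate equilibria have a negative real coordinate up to rotation;
  -- the turn by `π` puts them on the rays with `cos 3φ = -1`.
  obtain ⟨φ, hφd⟩ : ∃ φ : ℝ, φ = 2 * Real.pi * k / 3 + Real.pi := ⟨_, rfl⟩
  have hφ : Real.cos (3 * φ) = -1 := by
    have : 3 * φ = Real.pi + (k + 1 : ℤ) * (2 * Real.pi) := by rw [hφd]; push_cast; ring
    rw [this, Real.cos_add_int_mul_two_pi, Real.cos_pi]
  have hzφ : z = ((B / A : ℝ) : ℂ) * (((√2 * (3 / 8) : ℝ) : ℂ)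
      * Complex.exp ((φ : ℂ) * Complex.I)) := by
    rw [hk, axisRoot_saddleCenter, hφd]
    rw [Complex.ofReal_add, add_mul, Complex.exp_add, Complex.exp_pi_mul_I]
    push_cast; ring
  have hlim : Tendsto (fun e => |B / A| * (√2 * |3 / 8 - lev e φ (critEnergy e)|))
      (𝓝[>] (9 / 32)) (𝓝 0) := by
    have := (((tendsto_lev_saddleCenter hφ).const_sub (3 / 8)).abs.const_mul √2).const_mul |B / A|
    simpa using this
  refine squeeze_zero' (Eventually.of_forall fun e => Metric.infDist_nonneg) ?_ hlim
  filter_upwards [Ioo_mem_nhdsGT (show (9 / 32 : ℝ) < 3 / 4 by norm_num)] with e he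
  have hη := critEnergy_pos he
  have hmem : ((B / A : ℝ) : ℂ) * (((√2 * lev e φ (critEnergy e) : ℝ) : ℂ)
      * Complex.exp ((φ : ℂ) * Complex.I))
      ∈ {w | scaledForm A B e w = scaledEnergy A B (critEnergy e)} := by
    rw [Set.mem_ofPred_eq, scaledForm_mul hA, normalForm_polar, polarForm_lev he.1 hη, scaledEnergy]
  refine (Metric.infDist_le_dist_of_mem hmem).trans (le_of_eq ?_)
  rw [dist_eq_norm, hzφ, ← mul_sub, ← sub_mul, ← Complex.ofReal_sub, ← mul_sub, norm_mul, norm_mul,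
    Complex.norm_exp_ofReal_mul_I, Complex.norm_real, Complex.norm_real, Real.norm_eq_abs,
    Real.norm_eq_abs, abs_mul √2, abs_of_nonneg (Real.sqrt_nonneg 2), mul_one]


/-! ### Remainders -/

/-- A polynomial of degree below `n` that is `O(tⁿ)` vanishes. The induction weakens the bound to
order `n` to remove the lower coefficients and then divides out the last power. -/
theorem coeff_eq_zero_of_le {n : ℕ} : ∀ {c : ℕ → ℝ} {C δ : ℝ}, 0 < δ →
    (∀ t ∈ Set.Ioo 0 δ, |∑ k ∈ Finset.range n, c k * t ^ k| ≤ C * t ^ n) →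
    ∀ k < n, c k = 0 := by
  induction n with
  | zero => intro c C δ _ _ k hk; exact absurd hk (Nat.not_lt_zero k)
  | succ n ih =>
    intro c C δ hδ h
    have h1 : ∀ k < n, c k = 0 := by
      refine ih (C := |C| * δ + |c n|) hδ fun t ht => ?_
      have h2 := h t ht
      rw [Finset.sum_range_succ] at h2
      have ht0 : 0 ≤ t ^ n := pow_nonneg ht.1.le n
      have h3 : C * t ^ (n + 1) ≤ |C| * δ * t ^ n := by
        rw [pow_succ]
        have : C * t ≤ |C| * δ := by
          refine (mul_le_mul_of_nonneg_right (le_abs_self C) ht.1.le).trans ?_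
          exact mul_le_mul_of_nonneg_left ht.2.le (abs_nonneg C)
        nlinarith
      have h4 : |c n * t ^ n| = |c n| * t ^ n := by rw [abs_mul, abs_of_nonneg ht0]
      have h5 := abs_sub_abs_le_abs_sub (∑ k ∈ Finset.range n, c k * t ^ k) (-(c n * t ^ n))
      rw [sub_neg_eq_add, abs_neg, h4] at h5
      linarith
    have h2 : c n = 0 := by
      have hlim : Tendsto (fun t : ℝ => C * t) (𝓝[>] 0) (𝓝 0) := by
        have : Continuous fun t : ℝ => C * t := by fun_prop
        simpa using (this.tendsto 0).mono_left nhdsWithin_le_nhds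
      have hle : |c n| ≤ 0 := by
        refine ge_of_tendsto hlim ?_
        filter_upwards [Ioo_mem_nhdsGT hδ] with t ht
        have h3 := h t ht
        rw [Finset.sum_range_succ, Finset.sum_eq_zero fun k hk => by
          rw [h1 k (Finset.mem_range.1 hk), zero_mul], zero_add, abs_mul,
          abs_of_nonneg (pow_nonneg ht.1.le n), pow_succ, ← mul_assoc, mul_right_comm] at h3
        exact le_of_mul_le_mul_right h3 (pow_pos ht.1 n)
      exact abs_eq_zero.1 (le_antisymm hle (abs_nonneg _))
    intro k hk
    rcases (Nat.lt_succ_iff_lt_or_eq.1 hk) with h3 | h3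
    · exact h1 k h3
    · rw [h3, h2]

/-- Taylor's formula along a segment. -/
theorem abs_sub_taylor_le {E : Type*} [NormedAddCommGroup E] [NormedSpace ℝ E] {f : E → ℝ}
    (hf : ContDiff ℝ ∞ f) {x y : E} {M t : ℝ} (ht : 0 ≤ t)
    (hM : ∀ r ∈ Set.Icc 0 t, ‖iteratedFDeriv ℝ 5 f (x + r • y)‖ ≤ M) :
    |f (x + t • y) - ∑ k ∈ Finset.range 5,
      ((k.factorial : ℝ)⁻¹ * iteratedFDeriv ℝ k f x (fun _ => y)) * t ^ k|
      ≤ M * ‖y‖ ^ 5 * t ^ 5 := by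
  have h := map_add_eq_sum_add_integral_iteratedFDeriv (f := f) (x := x) (y := t • y) (n := 4)
    (fun r _ => by exact_mod_cast (contDiff_infty.1 hf 5).contDiffAt)
  have hmul : ∀ (k : ℕ) (z : E), iteratedFDeriv ℝ k f z (fun _ => t • y)
      = t ^ k * iteratedFDeriv ℝ k f z (fun _ => y) := by
    intro k z
    have := (iteratedFDeriv ℝ k f z).map_smul_univ (fun _ => t) (fun _ => y)
    simpa using this
  have hsum : ∑ k ∈ Finset.range (4 + 1), (k.factorial : ℝ)⁻¹
      • (iteratedFDeriv ℝ k f x fun _ => t • y) = ∑ k ∈ Finset.range 5,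
      ((k.factorial : ℝ)⁻¹ * iteratedFDeriv ℝ k f x (fun _ => y)) * t ^ k := by
    refine Finset.sum_congr rfl fun k _ => ?_
    rw [hmul, smul_eq_mul]; ring
  rw [h, hsum, add_sub_cancel_left]
  have hM0 : 0 ≤ M := (norm_nonneg _).trans (hM 0 ⟨le_rfl, ht⟩)
  have hint : ‖∫ r in (0 : ℝ)..1, (1 - r) ^ 4 • iteratedFDeriv ℝ (4 + 1) f (x + r • t • y)
      (fun _ => t • y)‖ ≤ M * ‖y‖ ^ 5 * t ^ 5 * |1 - 0| := by
    refine intervalIntegral.norm_integral_le_of_norm_le_const fun r hr => ?_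
    rw [Set.uIoc_of_le zero_le_one] at hr
    rw [norm_smul, hmul, norm_mul, norm_pow, norm_pow, Real.norm_eq_abs, Real.norm_eq_abs,
      abs_of_nonneg ht, abs_of_nonneg (by linarith [hr.2])]
    have h1 : (1 - r) ^ 4 ≤ 1 := pow_le_one₀ (by linarith [hr.2]) (by linarith [hr.1])
    have h2 := (iteratedFDeriv ℝ 5 f (x + r • t • y)).le_opNorm (fun _ => y)
    rw [Finset.prod_const, Finset.card_univ, Fintype.card_fin] at h2
    have h3 : ‖iteratedFDeriv ℝ 5 f (x + r • t • y)‖ ≤ M := by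
      rw [smul_smul]
      exact hM _ ⟨mul_nonneg hr.1.le ht, mul_le_of_le_one_left ht hr.2⟩
    have h4 := h2.trans (mul_le_mul_of_nonneg_right h3 (by positivity))
    calc (1 - r) ^ 4 * (t ^ 5 * ‖iteratedFDeriv ℝ 5 f (x + r • t • y) fun _ => y‖)
        ≤ 1 * (t ^ 5 * (M * ‖y‖ ^ 5)) := by gcongr
      _ = M * ‖y‖ ^ 5 * t ^ 5 := by ring
  rw [sub_zero, abs_one, mul_one] at hint
  rw [smul_eq_mul, abs_mul, abs_of_pos (by positivity)]
  have h24 : ((Nat.factorial 4 : ℕ) : ℝ)⁻¹ ≤ 1 := by norm_num [Nat.factorial]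
  calc _ ≤ 1 * (M * ‖y‖ ^ 5 * t ^ 5) :=
        mul_le_mul h24 hint (abs_nonneg _) zero_le_one
    _ = _ := one_mul _

namespace IsRemainder

variable {R : ℝ → ℂ → ℝ} (hR : IsRemainder R)

include hR

/-- The radius `5` leaves room for the points `z + t‖z‖u` with `‖z‖ ≤ 1` and `t ≤ 4` in
`exists_bound_fderiv`. -/
theorem exists_bound_iteratedFDeriv : ∃ M : ℝ, ∀ s ∈ Set.Icc 0 (2 * Real.pi), ∀ z : ℂ, ‖z‖ ≤ 5 →
    ‖iteratedFDeriv ℝ 5 (fun x : ℝ × ℂ => R x.1 x.2) (s, z)‖ ≤ M := by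
  have hc := (contDiff_infty.1 hR.smooth 5).continuous_iteratedFDeriv (m := 5) le_rfl
  obtain ⟨M, hM⟩ := (isCompact_Icc.prod (isCompact_closedBall (0 : ℂ) 5)).exists_bound_of_continuousOn
    (s := Set.Icc 0 (2 * Real.pi) ×ˢ Metric.closedBall (0 : ℂ) 5) hc.continuousOn
  exact ⟨M, fun s hs z hz => hM (s, z) ⟨hs, by simpa using hz⟩⟩

/-- The order condition holds for each `s` separately. It kills the Taylor coefficients at every
`s`, and the remaining fifth-order term is bounded uniformly by compactness. -/
theorem exists_bound : ∃ M : ℝ, ∀ s ∈ Set.Icc 0 (2 * Real.pi), ∀ z : ℂ, ‖z‖ ≤ 5 →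
    |R s z| ≤ M * ‖z‖ ^ 5 := by
  obtain ⟨M, hM⟩ := hR.exists_bound_iteratedFDeriv
  refine ⟨M, fun s hs z hz => ?_⟩
  have htay : ∀ t ∈ Set.Icc (0 : ℝ) 1, _ := fun t ht => abs_sub_taylor_le hR.smooth
    (x := (s, (0 : ℂ))) (y := ((0 : ℝ), z)) (M := M) ht.1 (fun r hr => by
      have := hM s hs (r • z) (by
        rw [norm_smul, Real.norm_eq_abs, abs_of_nonneg hr.1]
        exact (mul_le_of_le_one_left (norm_nonneg z) (hr.2.trans ht.2)).trans hz)
      simpa using this)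
  have hy : ‖((0 : ℝ), z)‖ = ‖z‖ := by simp
  simp only [Prod.smul_mk, Prod.mk_add_mk, smul_zero, add_zero, zero_add, hy] at htay
  obtain ⟨c, hc⟩ : ∃ c : ℕ → ℝ, c = fun k => (k.factorial : ℝ)⁻¹ * iteratedFDeriv ℝ k
    (fun x : ℝ × ℂ => R x.1 x.2) (s, 0) (fun _ => ((0 : ℝ), z)) := ⟨_, rfl⟩
  have hcz : ∀ k < 5, c k = 0 := by
    obtain ⟨C, hC⟩ := (hR.order s).bound
    have hlim : Tendsto (fun t : ℝ => t • z) (𝓝[>] 0) (𝓝 0) := by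
      have : Continuous fun t : ℝ => t • z := by fun_prop
      simpa using (this.tendsto 0).mono_left nhdsWithin_le_nhds
    obtain ⟨δ, hδ, hδ2⟩ := mem_nhdsGT_iff_exists_Ioo_subset.1
      ((hlim.eventually hC).and (Ioo_mem_nhdsGT (zero_lt_one' ℝ)))
    refine coeff_eq_zero_of_le (C := C * ‖z‖ ^ 5 + M * ‖z‖ ^ 5) (δ := δ) hδ fun t ht => ?_
    obtain ⟨h1, h2⟩ := hδ2 ht
    have h3 := htay t ⟨h2.1.le, h2.2.le⟩
    rw [norm_pow, norm_norm, norm_smul, Real.norm_eq_abs, Real.norm_eq_abs, abs_of_pos h2.1] at h1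
    rw [hc]
    have h4 := abs_sub_abs_le_abs_sub (∑ k ∈ Finset.range 5,
      ((k.factorial : ℝ)⁻¹ * iteratedFDeriv ℝ k (fun x : ℝ × ℂ => R x.1 x.2) (s, 0)
        (fun _ => ((0 : ℝ), z))) * t ^ k) (R s (t • z))
    rw [abs_sub_comm] at h4
    have h5 : C * (t * ‖z‖) ^ 5 = C * ‖z‖ ^ 5 * t ^ 5 := by ring
    rw [h5] at h1
    linarith
  have h1 := htay 1 ⟨zero_le_one, le_rfl⟩
  rw [Finset.sum_eq_zero fun k hk => by
    have := hcz k (Finset.mem_range.1 hk)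
    rw [hc] at this
    simp only at this
    rw [this, zero_mul]] at h1
  simpa using h1

theorem differentiable_right (s : ℝ) : Differentiable ℝ (R s) :=
  (hR.smooth.differentiable (by simp)).comp (g := fun x : ℝ × ℂ => R x.1 x.2)
    (f := fun z : ℂ => (s, z)) (by fun_prop)

theorem fderiv_right (s : ℝ) (z u : ℂ) :
    fderiv ℝ (R s) z u = fderiv ℝ (fun x : ℝ × ℂ => R x.1 x.2) (s, z) (0, u) := by
  have h1 := (hR.smooth.differentiable (by simp) (s, z)).hasFDerivAt
  have h2 : HasFDerivAt (fun z : ℂ => (s, z)) (ContinuousLinearMap.inr ℝ ℝ ℂ) z := by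
    exact hasFDerivAt_prodMk_right s z
  have h3 : HasFDerivAt (R s) _ z := h1.comp z h2
  rw [h3.fderiv]; simp

/-- The derivative is the linear coefficient of a Taylor polynomial of degree four with step `‖z‖`.
Interpolation at the five points `t = 0, …, 4` bounds it by values of `R`, all of order `‖z‖⁵`, and
division by the step leaves order four. -/
theorem exists_bound_fderiv : ∃ C : ℝ, 0 ≤ C ∧ ∀ s ∈ Set.Icc 0 (2 * Real.pi), ∀ z : ℂ, ‖z‖ ≤ 1 →
    ∀ u : ℂ, ‖u‖ = 1 → |fderiv ℝ (R s) z u| ≤ C * ‖z‖ ^ 4 := by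
  obtain ⟨M, hM⟩ := hR.exists_bound_iteratedFDeriv
  obtain ⟨N, hN⟩ := hR.exists_bound
  have hN0 : 0 ≤ N := by
    have h := (abs_nonneg _).trans (hN 0 ⟨le_rfl, Real.two_pi_pos.le⟩ 1 (by norm_num))
    simpa using h
  have hM0 : 0 ≤ M := (norm_nonneg _).trans (hM 0 ⟨le_rfl, Real.two_pi_pos.le⟩ 0 (by norm_num))
  -- A generous constant: the values contribute `5⁵N` each and the Taylor errors at most `4⁵M`,
  -- weighted by the interpolation coefficients.
  refine ⟨100000 * (N + M), by positivity, fun s hs z hz u hu => ?_⟩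
  rcases eq_or_ne z 0 with rfl | hz0
  · have h0 : HasFDerivAt (R s) (0 : ℂ →L[ℝ] ℝ) 0 := by
      refine Asymptotics.IsBigO.hasFDerivAt (n := 5) ?_ (by norm_num)
      simpa using hR.order s
    rw [h0.fderiv]; simp
  obtain ⟨h, hh⟩ : ∃ h, h = ‖z‖ := ⟨_, rfl⟩
  have hh0 : 0 < h := hh ▸ norm_pos_iff.2 hz0
  have hval : ∀ t ∈ Set.Icc (0 : ℝ) 4, ‖z + t • (h • u)‖ ≤ 5 * h := by
    intro t ht
    refine (norm_add_le _ _).trans ?_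
    rw [norm_smul, norm_smul, hu, Real.norm_eq_abs, Real.norm_eq_abs, abs_of_nonneg ht.1,
      abs_of_pos hh0, ← hh]
    nlinarith [ht.2]
  have htay : ∀ t ∈ Set.Icc (0 : ℝ) 4, _ := fun t ht => abs_sub_taylor_le hR.smooth
    (x := (s, z)) (y := ((0 : ℝ), h • u)) (M := M) ht.1 (fun r hr => by
      have := hM s hs (z + r • (h • u)) ((hval r ⟨hr.1, hr.2.trans ht.2⟩).trans (by linarith))
      simpa using this)
  have hy : ‖((0 : ℝ), h • u)‖ = h := by simp [hu, abs_of_pos hh0, hh0.le]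
  simp only [Prod.smul_mk, Prod.mk_add_mk, smul_zero, add_zero, hy] at htay
  have hc1 : (Nat.factorial 1 : ℝ)⁻¹ * iteratedFDeriv ℝ 1 (fun x : ℝ × ℂ => R x.1 x.2) (s, z)
      (fun _ => ((0 : ℝ), h • u)) = h * fderiv ℝ (R s) z u := by
    rw [iteratedFDeriv_one_apply, ← hR.fderiv_right, map_smul]; simp
  have hRv : ∀ t ∈ Set.Icc (0 : ℝ) 4, |R s (z + t • (h • u))| ≤ N * (5 * h) ^ 5 := by
    intro t ht
    refine (hN s hs _ ((hval t ht).trans (by linarith))).trans ?_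
    gcongr
    exact hval t ht
  have t0 := htay 0 ⟨by norm_num, by norm_num⟩
  have t1 := htay 1 ⟨by norm_num, by norm_num⟩
  have t2 := htay 2 ⟨by norm_num, by norm_num⟩
  have t3 := htay 3 ⟨by norm_num, by norm_num⟩
  have t4 := htay 4 ⟨by norm_num, by norm_num⟩
  have r0 := hRv 0 ⟨by norm_num, by norm_num⟩
  have r1 := hRv 1 ⟨by norm_num, by norm_num⟩
  have r2 := hRv 2 ⟨by norm_num, by norm_num⟩
  have r3 := hRv 3 ⟨by norm_num, by norm_num⟩
  have r4 := hRv 4 ⟨by norm_num, by norm_num⟩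
  simp only [Finset.sum_range_succ, Finset.sum_range_zero, hc1] at t0 t1 t2 t3 t4
  generalize ((Nat.factorial 0 : ℝ)⁻¹ * iteratedFDeriv ℝ 0 (fun x : ℝ × ℂ => R x.1 x.2) (s, z)
    (fun _ => ((0 : ℝ), h • u))) = c0 at *
  generalize ((Nat.factorial 2 : ℝ)⁻¹ * iteratedFDeriv ℝ 2 (fun x : ℝ × ℂ => R x.1 x.2) (s, z)
    (fun _ => ((0 : ℝ), h • u))) = c2 at *
  generalize ((Nat.factorial 3 : ℝ)⁻¹ * iteratedFDeriv ℝ 3 (fun x : ℝ × ℂ => R x.1 x.2) (s, z)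
    (fun _ => ((0 : ℝ), h • u))) = c3 at *
  generalize ((Nat.factorial 4 : ℝ)⁻¹ * iteratedFDeriv ℝ 4 (fun x : ℝ × ℂ => R x.1 x.2) (s, z)
    (fun _ => ((0 : ℝ), h • u))) = c4 at *
  generalize R s (z + (0 : ℝ) • (h • u)) = y0 at *
  generalize R s (z + (1 : ℝ) • (h • u)) = y1 at *
  generalize R s (z + (2 : ℝ) • (h • u)) = y2 at *
  generalize R s (z + (3 : ℝ) • (h • u)) = y3 at *
  generalize R s (z + (4 : ℝ) • (h • u)) = y4 at *
  generalize fderiv ℝ (R s) z u = D at *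
  rw [← hh]
  have hNh : N * (5 * h) ^ 5 = 3125 * (N * h ^ 5) := by ring
  rw [hNh] at r0 r1 r2 r3 r4
  have hNp : 0 ≤ N * h ^ 5 := by positivity
  have hMp : 0 ≤ M * h ^ 5 := by positivity
  have hkey : |h * D| ≤ 100000 * (N + M) * h ^ 5 := by
    have e : 100000 * (N + M) * h ^ 5 = 100000 * (N * h ^ 5) + 100000 * (M * h ^ 5) := by ring
    rw [e]
    generalize N * h ^ 5 = n at *
    generalize M * h ^ 5 = m' at *
    generalize h * D = d at *
    norm_num at t0 t1 t2 t3 t4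
    rw [abs_le] at *
    constructor <;> linarith
  rw [abs_mul, abs_of_pos hh0] at hkey
  have e2 : 100000 * (N + M) * h ^ 5 = h * (100000 * (N + M) * h ^ 4) := by ring
  rw [e2] at hkey
  exact le_of_mul_le_mul_left hkey hh0

/-- The Hamiltonian vector field of a remainder is of order four. -/
theorem exists_bound_hamVF : ∃ C : ℝ, 0 ≤ C ∧ ∀ s ∈ Set.Icc 0 (2 * Real.pi), ∀ z : ℂ, ‖z‖ ≤ 1 →
    ‖hamVF (R s) z‖ ≤ C * ‖z‖ ^ 4 := by
  obtain ⟨C, hC0, hC⟩ := hR.exists_bound_fderiv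
  refine ⟨2 * C, by positivity, fun s hs z hz => ?_⟩
  have h1 := hC s hs z hz 1 (by simp)
  have h2 := hC s hs z hz Complex.I (by simp)
  refine (norm_add_le _ _).trans ?_
  rw [norm_neg, norm_mul, Complex.norm_real, Complex.norm_real, Complex.norm_I, Real.norm_eq_abs,
    Real.norm_eq_abs, mul_one]
  linarith

end IsRemainder


/-! ### The equation transverse to the periodic orbit -/

/-- The energy `-E` on the level `H = 0`. -/
noncomputable def transHam (m : ℤ) (ε A B : ℝ) (R : ℝ → ℂ → ℝ) (x : ℝ × ℂ) : ℝ :=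
  resonantForm m ε A B x.1 x.2 + R x.1 x.2

/-- The vector field transverse to the periodic orbit. -/
noncomputable def transVF (m : ℤ) (ε A B : ℝ) (R : ℝ → ℂ → ℝ) (t : ℝ) (z : ℂ) : ℂ :=
  Complex.I * (((m / 3 + ε : ℝ) : ℂ) * z + A * (Complex.normSq z : ℂ) * z
    + 3 * (B / (2 * √2) : ℝ) * (starRingEnd ℂ z) ^ 2
      * Complex.exp (((m * t : ℝ) : ℂ) * Complex.I)) + hamVF (R t) z

section

variable {m : ℤ} {ε A B : ℝ} {R : ℝ → ℂ → ℝ} (hR : IsRemainder R)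

include hR

theorem contDiff_transHam : ContDiff ℝ ∞ (transHam m ε A B R) := by
  have hn : ContDiff ℝ ∞ (fun x : ℝ × ℂ => Complex.normSq x.2) := contDiff_normSq.comp contDiff_snd
  have he : ContDiff ℝ ∞ (fun x : ℝ × ℂ =>
      Complex.exp (((-(m * x.1) : ℝ) : ℂ) * Complex.I)) := by
    have h0 : ContDiff ℝ ∞ (fun x : ℝ × ℂ => (-(m * x.1) : ℝ)) := by fun_prop
    have : ContDiff ℝ ∞ (fun x : ℝ × ℂ => ((-(m * x.1) : ℝ) : ℂ)) :=
      Complex.ofRealCLM.contDiff.comp h0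
    exact (this.mul contDiff_const).cexp
  have hre : ContDiff ℝ ∞ (fun x : ℝ × ℂ =>
      (x.2 ^ 3 * Complex.exp (((-(m * x.1) : ℝ) : ℂ) * Complex.I)).re) :=
    Complex.reCLM.contDiff.comp ((contDiff_snd.pow 3).mul he)
  have hfun : transHam m ε A B R = fun x : ℝ × ℂ => (m / 3 + ε) * (Complex.normSq x.2 / 2)
      + A * (Complex.normSq x.2 / 2) ^ 2 + B / (2 * √2)
        * (x.2 ^ 3 * Complex.exp (((-(m * x.1) : ℝ) : ℂ) * Complex.I)).re + R x.1 x.2 := by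
    ext x; rw [transHam, resonantForm_eq]
  rw [hfun]
  exact (((contDiff_const.mul (hn.div_const 2)).add (contDiff_const.mul ((hn.div_const 2).pow 2))).add
    (contDiff_const.mul hre)).add hR.smooth

theorem differentiable_transHam : Differentiable ℝ (transHam m ε A B R) :=
  (contDiff_transHam hR).differentiable (by simp)

theorem hasFDerivAt_fullHam (s E : ℝ) (z : ℂ) : HasFDerivAt (fullHam m ε A B R)
    ((ContinuousLinearMap.fst ℝ ℝ ℂ).comp (ContinuousLinearMap.snd ℝ ℝ (ℝ × ℂ))
      + (fderiv ℝ (transHam m ε A B R) (s, z)).comp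
        ((ContinuousLinearMap.fst ℝ ℝ (ℝ × ℂ)).prod
          ((ContinuousLinearMap.snd ℝ ℝ ℂ).comp (ContinuousLinearMap.snd ℝ ℝ (ℝ × ℂ)))))
    (s, E, z) := by
  have h1 := (differentiable_transHam (m := m) (ε := ε) (A := A) (B := B) hR (s, z)).hasFDerivAt
  have h2 := h1.comp (s, E, z) ((ContinuousLinearMap.fst ℝ ℝ (ℝ × ℂ)).prod
    ((ContinuousLinearMap.snd ℝ ℝ ℂ).comp (ContinuousLinearMap.snd ℝ ℝ (ℝ × ℂ)))).hasFDerivAt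
  have h3 := ((ContinuousLinearMap.fst ℝ ℝ ℂ).comp
    (ContinuousLinearMap.snd ℝ ℝ (ℝ × ℂ))).hasFDerivAt (x := (s, E, z))
  refine (h3.add h2).congr_of_eventuallyEq (Eventually.of_forall fun x => ?_)
  simp [fullHam, transHam, add_assoc]

theorem hasFDerivAt_transHam_right (s : ℝ) (z : ℂ) :
    HasFDerivAt (fun z => transHam m ε A B R (s, z))
      ((fderiv ℝ (transHam m ε A B R) (s, z)).comp (ContinuousLinearMap.inr ℝ ℝ ℂ)) z :=
  (differentiable_transHam hR (s, z)).hasFDerivAt.comp z (hasFDerivAt_prodMk_right s z)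

theorem hamVF_transHam (s : ℝ) (z : ℂ) :
    hamVF (fun z => transHam m ε A B R (s, z)) z = transVF m ε A B R s z := by
  have h1 := hasFDerivAt_quarticHam (m / 3 + ε) A (B / (2 * √2))
    (Complex.exp (((-(m * s) : ℝ) : ℂ) * Complex.I)) z
  have h2 := (hR.differentiable_right s z).hasFDerivAt
  have h3 : (fun z => transHam m ε A B R (s, z)) = (quarticHam (m / 3 + ε) A (B / (2 * √2))
    (Complex.exp (((-(m * s) : ℝ) : ℂ) * Complex.I))) + R s := by
    ext z; simp [transHam, resonantForm_eq_quarticHam]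
  have h4 : hamVF (fun z => transHam m ε A B R (s, z)) z
      = hamVF (quarticHam (m / 3 + ε) A (B / (2 * √2))
        (Complex.exp (((-(m * s) : ℝ) : ℂ) * Complex.I))) z + hamVF (R s) z := by
    simp only [hamVF]
    rw [h3, (h1.add h2).fderiv, h1.fderiv]
    simp only [add_apply]
    push_cast; ring
  rw [h4, hamVF_quarticHam, transVF, ← Complex.exp_conj]
  simp

theorem hamVF_fullHam (s E : ℝ) (z : ℂ) :
    hamVF (fun z => fullHam m ε A B R (s, E, z)) z = transVF m ε A B R s z := by
  rw [← hamVF_transHam hR]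
  have h1 := hasFDerivAt_transHam_right (m := m) (ε := ε) (A := A) (B := B) hR s z
  have h2 := (h1.const_add E).congr_of_eventuallyEq (f₁ := fun z => fullHam m ε A B R (s, E, z))
    (Eventually.of_forall fun x => by simp [fullHam, transHam, add_assoc])
  simp only [hamVF, h1.fderiv, h2.fderiv]

/-- Because `∂H/∂E = 1`, the angle is the time itself: the return time is `2π` and the transverse
motion solves a forced equation that does not contain `E`. -/
theorem IsOrbit.transverse {T : ℝ} {s E : ℝ → ℝ} {ζ : ℝ → ℂ} (hT : 0 < T)
    (h : IsOrbit (fullHam m ε A B R) T s E ζ) (hs0 : s 0 = 0) (hsT : s T = 2 * Real.pi) :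
    T = 2 * Real.pi ∧ ∀ t ∈ Set.Icc 0 (2 * Real.pi), HasDerivWithinAt ζ
      (transVF m ε A B R t (ζ t)) (Set.Icc 0 (2 * Real.pi)) t := by
  have hs1 : ∀ t ∈ Set.Icc 0 T, HasDerivWithinAt (fun t => s t - t) 0 (Set.Icc 0 T) t := by
    intro t ht
    have h1 := (h t ht).1
    rw [(hasFDerivAt_fullHam hR _ _ _).fderiv] at h1
    exact (h1.sub (hasDerivWithinAt_id t _)).congr_deriv (by simp [Prod.mk_zero_zero])
  have hs : ∀ t ∈ Set.Icc 0 T, s t = t := by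
    intro t ht
    have := constant_of_has_deriv_right_zero (fun t ht => (hs1 t ht).continuousWithinAt)
      (fun t ht => (hs1 t (Set.Ico_subset_Icc_self ht)).mono_of_mem_nhdsWithin
        (Icc_mem_nhdsGE_of_mem ht)) t ht
    simp only [hs0] at this
    linarith
  have hTe : T = 2 * Real.pi := by rw [← hsT, hs T ⟨hT.le, le_rfl⟩]
  subst hTe
  refine ⟨rfl, fun t ht => ?_⟩
  have h1 := (h t ht).2.2
  rwa [hamVF_fullHam hR, hs t ht] at h1

/-- The level `H = 0` prescribes `E`. Its equation holds because the Hamiltonian field is tangent to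
the levels at fixed `s`, so only the explicit `s`-derivative survives. -/
theorem isOrbit_of_transverse {T : ℝ} {ζ : ℝ → ℂ}
    (h : ∀ t ∈ Set.Icc 0 T, HasDerivWithinAt ζ (transVF m ε A B R t (ζ t)) (Set.Icc 0 T) t) :
    IsOrbit (fullHam m ε A B R) T id (fun t => -transHam m ε A B R (t, ζ t)) ζ := by
  intro t ht
  rw [(hasFDerivAt_fullHam hR _ _ _).fderiv, hamVF_fullHam hR]
  refine ⟨?_, ?_, h t ht⟩
  · simpa [Prod.mk_zero_zero] using hasDerivWithinAt_id t (Set.Icc 0 T)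
  · have h1 := (differentiable_transHam (m := m) (ε := ε) (A := A) (B := B) hR
      (t, ζ t)).hasFDerivAt.comp_hasDerivWithinAt t ((hasDerivWithinAt_id t _).prodMk (h t ht))
    refine h1.neg.congr_deriv ?_
    have h2 := fderiv_hamVF_self (fun z => transHam m ε A B R (t, z)) (ζ t)
    rw [hamVF_transHam hR, (hasFDerivAt_transHam_right hR t (ζ t)).fderiv] at h2
    have h3 : ((1 : ℝ), transVF m ε A B R t (ζ t)) = (1, 0) + (0, transVF m ε A B R t (ζ t)) := by
      simp
    have h4 : fderiv ℝ (transHam m ε A B R) (t, ζ t) (0, transVF m ε A B R t (ζ t)) = 0 := by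
      simpa using h2
    rw [h3, map_add, h4]
    simp

theorem contDiff_transVF : ContDiff ℝ ∞ (fun x : ℝ × ℂ => transVF m ε A B R x.1 x.2) := by
  have hD : ContDiff ℝ ∞ (fderiv ℝ (fun x : ℝ × ℂ => R x.1 x.2)) :=
    hR.smooth.fderiv_right (by simp)
  have hu : ∀ u : ℂ, ContDiff ℝ ∞ (fun x : ℝ × ℂ => ((fderiv ℝ (R x.1) x.2 u : ℝ) : ℂ)) := by
    intro u
    simp only [hR.fderiv_right]
    exact Complex.ofRealCLM.contDiff.comp (hD.clm_apply contDiff_const)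
  have hn : ContDiff ℝ ∞ (fun x : ℝ × ℂ => (Complex.normSq x.2 : ℂ)) :=
    Complex.ofRealCLM.contDiff.comp (contDiff_normSq.comp contDiff_snd)
  have hc : ContDiff ℝ ∞ (fun x : ℝ × ℂ => starRingEnd ℂ x.2) :=
    Complex.conjCLE.contDiff.comp contDiff_snd
  have he : ContDiff ℝ ∞ (fun x : ℝ × ℂ =>
      Complex.exp (((m * x.1 : ℝ) : ℂ) * Complex.I)) := by
    have h0 : ContDiff ℝ ∞ (fun x : ℝ × ℂ => (m * x.1 : ℝ)) := by fun_prop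
    have : ContDiff ℝ ∞ (fun x : ℝ × ℂ => ((m * x.1 : ℝ) : ℂ)) :=
      Complex.ofRealCLM.contDiff.comp h0
    exact (this.mul contDiff_const).cexp
  unfold transVF hamVF
  exact (contDiff_const.mul (((contDiff_const.mul contDiff_snd).add
    ((contDiff_const.mul hn).mul contDiff_snd)).add ((contDiff_const.mul (hc.pow 2)).mul he))).add
    ((hu Complex.I).neg.add ((hu 1).mul contDiff_const))

theorem exists_bound_transVF : ∃ C : ℝ, 0 ≤ C ∧ ∀ t ∈ Set.Icc 0 (2 * Real.pi), ∀ z : ℂ, ‖z‖ ≤ 1 →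
    ‖transVF m ε A B R t z - Complex.I * ((m / 3 + ε : ℝ) : ℂ) * z‖ ≤ C * ‖z‖ ^ 2 := by
  obtain ⟨C, hC0, hC⟩ := hR.exists_bound_hamVF
  refine ⟨|A| + 3 * |B / (2 * √2)| + C, by positivity, fun t ht z hz => ?_⟩
  have h1 : transVF m ε A B R t z - Complex.I * ((m / 3 + ε : ℝ) : ℂ) * z
      = Complex.I * (A * (Complex.normSq z : ℂ) * z) + Complex.I * (3 * (B / (2 * √2) : ℝ)
        * (starRingEnd ℂ z) ^ 2 * Complex.exp (((m * t : ℝ) : ℂ) * Complex.I))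
        + hamVF (R t) z := by
    unfold transVF; ring
  have hz2 : ‖z‖ ^ 4 ≤ ‖z‖ ^ 2 := pow_le_pow_of_le_one (norm_nonneg z) hz (by norm_num)
  have hz3 : ‖z‖ ^ 3 ≤ ‖z‖ ^ 2 := pow_le_pow_of_le_one (norm_nonneg z) hz (by norm_num)
  have n1 : ‖Complex.I * (A * (Complex.normSq z : ℂ) * z)‖ ≤ |A| * ‖z‖ ^ 2 := by
    rw [norm_mul, norm_mul, norm_mul, Complex.norm_I, Complex.norm_real, Complex.norm_real,
      Complex.normSq_eq_norm_sq, Real.norm_eq_abs, norm_pow, norm_norm, one_mul, mul_assoc,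
      ← pow_succ]
    exact mul_le_mul_of_nonneg_left hz3 (abs_nonneg A)
  have n2 : ‖Complex.I * (3 * (B / (2 * √2) : ℝ) * (starRingEnd ℂ z) ^ 2
      * Complex.exp (((m * t : ℝ) : ℂ) * Complex.I))‖ = 3 * |B / (2 * √2)| * ‖z‖ ^ 2 := by
    rw [norm_mul, norm_mul, norm_mul, norm_mul, Complex.norm_I, Complex.norm_exp_ofReal_mul_I,
      Complex.norm_real, norm_pow, RCLike.norm_conj, Real.norm_eq_abs]
    norm_num
  have n3 := (hC t ht z hz).trans (mul_le_mul_of_nonneg_left hz2 hC0)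
  rw [h1]
  calc _ ≤ _ := norm_add₃_le
    _ ≤ |A| * ‖z‖ ^ 2 + 3 * |B / (2 * √2)| * ‖z‖ ^ 2 + C * ‖z‖ ^ 2 := by
      rw [n2]; gcongr
    _ = _ := by ring

end


/-! ### Orbits over one period and the existence of the Poincaré map. -/

/-- `ζ` is an orbit of the transverse equation over one period of the angle. -/
def IsTransOrbit (m : ℤ) (ε A B : ℝ) (R : ℝ → ℂ → ℝ) (ζ : ℝ → ℂ) : Prop :=
  ∀ t ∈ Set.Icc 0 (2 * Real.pi), HasDerivWithinAt ζ
    (transVF m ε A B R t (ζ t)) (Set.Icc 0 (2 * Real.pi)) t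

/-- The transverse vector field in a frame rotating with angular velocity `ν`. -/
noncomputable def rotVF (m : ℤ) (ε A B : ℝ) (R : ℝ → ℂ → ℝ) (ν t : ℝ) (v : ℂ) : ℂ :=
  Complex.exp (((-ν * t : ℝ) : ℂ) * Complex.I)
    * (transVF m ε A B R t (Complex.exp (((ν * t : ℝ) : ℂ) * Complex.I) * v)
      - Complex.I * (ν : ℂ) * (Complex.exp (((ν * t : ℝ) : ℂ) * Complex.I) * v))

theorem hasDerivAt_exp_mul_I (a t : ℝ) :
    HasDerivAt (fun t : ℝ => Complex.exp (((a * t : ℝ) : ℂ) * Complex.I))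
      (Complex.exp (((a * t : ℝ) : ℂ) * Complex.I) * (a * Complex.I)) t := by
  have h1 : HasDerivAt (fun t : ℝ => a * t) a t := by
    simpa using (hasDerivAt_id t).const_mul a
  exact (h1.ofReal_comp.mul_const Complex.I).cexp

theorem exp_neg_mul_exp (a t : ℝ) : Complex.exp (((-a * t : ℝ) : ℂ) * Complex.I)
    * Complex.exp (((a * t : ℝ) : ℂ) * Complex.I) = 1 := by
  rw [← Complex.exp_add, ← add_mul, ← Complex.ofReal_add]
  simp

theorem contDiff_rotating {F : ℝ × ℂ → ℂ} (hF : ContDiff ℝ ∞ F) (ν : ℝ) :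
    ContDiff ℝ ∞ (fun x : ℝ × ℂ => Complex.exp (((-ν * x.1 : ℝ) : ℂ) * Complex.I)
      * (F (x.1, Complex.exp (((ν * x.1 : ℝ) : ℂ) * Complex.I) * x.2)
        - Complex.I * (ν : ℂ) * (Complex.exp (((ν * x.1 : ℝ) : ℂ) * Complex.I) * x.2))) := by
  have hexp : ∀ a : ℝ, ContDiff ℝ ∞ (fun x : ℝ × ℂ =>
      Complex.exp (((a * x.1 : ℝ) : ℂ) * Complex.I)) := by
    intro a
    have h0 : ContDiff ℝ ∞ (fun x : ℝ × ℂ => (a * x.1 : ℝ)) := by fun_prop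
    have : ContDiff ℝ ∞ (fun x : ℝ × ℂ => ((a * x.1 : ℝ) : ℂ)) :=
      Complex.ofRealCLM.contDiff.comp h0
    exact (this.mul contDiff_const).cexp
  have h1 : ContDiff ℝ ∞ (fun x : ℝ × ℂ =>
      Complex.exp (((ν * x.1 : ℝ) : ℂ) * Complex.I) * x.2) := (hexp ν).mul contDiff_snd
  exact (hexp (-ν)).mul ((hF.comp (contDiff_fst.prodMk h1)).sub (contDiff_const.mul h1))

section

variable {m : ℤ} {ε A B : ℝ} {R : ℝ → ℂ → ℝ} (hR : IsRemainder R)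

include hR

/-- The linear part is a rotation and disappears in a rotating frame. What remains is quadratic,
hence slower than `|v|` in a small ball, so `δ eᵗ` is a barrier. -/
theorem exists_transOrbit_le_aux : ∃ r : ℝ, 0 < r ∧ r * Real.exp (2 * Real.pi) ≤ 1 ∧
    ∀ ζ, IsTransOrbit m ε A B R ζ → ∀ δ, 0 < δ → δ ≤ r → ‖ζ 0‖ ≤ δ →
      ∀ t ∈ Set.Icc 0 (2 * Real.pi), ‖ζ t‖ ≤ δ * Real.exp t := by
  obtain ⟨C, hC0, hC⟩ := exists_bound_transVF (m := m) (ε := ε) (A := A) (B := B) hR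
  have hexp := Real.exp_pos (2 * Real.pi)
  refine ⟨1 / ((C + 1) * Real.exp (2 * Real.pi)), by positivity, ?_, ?_⟩
  · rw [div_mul_eq_mul_div, one_mul, div_le_one (by positivity)]
    nlinarith
  intro ζ hζ δ hδ hδr h0
  rw [le_div_iff₀ (by positivity)] at hδr
  obtain ⟨ν, hν⟩ : ∃ ν : ℝ, ν = m / 3 + ε := ⟨_, rfl⟩
  rw [← hν] at hC
  obtain ⟨v, hv⟩ : ∃ v : ℝ → ℂ, v = fun t =>
    Complex.exp (((-ν * t : ℝ) : ℂ) * Complex.I) * ζ t := ⟨_, rfl⟩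
  have hnorm : ∀ t, ‖v t‖ = ‖ζ t‖ := fun t => by
    rw [hv]; simp only [norm_mul, Complex.norm_exp_ofReal_mul_I, one_mul]
  have hd : ∀ t ∈ Set.Icc 0 (2 * Real.pi), HasDerivWithinAt v
      (Complex.exp (((-ν * t : ℝ) : ℂ) * Complex.I)
        * (transVF m ε A B R t (ζ t) - Complex.I * (ν : ℂ) * ζ t)) (Set.Icc 0 (2 * Real.pi)) t := by
    intro t ht
    rw [hv]
    refine ((hasDerivAt_exp_mul_I (-ν) t).hasDerivWithinAt.mul (hζ t ht)).congr_deriv ?_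
    push_cast; ring
  have hfence := image_norm_le_of_norm_deriv_right_lt_deriv_boundary (f := v)
    (fun t ht => (hd t ht).continuousWithinAt)
    (fun t ht => (hd t (Set.Ico_subset_Icc_self ht)).mono_of_mem_nhdsWithin
      (Icc_mem_nhdsGE_of_mem ht)) (B := fun t => δ * Real.exp t) (B' := fun t => δ * Real.exp t)
    (by rw [hnorm]; simpa using h0) (fun t => (Real.hasDerivAt_exp t).const_mul δ) (by
      intro t ht heq
      rw [hnorm] at heq
      have ht' := Set.Ico_subset_Icc_self ht
      have hle : δ * Real.exp t ≤ δ * Real.exp (2 * Real.pi) := by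
        have := Real.exp_le_exp.2 ht'.2
        gcongr
      have hB : (C + 1) * (δ * Real.exp t) ≤ 1 := by nlinarith
      have hpos : 0 < δ * Real.exp t := by positivity
      have h1 : ‖ζ t‖ ≤ 1 := by rw [heq]; nlinarith
      have h2 := hC t ht' (ζ t) h1
      rw [norm_mul, Complex.norm_exp_ofReal_mul_I, one_mul]
      refine h2.trans_lt ?_
      rw [heq]
      nlinarith)
  intro t ht
  rw [← hnorm]
  exact hfence ht

/-- Orbits with a small initial value stay small. -/
theorem exists_transOrbit_le : ∃ r : ℝ, 0 < r ∧ r * Real.exp (2 * Real.pi) ≤ 1 ∧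
    ∀ ζ, IsTransOrbit m ε A B R ζ → ‖ζ 0‖ ≤ r →
      ∀ t ∈ Set.Icc 0 (2 * Real.pi), ‖ζ t‖ ≤ Real.exp (2 * Real.pi) * ‖ζ 0‖ := by
  obtain ⟨r, hr, hr1, h⟩ := exists_transOrbit_le_aux (m := m) (ε := ε) (A := A) (B := B) hR
  refine ⟨r, hr, hr1, fun ζ hζ h0 t ht => ?_⟩
  have hexp := Real.exp_pos (2 * Real.pi)
  have hδ : ∀ δ, 0 < δ → δ ≤ r → ‖ζ 0‖ ≤ δ → ‖ζ t‖ ≤ Real.exp (2 * Real.pi) * δ := by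
    intro δ h1 h2 h3
    refine (h ζ hζ δ h1 h2 h3 t ht).trans ?_
    rw [mul_comm]
    have := Real.exp_le_exp.2 ht.2
    gcongr
  -- The barrier needs `δ > 0`, so a zero initial value is handled by taking `δ` small compared with
  -- a supposed nonzero value at time `t`.
  rcases (norm_nonneg (ζ 0)).eq_or_lt with h1 | h1
  · rw [← h1, mul_zero]
    by_contra hc
    have hc' := not_le.1 hc
    have h2 := hδ (min r (‖ζ t‖ / (2 * Real.exp (2 * Real.pi)))) (by positivity) (min_le_left _ _)
      (by rw [← h1]; positivity)
    have h3 : Real.exp (2 * Real.pi) * min r (‖ζ t‖ / (2 * Real.exp (2 * Real.pi)))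
        ≤ Real.exp (2 * Real.pi) * (‖ζ t‖ / (2 * Real.exp (2 * Real.pi))) := by
      gcongr; exact min_le_right _ _
    have h4 : Real.exp (2 * Real.pi) * (‖ζ t‖ / (2 * Real.exp (2 * Real.pi))) = ‖ζ t‖ / 2 := by
      field_simp
    linarith
  · exact hδ _ h1 h0 le_rfl

theorem contDiff_rotVF (ν : ℝ) :
    ContDiff ℝ ∞ (fun x : ℝ × ℂ => rotVF m ε A B R ν x.1 x.2) :=
  contDiff_rotating (contDiff_transVF (m := m) (ε := ε) (A := A) (B := B) hR) ν

/-- In the rotating frame the field is at most `C a²` on the ball of radius `a`, so for small `a`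
the orbits starting within `a/2` stay inside during the whole time `2π`, and one application of
Picard–Lindelöf suffices. -/
theorem exists_transOrbit : ∃ r : ℝ, 0 < r ∧ ∀ z : ℂ, ‖z‖ ≤ r →
    ∃ ζ, IsTransOrbit m ε A B R ζ ∧ ζ 0 = z := by
  obtain ⟨C, hC0, hC⟩ := exists_bound_transVF (m := m) (ε := ε) (A := A) (B := B) hR
  obtain ⟨ν, hν⟩ : ∃ ν : ℝ, ν = m / 3 + ε := ⟨_, rfl⟩
  rw [← hν] at hC
  obtain ⟨W, hW⟩ : ∃ W : ℝ → ℂ → ℂ, W = rotVF m ε A B R ν := ⟨_, rfl⟩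
  have hWs : ContDiff ℝ ∞ (fun x : ℝ × ℂ => W x.1 x.2) := by rw [hW]; exact contDiff_rotVF hR ν
  have hpi := Real.pi_pos
  obtain ⟨a, ha⟩ : ∃ a : ℝ, a = 1 / (4 * Real.pi * (C + 1) + 1) := ⟨_, rfl⟩
  have ha0 : 0 < a := by rw [ha]; positivity
  have haC : 4 * Real.pi * (C + 1) * a ≤ 1 := by
    rw [ha, mul_one_div, div_le_one (by positivity)]; linarith
  have ha1 : a ≤ 1 := by
    rw [ha, div_le_one (by positivity)]
    have : 0 ≤ 4 * Real.pi * (C + 1) := by positivity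
    linarith
  have hWle : ∀ t ∈ Set.Icc 0 (2 * Real.pi), ∀ v : ℂ, ‖v‖ ≤ a → ‖W t v‖ ≤ C * a ^ 2 := by
    intro t ht v hv
    have hn : ‖Complex.exp (((ν * t : ℝ) : ℂ) * Complex.I) * v‖ = ‖v‖ := by
      rw [norm_mul, Complex.norm_exp_ofReal_mul_I, one_mul]
    have h1 := hC t ht (Complex.exp (((ν * t : ℝ) : ℂ) * Complex.I) * v)
      (by rw [hn]; exact hv.trans ha1)
    rw [hn] at h1
    rw [hW, rotVF, norm_mul, Complex.norm_exp_ofReal_mul_I, one_mul]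
    refine h1.trans ?_
    gcongr
  obtain ⟨K, hK⟩ := hWs.contDiffOn.exists_lipschitzOnWith (s := Set.Icc 0 (2 * Real.pi)
    ×ˢ Metric.closedBall (0 : ℂ) a) (by simp) ((convex_Icc _ _).prod (convex_closedBall _ _))
    (isCompact_Icc.prod (isCompact_closedBall _ _))
  have e1 : (a.toNNReal : ℝ) = a := Real.coe_toNNReal _ ha0.le
  have e2 : ((a / 2).toNNReal : ℝ) = a / 2 := Real.coe_toNNReal _ (by positivity)
  have e3 : ((C * a ^ 2).toNNReal : ℝ) = C * a ^ 2 := Real.coe_toNNReal _ (by positivity)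
  have hPL : IsPicardLindelof W (tmin := 0) (tmax := 2 * Real.pi)
      ⟨0, ⟨le_rfl, Real.two_pi_pos.le⟩⟩ (0 : ℂ) a.toNNReal (a / 2).toNNReal
      (C * a ^ 2).toNNReal K := by
    refine ⟨fun t ht => ?_, fun v _ => ?_, fun t ht v hv => ?_, ?_⟩
    · rw [e1]
      refine LipschitzOnWith.of_dist_le_mul fun x hx y hy => ?_
      have := hK.dist_le_mul (t, x) ⟨ht, hx⟩ (t, y) ⟨ht, hy⟩
      simpa [Prod.dist_eq] using this
    · exact (hWs.continuous.comp (f := fun t : ℝ => (t, v)) (by fun_prop)).continuousOn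
    · rw [e3]; rw [e1] at hv; exact hWle t ht v (by simpa using hv)
    · simp only [e1, e2, e3, sub_zero, sub_self]
      rw [max_eq_left Real.two_pi_pos.le]
      have h1 : C * a ^ 2 * (2 * Real.pi) = a / 2 * (4 * Real.pi * C * a) := by ring
      have h2 : 4 * Real.pi * C * a ≤ 1 := by
        have : 0 ≤ 4 * Real.pi * a := by positivity
        linarith
      rw [h1]
      nlinarith
  refine ⟨a / 2, by positivity, fun z hz => ?_⟩
  obtain ⟨α, hα0, hα⟩ := hPL.exists_eq_forall_mem_Icc_hasDerivWithinAt (x := z)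
    (by rw [e2]; simpa using hz)
  refine ⟨fun t => Complex.exp (((ν * t : ℝ) : ℂ) * Complex.I) * α t, fun t ht => ?_, ?_⟩
  · refine ((hasDerivAt_exp_mul_I ν t).hasDerivWithinAt.mul (hα t ht)).congr_deriv ?_
    have h1 := exp_neg_mul_exp ν t
    rw [hW, rotVF]
    linear_combination (transVF m ε A B R t
      (Complex.exp (((ν * t : ℝ) : ℂ) * Complex.I) * α t) - Complex.I * (ν : ℂ)
        * (Complex.exp (((ν * t : ℝ) : ℂ) * Complex.I) * α t)) * h1
  · simpa using hα0

end

/-- The Poincaré map exists near the origin. -/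
theorem exists_isPoincareMap (m : ℤ) {ε A B : ℝ} {R : ℝ → ℂ → ℝ} (hR : IsRemainder R) :
    ∃ f, IsPoincareMap (fullHam m ε A B R) f := by
  obtain ⟨r, hr, h⟩ := exists_transOrbit (m := m) (ε := ε) (A := A) (B := B) hR
  refine Filter.Eventually.choice (r := fun z w => ∃ (T : ℝ) (s E : ℝ → ℝ) (ζ : ℝ → ℂ), 0 < T ∧
    IsOrbit (fullHam m ε A B R) T s E ζ ∧ s 0 = 0 ∧ ζ 0 = z ∧
    fullHam m ε A B R (s 0, E 0, ζ 0) = 0 ∧ (∀ t ∈ Set.Ioo 0 T, s t ∈ Set.Ioo 0 (2 * Real.pi)) ∧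
    s T = 2 * Real.pi ∧ ζ T = w) ?_
  filter_upwards [Metric.closedBall_mem_nhds (0 : ℂ) hr] with z hz
  obtain ⟨ζ, hζ, h0⟩ := h z (by simpa using hz)
  refine ⟨ζ (2 * Real.pi), 2 * Real.pi, id, _, ζ, Real.two_pi_pos,
    isOrbit_of_transverse hR hζ, rfl, h0, ?_, fun t ht => ht, rfl, rfl⟩
  simp [fullHam, transHam, add_assoc]

/-- The Poincaré map is the time-`2π` map of the transverse equation. -/
theorem IsPoincareMap.exists_transOrbit {m : ℤ} {ε A B : ℝ} {R : ℝ → ℂ → ℝ} (hR : IsRemainder R)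
    {f : ℂ → ℂ} (hf : IsPoincareMap (fullHam m ε A B R) f) :
    ∀ᶠ z in 𝓝 (0 : ℂ), ∃ ζ, IsTransOrbit m ε A B R ζ ∧ ζ 0 = z ∧ ζ (2 * Real.pi) = f z := by
  filter_upwards [hf] with z hz
  obtain ⟨T, s, E, ζ, hT, horb, hs0, h0, -, -, hsT, hζT⟩ := hz
  obtain ⟨h1, h2⟩ := horb.transverse hR hT hs0 hsT
  exact ⟨ζ, h2, h0, h1 ▸ hζT⟩


/-! ### The Birkhoff normal form -/

/-- A solution of a perturbed rotation, in the frame rotating with angular velocity `a`. -/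
theorem norm_sub_rotation_le {u e : ℝ → ℂ} {T M : ℝ} (a : ℝ)
    (hu : ∀ t ∈ Set.Icc 0 T, HasDerivWithinAt u (Complex.I * a * u t + e t) (Set.Icc 0 T) t)
    (he : ∀ t ∈ Set.Icc 0 T, ‖e t‖ ≤ M) {t : ℝ} (ht : t ∈ Set.Icc 0 T) :
    ‖u t - Complex.exp (((a * t : ℝ) : ℂ) * Complex.I) * u 0‖ ≤ M * t := by
  obtain ⟨v, hv⟩ : ∃ v : ℝ → ℂ, v = fun t =>
    Complex.exp (((-a * t : ℝ) : ℂ) * Complex.I) * u t := ⟨_, rfl⟩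
  have hd : ∀ t ∈ Set.Icc 0 T, HasDerivWithinAt v
      (Complex.exp (((-a * t : ℝ) : ℂ) * Complex.I) * e t) (Set.Icc 0 T) t := by
    intro t ht
    rw [hv]
    refine ((hasDerivAt_exp_mul_I (-a) t).hasDerivWithinAt.mul (hu t ht)).congr_deriv ?_
    push_cast; ring
  have h1 := norm_image_sub_le_of_norm_deriv_le_segment' hd (C := M) (fun t ht => by
    rw [norm_mul, Complex.norm_exp_ofReal_mul_I, one_mul]
    exact he t (Set.Ico_subset_Icc_self ht)) t ht
  have h2 := exp_neg_mul_exp a t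
  have h3 : u t - Complex.exp (((a * t : ℝ) : ℂ) * Complex.I) * u 0
      = Complex.exp (((a * t : ℝ) : ℂ) * Complex.I) * (v t - v 0) := by
    rw [hv]
    simp only [mul_zero, Complex.ofReal_zero, zero_mul, Complex.exp_zero, one_mul]
    linear_combination -u t * h2
  rw [h3, norm_mul, Complex.norm_exp_ofReal_mul_I, one_mul]
  simpa using h1

/-- An orbit of a perturbation of order four of the integrable equation `u' = i(ε + τ|u|²)u`. -/
theorem norm_sub_twist_le {u e : ℝ → ℂ} {T K r ε τ : ℝ} (hT : 0 ≤ T) (hK : 0 ≤ K) (hr : 0 ≤ r)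
    (hr1 : r ≤ 1)
    (hu : ∀ t ∈ Set.Icc 0 T, HasDerivWithinAt u
      (Complex.I * ((ε + τ * Complex.normSq (u t) : ℝ) : ℂ) * u t + e t) (Set.Icc 0 T) t)
    (he : ∀ t ∈ Set.Icc 0 T, ‖e t‖ ≤ K * r ^ 4) (hur : ∀ t ∈ Set.Icc 0 T, ‖u t‖ ≤ K * r) :
    ‖u T - Complex.exp ((((ε + τ * Complex.normSq (u 0)) * T : ℝ) : ℂ) * Complex.I) * u 0‖
      ≤ (2 * |τ| * K ^ 2 * (|τ| * K ^ 3 + K) * T + K) * T * r ^ 4 := by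
  have hr43 : r ^ 4 ≤ r ^ 3 := pow_le_pow_of_le_one hr hr1 (by norm_num)
  have hr54 : r ^ 5 ≤ r ^ 4 := pow_le_pow_of_le_one hr hr1 (by norm_num)
  have hT0 : (0 : ℝ) ∈ Set.Icc 0 T := ⟨le_rfl, hT⟩
  have hτ := abs_nonneg τ
  -- A crude comparison with the pure rotation has error of order three; by `h2` this already keeps
  -- `|u|²` constant up to order four.
  have h1 : ∀ t ∈ Set.Icc 0 T, ‖u t - Complex.exp (((ε * t : ℝ) : ℂ) * Complex.I) * u 0‖
      ≤ (|τ| * K ^ 3 + K) * r ^ 3 * t := by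
    intro t ht
    refine norm_sub_rotation_le (e := fun t => Complex.I * ((τ * Complex.normSq (u t) : ℝ) : ℂ) * u t
      + e t) ε (fun t ht => (hu t ht).congr_deriv ?_) (fun t ht => ?_) ht
    · push_cast; ring
    · refine (norm_add_le _ _).trans ?_
      have h2 : ‖Complex.I * ((τ * Complex.normSq (u t) : ℝ) : ℂ) * u t‖ = |τ| * ‖u t‖ ^ 3 := by
        rw [norm_mul, norm_mul, Complex.norm_I, Complex.norm_real, ← Complex.sq_norm, norm_mul,
          Real.norm_eq_abs, norm_pow, norm_norm]
        ring
      have h3 : ‖u t‖ ^ 3 ≤ (K * r) ^ 3 := pow_le_pow_left₀ (norm_nonneg _) (hur t ht) 3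
      have h4 := he t ht
      rw [h2]
      have h5 : |τ| * ‖u t‖ ^ 3 ≤ |τ| * (K * r) ^ 3 := by gcongr
      have h6 : K * r ^ 4 ≤ K * r ^ 3 := by gcongr
      nlinarith
  have h2 : ∀ t ∈ Set.Icc 0 T, |Complex.normSq (u t) - Complex.normSq (u 0)|
      ≤ 2 * K * (|τ| * K ^ 3 + K) * T * r ^ 4 := by
    intro t ht
    have h3 : |‖u t‖ - ‖u 0‖| ≤ (|τ| * K ^ 3 + K) * r ^ 3 * t := by
      have h4 := abs_norm_sub_norm_le (u t) (Complex.exp (((ε * t : ℝ) : ℂ) * Complex.I) * u 0)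
      rw [norm_mul, Complex.norm_exp_ofReal_mul_I, one_mul] at h4
      exact h4.trans (h1 t ht)
    rw [← Complex.sq_norm, ← Complex.sq_norm, sq_sub_sq, abs_mul,
      abs_of_nonneg (add_nonneg (norm_nonneg _) (norm_nonneg _))]
    calc (‖u t‖ + ‖u 0‖) * |‖u t‖ - ‖u 0‖|
        ≤ (K * r + K * r) * ((|τ| * K ^ 3 + K) * r ^ 3 * T) := by
          have h5 := hur t ht
          have h6 := hur 0 hT0
          have h7 : (|τ| * K ^ 3 + K) * r ^ 3 * t ≤ (|τ| * K ^ 3 + K) * r ^ 3 * T := by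
            gcongr; exact ht.2
          exact mul_le_mul (add_le_add h5 h6) (h3.trans h7) (abs_nonneg _) (by positivity)
      _ = _ := by ring
  -- The frequency can now be frozen at the initial value of `|u|²`, and the deviation is part of
  -- the order-four error.
  have h3 := norm_sub_rotation_le (u := u) (T := T)
    (M := (2 * |τ| * K ^ 2 * (|τ| * K ^ 3 + K) * T + K) * r ^ 4)
    (e := fun t => Complex.I * ((τ * (Complex.normSq (u t) - Complex.normSq (u 0)) : ℝ) : ℂ) * u t
      + e t) (ε + τ * Complex.normSq (u 0)) (fun t ht => (hu t ht).congr_deriv ?_)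
    (fun t ht => ?_) (t := T) ⟨hT, le_rfl⟩
  · refine h3.trans (le_of_eq (by ring))
  · push_cast; ring
  · refine (norm_add_le _ _).trans ?_
    have h4 : ‖Complex.I * ((τ * (Complex.normSq (u t) - Complex.normSq (u 0)) : ℝ) : ℂ) * u t‖
        = |τ| * |Complex.normSq (u t) - Complex.normSq (u 0)| * ‖u t‖ := by
      rw [norm_mul, norm_mul, Complex.norm_I, Complex.norm_real, norm_mul,
        Real.norm_eq_abs, Real.norm_eq_abs, one_mul]
    rw [h4]
    have h5 := h2 t ht
    have h6 := hur t ht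
    have h7 : |τ| * |Complex.normSq (u t) - Complex.normSq (u 0)| * ‖u t‖
        ≤ |τ| * (2 * K * (|τ| * K ^ 3 + K) * T * r ^ 4) * (K * r) := by gcongr
    have h8 : |τ| * (2 * K * (|τ| * K ^ 3 + K) * T * r ^ 4) * (K * r)
        = 2 * |τ| * K ^ 2 * (|τ| * K ^ 3 + K) * T * r ^ 5 := by ring
    have h9 : 2 * |τ| * K ^ 2 * (|τ| * K ^ 3 + K) * T * r ^ 5
        ≤ 2 * |τ| * K ^ 2 * (|τ| * K ^ 3 + K) * T * r ^ 4 := by gcongr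
    have h10 := he t ht
    linarith

/-- The change of coordinates removing the resonant cubic terms. -/
noncomputable def birkhoffMap (c : ℝ) (w : ℂ) : ℂ :=
  w + c * (starRingEnd ℂ w) ^ 2 + c ^ 2 * (Complex.normSq w : ℂ) * w

/-- The derivative of `birkhoffMap c` at `w` in the direction `v`. -/
noncomputable def birkhoffDeriv (c : ℝ) (w v : ℂ) : ℂ :=
  v + 2 * c * starRingEnd ℂ w * starRingEnd ℂ v
    + c ^ 2 * (2 * (Complex.normSq w : ℂ) * v + w ^ 2 * starRingEnd ℂ v)

theorem hasDerivWithinAt_birkhoffMap {c : ℝ} {w : ℝ → ℂ} {v : ℂ} {s : Set ℝ} {t : ℝ}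
    (hw : HasDerivWithinAt w v s t) :
    HasDerivWithinAt (fun t => birkhoffMap c (w t)) (birkhoffDeriv c (w t) v) s t := by
  have h1 : HasDerivWithinAt (fun t => starRingEnd ℂ (w t)) (starRingEnd ℂ v) s t :=
    Complex.conjCLE.hasFDerivAt.comp_hasDerivWithinAt t hw
  have h2 := (hw.add ((h1.pow 2).const_mul (c : ℂ))).add
    (((hw.mul h1).mul hw).const_mul ((c : ℂ) ^ 2))
  refine (h2.congr_deriv ?_).congr (fun x _ => ?_) ?_
  · simp only [birkhoffDeriv, Pi.mul_apply, Complex.normSq_eq_conj_mul_self]; push_cast; ring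
  · simp only [birkhoffMap, Pi.mul_apply, Complex.normSq_eq_conj_mul_self]
    simp; ring
  · simp only [birkhoffMap, Pi.mul_apply, Complex.normSq_eq_conj_mul_self]
    simp; ring

/-- All monomials `w`, `w̄²`, `|w|²w` are equivariant under the cube roots of unity. At time `2π`
the rotating frame has turned by such a root, so the substitution commutes with the return to the
original frame. -/
theorem birkhoffMap_rotation (c : ℝ) {l : ℂ} (hl : l ^ 3 = 1) (w : ℂ) :
    birkhoffMap c (l * w) = l * birkhoffMap c w := by
  have hn : ‖l‖ = 1 := by
    have := congrArg norm hl
    rw [norm_pow, norm_one] at this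
    exact (pow_eq_one_iff_of_nonneg (norm_nonneg _) (by norm_num)).1 this
  have h1 : starRingEnd ℂ l * l = 1 := by
    rw [← Complex.normSq_eq_conj_mul_self, ← Complex.sq_norm, hn]; simp
  have h2 : starRingEnd ℂ l ^ 2 = l := by
    linear_combination (l * starRingEnd ℂ l + 1) * l * h1 - starRingEnd ℂ l ^ 2 * hl
  simp only [birkhoffMap, Complex.normSq_eq_conj_mul_self]
  simp only [map_mul]
  linear_combination c * starRingEnd ℂ w ^ 2 * h2
    + (c : ℂ) ^ 2 * starRingEnd ℂ w * w ^ 2 * l * h1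

theorem birkhoffDeriv_add (c : ℝ) (w v₁ v₂ : ℂ) :
    birkhoffDeriv c w (v₁ + v₂) = birkhoffDeriv c w v₁ + birkhoffDeriv c w v₂ := by
  simp only [birkhoffDeriv, map_add]; ring

/-- The normal form up to terms of order four. -/
theorem birkhoffDeriv_resonant (c ε A : ℝ) (w : ℂ) :
    birkhoffDeriv c w (Complex.I * (ε * w + A * (Complex.normSq w : ℂ) * w
      + 3 * ε * c * starRingEnd ℂ w ^ 2))
    = Complex.I * ε * birkhoffMap c w
      + Complex.I * ((A - 6 * ε * c ^ 2 : ℝ) : ℂ) * (Complex.normSq w : ℂ) * w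
      + Complex.I * (-2 * c * A * starRingEnd ℂ w ^ 3 * w + c ^ 2 * (A * w ^ 3 * starRingEnd ℂ w ^ 2
        + 6 * ε * c * starRingEnd ℂ w ^ 3 * w - 3 * ε * c * w ^ 4)) := by
  simp only [birkhoffDeriv, birkhoffMap, Complex.normSq_eq_conj_mul_self, map_mul, map_add,
    map_pow, Complex.conj_I, Complex.conj_ofReal, Complex.conj_conj, map_ofNat]
  push_cast
  ring


theorem norm_birkhoffMap_sub_le (c : ℝ) {w : ℂ} (hw : ‖w‖ ≤ 1) :
    ‖birkhoffMap c w - w‖ ≤ (|c| + c ^ 2) * ‖w‖ ^ 2 := by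
  have h1 : birkhoffMap c w - w = c * (starRingEnd ℂ w) ^ 2
      + c ^ 2 * (Complex.normSq w : ℂ) * w := by simp only [birkhoffMap]; ring
  have h2 : ‖w‖ ^ 3 ≤ ‖w‖ ^ 2 := pow_le_pow_of_le_one (norm_nonneg _) hw (by norm_num)
  have h3 : ‖(c : ℂ) * (starRingEnd ℂ w) ^ 2‖ = |c| * ‖w‖ ^ 2 := by simp
  have h4 : ‖(c : ℂ) ^ 2 * (Complex.normSq w : ℂ) * w‖ = c ^ 2 * ‖w‖ ^ 3 := by
    rw [norm_mul, norm_mul, norm_pow, Complex.norm_real, Complex.norm_real, ← Complex.sq_norm,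
      norm_pow, norm_norm, Real.norm_eq_abs, sq_abs]; ring
  rw [h1]
  refine (norm_add_le _ _).trans ?_
  rw [h3, h4]
  nlinarith [sq_nonneg c]

theorem norm_birkhoffMap_le (c : ℝ) {w : ℂ} (hw : ‖w‖ ≤ 1) :
    ‖birkhoffMap c w‖ ≤ (1 + |c| + c ^ 2) * ‖w‖ := by
  have h1 := norm_birkhoffMap_sub_le c hw
  have h2 : ‖w‖ ^ 2 ≤ ‖w‖ := by nlinarith [norm_nonneg w]
  have h3 := norm_le_norm_add_norm_sub' (birkhoffMap c w) w
  have h4 : (|c| + c ^ 2) * ‖w‖ ^ 2 ≤ (|c| + c ^ 2) * ‖w‖ := by gcongr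
  linarith

theorem norm_birkhoffDeriv_le (c : ℝ) {w : ℂ} (hw : ‖w‖ ≤ 1) (v : ℂ) :
    ‖birkhoffDeriv c w v‖ ≤ (1 + 2 * |c| + 3 * c ^ 2) * ‖v‖ := by
  have hv := norm_nonneg v
  have hn := norm_nonneg w
  have h2 : ‖w‖ ^ 2 ≤ 1 := pow_le_one₀ hn hw
  have h3 : ‖2 * (c : ℂ) * starRingEnd ℂ w * starRingEnd ℂ v‖ ≤ 2 * |c| * ‖v‖ := by
    simp only [norm_mul, RCLike.norm_conj, Complex.norm_ofNat, Complex.norm_real, Real.norm_eq_abs]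
    have : 2 * |c| * ‖w‖ ≤ 2 * |c| * 1 := by gcongr
    nlinarith
  have h4 : ‖(c : ℂ) ^ 2 * (2 * (Complex.normSq w : ℂ) * v + w ^ 2 * starRingEnd ℂ v)‖
      ≤ 3 * c ^ 2 * ‖v‖ := by
    rw [norm_mul, norm_pow, Complex.norm_real, Real.norm_eq_abs, sq_abs]
    have h5 : ‖2 * (Complex.normSq w : ℂ) * v + w ^ 2 * starRingEnd ℂ v‖ ≤ 3 * ‖v‖ := by
      refine (norm_add_le _ _).trans ?_
      simp only [norm_mul, RCLike.norm_conj, Complex.norm_ofNat, Complex.norm_real, norm_pow,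
        ← Complex.sq_norm, norm_norm]
      nlinarith
    calc _ ≤ c ^ 2 * (3 * ‖v‖) := by gcongr
      _ = _ := by ring
  rw [birkhoffDeriv]
  refine (norm_add₃_le).trans ?_
  linarith

theorem norm_normSq_mul_sub_le (a b : ℂ) :
    ‖(Complex.normSq a : ℂ) * a - (Complex.normSq b : ℂ) * b‖
      ≤ (‖a‖ ^ 2 + (‖a‖ + ‖b‖) * ‖b‖) * ‖a - b‖ := by
  have h1 : (Complex.normSq a : ℂ) * a - (Complex.normSq b : ℂ) * b
      = ((‖a‖ ^ 2 : ℝ) : ℂ) * (a - b) + (((‖a‖ + ‖b‖) * (‖a‖ - ‖b‖) : ℝ) : ℂ) * b := by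
    rw [← Complex.sq_norm, ← Complex.sq_norm]; push_cast; ring
  have h2 := abs_norm_sub_norm_le a b
  rw [h1]
  refine (norm_add_le _ _).trans ?_
  rw [norm_mul, norm_mul, Complex.norm_real, Complex.norm_real, norm_mul, norm_pow, norm_norm,
    Real.norm_eq_abs, Real.norm_eq_abs, abs_of_nonneg (add_nonneg (norm_nonneg a) (norm_nonneg b))]
  have h3 : (‖a‖ + ‖b‖) * |‖a‖ - ‖b‖| * ‖b‖ ≤ (‖a‖ + ‖b‖) * ‖a - b‖ * ‖b‖ := by gcongr
  linarith

/-- `birkhoffDeriv_resonant` has no quadratic term outside `iε · birkhoffMap c w`. Replacing `|w|²w`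
by the same cubic expression in the new coordinate costs only order four, because the two
coordinates differ by order two. -/
theorem exists_bound_birkhoffDeriv (c ε A : ℝ) : ∃ C : ℝ, 0 ≤ C ∧ ∀ w ρ : ℂ, ‖w‖ ≤ 1 →
    ‖birkhoffDeriv c w (Complex.I * (ε * w + A * (Complex.normSq w : ℂ) * w
      + 3 * ε * c * starRingEnd ℂ w ^ 2) + ρ)
      - Complex.I * ((ε + (A - 6 * ε * c ^ 2) * Complex.normSq (birkhoffMap c w) : ℝ) : ℂ)
        * birkhoffMap c w‖ ≤ C * (‖w‖ ^ 4 + ‖ρ‖) := by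
  obtain ⟨M, hM⟩ : ∃ M : ℝ, M = 1 + |c| + c ^ 2 := ⟨_, rfl⟩
  have hM1 : 1 ≤ M := by rw [hM]; have := abs_nonneg c; nlinarith [sq_nonneg c]
  obtain ⟨D, hD⟩ : ∃ D : ℝ, D = 1 + 2 * |c| + 3 * c ^ 2 := ⟨_, rfl⟩
  have hD0 : 0 ≤ D := by rw [hD]; positivity
  refine ⟨D + (2 * |c| * |A| + c ^ 2 * (|A| + 9 * |ε| * |c|)) + |A - 6 * ε * c ^ 2| * (3 * M ^ 3),
    by positivity, fun w ρ hw => ?_⟩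
  obtain ⟨τ, hτ⟩ : ∃ τ : ℝ, τ = A - 6 * ε * c ^ 2 := ⟨_, rfl⟩
  have hn := norm_nonneg w
  have hρ := norm_nonneg ρ
  have h54 : ‖w‖ ^ 5 ≤ ‖w‖ ^ 4 := pow_le_pow_of_le_one hn hw (by norm_num)
  have hw4 : 0 ≤ ‖w‖ ^ 4 := by positivity
  rw [birkhoffDeriv_add, birkhoffDeriv_resonant, ← hτ]
  have h1 := norm_birkhoffDeriv_le c hw ρ
  rw [← hD] at h1
  have h2 : ‖Complex.I * (-2 * c * A * starRingEnd ℂ w ^ 3 * w + c ^ 2 * (A * w ^ 3 * starRingEnd ℂ w ^ 2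
        + 6 * ε * c * starRingEnd ℂ w ^ 3 * w - 3 * ε * c * w ^ 4))‖
      ≤ (2 * |c| * |A| + c ^ 2 * (|A| + 9 * |ε| * |c|)) * ‖w‖ ^ 4 := by
    rw [norm_mul, Complex.norm_I, one_mul]
    have e1 : ‖-2 * c * A * starRingEnd ℂ w ^ 3 * w‖ = 2 * |c| * |A| * ‖w‖ ^ 4 := by
      simp only [norm_mul, norm_pow, RCLike.norm_conj, norm_neg, Complex.norm_ofNat,
        Complex.norm_real, Real.norm_eq_abs]; ring
    have e2 : ‖A * w ^ 3 * starRingEnd ℂ w ^ 2‖ = |A| * ‖w‖ ^ 5 := by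
      simp only [norm_mul, norm_pow, RCLike.norm_conj, Complex.norm_real, Real.norm_eq_abs]; ring
    have e3 : ‖6 * ε * c * starRingEnd ℂ w ^ 3 * w‖ = 6 * |ε| * |c| * ‖w‖ ^ 4 := by
      simp only [norm_mul, norm_pow, RCLike.norm_conj, Complex.norm_ofNat,
        Complex.norm_real, Real.norm_eq_abs]; ring
    have e4 : ‖3 * ε * c * w ^ 4‖ = 3 * |ε| * |c| * ‖w‖ ^ 4 := by
      simp only [norm_mul, norm_pow, Complex.norm_ofNat, Complex.norm_real, Real.norm_eq_abs]
    have e5 : ‖A * w ^ 3 * starRingEnd ℂ w ^ 2 + 6 * ε * c * starRingEnd ℂ w ^ 3 * w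
        - 3 * ε * c * w ^ 4‖ ≤ (|A| + 9 * |ε| * |c|) * ‖w‖ ^ 4 := by
      refine (norm_sub_le _ _).trans ?_
      refine (add_le_add_left (norm_add_le _ _) _).trans ?_
      rw [e2, e3, e4]
      nlinarith [abs_nonneg A]
    refine (norm_add_le _ _).trans ?_
    rw [e1, norm_mul, norm_pow, Complex.norm_real, Real.norm_eq_abs, sq_abs]
    have := mul_le_mul_of_nonneg_left e5 (sq_nonneg c)
    linarith
  have h3 : ‖Complex.I * (τ : ℂ) * ((Complex.normSq (birkhoffMap c w) : ℂ) * birkhoffMap c w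
      - (Complex.normSq w : ℂ) * w)‖ ≤ |τ| * (3 * M ^ 3) * ‖w‖ ^ 4 := by
    rw [norm_mul, norm_mul, Complex.norm_I, Complex.norm_real, Real.norm_eq_abs, one_mul, mul_assoc]
    refine mul_le_mul_of_nonneg_left ((norm_normSq_mul_sub_le _ _).trans ?_) (abs_nonneg _)
    have e1 := norm_birkhoffMap_le c hw
    rw [← hM] at e1
    have e2 : ‖birkhoffMap c w - w‖ ≤ M * ‖w‖ ^ 2 := by
      refine (norm_birkhoffMap_sub_le c hw).trans ?_
      have : |c| + c ^ 2 ≤ M := by rw [hM]; linarith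
      gcongr
    have e3 : ‖w‖ ≤ M * ‖w‖ := by nlinarith
    calc (‖birkhoffMap c w‖ ^ 2 + (‖birkhoffMap c w‖ + ‖w‖) * ‖w‖) * ‖birkhoffMap c w - w‖
        ≤ ((M * ‖w‖) ^ 2 + (M * ‖w‖ + M * ‖w‖) * (M * ‖w‖)) * (M * ‖w‖ ^ 2) := by gcongr
      _ = _ := by ring
  have h4 : ∀ a b d : ℂ, ‖a + b - d‖ ≤ ‖a‖ + ‖b‖ + ‖d‖ := fun a b d =>
    (norm_sub_le _ _).trans (add_le_add_left (norm_add_le _ _) _)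
  have h5 := h4 (birkhoffDeriv c w ρ)
    (Complex.I * (-2 * c * A * starRingEnd ℂ w ^ 3 * w + c ^ 2 * (A * w ^ 3 * starRingEnd ℂ w ^ 2
        + 6 * ε * c * starRingEnd ℂ w ^ 3 * w - 3 * ε * c * w ^ 4)))
    (Complex.I * (τ : ℂ) * ((Complex.normSq (birkhoffMap c w) : ℂ) * birkhoffMap c w
      - (Complex.normSq w : ℂ) * w))
  refine (le_trans (le_of_eq (congrArg norm ?_)) h5).trans ?_
  · push_cast; ring
  · have h6 : 0 ≤ (2 * |c| * |A| + c ^ 2 * (|A| + 9 * |ε| * |c|)) + |τ| * (3 * M ^ 3) := by positivity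
    have h7 : 0 ≤ D * ‖w‖ ^ 4 := by positivity
    nlinarith

theorem radialAction_eq (z : ℂ) : radialAction z = Complex.normSq z / 2 := by
  rw [radialAction, Complex.sq_norm]

/-- The transverse equation in the frame rotating with the resonance. -/
theorem IsTransOrbit.rotating {m : ℤ} {ε A B : ℝ} {R : ℝ → ℂ → ℝ} {ζ : ℝ → ℂ} (hζ : IsTransOrbit m ε A B R ζ) {c : ℝ}
    (hc : 3 * ε * c = 3 * (B / (2 * √2))) :
    ∀ t ∈ Set.Icc 0 (2 * Real.pi), HasDerivWithinAt
      (fun t => Complex.exp (((-(m / 3 : ℝ) * t : ℝ) : ℂ) * Complex.I) * ζ t)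
      (Complex.I * (ε * (Complex.exp (((-(m / 3 : ℝ) * t : ℝ) : ℂ) * Complex.I) * ζ t)
        + A * (Complex.normSq (Complex.exp (((-(m / 3 : ℝ) * t : ℝ) : ℂ) * Complex.I) * ζ t) : ℂ)
          * (Complex.exp (((-(m / 3 : ℝ) * t : ℝ) : ℂ) * Complex.I) * ζ t)
        + 3 * ε * c * starRingEnd ℂ (Complex.exp (((-(m / 3 : ℝ) * t : ℝ) : ℂ) * Complex.I) * ζ t) ^ 2)
        + Complex.exp (((-(m / 3 : ℝ) * t : ℝ) : ℂ) * Complex.I) * hamVF (R t) (ζ t))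
      (Set.Icc 0 (2 * Real.pi)) t := by
  intro t ht
  refine ((hasDerivAt_exp_mul_I (-(m / 3 : ℝ)) t).hasDerivWithinAt.mul (hζ t ht)).congr_deriv ?_
  have h1 : Complex.normSq (Complex.exp (((-(m / 3 : ℝ) * t : ℝ) : ℂ) * Complex.I) * ζ t)
      = Complex.normSq (ζ t) := by
    rw [← Complex.sq_norm, ← Complex.sq_norm, norm_mul, Complex.norm_exp_ofReal_mul_I, one_mul]
  -- The conjugate square of the frame rotation absorbs the phase `e^{imt}`, so the resonant term
  -- becomes independent of time.
  have h2 : starRingEnd ℂ (Complex.exp (((-(m / 3 : ℝ) * t : ℝ) : ℂ) * Complex.I)) ^ 2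
      = Complex.exp (((-(m / 3 : ℝ) * t : ℝ) : ℂ) * Complex.I)
        * Complex.exp (((m * t : ℝ) : ℂ) * Complex.I) := by
    rw [← Complex.exp_conj, ← Complex.exp_nat_mul, ← Complex.exp_add]
    congr 1
    simp only [map_mul, Complex.conj_ofReal, Complex.conj_I]
    push_cast; ring
  have h3 : (3 * ε * c : ℂ) = 3 * ((B / (2 * √2) : ℝ) : ℂ) := by
    rw [← Complex.ofReal_ofNat, ← Complex.ofReal_mul, ← Complex.ofReal_mul, ← Complex.ofReal_mul, hc]
  rw [h1, map_mul, mul_pow, h2, h3, transVF]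
  push_cast
  ring

section

variable {m : ℤ} {ε A B : ℝ} {R : ℝ → ℂ → ℝ} (hR : IsRemainder R)

include hR

theorem IsTransOrbit.birkhoff (hε : ε ≠ 0) : ∃ C r : ℝ, 0 < r ∧
    ∀ ζ, IsTransOrbit m ε A B R ζ → ‖ζ 0‖ ≤ r →
      ‖birkhoffMap (B / (2 * √2 * ε)) (ζ (2 * Real.pi))
        - Complex.exp (((2 * Real.pi * ((m / 3 + ε) + (2 * A - 3 * B ^ 2 / (2 * ε))
          * radialAction (birkhoffMap (B / (2 * √2 * ε)) (ζ 0))) : ℝ) : ℂ) * Complex.I)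
          * birkhoffMap (B / (2 * √2 * ε)) (ζ 0)‖ ≤ C * ‖ζ 0‖ ^ 4 ∧
      ‖ζ (2 * Real.pi)‖ ≤ Real.exp (2 * Real.pi) * ‖ζ 0‖ := by
  obtain ⟨c, hc⟩ : ∃ c : ℝ, c = B / (2 * √2 * ε) := ⟨_, rfl⟩
  have hsq : √2 ^ 2 = 2 := Real.sq_sqrt (by norm_num)
  have hc1 : 3 * ε * c = 3 * (B / (2 * √2)) := by
    rw [hc]; field_simp
  -- The factor `2` converts `|u|²` into `J = |u|²/2`, and `c² = B²/(8ε²)`.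
  have hτ : 2 * A - 3 * B ^ 2 / (2 * ε) = 2 * (A - 6 * ε * c ^ 2) := by
    rw [hc, div_pow, mul_pow, mul_pow, hsq]; field_simp; ring
  rw [hτ, ← hc]
  obtain ⟨r, hr, hr1, hbd⟩ := exists_transOrbit_le (m := m) (ε := ε) (A := A) (B := B) hR
  obtain ⟨C₁, hC₁, hH⟩ := hR.exists_bound_hamVF
  obtain ⟨C₂, hC₂, hG⟩ := exists_bound_birkhoffDeriv c ε A
  obtain ⟨X, hX⟩ : ∃ X : ℝ, X = Real.exp (2 * Real.pi) := ⟨_, rfl⟩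
  have hX1 : 1 ≤ X := by rw [hX]; exact Real.one_le_exp (by positivity)
  rw [← hX] at hr1 hbd ⊢
  obtain ⟨K, hK⟩ : ∃ K : ℝ, K = C₂ * (1 + C₁) * X ^ 4 + (1 + |c| + c ^ 2) * X := ⟨_, rfl⟩
  have hK0 : 0 ≤ K := by rw [hK]; positivity
  obtain ⟨τ, hτ⟩ : ∃ τ : ℝ, τ = A - 6 * ε * c ^ 2 := ⟨_, rfl⟩
  refine ⟨(2 * |τ| * K ^ 2 * (|τ| * K ^ 3 + K) * (2 * Real.pi) + K) * (2 * Real.pi), r, hr,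
    fun ζ hζ h0 => ⟨?_, hbd ζ hζ h0 _ ⟨Real.two_pi_pos.le, le_rfl⟩⟩⟩
  have hb := hbd ζ hζ h0
  have hw := hζ.rotating hc1
  obtain ⟨w, hwd⟩ : ∃ w : ℝ → ℂ, w = fun t =>
    Complex.exp (((-(m / 3 : ℝ) * t : ℝ) : ℂ) * Complex.I) * ζ t := ⟨_, rfl⟩
  have hwn : ∀ t, ‖w t‖ = ‖ζ t‖ := fun t => by
    rw [hwd]; simp only [norm_mul, Complex.norm_exp_ofReal_mul_I, one_mul]
  have hw1 : ∀ t ∈ Set.Icc 0 (2 * Real.pi), ‖w t‖ ≤ X * ‖ζ 0‖ := fun t ht => by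
    rw [hwn]; exact hb t ht
  have hXr : X * ‖ζ 0‖ ≤ 1 := by nlinarith
  have hz1 : ‖ζ 0‖ ≤ 1 := by nlinarith [norm_nonneg (ζ 0)]
  have hw' : ∀ t ∈ Set.Icc 0 (2 * Real.pi), HasDerivWithinAt w (Complex.I * (ε * w t
      + A * (Complex.normSq (w t) : ℂ) * w t + 3 * ε * c * starRingEnd ℂ (w t) ^ 2)
      + Complex.exp (((-(m / 3 : ℝ) * t : ℝ) : ℂ) * Complex.I) * hamVF (R t) (ζ t))
      (Set.Icc 0 (2 * Real.pi)) t := by rw [hwd]; exact hw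
  have hρ : ∀ t ∈ Set.Icc 0 (2 * Real.pi),
      ‖Complex.exp (((-(m / 3 : ℝ) * t : ℝ) : ℂ) * Complex.I) * hamVF (R t) (ζ t)‖
        ≤ C₁ * ‖w t‖ ^ 4 := by
    intro t ht
    rw [norm_mul, Complex.norm_exp_ofReal_mul_I, one_mul, hwn]
    exact hH t ht _ (by rw [← hwn]; exact (hw1 t ht).trans hXr)
  have key := norm_sub_twist_le (u := fun t => birkhoffMap c (w t)) (T := 2 * Real.pi) (K := K)
    (r := ‖ζ 0‖) (ε := ε) (τ := τ)
    (e := fun t => birkhoffDeriv c (w t) (Complex.I * (ε * w t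
      + A * (Complex.normSq (w t) : ℂ) * w t + 3 * ε * c * starRingEnd ℂ (w t) ^ 2)
      + Complex.exp (((-(m / 3 : ℝ) * t : ℝ) : ℂ) * Complex.I) * hamVF (R t) (ζ t))
      - Complex.I * ((ε + τ * Complex.normSq (birkhoffMap c (w t)) : ℝ) : ℂ) * birkhoffMap c (w t))
    Real.two_pi_pos.le hK0 (norm_nonneg _) hz1
    (fun t ht => (hasDerivWithinAt_birkhoffMap (c := c) (hw' t ht)).congr_deriv (by ring))
    (fun t ht => by
      have h1 := hw1 t ht
      rw [hτ]
      refine (hG _ _ (h1.trans hXr)).trans ?_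
      have h2 := hρ t ht
      have h3 : ‖w t‖ ^ 4 ≤ (X * ‖ζ 0‖) ^ 4 := pow_le_pow_left₀ (norm_nonneg _) h1 4
      calc C₂ * (‖w t‖ ^ 4 + _) ≤ C₂ * (‖w t‖ ^ 4 + C₁ * ‖w t‖ ^ 4) := by gcongr
        _ = C₂ * (1 + C₁) * ‖w t‖ ^ 4 := by ring
        _ ≤ C₂ * (1 + C₁) * (X * ‖ζ 0‖) ^ 4 := by gcongr
        _ = C₂ * (1 + C₁) * X ^ 4 * ‖ζ 0‖ ^ 4 := by ring
        _ ≤ K * ‖ζ 0‖ ^ 4 := by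
          have : C₂ * (1 + C₁) * X ^ 4 ≤ K := by
            rw [hK]; exact le_add_of_nonneg_right (by positivity)
          gcongr)
    (fun t ht => by
      have h1 := hw1 t ht
      refine (norm_birkhoffMap_le c (h1.trans hXr)).trans ?_
      calc (1 + |c| + c ^ 2) * ‖w t‖ ≤ (1 + |c| + c ^ 2) * (X * ‖ζ 0‖) := by gcongr
        _ = (1 + |c| + c ^ 2) * X * ‖ζ 0‖ := by ring
        _ ≤ K * ‖ζ 0‖ := by
          have : (1 + |c| + c ^ 2) * X ≤ K := by
            rw [hK]; exact le_add_of_nonneg_left (by positivity)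
          gcongr)
  have hw0 : w 0 = ζ 0 := by rw [hwd]; simp
  obtain ⟨l, hl⟩ : ∃ l : ℂ, l = Complex.exp (((m / 3 * (2 * Real.pi) : ℝ) : ℂ) * Complex.I) :=
    ⟨_, rfl⟩
  have hl3 : l ^ 3 = 1 := by
    rw [hl, ← Complex.exp_nat_mul, ← Complex.exp_int_mul_two_pi_mul_I m]
    congr 1; push_cast; ring
  have hl1 : ζ (2 * Real.pi) = l * w (2 * Real.pi) := by
    have := exp_neg_mul_exp (m / 3) (2 * Real.pi)
    rw [hwd, hl]
    linear_combination -ζ (2 * Real.pi) * this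
  have hln : ‖l‖ = 1 := by rw [hl, Complex.norm_exp_ofReal_mul_I]
  have e1 : Complex.exp (((2 * Real.pi * ((m / 3 + ε) + 2 * τ
      * radialAction (birkhoffMap c (ζ 0))) : ℝ) : ℂ) * Complex.I)
      = l * Complex.exp ((((ε + τ * Complex.normSq (birkhoffMap c (ζ 0))) * (2 * Real.pi) : ℝ) : ℂ)
        * Complex.I) := by
    rw [hl, ← Complex.exp_add, ← add_mul, ← Complex.ofReal_add, radialAction_eq]
    congr 4; ring
  rw [← hτ, hl1, birkhoffMap_rotation c hl3, e1, mul_assoc, ← mul_sub, norm_mul, hln, one_mul]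
  simp only [hw0] at key
  exact key

end

/-- The Poincaré map in the coordinate `birkhoffMap`. -/
theorem IsPoincareMap.birkhoff {m : ℤ} {ε A B : ℝ} (hε : ε ≠ 0) {R : ℝ → ℂ → ℝ}
    (hR : IsRemainder R) {f : ℂ → ℂ} (hf : IsPoincareMap (fullHam m ε A B R) f) :
    (fun z => birkhoffMap (B / (2 * √2 * ε)) (f z)
      - Complex.exp (((2 * Real.pi * ((m / 3 + ε) + (2 * A - 3 * B ^ 2 / (2 * ε))
        * radialAction (birkhoffMap (B / (2 * √2 * ε)) z)) : ℝ) : ℂ) * Complex.I)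
        * birkhoffMap (B / (2 * √2 * ε)) z) =O[𝓝 0] (fun z => ‖z‖ ^ 4) ∧
    f =O[𝓝 0] (fun z => z) := by
  obtain ⟨C, r, hr, h⟩ := IsTransOrbit.birkhoff (m := m) (A := A) (B := B) hR hε
  have h1 := hf.exists_transOrbit hR
  have h2 := Metric.closedBall_mem_nhds (0 : ℂ) hr
  refine ⟨IsBigO.of_bound C ?_, IsBigO.of_bound (Real.exp (2 * Real.pi)) ?_⟩ <;>
  · filter_upwards [h1, h2] with z hz hzr
    obtain ⟨ζ, hζ, h0, h2π⟩ := hz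
    have := h ζ hζ (by rw [h0]; simpa using hzr)
    rw [h0, h2π] at this
    first
    | exact this.2
    | simpa using this.1


/-! ### The area-preserving change of coordinates. -/

theorem isBigO_comp_sub_comp {N u v : ℂ → ℂ} {a : ℂ} {l : Filter ℂ} (hN : ContDiffAt ℝ 1 N a)
    (hu : Tendsto u l (𝓝 a)) (hv : Tendsto v l (𝓝 a)) :
    (fun z => N (u z) - N (v z)) =O[l] (fun z => u z - v z) := by
  obtain ⟨K, t, ht, hK⟩ := hN.exists_lipschitzOnWith
  refine IsBigO.of_bound K ?_
  filter_upwards [hu ht, hv ht] with z h1 h2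
  simpa [dist_eq_norm] using hK.dist_le_mul _ h1 _ h2

theorem isBigO_id_of_contDiffAt {g : ℂ → ℂ} (hg : ContDiffAt ℝ ∞ g 0) (h0 : g 0 = 0) :
    g =O[𝓝 0] (fun z => z) := by
  have := isBigO_comp_sub_comp (hg.of_le (by exact_mod_cast le_top)) tendsto_id
    (tendsto_const_nhds (x := (0 : ℂ)) (f := 𝓝 0))
  simpa [h0] using this

theorem tendsto_zero_of_contDiffAt {g : ℂ → ℂ} (hg : ContDiffAt ℝ ∞ g 0) (h0 : g 0 = 0) :
    Tendsto g (𝓝 0) (𝓝 0) := by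
  have := hg.continuousAt.tendsto
  rwa [h0] at this

/-- The inverse function theorem at a fixed point. -/
theorem exists_local_inverse {g : ℂ → ℂ} (hg : ContDiffAt ℝ ∞ g 0) (h0 : g 0 = 0)
    (hdet : (fderiv ℝ g 0).det ≠ 0) : ∃ ψ : ℂ → ℂ, ContDiffAt ℝ ∞ ψ 0 ∧ ψ 0 = 0 ∧
      (∀ᶠ z in 𝓝 0, g (ψ z) = z) ∧ ∀ᶠ z in 𝓝 0, ψ (g z) = z := by
  have h1 : HasFDerivAt g
      (((fderiv ℝ g 0).toContinuousLinearEquivOfDetNeZero hdet : ℂ ≃L[ℝ] ℂ) : ℂ →L[ℝ] ℂ) 0 := by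
    rw [ContinuousLinearMap.coe_toContinuousLinearEquivOfDetNeZero]
    exact (hg.differentiableAt (by simp)).hasFDerivAt
  have h2 := hg.hasStrictFDerivAt' h1 (by simp)
  refine ⟨hg.localInverse h1 (by simp), ?_, ?_, ?_, ?_⟩
  · simpa [h0] using hg.to_localInverse h1 (by simp)
  · have := hg.localInverse_apply_image h1 (by simp)
    rwa [h0] at this
  · have := h2.eventually_right_inverse
    rwa [h0] at this
  · exact h2.eventually_left_inverse

theorem contDiff_birkhoffMap (c : ℝ) : ContDiff ℝ ∞ (birkhoffMap c) := by
  have h1 : ContDiff ℝ ∞ (fun w : ℂ => starRingEnd ℂ w) := Complex.conjCLE.contDiff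
  have h2 : ContDiff ℝ ∞ (fun w : ℂ => (Complex.normSq w : ℂ)) :=
    Complex.ofRealCLM.contDiff.comp contDiff_normSq
  exact (contDiff_id.add (contDiff_const.mul (h1.pow 2))).add ((contDiff_const.mul h2).mul contDiff_id)

theorem fderiv_birkhoffMap (c : ℝ) (w v : ℂ) :
    fderiv ℝ (birkhoffMap c) w v = birkhoffDeriv c w v := by
  have hl : HasDerivAt (fun t : ℝ => w + t * v) v 0 := by
    simpa using ((hasDerivAt_id (0 : ℝ)).ofReal_comp.mul_const v).const_add w
  have h1 := ((contDiff_birkhoffMap c).differentiable (by simp) w).hasFDerivAt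
  have h2 : HasDerivAt (fun t : ℝ => birkhoffMap c (w + t * v)) (fderiv ℝ (birkhoffMap c) w v) 0 := by
    have h1' : HasFDerivAt (birkhoffMap c) (fderiv ℝ (birkhoffMap c) w)
        (w + ((0 : ℝ) : ℂ) * v) := by simpa using h1
    exact h1'.comp_hasDerivAt (0 : ℝ) hl
  have h3 := hasDerivWithinAt_birkhoffMap (c := c) hl.hasDerivWithinAt (s := Set.univ)
  rw [hasDerivWithinAt_univ] at h3
  simpa using h2.unique h3

/-- The cubic term of `birkhoffMap` is chosen so that the contributions `±4c²|w|²` cancel; the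
Jacobian differs from `1` only from order three on. -/
theorem det_fderiv_birkhoffMap (c : ℝ) (w : ℂ) : (fderiv ℝ (birkhoffMap c) w).det
    = 1 + 3 * c ^ 4 * (w.re ^ 2 + w.im ^ 2) ^ 2 - 4 * c ^ 3 * (w.re ^ 3 - 3 * w.re * w.im ^ 2) := by
  rw [det_mul_add_mul_conj _ (1 + 2 * c ^ 2 * (Complex.normSq w : ℂ))
    (2 * c * starRingEnd ℂ w + c ^ 2 * w ^ 2)]
  · simp [Complex.normSq_apply, pow_two]; ring
  · intro v
    rw [fderiv_birkhoffMap, birkhoffDeriv]; ring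

/-- The horizontal shift by which a map has the Jacobian of `birkhoffMap`. -/
noncomputable def jacobianShift (c : ℝ) (z : ℂ) : ℝ :=
  3 * c ^ 4 * (z.re ^ 5 / 5 + 2 / 3 * (z.re ^ 3 * z.im ^ 2) + z.re * z.im ^ 4)
    - 4 * c ^ 3 * (z.re ^ 4 / 4 - 3 / 2 * (z.re ^ 2 * z.im ^ 2))

theorem contDiff_jacobianShift (c : ℝ) : ContDiff ℝ ∞ (jacobianShift c) := by
  have hx : ContDiff ℝ ∞ (fun z : ℂ => z.re) := Complex.reCLM.contDiff
  have hy : ContDiff ℝ ∞ (fun z : ℂ => z.im) := Complex.imCLM.contDiff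
  unfold jacobianShift
  exact (contDiff_const.mul ((((hx.pow 5).div_const 5).add
    (contDiff_const.mul ((hx.pow 3).mul (hy.pow 2)))).add (hx.mul (hy.pow 4)))).sub
    (contDiff_const.mul (((hx.pow 4).div_const 4).sub
      (contDiff_const.mul ((hx.pow 2).mul (hy.pow 2)))))

theorem fderiv_jacobianShift_one (c : ℝ) (z : ℂ) : fderiv ℝ (jacobianShift c) z 1
    = 3 * c ^ 4 * (z.re ^ 2 + z.im ^ 2) ^ 2 - 4 * c ^ 3 * (z.re ^ 3 - 3 * z.re * z.im ^ 2) := by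
  have hx : HasFDerivAt (fun z : ℂ => z.re) Complex.reCLM z := Complex.reCLM.hasFDerivAt
  have hy : HasFDerivAt (fun z : ℂ => z.im) Complex.imCLM z := Complex.imCLM.hasFDerivAt
  have h := ((((((hx.pow 5).mul_const (1 / 5)).add
    (((hx.pow 3).mul (hy.pow 2)).const_mul (2 / 3))).add (hx.mul (hy.pow 4))).const_mul (3 * c ^ 4)).sub
    ((((hx.pow 4).mul_const (1 / 4)).sub
      (((hx.pow 2).mul (hy.pow 2)).const_mul (3 / 2))).const_mul (4 * c ^ 3)))
  have h' := h.congr_of_eventuallyEq (f₁ := jacobianShift c) (Eventually.of_forall fun z => by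
    simp only [jacobianShift, Pi.sub_apply, Pi.add_apply, Pi.mul_apply]; ring)
  rw [h'.fderiv]
  simp
  ring

theorem abs_jacobianShift_le (c : ℝ) {z : ℂ} (hz : ‖z‖ ≤ 1) :
    |jacobianShift c z| ≤ (9 * c ^ 4 + 8 * |c| ^ 3) * ‖z‖ ^ 4 := by
  have hn := norm_nonneg z
  have hx := Complex.abs_re_le_norm z
  have hy := Complex.abs_im_le_norm z
  have h54 : ‖z‖ ^ 5 ≤ ‖z‖ ^ 4 := pow_le_pow_of_le_one hn hz (by norm_num)
  have hm : ∀ i j : ℕ, |z.re ^ i * z.im ^ j| ≤ ‖z‖ ^ (i + j) := by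
    intro i j
    rw [abs_mul, abs_pow, abs_pow, pow_add]
    gcongr
  have e1 := abs_le.1 (hm 5 0)
  have e2 := abs_le.1 (hm 3 2)
  have e3 := abs_le.1 (hm 1 4)
  have e4 := abs_le.1 (hm 4 0)
  have e5 := abs_le.1 (hm 2 2)
  simp only [pow_zero, mul_one, pow_one, add_zero] at e1 e2 e3 e4 e5
  norm_num at e1 e2 e3 e4 e5
  have a1 : |z.re ^ 5 / 5 + 2 / 3 * (z.re ^ 3 * z.im ^ 2) + z.re * z.im ^ 4| ≤ 3 * ‖z‖ ^ 4 := by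
    rw [abs_le]; constructor <;> linarith [e1.1, e1.2, e2.1, e2.2, e3.1, e3.2]
  have a2 : |z.re ^ 4 / 4 - 3 / 2 * (z.re ^ 2 * z.im ^ 2)| ≤ 2 * ‖z‖ ^ 4 := by
    rw [abs_le]; constructor <;> linarith [e4.1, e4.2, e5.1, e5.2]
  rw [jacobianShift]
  refine (abs_sub _ _).trans ?_
  rw [abs_mul, abs_mul, abs_mul, abs_mul, abs_pow, abs_pow, abs_of_pos (by norm_num : (0:ℝ) < 3),
    abs_of_pos (by norm_num : (0:ℝ) < 4)]
  have hc4 : |c| ^ 4 = c ^ 4 := by rw [← abs_pow]; exact abs_of_nonneg (by positivity)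
  rw [hc4]
  have b1 := mul_le_mul_of_nonneg_left a1 (by positivity : 0 ≤ 3 * c ^ 4)
  have b2 := mul_le_mul_of_nonneg_left a2 (by positivity : 0 ≤ 4 * |c| ^ 3)
  linarith

/-- An area-preserving modification of `birkhoffMap` by terms of order four. -/
theorem exists_symplectic_birkhoffMap (c : ℝ) : ∃ g : ℂ → ℂ, ContDiffAt ℝ ∞ g 0 ∧ g 0 = 0 ∧
    (∀ᶠ z in 𝓝 (0 : ℂ), (fderiv ℝ g z).det = 1) ∧
    (fun z => g z - birkhoffMap c z) =O[𝓝 0] (fun z => ‖z‖ ^ 4) := by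
  -- The horizontal shift `φ` has the same Jacobian as `birkhoffMap c` at the same point, so
  -- `birkhoffMap c ∘ φ⁻¹` preserves area. Since the shift is of order four, so is the modification.
  obtain ⟨φ, hφ⟩ : ∃ φ : ℂ → ℂ, φ = fun z => z + (jacobianShift c z : ℂ) := ⟨_, rfl⟩
  have hφs : ContDiff ℝ ∞ φ := by
    rw [hφ]; exact contDiff_id.add (Complex.ofRealCLM.contDiff.comp (contDiff_jacobianShift c))
  have hφd : ∀ z v, fderiv ℝ φ z v = v + (fderiv ℝ (jacobianShift c) z v : ℂ) := by
    intro z v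
    have h1 := ((contDiff_jacobianShift c).differentiable (by simp) z).hasFDerivAt
    have h2 := (hasFDerivAt_id z).add (Complex.ofRealCLM.hasFDerivAt.comp z h1)
    have h3 := h2.congr_of_eventuallyEq (f₁ := φ) (Eventually.of_forall fun z => by rw [hφ]; rfl)
    rw [h3.fderiv]; rfl
  have hdet : ∀ z, (fderiv ℝ φ z).det = (fderiv ℝ (birkhoffMap c) z).det := by
    intro z
    rw [det_eq, hφd, hφd, fderiv_jacobianShift_one, det_fderiv_birkhoffMap]
    simp only [Complex.add_re, Complex.add_im, Complex.ofReal_re, Complex.ofReal_im,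
      Complex.one_re, Complex.one_im, Complex.I_re, Complex.I_im]
    ring
  have hφ0 : φ 0 = 0 := by rw [hφ]; simp [jacobianShift]
  obtain ⟨ψ, hψs, hψ0, hr, hl⟩ := exists_local_inverse (g := φ) hφs.contDiffAt hφ0 (by
    rw [hdet, det_fderiv_birkhoffMap]; simp)
  have hψt := tendsto_zero_of_contDiffAt hψs hψ0
  have hG := contDiff_birkhoffMap c
  refine ⟨fun z => birkhoffMap c (ψ z), hG.contDiffAt.comp _ hψs, ?_, ?_, ?_⟩
  · simp [hψ0, birkhoffMap]
  · have h1 : ∀ᶠ z in 𝓝 (0 : ℂ), ContDiffAt ℝ 1 ψ z :=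
      (hψs.of_le (by exact_mod_cast le_top : (1 : WithTop ℕ∞) ≤ ∞)).eventually (by simp)
    filter_upwards [h1, hr.eventually_nhds] with z h1 h2
    have h3 := (h1.differentiableAt (by simp)).hasFDerivAt
    have h4 := ((hφs.differentiable (by simp) (ψ z)).hasFDerivAt).comp z h3
    have h5 : fderiv ℝ (φ ∘ ψ) z = ContinuousLinearMap.id ℝ ℂ :=
      ((hasFDerivAt_id z).congr_of_eventuallyEq h2).fderiv
    have h6 := ((hG.differentiable (by simp) (ψ z)).hasFDerivAt).comp z h3
    have h7 : fderiv ℝ (fun z => birkhoffMap c (ψ z)) z = _ := h6.fderiv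
    have h8 : ∀ L M : ℂ →L[ℝ] ℂ, (L.comp M).det = L.det * M.det := fun L M => LinearMap.det_comp _ _
    rw [h7, h8, ← hdet, ← h8, ← h4.fderiv, h5]
    exact LinearMap.det_id
  · have h1 := isBigO_comp_sub_comp (hG.contDiffAt.of_le (by exact_mod_cast le_top) :
      ContDiffAt ℝ 1 (birkhoffMap c) 0) hψt tendsto_id
    refine h1.trans ?_
    have h2 : (fun z => (jacobianShift c z : ℂ)) =O[𝓝 0] (fun z : ℂ => ‖z‖ ^ 4) := by
      refine IsBigO.of_bound (9 * c ^ 4 + 8 * |c| ^ 3) ?_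
      filter_upwards [Metric.closedBall_mem_nhds (0 : ℂ) one_pos] with z hz
      simpa using abs_jacobianShift_le c (z := z) (by simpa using hz)
    have h3 := (h2.comp_tendsto hψt).trans
      ((isBigO_id_of_contDiffAt hψs hψ0).norm_left.pow 4 : (fun z => ‖ψ z‖ ^ 4) =O[𝓝 0] _)
    refine (h3.neg_left.norm_right.congr' ?_ ?_)
    · filter_upwards [hr] with z hz
      have : z = ψ z + (jacobianShift c (ψ z) : ℂ) := by rw [hφ] at hz; exact hz.symm
      simp only [Function.comp_apply, id]
      linear_combination this
    · exact Eventually.of_forall fun z => by simp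

/-- The Birkhoff normal form of rotation number `ν` and twist `τ`. -/
noncomputable def twistMap (ν τ : ℝ) (z : ℂ) : ℂ :=
  Complex.exp (((2 * Real.pi * (ν + τ * radialAction z) : ℝ) : ℂ) * Complex.I) * z

theorem contDiff_twistMap (ν τ : ℝ) : ContDiff ℝ ∞ (twistMap ν τ) := by
  have h1 : ContDiff ℝ ∞ (fun z : ℂ => radialAction z) := by
    simp only [radialAction_eq]
    exact contDiff_normSq.div_const 2
  have h2 : ContDiff ℝ ∞ (fun z : ℂ => (2 * Real.pi * (ν + τ * radialAction z) : ℝ)) :=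
    contDiff_const.mul (contDiff_const.add (contDiff_const.mul h1))
  have h3 : ContDiff ℝ ∞ (fun z : ℂ => ((2 * Real.pi * (ν + τ * radialAction z) : ℝ) : ℂ)) :=
    Complex.ofRealCLM.contDiff.comp h2
  exact (h3.mul contDiff_const).cexp.mul contDiff_id

theorem IsPoincareMap.hasBirkhoffTwist {m : ℤ} {ε A B : ℝ} (hε : ε ≠ 0) {R : ℝ → ℂ → ℝ}
    (hR : IsRemainder R) {f : ℂ → ℂ} (hf : IsPoincareMap (fullHam m ε A B R) f) :
    HasBirkhoffTwist f (m / 3 + ε) (2 * A - 3 * B ^ 2 / (2 * ε)) := by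
  obtain ⟨h1, h2⟩ := hf.birkhoff hε hR
  obtain ⟨c, hc⟩ : ∃ c : ℝ, c = B / (2 * √2 * ε) := ⟨_, rfl⟩
  obtain ⟨ν, hν⟩ : ∃ ν : ℝ, ν = m / 3 + ε := ⟨_, rfl⟩
  obtain ⟨τ, hτ⟩ : ∃ τ : ℝ, τ = 2 * A - 3 * B ^ 2 / (2 * ε) := ⟨_, rfl⟩
  rw [← hc, ← hν, ← hτ] at h1
  rw [← hν, ← hτ]
  obtain ⟨g, hg, hg0, hdet, hgG⟩ := exists_symplectic_birkhoffMap c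
  refine ⟨g, hg, hg0, hdet, ?_⟩
  have hft : Tendsto f (𝓝 0) (𝓝 0) := h2.trans_tendsto tendsto_id
  have h3 := (hgG.comp_tendsto hft).trans (h2.norm_left.norm_right.pow 4 :
    (fun z => ‖f z‖ ^ 4) =O[𝓝 0] (fun z => ‖z‖ ^ 4))
  have hGt : Tendsto (birkhoffMap c) (𝓝 0) (𝓝 0) :=
    tendsto_zero_of_contDiffAt (contDiff_birkhoffMap c).contDiffAt (by simp [birkhoffMap])
  have h4 := (isBigO_comp_sub_comp ((contDiff_twistMap ν τ).contDiffAt.of_le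
    (by exact_mod_cast le_top)) (tendsto_zero_of_contDiffAt hg hg0) hGt).trans hgG
  refine ((h3.add h1).sub h4).congr_left fun z => ?_
  simp only [Function.comp_apply, twistMap]
  ring


/-! ### Uniqueness of the Birkhoff twist -/

/-- The first Fourier coefficient, times `2π`, of `W` on the circle of radius `r`. -/
noncomputable def circleCoeff (W : ℂ → ℂ) (r : ℝ) : ℂ :=
  ∫ θ in (0 : ℝ)..(2 * Real.pi),
    W (r * Complex.exp ((θ : ℂ) * Complex.I)) * Complex.exp (-((θ : ℂ) * Complex.I))

theorem circleCoeff_isLittleO {W : ℂ → ℂ} {k : ℕ} (hW : W =o[𝓝 0] fun y => ‖y‖ ^ k) :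
    circleCoeff W =o[𝓝[>] 0] fun r => r ^ k := by
  refine IsLittleO.of_bound fun c hc => ?_
  have h1 := hW.bound (show 0 < c / (2 * Real.pi) by positivity)
  obtain ⟨δ, hδ, h2⟩ := Metric.eventually_nhds_iff_ball.1 h1
  filter_upwards [Ioo_mem_nhdsGT hδ] with r hr
  have h3 := intervalIntegral.norm_integral_le_of_norm_le_const (a := 0) (b := 2 * Real.pi)
    (f := fun θ : ℝ => W (r * Complex.exp ((θ : ℂ) * Complex.I))
      * Complex.exp (-((θ : ℂ) * Complex.I))) (C := c / (2 * Real.pi) * r ^ k) (fun θ _ => by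
      have e1 : ‖(r : ℂ) * Complex.exp ((θ : ℂ) * Complex.I)‖ = r := by
        rw [norm_mul, Complex.norm_exp_ofReal_mul_I, mul_one, Complex.norm_real,
          Real.norm_of_nonneg hr.1.le]
      have e2 : ‖Complex.exp (-((θ : ℂ) * Complex.I))‖ = 1 := by
        rw [← neg_mul, ← Complex.ofReal_neg, Complex.norm_exp_ofReal_mul_I]
      have h4 := h2 ((r : ℂ) * Complex.exp ((θ : ℂ) * Complex.I)) (by rw [mem_ball_zero_iff, e1]; exact hr.2)
      rw [e1, norm_pow, Real.norm_of_nonneg hr.1.le] at h4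
      rwa [norm_mul, e2, mul_one])
  rw [norm_pow, Real.norm_of_nonneg hr.1.le]
  refine h3.trans (le_of_eq ?_)
  rw [sub_zero, abs_of_pos Real.two_pi_pos]
  field_simp

theorem integral_exp_int_mul {k : ℤ} (hk : k ≠ 0) :
    ∫ θ in (0 : ℝ)..(2 * Real.pi), Complex.exp ((k : ℂ) * Complex.I * θ) = 0 := by
  have hk' : (k : ℂ) * Complex.I ≠ 0 := mul_ne_zero (by exact_mod_cast hk) Complex.I_ne_zero
  rw [integral_exp_mul_complex hk']
  have : Complex.exp ((k : ℂ) * Complex.I * ((2 * Real.pi : ℝ) : ℂ)) = 1 := by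
    rw [← Complex.exp_int_mul_two_pi_mul_I k]
    congr 1; push_cast; ring
  rw [this]; simp

theorem circleCoeff_const_mul (c : ℂ) (W : ℂ → ℂ) (r : ℝ) :
    circleCoeff (fun y => c * W y) r = c * circleCoeff W r := by
  simp only [circleCoeff, mul_assoc]
  rw [intervalIntegral.integral_const_mul]

theorem circleCoeff_sub {V W : ℂ → ℂ} {r : ℝ}
    (hV : Continuous fun θ : ℝ => V (r * Complex.exp ((θ : ℂ) * Complex.I)))
    (hW : Continuous fun θ : ℝ => W (r * Complex.exp ((θ : ℂ) * Complex.I))) :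
    circleCoeff (fun y => V y - W y) r = circleCoeff V r - circleCoeff W r := by
  have he : Continuous fun θ : ℝ => Complex.exp (-((θ : ℂ) * Complex.I)) := by fun_prop
  simp only [circleCoeff, sub_mul]
  exact intervalIntegral.integral_sub ((hV.mul he).intervalIntegrable _ _)
    ((hW.mul he).intervalIntegrable _ _)

theorem norm_circle {r : ℝ} (hr : 0 < r) (θ : ℝ) :
    ‖(r : ℂ) * Complex.exp ((θ : ℂ) * Complex.I)‖ = r := by
  rw [norm_mul, Complex.norm_exp_ofReal_mul_I, mul_one, Complex.norm_real,
    Real.norm_of_nonneg hr.le]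

theorem circleCoeff_linear (a b : ℂ) (r : ℝ) :
    circleCoeff (fun y => a * y + b * starRingEnd ℂ y) r = 2 * Real.pi * a * r := by
  have h1 : ∀ θ : ℝ, (a * (r * Complex.exp ((θ : ℂ) * Complex.I))
      + b * starRingEnd ℂ (r * Complex.exp ((θ : ℂ) * Complex.I)))
        * Complex.exp (-((θ : ℂ) * Complex.I))
      = a * r + b * r * Complex.exp (((-2 : ℤ) : ℂ) * Complex.I * θ) := by
    intro θ
    have e1 : starRingEnd ℂ (Complex.exp ((θ : ℂ) * Complex.I))
        = Complex.exp (-((θ : ℂ) * Complex.I)) := by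
      rw [← Complex.exp_conj]; congr 1; simp
    have e2 : Complex.exp ((θ : ℂ) * Complex.I) * Complex.exp (-((θ : ℂ) * Complex.I)) = 1 := by
      rw [← Complex.exp_add]; simp
    have e3 : Complex.exp (((-2 : ℤ) : ℂ) * Complex.I * θ)
        = Complex.exp (-((θ : ℂ) * Complex.I)) ^ 2 := by
      rw [← Complex.exp_nat_mul]; congr 1; push_cast; ring
    rw [map_mul, Complex.conj_ofReal, e1, e3]
    linear_combination a * r * e2
  rw [circleCoeff]
  simp only [h1]
  rw [intervalIntegral.integral_add (by simp) (Continuous.intervalIntegrable (by fun_prop) _ _),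
    intervalIntegral.integral_const, intervalIntegral.integral_const_mul,
    integral_exp_int_mul (by norm_num), Complex.real_smul]
  push_cast; ring

/-- On a circle only the monomial `|y|²y` of the expansion contributes. Its coefficient `a(|a|² +
2|b|²)` is the source of the factor `k` in `exists_twist_eq_mul`. -/
theorem circleCoeff_cubic (a b : ℂ) (r : ℝ) :
    circleCoeff (fun y => (Complex.normSq (a * y + b * starRingEnd ℂ y) : ℂ)
      * (a * y + b * starRingEnd ℂ y)) r
      = 2 * Real.pi * a * (Complex.normSq a + 2 * Complex.normSq b : ℝ) * r ^ 3 := by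
  have h1 : ∀ θ : ℝ, ((Complex.normSq (a * (r * Complex.exp ((θ : ℂ) * Complex.I))
      + b * starRingEnd ℂ (r * Complex.exp ((θ : ℂ) * Complex.I))) : ℂ)
        * (a * (r * Complex.exp ((θ : ℂ) * Complex.I))
      + b * starRingEnd ℂ (r * Complex.exp ((θ : ℂ) * Complex.I))))
        * Complex.exp (-((θ : ℂ) * Complex.I))
      = a * (Complex.normSq a + 2 * Complex.normSq b : ℝ) * r ^ 3
        + starRingEnd ℂ b * a ^ 2 * r ^ 3 * Complex.exp (((2 : ℤ) : ℂ) * Complex.I * θ)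
        + (2 * starRingEnd ℂ a * a * b + starRingEnd ℂ b * b ^ 2) * r ^ 3
          * Complex.exp (((-2 : ℤ) : ℂ) * Complex.I * θ)
        + starRingEnd ℂ a * b ^ 2 * r ^ 3 * Complex.exp (((-4 : ℤ) : ℂ) * Complex.I * θ) := by
    intro θ
    have e1 : starRingEnd ℂ (Complex.exp ((θ : ℂ) * Complex.I))
        = Complex.exp (-((θ : ℂ) * Complex.I)) := by
      rw [← Complex.exp_conj]; congr 1; simp
    have e2 : Complex.exp ((θ : ℂ) * Complex.I) * Complex.exp (-((θ : ℂ) * Complex.I)) = 1 := by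
      rw [← Complex.exp_add]; simp
    have e3 : Complex.exp (((-2 : ℤ) : ℂ) * Complex.I * θ)
        = Complex.exp (-((θ : ℂ) * Complex.I)) ^ 2 := by
      rw [← Complex.exp_nat_mul]; congr 1; push_cast; ring
    have e4 : Complex.exp (((-4 : ℤ) : ℂ) * Complex.I * θ)
        = Complex.exp (-((θ : ℂ) * Complex.I)) ^ 4 := by
      rw [← Complex.exp_nat_mul]; congr 1; push_cast; ring
    have e5 : Complex.exp (((2 : ℤ) : ℂ) * Complex.I * θ)
        = Complex.exp ((θ : ℂ) * Complex.I) ^ 2 := by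
      rw [← Complex.exp_nat_mul]; congr 1; push_cast; ring
    push_cast
    simp only [Complex.normSq_eq_conj_mul_self, map_mul, map_add, Complex.conj_ofReal, e1]
    push_cast at e3 e4 e5
    rw [e3, e4, e5]
    have e6 : starRingEnd ℂ (Complex.exp (-((θ : ℂ) * Complex.I)))
        = Complex.exp ((θ : ℂ) * Complex.I) := by
      rw [← Complex.exp_conj]; congr 1; simp
    rw [e6]
    obtain ⟨X, hX⟩ : ∃ X, X = Complex.exp ((θ : ℂ) * Complex.I) := ⟨_, rfl⟩
    obtain ⟨Y, hY⟩ : ∃ Y, Y = Complex.exp (-((θ : ℂ) * Complex.I)) := ⟨_, rfl⟩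
    rw [← hX, ← hY] at e2 ⊢
    obtain ⟨a', ha⟩ : ∃ x, x = starRingEnd ℂ a := ⟨_, rfl⟩
    obtain ⟨b', hb⟩ : ∃ x, x = starRingEnd ℂ b := ⟨_, rfl⟩
    rw [← ha, ← hb]
    linear_combination (r : ℂ) ^ 3 * (a' * a ^ 2 * (X * Y + 1) + b' * a ^ 2 * X ^ 2
      + 2 * a' * a * b * Y ^ 2 + 2 * b' * a * b * (X * Y + 1) + b' * b ^ 2 * Y ^ 2) * e2
  rw [circleCoeff]
  simp only [h1]
  have hi : ∀ (c : ℂ) (k : ℤ), IntervalIntegrable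
      (fun θ : ℝ => c * Complex.exp ((k : ℂ) * Complex.I * θ)) volume 0 (2 * Real.pi) :=
    fun c k => Continuous.intervalIntegrable (by fun_prop) _ _
  rw [intervalIntegral.integral_add (((by simp : IntervalIntegrable _ _ _ _).add (hi _ _)).add (hi _ _))
      (hi _ _),
    intervalIntegral.integral_add ((by simp : IntervalIntegrable _ _ _ _).add (hi _ _)) (hi _ _),
    intervalIntegral.integral_add (by simp) (hi _ _), intervalIntegral.integral_const,
    intervalIntegral.integral_const_mul, intervalIntegral.integral_const_mul,
    intervalIntegral.integral_const_mul, integral_exp_int_mul (by norm_num),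
    integral_exp_int_mul (by norm_num), integral_exp_int_mul (by norm_num), Complex.real_smul]
  push_cast; ring

/-- The normal form rotates each circle rigidly, so it multiplies the first Fourier coefficient of
any function by a phase. No expansion of `h` beyond its linear part is therefore needed. -/
theorem circleCoeff_twistMap (h : ℂ → ℂ) (ν τ r : ℝ) : circleCoeff (fun y => h (twistMap ν τ y)) r
    = Complex.exp (((2 * Real.pi * (ν + τ * (r ^ 2 / 2)) : ℝ) : ℂ) * Complex.I)
      * circleCoeff h r := by
  obtain ⟨α, hα⟩ : ∃ α : ℝ, α = 2 * Real.pi * (ν + τ * (r ^ 2 / 2)) := ⟨_, rfl⟩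
  have h1 : ∀ θ : ℝ, twistMap ν τ (r * Complex.exp ((θ : ℂ) * Complex.I))
      = r * Complex.exp (((θ + α : ℝ) : ℂ) * Complex.I) := by
    intro θ
    have e1 : radialAction (r * Complex.exp ((θ : ℂ) * Complex.I)) = r ^ 2 / 2 := by
      rw [radialAction, norm_mul, Complex.norm_exp_ofReal_mul_I, mul_one, Complex.norm_real,
        Real.norm_eq_abs, sq_abs]
    rw [twistMap, e1, ← hα, Complex.ofReal_add, add_mul, Complex.exp_add]
    ring
  obtain ⟨p, hp⟩ : ∃ p : ℝ → ℂ, p = fun θ : ℝ => h (r * Complex.exp ((θ : ℂ) * Complex.I))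
      * Complex.exp (-((θ : ℂ) * Complex.I)) := ⟨_, rfl⟩
  have hper : Function.Periodic p (2 * Real.pi) := by
    intro θ
    have e1 : Complex.exp (((θ + 2 * Real.pi : ℝ) : ℂ) * Complex.I)
        = Complex.exp ((θ : ℂ) * Complex.I) := by
      rw [← Complex.exp_periodic ((θ : ℂ) * Complex.I)]; congr 1; push_cast; ring
    rw [hp]
    simp only [Complex.exp_neg, e1]
  have h2 : ∀ θ : ℝ, h (r * Complex.exp (((θ + α : ℝ) : ℂ) * Complex.I))
      * Complex.exp (-((θ : ℂ) * Complex.I))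
      = Complex.exp ((α : ℂ) * Complex.I) * p (θ + α) := by
    intro θ
    have e1 : Complex.exp (-((θ : ℂ) * Complex.I)) = Complex.exp ((α : ℂ) * Complex.I)
        * Complex.exp (-(((θ + α : ℝ) : ℂ) * Complex.I)) := by
      rw [← Complex.exp_add]; congr 1; push_cast; ring
    rw [hp, e1]; ring
  rw [circleCoeff, circleCoeff, ← hα]
  simp only [h1, h2]
  rw [intervalIntegral.integral_const_mul, intervalIntegral.integral_comp_add_right,
    zero_add, add_comm (2 * Real.pi) α, hper.intervalIntegral_add_eq α 0, zero_add, hp]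

/-- A conjugacy between two Birkhoff normal forms relates their twists. -/
theorem exists_twist_eq_mul {h : ℂ → ℂ} {ν τ₁ τ₂ : ℝ} (hh : ContDiffAt ℝ ∞ h 0) (h0 : h 0 = 0)
    (hdet : (fderiv ℝ h 0).det = 1)
    (hN : (fun y => h (twistMap ν τ₁ y) - twistMap ν τ₂ (h y)) =O[𝓝 0] fun y => ‖y‖ ^ 4) :
    ∃ k : ℝ, 1 ≤ k ∧ τ₁ = k * τ₂ := by
  obtain ⟨a, ha⟩ : ∃ a, a = (fderiv ℝ h 0 1 - Complex.I * fderiv ℝ h 0 Complex.I) / 2 := ⟨_, rfl⟩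
  obtain ⟨b, hb⟩ : ∃ b, b = (fderiv ℝ h 0 1 + Complex.I * fderiv ℝ h 0 Complex.I) / 2 := ⟨_, rfl⟩
  have hL : ∀ y, fderiv ℝ h 0 y = a * y + b * starRingEnd ℂ y := by
    intro y
    have e1 : y = y.re • (1 : ℂ) + y.im • Complex.I := by
      simp [Complex.real_smul, Complex.re_add_im]
    have e2 : starRingEnd ℂ y = y.re - y.im * Complex.I := by
      apply Complex.ext <;> simp
    have e3 : y = y.re + y.im * Complex.I := (Complex.re_add_im y).symm
    have e4 : fderiv ℝ h 0 y = y.re * fderiv ℝ h 0 1 + y.im * fderiv ℝ h 0 Complex.I := by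
      conv_lhs => rw [e1]
      rw [map_add, map_smul, map_smul, Complex.real_smul, Complex.real_smul]
    rw [e4, e2, ha, hb]
    conv_rhs => rw [e3]
    simp only [Complex.add_re, Complex.ofReal_re, Complex.mul_re, Complex.I_re, mul_zero,
      Complex.ofReal_im, Complex.I_im, mul_one, sub_self, add_zero, Complex.add_im, Complex.mul_im,
      zero_add]
    linear_combination (y.im : ℂ) * fderiv ℝ h 0 Complex.I * Complex.I_sq
  have hab := det_mul_add_mul_conj _ a b hL
  rw [hdet] at hab
  have ha0 : a ≠ 0 := by
    rintro rfl
    have := Complex.normSq_nonneg b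
    simp at hab
    linarith
  obtain ⟨L, hLd⟩ : ∃ L : ℂ → ℂ, L = fun y => a * y + b * starRingEnd ℂ y := ⟨_, rfl⟩
  have hhL : (fun y => h y - L y) =o[𝓝 0] fun y => y := by
    have h1 := (hh.differentiableAt (by simp)).hasFDerivAt.isLittleO
    simp only [h0, sub_zero] at h1
    exact h1.congr_left fun y => by rw [hL, hLd]
  have hhO := isBigO_id_of_contDiffAt hh h0
  have hLO : L =O[𝓝 0] fun y => y := (hhO.sub hhL.isBigO).congr_left fun y => by ring
  have hexp : (fun t : ℂ => Complex.exp t - 1 - t) =o[𝓝 0] fun t => t := by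
    have h1 := (Complex.hasDerivAt_exp 0).isLittleO
    simpa using h1
  -- The conjugacy relation turned back by `ν` and expanded to third order. In the cubic term `h`
  -- may be replaced by its linear part `L`; elsewhere `h` is kept whole, with its unknown quadratic
  -- and cubic terms.
  have hW : (fun y => Complex.exp (-((2 * Real.pi * ν : ℝ) : ℂ) * Complex.I) * h (twistMap ν τ₁ y)
      - h y - Complex.I * (Real.pi * τ₂) * ((Complex.normSq (L y) : ℂ) * L y))
      =o[𝓝 0] fun y => ‖y‖ ^ 3 := by
    have t1 : (fun y => Complex.exp (-((2 * Real.pi * ν : ℝ) : ℂ) * Complex.I)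
        * (h (twistMap ν τ₁ y) - twistMap ν τ₂ (h y))) =o[𝓝 0] fun y => ‖y‖ ^ 3 :=
      (hN.const_mul_left _).trans_isLittleO (isLittleO_norm_pow_norm_pow (by norm_num))
    have hq : (fun y => Complex.I * ((Real.pi * τ₂ * Complex.normSq (h y) : ℝ) : ℂ))
        =O[𝓝 0] fun y => ‖y‖ ^ 2 := by
      have h1 : (fun y => ‖h y‖ ^ 2) =O[𝓝 0] fun y => ‖y‖ ^ 2 := (hhO.norm_norm).pow 2
      refine IsBigO.trans (IsBigO.of_bound (|Real.pi * τ₂|) (Eventually.of_forall fun y => ?_)) h1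
      rw [norm_mul, Complex.norm_I, one_mul, Complex.norm_real, norm_mul, ← Complex.sq_norm,
        Real.norm_eq_abs]
    have hqt : Tendsto (fun y => Complex.I * ((Real.pi * τ₂ * Complex.normSq (h y) : ℝ) : ℂ))
        (𝓝 0) (𝓝 0) := by
      refine hq.trans_tendsto ?_
      have : Tendsto (fun y : ℂ => ‖y‖ ^ 2) (𝓝 0) (𝓝 (‖(0 : ℂ)‖ ^ 2)) :=
        (continuous_norm.pow 2).tendsto 0
      simpa using this
    have t2 := (((hexp.comp_tendsto hqt).trans_isBigO hq).mul_isBigO hhO.norm_right)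
    have t3 : (fun y => (Complex.normSq (h y) : ℂ) * h y - (Complex.normSq (L y) : ℂ) * L y)
        =o[𝓝 0] fun y => ‖y‖ ^ 3 := by
      have h1 : (fun y => ‖h y‖ ^ 2 + (‖h y‖ + ‖L y‖) * ‖L y‖) =O[𝓝 0] fun y => ‖y‖ ^ 2 := by
        have := (hhO.norm_norm.pow 2).add ((hhO.norm_norm.add hLO.norm_norm).mul hLO.norm_norm
          |>.congr_right fun y => (pow_two ‖y‖).symm)
        exact this
      have h2 := h1.mul_isLittleO hhL.norm_norm
      refine IsBigO.trans_isLittleO (IsBigO.of_bound 1 (Eventually.of_forall fun y => ?_))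
        (h2.congr_right fun y => (pow_succ ‖y‖ 2).symm)
      rw [one_mul]
      exact (norm_normSq_mul_sub_le _ _).trans (le_abs_self _)
    refine ((t1.add (t2.congr_right fun y => (pow_succ ‖y‖ 2).symm)).add
      (t3.const_mul_left (Complex.I * (Real.pi * τ₂)))).congr_left fun y => ?_
    have e1 : Complex.exp (-((2 * Real.pi * ν : ℝ) : ℂ) * Complex.I) * twistMap ν τ₂ (h y)
        = Complex.exp (Complex.I * ((Real.pi * τ₂ * Complex.normSq (h y) : ℝ) : ℂ)) * h y := by
      rw [twistMap, ← mul_assoc, ← Complex.exp_add, radialAction_eq]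
      congr 2; push_cast; ring
    simp only [Function.comp_apply]
    rw [mul_sub, e1]
    push_cast
    ring
  have hc := circleCoeff_isLittleO hW
  have hcont : ∀ᶠ r : ℝ in 𝓝[>] 0, 0 < r ∧ ∀ y : ℂ, ‖y‖ = r → ContinuousAt h y := by
    have h1 : ∀ᶠ y in 𝓝 (0 : ℂ), ContinuousAt h y :=
      ((hh.of_le (by exact_mod_cast le_top : (1 : WithTop ℕ∞) ≤ ∞)).eventually (by simp)).mono
        fun y hy => hy.continuousAt
    obtain ⟨δ, hδ, h2⟩ := Metric.eventually_nhds_iff_ball.1 h1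
    filter_upwards [Ioo_mem_nhdsGT hδ] with r hr
    exact ⟨hr.1, fun y hy => h2 y (by rw [mem_ball_zero_iff, hy]; exact hr.2)⟩
  have hLc : Continuous L := by
    rw [hLd]
    exact (continuous_const.mul continuous_id).add (continuous_const.mul Complex.continuous_conj)
  have hcirc : ∀ r : ℝ, Continuous fun θ : ℝ => (r : ℂ) * Complex.exp ((θ : ℂ) * Complex.I) :=
    fun r => by fun_prop
  have hcL : (fun r : ℝ => circleCoeff h r - 2 * Real.pi * a * r) =o[𝓝[>] 0] fun r : ℝ => r := by
    have h1 := circleCoeff_isLittleO (k := 1) (by simpa using hhL.norm_right)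
    refine (h1.congr' ?_ (Eventually.of_forall fun r => pow_one r))
    filter_upwards [hcont] with r hr
    rw [circleCoeff_sub ?_ (hLc.comp (hcirc r)), hLd, circleCoeff_linear]
    exact continuous_iff_continuousAt.2 fun θ => ContinuousAt.comp
      (hr.2 _ (norm_circle hr.1 θ)) (hcirc r).continuousAt
  have hsmall : (fun r : ℝ => Complex.I * ((Real.pi * τ₁ * r ^ 2 : ℝ) : ℂ))
      =O[𝓝[>] 0] fun r : ℝ => r ^ 2 := by
    refine IsBigO.of_bound (|Real.pi * τ₁|) (Eventually.of_forall fun r => ?_)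
    rw [norm_mul, Complex.norm_I, one_mul, Complex.norm_real, norm_mul, Real.norm_eq_abs]
  have hsmallt : Tendsto (fun r : ℝ => Complex.I * ((Real.pi * τ₁ * r ^ 2 : ℝ) : ℂ))
      (𝓝[>] 0) (𝓝 0) := by
    refine hsmall.trans_tendsto ?_
    have : Tendsto (fun r : ℝ => r ^ 2) (𝓝 0) (𝓝 (0 ^ 2)) := (continuous_pow 2).tendsto 0
    exact (by simpa using this : Tendsto (fun r : ℝ => r ^ 2) (𝓝 0) (𝓝 0)).mono_left
      nhdsWithin_le_nhds
  have hcO : circleCoeff h =O[𝓝[>] 0] fun r : ℝ => r := by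
    have h1 : (fun r : ℝ => 2 * Real.pi * a * (r : ℂ)) =O[𝓝[>] 0] fun r : ℝ => r := by
      refine IsBigO.of_bound ‖2 * Real.pi * a‖ (Eventually.of_forall fun r => ?_)
      rw [norm_mul, Complex.norm_real]
    exact (hcL.isBigO.add h1).congr_left fun r => by ring
  have s1 := ((hexp.comp_tendsto hsmallt).trans_isBigO hsmall).mul_isBigO hcO
  have s2 := hsmall.mul_isLittleO hcL
  -- In first Fourier coefficients the two occurrences of `h` differ by the phase `e^{iπτ₁r²} - 1`
  -- only. Comparison at order `r³` leaves a constant that must vanish.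
  have hconst : (fun r : ℝ => (Complex.I * Real.pi * (2 * Real.pi * a)
      * (τ₁ - τ₂ * (Complex.normSq a + 2 * Complex.normSq b : ℝ))) * ((r ^ 3 : ℝ) : ℂ))
      =o[𝓝[>] 0] fun r : ℝ => r ^ 3 := by
    refine ((hc.sub (s1.congr_right fun r => (pow_succ r 2).symm)).sub
      (s2.congr_right fun r => (pow_succ r 2).symm)).congr' ?_ EventuallyEq.rfl
    filter_upwards [hcont] with r hr
    have c1 : Continuous fun θ : ℝ => h (r * Complex.exp ((θ : ℂ) * Complex.I)) :=
      continuous_iff_continuousAt.2 fun θ => ContinuousAt.comp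
        (hr.2 _ (norm_circle hr.1 θ)) (hcirc r).continuousAt
    have c2 : Continuous fun θ : ℝ => h (twistMap ν τ₁ (r * Complex.exp ((θ : ℂ) * Complex.I))) := by
      refine continuous_iff_continuousAt.2 fun θ => ContinuousAt.comp (hr.2 _ ?_)
        ((contDiff_twistMap ν τ₁).continuous.comp (hcirc r)).continuousAt
      rw [twistMap, norm_mul, Complex.norm_exp_ofReal_mul_I, one_mul, norm_circle hr.1]
    have c3 : Continuous fun θ : ℝ => (Complex.normSq (L (r * Complex.exp ((θ : ℂ) * Complex.I))) : ℂ)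
        * L (r * Complex.exp ((θ : ℂ) * Complex.I)) :=
      (Complex.continuous_ofReal.comp (contDiff_normSq.continuous.comp
        (hLc.comp (hcirc r)))).mul (hLc.comp (hcirc r))
    rw [circleCoeff_sub (V := fun y => Complex.exp (-((2 * Real.pi * ν : ℝ) : ℂ) * Complex.I)
        * h (twistMap ν τ₁ y) - h y)
        (W := fun y => Complex.I * (Real.pi * τ₂) * ((Complex.normSq (L y) : ℂ) * L y))
        ((continuous_const.mul c2).sub c1) (continuous_const.mul c3),
      circleCoeff_sub (V := fun y => Complex.exp (-((2 * Real.pi * ν : ℝ) : ℂ) * Complex.I)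
        * h (twistMap ν τ₁ y)) (continuous_const.mul c2) c1, circleCoeff_const_mul, circleCoeff_const_mul,
      circleCoeff_twistMap, hLd, circleCoeff_cubic, ← mul_assoc, ← Complex.exp_add]
    have e1 : -((2 * Real.pi * ν : ℝ) : ℂ) * Complex.I
        + ((2 * Real.pi * (ν + τ₁ * (r ^ 2 / 2)) : ℝ) : ℂ) * Complex.I
        = Complex.I * ((Real.pi * τ₁ * r ^ 2 : ℝ) : ℂ) := by push_cast; ring
    rw [e1]
    simp only [Function.comp_apply]
    push_cast
    ring
  have hzero : Complex.I * Real.pi * (2 * Real.pi * a)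
      * (τ₁ - τ₂ * (Complex.normSq a + 2 * Complex.normSq b : ℝ)) = 0 := by
    by_contra hne
    have h1 := (isLittleO_const_mul_left_iff hne).1 hconst
    have h2 : (fun r : ℝ => ‖r ^ 3‖) =o[𝓝[>] (0 : ℝ)] fun r : ℝ => r ^ 3 :=
      h1.norm_left.congr_left fun r => by rw [Complex.norm_real]
    refine isLittleO_irrefl (Filter.Eventually.frequently ?_) h2.of_norm_left
    filter_upwards [self_mem_nhdsWithin] with r hr
    exact pow_ne_zero 3 (ne_of_gt hr)
  have hpi : (Real.pi : ℂ) ≠ 0 := by exact_mod_cast Real.pi_ne_zero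
  have h1 : (τ₁ : ℂ) - τ₂ * (Complex.normSq a + 2 * Complex.normSq b : ℝ) = 0 := by
    simpa [hpi, ha0] using hzero
  refine ⟨Complex.normSq a + 2 * Complex.normSq b, ?_, ?_⟩
  · linarith [Complex.normSq_nonneg b]
  · have h2 : τ₁ - τ₂ * (Complex.normSq a + 2 * Complex.normSq b) = 0 := by exact_mod_cast h1
    linarith

/-- The conjugacy is `g₂ ∘ g₁⁻¹`, which inherits determinant `1` at the origin and intertwines the
two normal forms up to order four. -/
theorem exists_twist_eq_mul_of_normalForms {f g₁ g₂ : ℂ → ℂ} {ν τ₁ τ₂ : ℝ}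
    (hf : Tendsto f (𝓝 0) (𝓝 0))
    (h₁ : ContDiffAt ℝ ∞ g₁ 0) (h₁0 : g₁ 0 = 0) (h₁d : (fderiv ℝ g₁ 0).det = 1)
    (h₁N : (fun z => g₁ (f z) - twistMap ν τ₁ (g₁ z)) =O[𝓝 0] fun z => ‖z‖ ^ 4)
    (h₂ : ContDiffAt ℝ ∞ g₂ 0) (h₂0 : g₂ 0 = 0) (h₂d : (fderiv ℝ g₂ 0).det = 1)
    (h₂N : (fun z => g₂ (f z) - twistMap ν τ₂ (g₂ z)) =O[𝓝 0] fun z => ‖z‖ ^ 4) :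
    ∃ k : ℝ, 1 ≤ k ∧ τ₁ = k * τ₂ := by
  obtain ⟨ψ, hψ, hψ0, hr, hl⟩ := exists_local_inverse h₁ h₁0 (by rw [h₁d]; exact one_ne_zero)
  have hψt := tendsto_zero_of_contDiffAt hψ hψ0
  have hψO : (fun y => ‖ψ y‖ ^ 4) =O[𝓝 0] fun y => ‖y‖ ^ 4 :=
    (isBigO_id_of_contDiffAt hψ hψ0).norm_norm.pow 4
  have hgψ : ContDiffAt ℝ ∞ g₂ (ψ 0) := by rwa [hψ0]
  have hh : ContDiffAt ℝ ∞ (fun y => g₂ (ψ y)) 0 := hgψ.comp 0 hψ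
  have hdet : (fderiv ℝ (fun y => g₂ (ψ y)) 0).det = 1 := by
    have d0 := (hψ.differentiableAt (by simp)).hasFDerivAt
    have d1 : HasFDerivAt g₁ (fderiv ℝ g₁ 0) (ψ 0) := by
      rw [hψ0]; exact (h₁.differentiableAt (by simp)).hasFDerivAt
    have d2 : HasFDerivAt g₂ (fderiv ℝ g₂ 0) (ψ 0) := by
      rw [hψ0]; exact (h₂.differentiableAt (by simp)).hasFDerivAt
    have d3 : fderiv ℝ (g₁ ∘ ψ) 0 = ContinuousLinearMap.id ℝ ℂ :=
      ((hasFDerivAt_id 0).congr_of_eventuallyEq hr).fderiv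
    have d4 : fderiv ℝ (fun y => g₂ (ψ y)) 0 = _ := (d2.comp 0 d0).fderiv
    have d5 : ∀ L M : ℂ →L[ℝ] ℂ, (L.comp M).det = L.det * M.det := fun L M => LinearMap.det_comp _ _
    rw [d4, d5, h₂d, ← h₁d, ← d5, ← (d1.comp 0 d0).fderiv, d3]
    exact LinearMap.det_id.trans h₁d.symm
  refine exists_twist_eq_mul (ν := ν) hh (by simp only [hψ0, h₂0]) hdet ?_
  have t1 := h₁N.comp_tendsto hψt
  have t2 := h₂N.comp_tendsto hψt
  have hN0 : Tendsto (twistMap ν τ₁) (𝓝 0) (𝓝 0) :=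
    tendsto_zero_of_contDiffAt (contDiff_twistMap ν τ₁).contDiffAt (by simp [twistMap])
  have hg₁ := tendsto_zero_of_contDiffAt h₁ h₁0
  have t3 := isBigO_comp_sub_comp (hh.of_le (by exact_mod_cast le_top))
    (hN0.comp (hg₁.comp hψt)) ((hg₁.comp hf).comp hψt)
  have t4 := (t3.trans (t1.neg_left.congr_left fun y => by simp)).trans hψO
  refine (t4.add (t2.trans hψO)).congr' ?_ EventuallyEq.rfl
  filter_upwards [hr, (hf.comp hψt).eventually hl] with y h1 h2
  simp only [Function.comp_apply] at h2 ⊢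
  rw [h1, h2]
  ring

/-- The Birkhoff twist is unique. -/
theorem HasBirkhoffTwist.unique {f : ℂ → ℂ} {ν τ₁ τ₂ : ℝ} (hf : Tendsto f (𝓝 0) (𝓝 0))
    (h₁ : HasBirkhoffTwist f ν τ₁) (h₂ : HasBirkhoffTwist f ν τ₂) : τ₁ = τ₂ := by
  obtain ⟨g₁, a1, b1, c1, d1⟩ := h₁
  obtain ⟨g₂, a2, b2, c2, d2⟩ := h₂
  obtain ⟨k, hk, e1⟩ := exists_twist_eq_mul_of_normalForms hf a1 b1 c1.self_of_nhds d1 a2 b2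
    c2.self_of_nhds d2
  obtain ⟨l, hl, e2⟩ := exists_twist_eq_mul_of_normalForms hf a2 b2 c2.self_of_nhds d2 a1 b1
    c1.self_of_nhds d1
  rcases eq_or_ne τ₂ 0 with h | h
  · rw [e1, h, mul_zero]
  · have h3 : l * k = 1 := by
      have : τ₂ * (l * k - 1) = 0 := by rw [e1] at e2; linear_combination -e2
      have := (mul_eq_zero.1 this).resolve_left h
      linarith
    have : k = 1 := by nlinarith
    rw [e1, this, one_mul]

theorem hasBirkhoffTwist_iff (m : ℤ) {ε A B τ : ℝ} (hε : ε ≠ 0) {R : ℝ → ℂ → ℝ}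
    (hR : IsRemainder R) {f : ℂ → ℂ} (hf : IsPoincareMap (fullHam m ε A B R) f) :
    HasBirkhoffTwist f (m / 3 + ε) τ ↔ τ = 2 * A - 3 * B ^ 2 / (2 * ε) := by
  have h := hf.hasBirkhoffTwist hε hR
  refine ⟨fun h' => h'.unique ((hf.birkhoff hε hR).2.trans_tendsto tendsto_id) h, ?_⟩
  rintro rfl
  exact h

end Tripling

/-! ### The theorem. -/

theorem mainTheorem1 (m : ℤ) (hm : ¬ (3 : ℤ) ∣ m) (A B : ℝ) (hA : A ≠ 0) (hB : B ≠ 0) :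
    -- The twist `τ₀ ε` of the periodic orbit, for all higher order terms, and its codimension one
    -- vanishing at `ε₀ = 3B²/(4A)`.
    ∃ τ₀ : ℝ → ℝ,
    (∀ ε : ℝ, ε ≠ 0 → τ₀ ε = 2 * A - 3 * B ^ 2 / (2 * ε)) ∧
    (∀ ε : ℝ, ε ≠ 0 → ∀ R : ℝ → ℂ → ℝ, Tripling.IsRemainder R →
      (∃ f, Tripling.IsPoincareMap (Tripling.fullHam m ε A B R) f) ∧
      ∀ f, Tripling.IsPoincareMap (Tripling.fullHam m ε A B R) f →
        ∀ τ, Tripling.HasBirkhoffTwist f (m / 3 + ε) τ ↔ τ = τ₀ ε) ∧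
    (∀ ε : ℝ, ε ≠ 0 → (τ₀ ε = 0 ↔ ε = 3 * B ^ 2 / (4 * A))) ∧
    (∃ d : ℝ, d ≠ 0 ∧ HasDerivAt τ₀ d (3 * B ^ 2 / (4 * A))) ∧
    -- The saddle-center bifurcation of the period-three orbits at `e = 9/32`.
    ∃ (zc : ℂ) (zs ze : ℝ → ℂ),
    (∀ e : ℝ, 9 / 32 < e → Tripling.equilibria (Tripling.scaledForm A B e) = ∅) ∧
    (Tripling.equilibria (Tripling.scaledForm A B (9 / 32)) = Tripling.tripleOrbit zc ∧
      Tripling.linDet (Tripling.scaledForm A B (9 / 32)) zc = 0 ∧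
      Tripling.scaledForm A B (9 / 32) zc = Tripling.scaledEnergy A B (27 / 4096)) ∧
    (∀ e ∈ Set.Ioo (0 : ℝ) (9 / 32),
      Tripling.equilibria (Tripling.scaledForm A B e)
        = Tripling.tripleOrbit (zs e) ∪ Tripling.tripleOrbit (ze e) ∧
      Tripling.linDet (Tripling.scaledForm A B e) (zs e) < 0 ∧
      0 < Tripling.linDet (Tripling.scaledForm A B e) (ze e)) ∧
    Tendsto zs (𝓝[<] (9 / 32)) (𝓝 zc) ∧ Tendsto ze (𝓝[<] (9 / 32)) (𝓝 zc) ∧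
    -- For `e > 9/32` all level sets are invariant circles around the origin; their twist is
    -- defined and tends to the twist of the periodic orbit at the origin.
    (∀ e : ℝ, 9 / 32 < e →
      (∀ η : ℝ, 0 < η → ∀ φ : ℝ, ∃! r : ℝ, 0 < r ∧
        Tripling.scaledForm A B e ((r : ℂ) * Complex.exp ((φ : ℂ) * Complex.I))
          = Tripling.scaledEnergy A B η) ∧
      ∃ τ : ℝ → ℝ,
        (∀ η : ℝ, 0 < η → ∀ t, Tripling.HasTorusTwist (Tripling.scaledForm A B e)
          (Tripling.scaledEnergy A B η) t ↔ t = τ η) ∧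
        Tendsto τ (𝓝[>] 0) (𝓝 (τ₀ (B ^ 2 / A * e)))) ∧
    -- The twistless curve, of scaled energy `ηs e`.
    ∃ ηs : ℝ → ℝ,
    ContinuousOn ηs (Set.Ioo (9 / 32) (3 / 4)) ∧
    (∀ e ∈ Set.Ioo (9 / 32 : ℝ) (3 / 4), 0 < ηs e ∧
      Tripling.HasTorusTwist (Tripling.scaledForm A B e)
        (Tripling.scaledEnergy A B (ηs e)) 0) ∧
    -- It is created at the origin at `e = 3/4` and then moves away from the origin.
    Tendsto ηs (𝓝[<] (3 / 4)) (𝓝 0) ∧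
    Tendsto (fun e => Tripling.action (Tripling.scaledForm A B e)
      (Tripling.scaledEnergy A B (ηs e))) (𝓝[<] (3 / 4)) (𝓝 0) ∧
    (∃ δ : ℝ, 0 < δ ∧
      (∀ e ∈ Set.Ioo (3 / 4 - δ) (3 / 4 + δ), ∀ η ∈ Set.Ioo 0 δ,
        (Tripling.HasTorusTwist (Tripling.scaledForm A B e)
          (Tripling.scaledEnergy A B η) 0 ↔ e < 3 / 4 ∧ η = ηs e)) ∧
      StrictAntiOn (fun e => Tripling.action (Tripling.scaledForm A B e)
        (Tripling.scaledEnergy A B (ηs e))) (Set.Ioo (3 / 4 - δ) (3 / 4))) ∧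
    -- It collides with the saddle-center bifurcation at `e = 9/32`.
    Tendsto ηs (𝓝[>] (9 / 32)) (𝓝 (27 / 4096)) ∧
    (∀ z ∈ Tripling.tripleOrbit zc,
      Tendsto (fun e => Metric.infDist z
        {w | Tripling.scaledForm A B e w = Tripling.scaledEnergy A B (ηs e)})
        (𝓝[>] (9 / 32)) (𝓝 0)) := by
  have hB2 : B ^ 2 ≠ 0 := pow_ne_zero 2 hB
  refine ⟨fun ε => 2 * A - 3 * B ^ 2 / (2 * ε), fun ε _ => rfl, fun ε hε R hR =>
    ⟨Tripling.exists_isPoincareMap m hR, fun f hf τ => Tripling.hasBirkhoffTwist_iff m hε hR hf⟩,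
    fun ε hε => ?_, ?_, Tripling.axisRoot A B 1 (9 / 32), fun e => Tripling.axisRoot A B 1 e,
    fun e => Tripling.axisRoot A B (-1) e,
    fun e he => Tripling.equilibria_scaledForm_of_lt hA hB he,
    ⟨?_, ?_, Tripling.scaledForm_saddleCenter hA B 1⟩, fun e he => ⟨?_, ?_, ?_⟩,
    Tripling.tendsto_axisRoot A B 1, ?_, fun e he => ⟨fun η hη φ =>
      Tripling.existsUnique_radius hA hB he hη φ, fun η => A * Tripling.levTwist e η,
      fun η hη t => Tripling.hasTorusTwist_iff hA hB he hη, ?_⟩, Tripling.critEnergy,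
    Tripling.continuousOn_critEnergy, fun e he => ⟨Tripling.critEnergy_pos he, ?_⟩,
    Tripling.tendsto_critEnergy_three_quarters, Tripling.tendsto_action_critEnergy hA hB, ?_,
    Tripling.tendsto_critEnergy_saddleCenter, fun z hz =>
      Tripling.tendsto_infDist_saddleCenter hA B 1 hz⟩
  · field_simp
    constructor <;> intro h <;> linarith
  · refine ⟨3 * B ^ 2 / (2 * (3 * B ^ 2 / (4 * A)) ^ 2), by positivity, ?_⟩
    have hx : 3 * B ^ 2 / (4 * A) ≠ 0 := by positivity
    have h := ((hasDerivAt_inv hx).const_mul (3 * B ^ 2 / 2)).const_sub (2 * A)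
    refine (h.congr_of_eventuallyEq (Eventually.of_forall fun ε => ?_)).congr_deriv ?_
    · simp only
      rw [← div_div, ← div_eq_mul_inv]
    · field_simp
  · rw [Tripling.equilibria_scaledForm hA hB (by norm_num) le_rfl,
      Tripling.axisRoot_saddleCenter B (-1), ← Tripling.axisRoot_saddleCenter B 1, Set.union_self]
  · rw [Tripling.linDet_axisRoot hA (by norm_num) le_rfl]
    norm_num
  · exact Tripling.equilibria_scaledForm hA hB he.1 he.2.le
  · rw [Tripling.linDet_axisRoot hA (by norm_num) he.2.le, mul_one]
    have h1 := Tripling.axisRoot_ne_zero hA hB (σ := 1) (by norm_num) he.1 he.2.le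
    have h2 : 0 < √(9 / 8 - 4 * e) := Real.sqrt_pos.2 (by linarith [he.2])
    have h3 : 0 < 9 * B ^ 2 / (2 * √2) * Tripling.axisRoot A B 1 e ^ 2 * √(9 / 8 - 4 * e) := by
      positivity
    linarith
  · rw [Tripling.linDet_axisRoot hA (by norm_num) he.2.le]
    have h1 := Tripling.axisRoot_ne_zero hA hB (σ := -1) (by norm_num) he.1 he.2.le
    have h2 : 0 < √(9 / 8 - 4 * e) := Real.sqrt_pos.2 (by linarith [he.2])
    have h3 : 0 < 9 * B ^ 2 / (2 * √2) * Tripling.axisRoot A B (-1) e ^ 2 * √(9 / 8 - 4 * e) := by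
      positivity
    linarith
  · rw [Tripling.axisRoot_saddleCenter B 1, ← Tripling.axisRoot_saddleCenter B (-1)]
    exact Tripling.tendsto_axisRoot A B (-1)
  · have h := (Tripling.tendsto_levTwist_zero he).const_mul A
    have he0 : e ≠ 0 := by linarith
    have h2 : A * (2 - 3 / (2 * e)) = 2 * A - 3 * B ^ 2 / (2 * (B ^ 2 / A * e)) := by
      field_simp
    rwa [h2] at h
  · have hη := Tripling.critEnergy_pos he
    rw [Tripling.hasTorusTwist_iff hA hB he.1 hη,
      (Tripling.levTwist_eq_zero_iff he.1 hη).2 ⟨he.2, rfl⟩, mul_zero]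
  · obtain ⟨δ, hδ, hδ2, hanti⟩ := Tripling.exists_strictAntiOn_critEnergy
    refine ⟨δ, hδ, fun e he η hη => ?_, Tripling.strictAntiOn_action hA hB hδ2 hanti⟩
    have he' : 9 / 32 < e := by linarith [he.1]
    rw [Tripling.hasTorusTwist_iff hA hB he' hη.1, ← Tripling.levTwist_eq_zero_iff he' hη.1,
      eq_comm, mul_eq_zero]
    simp [hA]
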